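/- Let $M$ be a Sasakian sub-Riemannian $3$-manifold: a connected $3$-manifold with an oriented contact plane distribution $\mathcal H$ and a Riemannian metric $g_h$ on $\mathcal H$, with contact form $\eta$ normalized by $\ker\eta=\mathcal H$ and $d\eta|_{\mathcal H}$ equal to the area form of $\mathcal H$ (where $d\eta(U,V)=\frac12(U\eta(V)-V\eta(U)-\eta([U,V]))$), such that the flow of the Reeb field $T$ (defined by $\eta(T)=1$, $d\eta(T,\cdot)=0$) consists of isometries. Let $g=\langle\cdot,\cdot\rangle$ be the Riemannian metric extending $g_h$ for which $T$ is a unit field orthogonal to $\mathcal H$, $D$ its Levi-Civita connection, $J$ the $90$ degree rotation of $\mathcal H$ (with $J(T)=0$), and $K=\frac14(K_h+3)$ the Webster scalar curvature, $K_h$ being the sectional curvature of $\mathcal H$ in $(M,g)$. Orient $M$ by $\eta\wedge d\eta$ and let $dv$ be its volume form. Let $\Sigma$ be an oriented $C^2$ surface without boundary immersed in $M$, with compatible unit normal $N$, area element $da$ and shape operator $B(U)=-D_UN$. Write $N_h=N-\langle N,T\rangle T$, let $\Sigma_0$ be the singular set (the points with $N_h=0$, i.e. with horizontal tangent plane), and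 on $\Sigma-\Sigma_0$ put $\nu_h=N_h/|N_h|$, $Z=J(\nu_h)$, $S=\langle N,T\rangle\nu_h-|N_h|T$. Suppose that $\Sigma-\Sigma_0$ is $C^3$ and has constant mean curvature $H$, where $-2H=\langle D_Z\nu_h,Z\rangle+\langle D_S\nu_h,S\rangle$. For $\psi\in C^2(\Sigma-\Sigma_0)$ let $$\mathcal L(\psi)=|N_h|^{-1}\Big\{Z(Z(\psi))+2|N_h|^{-1}\langle N,T\rangle\langle B(Z),S\rangle Z(\psi)+\big(|B(Z)+S|^2+4(K-1)|N_h|^2\big)\psi\Big\}.$$ For a compactly supported $C^3$ variation $\varphi:I\times(\Sigma-\Sigma_0)\to M$ by immersions $\varphi_s$ (so $\varphi_0$ is the given immersion and $\varphi_s=\varphi_0$ off a compact set $C\subseteq\Sigma-\Sigma_0$), with velocity field $U=\partial\varphi/\partial s|_{s=0}$, let $A(s)=\int_C|N_h|\,da$ be the sub-Riemannian area of $\varphi_s$ on $C$ and $V(s)=\int_{[0,s]\times C}\varphi^*(dv)$. The surface $\Sigma-\Sigma_0$ is called strongly stable if $A'(0)=0$ for every such variation with $V$ constant near $0$, and for every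 such variation $A+2HV$ is $C^2$ near $0$ with $(A+2HV)''(0)\ge 0$. It is called strictly stable if, in addition, $(A+2HV)''(0)=0$ holds if and only if $U$ is tangent to $\Sigma$. Suppose that one of the following conditions holds: (i) there is a nowhere vanishing Jacobi function on $\Sigma$, i.e. a function $\psi\in C^2(\Sigma-\Sigma_0)$ without zeros such that $\mathcal L(\psi)=0$; (ii) there are no vertical points in $\Sigma$, i.e. no points where $T$ is tangent to $\Sigma$ (equivalently, $\langle N,T\rangle$ does not vanish); (iii) $\mathcal L(|N_h|)\le 0$ on $\Sigma-\Sigma_0$. Then $\Sigma-\Sigma_0$ is strongly stable. Moreover, if $\mathcal L(|N_h|)<0$ on $\Sigma-\Sigma_0$, then $\Sigma-\Sigma_0$ is strictly stable. -/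

import Mathlib

open Set Filter Topology MeasureTheory Manifold Bundle
open scoped ContDiff Manifold

noncomputable section

namespace SubRiem

/-- The model space of the ambient `3`-manifolds. -/
abbrev E3 : Type := EuclideanSpace ℝ (Fin 3)

/-- The model space of the surfaces. -/
abbrev E2 : Type := EuclideanSpace ℝ (Fin 2)

/-- The first vector of the standard basis of the model plane. -/
def e₁ : E2 := EuclideanSpace.single 0 1

/-- The second vector of the standard basis of the model plane. -/
def e₂ : E2 := EuclideanSpace.single 1 1

section Riemannian

variable {E : Type*} [NormedAddCommGroup E] [NormedSpace ℝ E]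
  {M : Type*} [TopologicalSpace M] [ChartedSpace E M]

/-- The differential at `q` of the preferred chart `x` around `p`. -/
def dChart (p q : M) : TangentSpace 𝓘(ℝ, E) q →L[ℝ] E :=
  mfderiv 𝓘(ℝ, E) 𝓘(ℝ, E) (extChartAt 𝓘(ℝ, E) p) q

/-- The differential at `y` of the inverse of the preferred chart `x` around `p`; the image of
the standard basis is the coordinate frame at `x⁻¹ y`. -/
def dChartSymm (p : M) (y : E) :
    E →L[ℝ] TangentSpace 𝓘(ℝ, E) ((extChartAt 𝓘(ℝ, E) p).symm y) :=
  mfderiv 𝓘(ℝ, E) 𝓘(ℝ, E) (extChartAt 𝓘(ℝ, E) p).symm y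

/-- The differential of a map from a vector space to `M`. -/
def dMap {P : Type*} [NormedAddCommGroup P] [NormedSpace ℝ P] (k : P → M) (y : P) :
    P →L[ℝ] TangentSpace 𝓘(ℝ, E) (k y) :=
  mfderiv 𝓘(ℝ, P) 𝓘(ℝ, E) k y

/-- The `1`-form `α` in the coordinates of the preferred chart around `p`. -/
def formInChart (α : ∀ q : M, TangentSpace 𝓘(ℝ, E) q →L[ℝ] ℝ) (p : M) (y : E) : E →L[ℝ] ℝ :=
  (α ((extChartAt 𝓘(ℝ, E) p).symm y)).comp (dChartSymm p y)

/-- The exterior derivative of a `1`-form, with the convention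
`dα(U,V) = (1/2) (U(α(V)) - V(α(U)) - α([U,V]))`. In coordinates,
`dα(u,v) = (1/2) (∂_u α (v) - ∂_v α (u))`. -/
def extD (α : ∀ q : M, TangentSpace 𝓘(ℝ, E) q →L[ℝ] ℝ) (p : M) (u : TangentSpace 𝓘(ℝ, E) p) :
    TangentSpace 𝓘(ℝ, E) p →L[ℝ] ℝ :=
  let A : E →L[ℝ] E →L[ℝ] ℝ := fderiv ℝ (formInChart α p) (extChartAt 𝓘(ℝ, E) p p)
  (1 / 2 : ℝ) • (A (dChart p p u) - A.flip (dChart p p u)).comp (dChart p p)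

variable [IsManifold 𝓘(ℝ, E) ∞ M]

variable (E M) in
/-- Smooth Riemannian metrics on `M`. -/
abbrev Metric : Type _ :=
  ContMDiffRiemannianMetric 𝓘(ℝ, E) ∞ E (fun p : M => TangentSpace 𝓘(ℝ, E) p)

/-- The length of a tangent vector. -/
def len (g : Metric E M) {p : M} (v : TangentSpace 𝓘(ℝ, E) p) : ℝ := √(g.inner p v v)

/-- The vector metrically dual to a covector: `⟨sharp g p α, v⟩ = α v`. -/
def sharp (g : Metric E M) (p : M) (α : TangentSpace 𝓘(ℝ, E) p →L[ℝ] ℝ) :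
    TangentSpace 𝓘(ℝ, E) p :=
  (g.inner p).inverse α

/-- The metric in the coordinates of the preferred chart around `p`. -/
def metricInChart (g : Metric E M) (p : M) (y : E) : E →L[ℝ] E →L[ℝ] ℝ :=
  ((dChartSymm p y).precomp ℝ).comp
    ((g.inner ((extChartAt 𝓘(ℝ, E) p).symm y)).comp (dChartSymm p y))

/-- The Christoffel symbols `Γ_y(u,v)` in the preferred chart around `p`, determined by
`2 G(Γ(u,v),w) = ∂_u G(v,w) + ∂_v G(u,w) - ∂_w G(u,v)`. -/
def christoffel (g : Metric E M) (p : M) (y u v : E) : E :=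
  (metricInChart g p y).inverse ((1 / 2 : ℝ) •
    (fderiv ℝ (fun z => metricInChart g p z v) y u + fderiv ℝ (fun z => metricInChart g p z u) y v
      - fderiv ℝ (fun z => metricInChart g p z u v) y))

/-- The Levi-Civita covariant derivative `D_v Y` of a vector field `Y` along a map `f : N → M`
in the direction of `v ∈ T_p N`, computed in the preferred chart around `f p`. -/
def covDeriv (g : Metric E M) {E' H' : Type*} [NormedAddCommGroup E'] [NormedSpace ℝ E']
    [TopologicalSpace H'] (I' : ModelWithCorners ℝ E' H') {N : Type*} [TopologicalSpace N]
    [ChartedSpace H' N] (f : N → M) (Y : ∀ q : N, TangentSpace 𝓘(ℝ, E) (f q)) (p : N)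
    (v : TangentSpace I' p) : TangentSpace 𝓘(ℝ, E) (f p) :=
  let a : E := mfderiv I' 𝓘(ℝ, E) (fun q => dChart (f p) (f q) (Y q)) p v
  let b : E := christoffel g (f p) (extChartAt 𝓘(ℝ, E) (f p) (f p))
    (dChart (f p) (f p) (mfderiv I' 𝓘(ℝ, E) f p v)) (dChart (f p) (f p) (Y p))
  (dChart (f p) (f p)).inverse (a + b)

/-- The number `⟨R(u,v)v,u⟩` for the Riemann curvature tensor
`R(u,v) = D_u D_v - D_v D_u - D_[u,v]`; it is the sectional curvature of the plane spanned by
`u`, `v` when `u`, `v` are orthonormal. -/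
def sectional (g : Metric E M) (p : M) (u v : TangentSpace 𝓘(ℝ, E) p) : ℝ :=
  let y : E := extChartAt 𝓘(ℝ, E) p p
  let a : E := dChart p p u
  let b : E := dChart p p v
  metricInChart g p y
    (fderiv ℝ (fun z => christoffel g p z b b) y a - fderiv ℝ (fun z => christoffel g p z a b) y b
      + christoffel g p y a (christoffel g p y b b) - christoffel g p y b (christoffel g p y a b))
    a

/-- The contact form `η = ⟨T, ·⟩`. -/
def etaForm (g : Metric E M) (T : ∀ p : M, TangentSpace 𝓘(ℝ, E) p) (p : M) :
    TangentSpace 𝓘(ℝ, E) p →L[ℝ] ℝ :=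
  g.inner p (T p)

end Riemannian

section Ambient

variable {M : Type*} [TopologicalSpace M] [ChartedSpace E3 M] [IsManifold (𝓡 3) ∞ M]

variable (M) in
/-- A Sasakian sub-Riemannian structure on a `3`-manifold. The data `(𝓗, orientation of 𝓗, g_h)`
is recorded through the canonical extension `g` of `g_h` and the Reeb vector field `T`: the
horizontal distribution is `𝓗 = T^⊥ = Ker η` with `η = ⟨T, ·⟩`, the metric `g_h` is the
restriction of `g`, and the orientation of `𝓗` is the one for which `dη` is positive. -/
structure SasakianStructure where
  /-- The canonical extension of the sub-Riemannian metric. -/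
  g : Metric E3 M
  /-- The Reeb vector field. -/
  T : ∀ p : M, TangentSpace (𝓡 3) p
  smooth_T : ContMDiff (𝓡 3) (𝓡 3).tangent ∞ (fun p => (⟨p, T p⟩ : TangentBundle (𝓡 3) M))
  /-- `η(T) = 1`, that is, `T` is a unit field. -/
  unit_T : ∀ p, g.inner p (T p) (T p) = 1
  /-- `dη(T, ·) = 0`. -/
  reeb : ∀ p v, extD (etaForm g T) p (T p) v = 0
  /-- `dη` restricted to `𝓗` is an area form of `g_h`. -/
  normalized : ∀ p (u v : TangentSpace (𝓡 3) p), etaForm g T p u = 0 → etaForm g T p v = 0 →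
    extD (etaForm g T) p u v ^ 2 = g.inner p u u * g.inner p v v - g.inner p u v ^ 2
  /-- `T` is a Killing field: its flow consists of isometries. -/
  killing : ∀ p (u v : TangentSpace (𝓡 3) p),
    g.inner p (covDeriv g (𝓡 3) (fun q => q) T p u) v
      + g.inner p u (covDeriv g (𝓡 3) (fun q => q) T p v) = 0

namespace SasakianStructure

variable (X : SasakianStructure M)

/-- The normalized contact form. -/
def η (p : M) : TangentSpace (𝓡 3) p →L[ℝ] ℝ := etaForm X.g X.T p

/-- The `2`-form `dη`, which restricts to the area form of the oriented plane `𝓗_p`. -/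
def dη (p : M) (u : TangentSpace (𝓡 3) p) : TangentSpace (𝓡 3) p →L[ℝ] ℝ := extD X.η p u

/-- The rotation `J` of angle `90` degrees in the oriented planes `𝓗_p`, extended by `J(T) = 0`:
`⟨J(u), v⟩ = dη(u,v)`. -/
def J (p : M) (u : TangentSpace (𝓡 3) p) : TangentSpace (𝓡 3) p := sharp X.g p (X.dη p u)

/-- The horizontal projection. -/
def hor {p : M} (v : TangentSpace (𝓡 3) p) : TangentSpace (𝓡 3) p :=
  v - X.g.inner p v (X.T p) • X.T p

/-- The Riemannian volume form `dv = η ∧ dη` of `(M,g)`, with the orientation given by `η ∧ dη`: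
`dv(a,b,c) = η(a) dη(b,c) + η(b) dη(c,a) + η(c) dη(a,b)`. It equals `1` on `(u, J(u), T)` for `u`
horizontal and unit. -/
def vol (p : M) (a b : TangentSpace (𝓡 3) p) : TangentSpace (𝓡 3) p →L[ℝ] ℝ :=
  X.η p a • X.dη p b - X.η p b • X.dη p a + X.dη p a b • X.η p

/-- The sectional curvature `K_h` of the horizontal plane at `p` (the common value of
`⟨R(u,v)v,u⟩` over all the orthonormal bases `u, v` of this plane). -/
def horSectional (p : M) : ℝ :=
  sSup {k | ∃ u v : TangentSpace (𝓡 3) p, X.η p u = 0 ∧ X.η p v = 0 ∧ X.g.inner p u u = 1 ∧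
    X.g.inner p v v = 1 ∧ X.g.inner p u v = 0 ∧ k = sectional X.g p u v}

/-- The Webster scalar curvature `K = (K_h + 3) / 4`. -/
def webster (p : M) : ℝ := (X.horSectional p + 3) / 4

end SasakianStructure

section Maps

variable (X : SasakianStructure M) {S : Type*} [TopologicalSpace S] [ChartedSpace E2 S]

/-- The unit normal along an immersion `h : S → M` obtained from the standard basis of the
coordinate plane `T_p S`. It does not have to be continuous: it is defined up to sign. -/
def unitNormal (h : S → M) (p : S) : TangentSpace (𝓡 3) (h p) :=
  let n := sharp X.g (h p)
    (X.vol (h p) (mfderiv (𝓡 2) (𝓡 3) h p e₁) (mfderiv (𝓡 2) (𝓡 3) h p e₂))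
  (len X.g n)⁻¹ • n

/-- The Riemannian area density `√det` of a map from the plane to `M`. -/
def areaDensity (g : Metric E3 M) (k : E2 → M) (y : E2) : ℝ :=
  let a : TangentSpace (𝓡 3) (k y) := dMap k y e₁
  let b : TangentSpace (𝓡 3) (k y) := dMap k y e₂
  √(g.inner (k y) a a * g.inner (k y) b b - g.inner (k y) a b ^ 2)

/-- The area element `da` of the metric induced by an immersion `h : S → M`. It is the measure on
`S` which over the domain of any chart `e` of the atlas is given by
`√det ⟨∂_i (h ∘ e⁻¹), ∂_j (h ∘ e⁻¹)⟩ dy₁ dy₂`. The measures for two charts agree on the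
intersection of their domains, and the supremum glues them. -/
def areaMeasure (g : Metric E3 M) [MeasurableSpace S] (h : S → M) : Measure S :=
  ⨆ e ∈ atlas E2 S, Measure.map e.symm
    ((volume.restrict e.target).withDensity
      (fun y => ENNReal.ofReal (areaDensity g (h ∘ e.symm) y)))

/-- The sub-Riemannian area `∫_C |N_h| da` of the part of the immersed surface `h : S → M`
parameterized by `C`. -/
def subArea [MeasurableSpace S] (h : S → M) (C : Set S) : ℝ :=
  ∫ p in C, len X.g (X.hor (unitNormal X h p)) ∂(areaMeasure X.g h)

end Maps

variable (X : SasakianStructure M) (S : Type*) [TopologicalSpace S] [ChartedSpace E2 S]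

/-- An oriented `C²` surface (without boundary) immersed in `M`; here `S` is a `C²`
`2`-manifold and `f` the immersion. The orientation is recorded
through the continuous unit normal compatible with it: a basis `a, b` of `T_p S` is positive when
`dv(df a, df b, N) > 0`. -/
structure OrientedSurface where
  f : S → M
  contMDiff_f : ContMDiff (𝓡 2) (𝓡 3) 2 f
  immersion : ∀ p, Function.Injective (mfderiv (𝓡 2) (𝓡 3) f p)
  N : ∀ p, TangentSpace (𝓡 3) (f p)
  continuous_N : Continuous (fun p => (⟨f p, N p⟩ : TangentBundle (𝓡 3) M))
  unit_N : ∀ p, X.g.inner (f p) (N p) (N p) = 1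
  normal_N : ∀ p v, X.g.inner (f p) (N p) (mfderiv (𝓡 2) (𝓡 3) f p v) = 0

variable {X S}

namespace OrientedSurface

variable (F : OrientedSurface X S)

/-- The regular set `Σ - Σ₀`: the points where the tangent plane is not horizontal. -/
def regularSet : Set S := {p | ∃ v, X.η (F.f p) (mfderiv (𝓡 2) (𝓡 3) F.f p v) ≠ 0}

/-- A vertical point: `T` is tangent to the surface. -/
def IsVertical (p : S) : Prop := ∃ v, mfderiv (𝓡 2) (𝓡 3) F.f p v = X.T (F.f p)

/-- The open part `U` of the surface is of class `C³`: the coordinate changes and the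
immersion are `C³` there. -/
def IsC3On (U : Set S) : Prop :=
  (∀ e ∈ atlas E2 S, ∀ e' ∈ atlas E2 S,
    ContDiffOn ℝ 3 (e' ∘ e.symm) ((e.symm.trans e').source ∩ e.symm ⁻¹' U)) ∧
  ContMDiffOn (𝓡 2) (𝓡 3) 3 F.f U

/-- The function `⟨N,T⟩`. -/
def NT (p : S) : ℝ := X.g.inner (F.f p) (F.N p) (X.T (F.f p))

/-- The function `|N_h|`. -/
def normNh (p : S) : ℝ := len X.g (X.hor (F.N p))

/-- The horizontal Gauss map `ν_h = N_h / |N_h|`. -/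
def ν (p : S) : TangentSpace (𝓡 3) (F.f p) := (F.normNh p)⁻¹ • X.hor (F.N p)

/-- The characteristic field `Z = J(ν_h)`. -/
def Z (p : S) : TangentSpace (𝓡 3) (F.f p) := X.J (F.f p) (F.ν p)

/-- The field `S = ⟨N,T⟩ ν_h - |N_h| T`; `{Z, S}` is an orthonormal basis of the tangent plane. -/
def Sv (p : S) : TangentSpace (𝓡 3) (F.f p) := F.NT p • F.ν p - F.normNh p • X.T (F.f p)

/-- The first fundamental form. -/
def firstForm (p : S) : TangentSpace (𝓡 2) p →L[ℝ] TangentSpace (𝓡 2) p →L[ℝ] ℝ :=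
  ((mfderiv (𝓡 2) (𝓡 3) F.f p).precomp ℝ).comp
    ((X.g.inner (F.f p)).comp (mfderiv (𝓡 2) (𝓡 3) F.f p))

/-- The vector of `T_p S` whose image is the tangent part of `w`; if `w` is tangent, it is the
vector `v` with `df(v) = w`. -/
def lift (p : S) (w : TangentSpace (𝓡 3) (F.f p)) : TangentSpace (𝓡 2) p :=
  (F.firstForm p).inverse ((X.g.inner (F.f p) w).comp (mfderiv (𝓡 2) (𝓡 3) F.f p))

/-- The derivative `D_w Y` of a vector field along the surface in the direction of a tangent
vector `w`. -/
def D (Y : ∀ q, TangentSpace (𝓡 3) (F.f q)) (p : S) (w : TangentSpace (𝓡 3) (F.f p)) :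
    TangentSpace (𝓡 3) (F.f p) :=
  covDeriv X.g (𝓡 2) F.f Y p (F.lift p w)

/-- The shape operator `B(w) = -D_w N`. -/
def B (p : S) (w : TangentSpace (𝓡 3) (F.f p)) : TangentSpace (𝓡 3) (F.f p) := -F.D F.N p w

/-- The mean curvature: `-2H = ⟨D_Z ν_h, Z⟩ + ⟨D_S ν_h, S⟩`. -/
def meanCurvature (p : S) : ℝ :=
  -(X.g.inner (F.f p) (F.D F.ν p (F.Z p)) (F.Z p)
    + X.g.inner (F.f p) (F.D F.ν p (F.Sv p)) (F.Sv p)) / 2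

/-- The derivative `Z(ψ)` of a function along the characteristic field. -/
def Zderiv (ψ : S → ℝ) (p : S) : ℝ := mfderiv (𝓡 2) 𝓘(ℝ, ℝ) ψ p (F.lift p (F.Z p))

/-- The function `|B(Z) + S|² + 4 (K - 1) |N_h|²`. -/
def q (p : S) : ℝ :=
  len X.g (F.B p (F.Z p) + F.Sv p) ^ 2 + 4 * (X.webster (F.f p) - 1) * F.normNh p ^ 2

/-- The Jacobi operator
`𝓛(ψ) = |N_h|⁻¹ {Z(Z(ψ)) + 2 |N_h|⁻¹ ⟨N,T⟩ ⟨B(Z),S⟩ Z(ψ) + (|B(Z)+S|² + 4(K-1)|N_h|²) ψ}`. -/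
def jacobiOp (ψ : S → ℝ) (p : S) : ℝ :=
  (F.normNh p)⁻¹ * (F.Zderiv (F.Zderiv ψ) p
    + 2 * (F.normNh p)⁻¹ * F.NT p * X.g.inner (F.f p) (F.B p (F.Z p)) (F.Sv p) * F.Zderiv ψ p
    + F.q p * ψ p)

/-- A Jacobi function: `ψ ∈ C²(Σ - Σ₀)` with `𝓛(ψ) = 0`. -/
def IsJacobiFunction (ψ : S → ℝ) : Prop :=
  ContMDiffOn (𝓡 2) 𝓘(ℝ, ℝ) 2 ψ F.regularSet ∧ ∀ p ∈ F.regularSet, F.jacobiOp ψ p = 0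

/-- A (`C³`) variation `φ : I × U → M` of the open part `U` of the surface, with `φ_s = f` off of
the compact set `C ⊆ U`. The maps `φ_s` are extended by `f` to the whole surface. -/
structure IsVariation (U : Set S) (I : Set ℝ) (C : Set S) (φ : ℝ → S → M) : Prop where
  isOpen_I : IsOpen I
  ordConnected_I : I.OrdConnected
  zero_mem : (0 : ℝ) ∈ I
  isCompact_C : IsCompact C
  subset : C ⊆ U
  contMDiffOn : ContMDiffOn (𝓘(ℝ, ℝ).prod (𝓡 2)) (𝓡 3) 3 (fun z : ℝ × S => φ z.1 z.2) (I ×ˢ U)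
  zero : ∀ p, φ 0 p = F.f p
  immersion : ∀ s ∈ I, ∀ p ∈ U, Function.Injective (mfderiv (𝓡 2) (𝓡 3) (φ s) p)
  off : ∀ s ∈ I, ∀ p ∉ C, φ s p = F.f p

/-- The velocity `∂φ/∂s` of a variation. -/
def velocity (φ : ℝ → S → M) (s : ℝ) (p : S) : TangentSpace (𝓡 3) (φ s p) :=
  mfderiv 𝓘(ℝ, ℝ) (𝓡 3) (fun t => φ t p) s (1 : ℝ)

/-- The signed volume `V(s) = ∫_{[0,s] × C} φ^*(dv)`. The form `φ^*(dv)` is written as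
`ρ ds ∧ da` where `da = dv(df ·, df ·, N)` is the area form of the oriented surface, that is,
`ρ = dv(∂φ/∂s, dφ_s(a), dφ_s(b)) / dv(df(a), df(b), N)` for any basis `a, b` of `T_p S`. -/
def volumeFun [MeasurableSpace S] (φ : ℝ → S → M) (C : Set S) (s : ℝ) : ℝ :=
  ∫ t in (0 : ℝ)..s, ∫ p in C,
    X.vol (φ t p) (velocity φ t p) (mfderiv (𝓡 2) (𝓡 3) (φ t) p e₁)
        (mfderiv (𝓡 2) (𝓡 3) (φ t) p e₂)
      / X.vol (F.f p) (mfderiv (𝓡 2) (𝓡 3) F.f p e₁) (mfderiv (𝓡 2) (𝓡 3) F.f p e₂) (F.N p)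
    ∂(areaMeasure X.g F.f)

/-- The functional `s ↦ (A + 2HV)(s)`. The area is computed in `C`; off of `C` the surface does
not change. -/
def areaVolume [MeasurableSpace S] (H : ℝ) (φ : ℝ → S → M) (C : Set S) (s : ℝ) : ℝ :=
  subArea X (φ s) C + 2 * H * F.volumeFun φ C s

/-- The open part `U` of the surface is area-stationary under a volume constraint: `A'(0) = 0`
for any variation with `V(s)` constant for `s` small enough. -/
def IsVolumePreservingAreaStationary [MeasurableSpace S] (U : Set S) : Prop :=
  ∀ I C φ, F.IsVariation U I C φ → (∀ᶠ s in 𝓝 (0 : ℝ), F.volumeFun φ C s = F.volumeFun φ C 0) →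
    HasDerivAt (fun s => subArea X (φ s) C) 0 0

/-- The open part `U` of the surface, with mean curvature `H`, is strongly stable: it is
area-stationary under a volume constraint and `(A + 2HV)''(0) ≥ 0` for any variation. The
existence of the second derivative is part of the claim. -/
def IsStronglyStable [MeasurableSpace S] (U : Set S) (H : ℝ) : Prop :=
  F.IsVolumePreservingAreaStationary U ∧
  ∀ I C φ, F.IsVariation U I C φ →
    ContDiffAt ℝ 2 (F.areaVolume H φ C) 0 ∧ 0 ≤ iteratedDeriv 2 (F.areaVolume H φ C) 0

/-- The open part `U` of the surface, with mean curvature `H`, is strictly stable: it is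
strongly stable, and `(A + 2HV)''(0) = 0` if and only if the velocity of the variation is
tangent to the surface. -/
def IsStrictlyStable [MeasurableSpace S] (U : Set S) (H : ℝ) : Prop :=
  F.IsStronglyStable U H ∧
  ∀ I C φ, F.IsVariation U I C φ →
    (iteratedDeriv 2 (F.areaVolume H φ C) 0 = 0 ↔
      ∀ p ∈ U, ∃ v, mfderiv (𝓡 2) (𝓡 3) (φ 0) p v = velocity φ 0 p)

end OrientedSurface

end Ambient

end SubRiem

end

/-!
The proof computes the first and second variation of `A + 2 H V` by moving frames, with the
Tanaka–Webster connection in place of the Levi-Civita connection, and completes a square.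

**Structure equations.** For a local horizontal orthonormal frame `A, B` with dual forms `θ₁, θ₂`
the connection form `w` of the Tanaka–Webster connection is `⟨DA, B⟩ - η`. Since `T` is a Killing
field, `D_u T = J(u)`, and
`dη = 2 θ₁ ∧ θ₂`, `dθ₁ = w ∧ θ₂`, `dθ₂ = -w ∧ θ₁`, `dw = -4 K θ₁ ∧ θ₂`,
where `d` is the exterior derivative without the factor `1/2` (`IsHorFrame.extD_flatA`,
`IsHorFrame.extD_flatB`, `IsHorFrame.extD_websterForm`). A variation `φ` is written in a chart of
the surface as a map from an open subset of `ℝ × ℝ²`, and the four equations are pulled back by it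
(`IsHorFrame.isStructureSystem`). Then the frame is rotated (`IsStructureSystem.isCartan`) so that
in the new coframe `η, α, β, ζ` the form `η ∧ β` vanishes on every slice `s = const`. On the slices
`α` is dual to the characteristic field `Z`, the area density is `η ∧ α` up to sign, and
`β = λ η` with `λ = ⟨N, T⟩ / |N_h|`. The structure equations restricted to a slice express `ζ`
through `λ` and the mean curvature, and the one for `ζ` becomes a Codazzi equation.

**First variation.** With `v = -⟨U, N⟩ / |N_h|`, the time derivative of `η ∧ α` is `2 H v η ∧ α` plus
an exact form (`Coframe.IsCartan.fderiv_m`), so `A' + 2 H V' = 0` at the initial time by Stokes'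
theorem for compactly supported forms on a surface (`IsCurl.integral_eq_zero`).

**Second variation.** Differentiating once more produces the derivative of the mean curvature in
the direction of the velocity, which is `-(Z(Z(v)) + 2 λ Z(v) + Q v)` (`Coframe.IsCartan.fderiv_h`).
The operator in the bracket is the conjugate of the Jacobi operator `𝓛` by multiplication with
`|N_h|` (`Coframe.IsCartan.jacobi_mul_nh`). For every function `g` without zeros one obtains, up to
an exact form (`Coframe.IsCartan.second_variation`),
`(A + 2 H V)''(0) = ∫ |N_h| ((Z(v) - v Z(g) / g)² - v² 𝓛(|N_h| g) / g) da`.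
The derivatives under the integral sign are justified by `HasParamDeriv.setIntegral`.

**Stability.** The right-hand side is nonnegative if `𝓛(|N_h| g) / g ≤ 0`. A Jacobi function `ψ`
without zeros gives `g = ψ / |N_h|`. The Codazzi equation says that `⟨N, T⟩` is a Jacobi function
(`Coframe.IsCartan.jacobi_lam`), which gives `g = ⟨N, T⟩ / |N_h|` when there are no vertical points.
If `𝓛(|N_h|) ≤ 0`, take `g = 1`. If `𝓛(|N_h|) < 0`, the integrand is moreover positive wherever `v`
does not vanish, so the second variation vanishes only if `v = 0`, that is, if `U` is tangent to the
surface.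
-/

set_option linter.unusedSectionVars false


noncomputable section

namespace SubRiem

/-! ### Pullbacks of forms and chart derivatives -/

section Charts

variable {E : Type*} [NormedAddCommGroup E] [NormedSpace ℝ E]
  {M : Type*} [TopologicalSpace M] [ChartedSpace E M]

/-- The pullback `k^*α` of a `1`-form by a map from a vector space. -/
def pullForm {P : Type*} [NormedAddCommGroup P] [NormedSpace ℝ P]
    (α : ∀ q : M, TangentSpace 𝓘(ℝ, E) q →L[ℝ] ℝ) (k : P → M) (z : P) : P →L[ℝ] ℝ :=
  (α (k z)).comp (dMap k z)

/-- The coordinates of the vector field `W` in the preferred chart around `p`. -/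
def fieldInChart (W : ∀ q : M, TangentSpace 𝓘(ℝ, E) q) (p : M) (y : E) : E :=
  dChart p ((extChartAt 𝓘(ℝ, E) p).symm y) (W ((extChartAt 𝓘(ℝ, E) p).symm y))

variable {P : Type*} [NormedAddCommGroup P] [NormedSpace ℝ P]

lemma pullForm_congr (α : ∀ q : M, TangentSpace 𝓘(ℝ, E) q →L[ℝ] ℝ) {k k' : P → M} {z : P}
    (h : k =ᶠ[𝓝 z] k') : pullForm α k z = pullForm α k' z := by
  have h1 : (dMap k z : P →L[ℝ] E) = dMap k' z := h.mfderiv_eq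
  have h2 : ∀ q, q = k' z → (α q : E →L[ℝ] ℝ).comp (dMap k' z : P →L[ℝ] E)
      = (α (k' z) : E →L[ℝ] ℝ).comp (dMap k' z : P →L[ℝ] E) := by
    rintro _ rfl; rfl
  have h3 : pullForm α k z = (α (k z) : E →L[ℝ] ℝ).comp (dMap k z : P →L[ℝ] E) := rfl
  rw [h3, h1]
  exact h2 _ h.self_of_nhds

lemma dMap_comp {Q : Type*} [NormedAddCommGroup Q] [NormedSpace ℝ Q] {j : P → M} {κ : Q → P}
    {z : Q} (hj : MDifferentiableAt 𝓘(ℝ, P) 𝓘(ℝ, E) j (κ z)) (hκ : DifferentiableAt ℝ κ z) :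
    (dMap (j ∘ κ) z : Q →L[ℝ] E) = (dMap j (κ z) : P →L[ℝ] E).comp (fderiv ℝ κ z) := by
  have := mfderiv_comp (I := 𝓘(ℝ, Q)) (I' := 𝓘(ℝ, P)) (I'' := 𝓘(ℝ, E)) z hj
    hκ.mdifferentiableAt
  rw [mfderiv_eq_fderiv] at this
  exact this

lemma pullForm_comp {Q : Type*} [NormedAddCommGroup Q] [NormedSpace ℝ Q]
    (α : ∀ q : M, TangentSpace 𝓘(ℝ, E) q →L[ℝ] ℝ) {j : P → M} {κ : Q → P}
    {z : Q} (hj : MDifferentiableAt 𝓘(ℝ, P) 𝓘(ℝ, E) j (κ z)) (hκ : DifferentiableAt ℝ κ z) :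
    pullForm α (j ∘ κ) z = (pullForm α j (κ z)).comp (fderiv ℝ κ z) := by
  have h : pullForm α (j ∘ κ) z
    = (α (j (κ z)) : E →L[ℝ] ℝ).comp (dMap (j ∘ κ) z : Q →L[ℝ] E) := rfl
  rw [h, dMap_comp hj hκ]
  rfl

lemma formInChart_eq_pullForm (α : ∀ q : M, TangentSpace 𝓘(ℝ, E) q →L[ℝ] ℝ) (p : M) :
    formInChart α p = pullForm α (extChartAt 𝓘(ℝ, E) p).symm := rfl

lemma mem_extChartAt_source' {p q : M} (h : q ∈ (extChartAt 𝓘(ℝ, E) p).source) :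
    q ∈ (chartAt E p).source := by
  rwa [extChartAt_source] at h

lemma fderiv_extChartAt_comp [IsManifold 𝓘(ℝ, E) ∞ M] {k : P → M} {z : P} {p : M}
    (hk : MDifferentiableAt 𝓘(ℝ, P) 𝓘(ℝ, E) k z) (hp : k z ∈ (extChartAt 𝓘(ℝ, E) p).source)
    (u : P) :
    fderiv ℝ (extChartAt 𝓘(ℝ, E) p ∘ k) z u = dChart p (k z) (dMap k z u) := by
  have : IsManifold 𝓘(ℝ, E) 1 M := IsManifold.of_le (n := ∞) (by norm_cast)
  have h2 := mfderiv_comp (I := 𝓘(ℝ, P)) (I' := 𝓘(ℝ, E)) (I'' := 𝓘(ℝ, E)) z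
    (mdifferentiableAt_extChartAt (mem_extChartAt_source' hp)) hk
  rw [mfderiv_eq_fderiv] at h2
  rw [h2]; rfl

variable [IsManifold 𝓘(ℝ, E) ∞ M]

lemma contMDiffAt_extChartAt_symm (p : M) {y : E} (hy : y ∈ (extChartAt 𝓘(ℝ, E) p).target) :
    ContMDiffAt 𝓘(ℝ, E) 𝓘(ℝ, E) ∞ (extChartAt 𝓘(ℝ, E) p).symm y :=
  (contMDiffOn_extChartAt_symm p).contMDiffAt ((isOpen_extChartAt_target p).mem_nhds hy)

lemma mdifferentiableAt_extChartAt_symm (p : M) {y : E}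
    (hy : y ∈ (extChartAt 𝓘(ℝ, E) p).target) :
    MDifferentiableAt 𝓘(ℝ, E) 𝓘(ℝ, E) (extChartAt 𝓘(ℝ, E) p).symm y :=
  (contMDiffAt_extChartAt_symm p hy).mdifferentiableAt (by simp)

lemma dChart_self (p : M) : (dChart p p : E →L[ℝ] E) = ContinuousLinearMap.id ℝ E := by
  have : IsManifold 𝓘(ℝ, E) 1 M := IsManifold.of_le (n := ∞) (by norm_cast)
  exact mfderiv_extChartAt_self

lemma dChart_dChartSymm {p : M} {y : E} (hy : y ∈ (extChartAt 𝓘(ℝ, E) p).target) (v : E) :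
    dChart p ((extChartAt 𝓘(ℝ, E) p).symm y) (dChartSymm p y v) = v := by
  have : IsManifold 𝓘(ℝ, E) 1 M := IsManifold.of_le (n := ∞) (by norm_cast)
  have h := mfderiv_extChartAt_comp_mfderivWithin_extChartAt_symm (I := 𝓘(ℝ, E)) hy
  rw [modelWithCornersSelf_coe, range_id, mfderivWithin_univ] at h
  exact DFunLike.congr_fun h v

lemma dChartSymm_dChart {p : M} {y : E} (hy : y ∈ (extChartAt 𝓘(ℝ, E) p).target)
    (v : TangentSpace 𝓘(ℝ, E) ((extChartAt 𝓘(ℝ, E) p).symm y)) :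
    dChartSymm p y (dChart p ((extChartAt 𝓘(ℝ, E) p).symm y) v) = v := by
  have : IsManifold 𝓘(ℝ, E) 1 M := IsManifold.of_le (n := ∞) (by norm_cast)
  have h := mfderivWithin_extChartAt_symm_comp_mfderiv_extChartAt (I := 𝓘(ℝ, E)) hy
  rw [modelWithCornersSelf_coe, range_id, mfderivWithin_univ] at h
  exact DFunLike.congr_fun h v

lemma dChartSymm_fieldInChart (W : ∀ q : M, TangentSpace 𝓘(ℝ, E) q) {p : M} {y : E}
    (hy : y ∈ (extChartAt 𝓘(ℝ, E) p).target) :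
    dChartSymm p y (fieldInChart W p y) = W ((extChartAt 𝓘(ℝ, E) p).symm y) :=
  dChartSymm_dChart hy _

/-- Locally, `k` factors through the preferred chart around any point `p` near `k z`, and the
pullback by `k` is the pullback of the coordinate expression of the form. -/
lemma pullForm_eventuallyEq (α : ∀ q : M, TangentSpace 𝓘(ℝ, E) q →L[ℝ] ℝ) {k : P → M} {z : P}
    {p : M} (hk : ContMDiffAt 𝓘(ℝ, P) 𝓘(ℝ, E) 1 k z)
    (hp : k z ∈ (extChartAt 𝓘(ℝ, E) p).source) :
    pullForm α k =ᶠ[𝓝 z] fun z' => (formInChart α p (extChartAt 𝓘(ℝ, E) p (k z'))).comp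
      (fderiv ℝ (extChartAt 𝓘(ℝ, E) p ∘ k) z') := by
  have : IsManifold 𝓘(ℝ, E) 1 M := IsManifold.of_le (n := ∞) (by norm_cast)
  have hs : ∀ᶠ z' in 𝓝 z, k z' ∈ (extChartAt 𝓘(ℝ, E) p).source :=
    hk.continuousAt.eventually ((isOpen_extChartAt_source p).mem_nhds hp)
  filter_upwards [hs.eventually_nhds,
    (contMDiffAt_iff_contMDiffAt_nhds (by simp)).1 hk, hs] with z' h1 h2 h3
  have h4 : k =ᶠ[𝓝 z'] (extChartAt 𝓘(ℝ, E) p).symm ∘ (extChartAt 𝓘(ℝ, E) p ∘ k) := by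
    filter_upwards [h1] with w hw
    exact ((extChartAt 𝓘(ℝ, E) p).left_inv hw).symm
  rw [pullForm_congr α h4, pullForm_comp]
  · rfl
  · exact mdifferentiableAt_extChartAt_symm p ((extChartAt 𝓘(ℝ, E) p).map_source h3)
  · exact ((mdifferentiableAt_extChartAt (mem_extChartAt_source' h3)).comp z'
      (h2.mdifferentiableAt (by simp))).differentiableAt

lemma contDiffAt_extChartAt_comp {n : WithTop ℕ∞} (hn : n ≤ ∞) {k : P → M} {z : P}
    {p : M} (hk : ContMDiffAt 𝓘(ℝ, P) 𝓘(ℝ, E) n k z)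
    (hp : k z ∈ (extChartAt 𝓘(ℝ, E) p).source) :
    ContDiffAt ℝ n (extChartAt 𝓘(ℝ, E) p ∘ k) z := by
  have h := (contMDiffAt_extChartAt' (I := 𝓘(ℝ, E)) (n := ∞) (mem_extChartAt_source' hp)).of_le hn
  exact (h.comp z hk).contDiffAt

/-- The coordinate expression of a pulled back form is differentiable to the order `n` of the form,
provided that the map has one derivative more. -/
lemma contDiffAt_pullForm {n : WithTop ℕ∞} (hn : n + 1 ≤ ∞)
    {α : ∀ q : M, TangentSpace 𝓘(ℝ, E) q →L[ℝ] ℝ} {k : P → M}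
    {z : P} {p : M} (hk : ContMDiffAt 𝓘(ℝ, P) 𝓘(ℝ, E) (n + 1) k z)
    (hp : k z ∈ (extChartAt 𝓘(ℝ, E) p).source)
    (hα : ContDiffAt ℝ n (formInChart α p) (extChartAt 𝓘(ℝ, E) p (k z))) :
    ContDiffAt ℝ n (pullForm α k) z := by
  have hc := contDiffAt_extChartAt_comp hn hk hp
  have h1 : ContDiffAt ℝ n (fun z' => (formInChart α p (extChartAt 𝓘(ℝ, E) p (k z'))).comp
      (fderiv ℝ (extChartAt 𝓘(ℝ, E) p ∘ k) z')) z := by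
    apply ContDiffAt.clm_comp
    · exact ContDiffAt.comp z (g := formInChart α p) hα (hc.of_le le_self_add)
    · exact hc.fderiv_right le_rfl
  exact h1.congr_of_eventuallyEq (pullForm_eventuallyEq α (hk.of_le le_add_self) hp)

/-- The exterior derivative commutes with pullbacks by `C²` maps. The factor `2` comes from the
convention in the definition of `extD`. -/
lemma fderiv_pullForm_antisymm {α : ∀ q : M, TangentSpace 𝓘(ℝ, E) q →L[ℝ] ℝ} {k : P → M}
    {z : P} (hk : ContMDiffAt 𝓘(ℝ, P) 𝓘(ℝ, E) 2 k z)
    (hα : DifferentiableAt ℝ (formInChart α (k z)) (extChartAt 𝓘(ℝ, E) (k z) (k z))) (u v : P) :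
    fderiv ℝ (pullForm α k) z u v - fderiv ℝ (pullForm α k) z v u
      = 2 * extD α (k z) (dMap k z u) (dMap k z v) := by
  have hp := mem_extChartAt_source (I := 𝓘(ℝ, E)) (k z)
  have hc := contDiffAt_extChartAt_comp (by norm_cast) hk hp
  have hd := hk.mdifferentiableAt (by simp)
  set κ : P → E := extChartAt 𝓘(ℝ, E) (k z) ∘ k with hκ
  have hA : DifferentiableAt ℝ (fun z' => formInChart α (k z) (κ z')) z :=
    DifferentiableAt.comp z (g := formInChart α (k z)) hα (hc.differentiableAt (by simp))
  have hA' : fderiv ℝ (fun z' => formInChart α (k z) (κ z')) z =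
      (fderiv ℝ (formInChart α (k z)) (extChartAt 𝓘(ℝ, E) (k z) (k z))).comp (fderiv ℝ κ z) :=
    fderiv_comp z (g := formInChart α (k z)) hα (hc.differentiableAt (by simp))
  have hB : DifferentiableAt ℝ (fderiv ℝ κ) z :=
    (hc.fderiv_right (m := 1) (by norm_num)).differentiableAt (by simp)
  have hsym : IsSymmSndFDerivAt ℝ κ z := hc.isSymmSndFDerivAt (by simp)
  have e := pullForm_eventuallyEq α (hk.of_le (by norm_cast)) hp
  have key : ∀ a b, fderiv ℝ (pullForm α k) z a b =
      fderiv ℝ (formInChart α (k z)) (extChartAt 𝓘(ℝ, E) (k z) (k z)) (fderiv ℝ κ z a)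
        (fderiv ℝ κ z b) + formInChart α (k z) (κ z) (fderiv ℝ (fderiv ℝ κ) z a b) := by
    intro a b
    rw [e.fderiv_eq]
    have := (hA.hasFDerivAt.clm_comp hB.hasFDerivAt).fderiv
    have h3 := DFunLike.congr_fun (DFunLike.congr_fun this a) b
    simp only [hA'] at h3
    refine h3.trans ?_
    simp [add_comm]
  rw [key, key, hsym.eq u v]
  have h1 : ∀ a, fderiv ℝ κ z a = dChart (k z) (k z) (dMap k z a) := fun a =>
    fderiv_extChartAt_comp hd hp a
  simp only [extD, h1]
  simp

end Charts

/-! ### The Levi-Civita connection in a chart -/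

section ChartMetric

variable {E : Type*} [NormedAddCommGroup E] [NormedSpace ℝ E]
  {M : Type*} [TopologicalSpace M] [ChartedSpace E M] [IsManifold 𝓘(ℝ, E) ∞ M]

lemma metricInChart_apply (g : Metric E M) (p : M) (y u v : E) :
    metricInChart g p y u v
      = g.inner ((extChartAt 𝓘(ℝ, E) p).symm y) (dChartSymm p y u) (dChartSymm p y v) := rfl

lemma metricInChart_symm (g : Metric E M) (p : M) (y u v : E) :
    metricInChart g p y u v = metricInChart g p y v u := by
  rw [metricInChart_apply, metricInChart_apply, g.symm]

lemma metricInChart_pos (g : Metric E M) (p : M) {y : E}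
    (hy : y ∈ (extChartAt 𝓘(ℝ, E) p).target) {v : E} (hv : v ≠ 0) :
    0 < metricInChart g p y v v := by
  rw [metricInChart_apply]
  apply g.pos
  intro h
  apply hv
  rw [← dChart_dChartSymm hy v, h, map_zero]

lemma contMDiffAt_coordField (p : M) {y : E} (hy : y ∈ (extChartAt 𝓘(ℝ, E) p).target) (v : E) :
    ContMDiffAt 𝓘(ℝ, E) (𝓘(ℝ, E).prod 𝓘(ℝ, E)) ∞
      (fun z => (⟨(extChartAt 𝓘(ℝ, E) p).symm z, dChartSymm p z v⟩ : TangentBundle 𝓘(ℝ, E) M)) y := by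
  have : IsManifold 𝓘(ℝ, E) 1 M := IsManifold.of_le (n := ∞) (by norm_cast)
  have h1 := (contMDiffOn_extChartAt_symm (I := 𝓘(ℝ, E)) (n := ∞) p).contMDiffOn_tangentMapWithin
    (m := ∞) (by simp) (isOpen_extChartAt_target p).uniqueMDiffOn
  have h2 : ContMDiffAt 𝓘(ℝ, E) (𝓘(ℝ, E).prod 𝓘(ℝ, E)) ∞
      (fun z : E => (⟨z, v⟩ : TangentBundle 𝓘(ℝ, E) E)) y := by
    exact contMDiffAt_vectorSpace_iff_contDiffAt.2 contDiffAt_const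
  have h3 := (h1 (⟨y, v⟩ : TangentBundle 𝓘(ℝ, E) E) hy).contMDiffAt (by
    have : Continuous (Bundle.TotalSpace.proj : TangentBundle 𝓘(ℝ, E) E → E) :=
      FiberBundle.continuous_proj E _
    exact this.continuousAt.preimage_mem_nhds ((isOpen_extChartAt_target p).mem_nhds hy))
  have h4 := h3.comp y (f := fun z : E => (⟨z, v⟩ : TangentBundle 𝓘(ℝ, E) E)) h2
  refine h4.congr_of_eventuallyEq ?_
  filter_upwards [(isOpen_extChartAt_target p).mem_nhds hy] with z hz
  simp only [Function.comp, tangentMapWithin, dChartSymm]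
  rw [mfderivWithin_of_isOpen (isOpen_extChartAt_target p) hz]
  rfl

lemma contDiffAt_metricInChart [FiniteDimensional ℝ E] (g : Metric E M) (p : M) {y : E}
    (hy : y ∈ (extChartAt 𝓘(ℝ, E) p).target) : ContDiffAt ℝ ∞ (metricInChart g p) y := by
  have : ContDiffOn ℝ ∞ (metricInChart g p) (extChartAt 𝓘(ℝ, E) p).target := by
    rw [contDiffOn_clm_apply]
    intro u
    rw [contDiffOn_clm_apply]
    intro v z hz
    have h1 := g.contMDiff ((extChartAt 𝓘(ℝ, E) p).symm z)
    have h2 := h1.comp z (contMDiffAt_extChartAt_symm p hz)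
    have h3 := ContMDiffAt.clm_bundle_apply₂ (F₃ := ℝ) (E₃ := Bundle.Trivial M ℝ) h2
      (contMDiffAt_coordField p hz u) (contMDiffAt_coordField p hz v)
    rw [contMDiffAt_totalSpace] at h3
    exact h3.2.contDiffAt.contDiffWithinAt
  exact this.contDiffAt ((isOpen_extChartAt_target p).mem_nhds hy)

lemma contMDiffAt_of_fieldInChart {n : WithTop ℕ∞} (hn : n ≤ ∞)
    {W : ∀ q : M, TangentSpace 𝓘(ℝ, E) q} {p q : M}
    (hq : q ∈ (extChartAt 𝓘(ℝ, E) p).source)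
    (hW : ContDiffAt ℝ n (fieldInChart W p) (extChartAt 𝓘(ℝ, E) p q)) :
    ContMDiffAt 𝓘(ℝ, E) 𝓘(ℝ, E).tangent n (fun q => (⟨q, W q⟩ : TangentBundle 𝓘(ℝ, E) M)) q := by
  have : IsManifold 𝓘(ℝ, E) 1 M := IsManifold.of_le (n := ∞) (by norm_cast)
  have : IsManifold 𝓘(ℝ, E) n M := IsManifold.of_le hn
  have : ContMDiffVectorBundle n E (TangentSpace 𝓘(ℝ, E) : M → Type _) 𝓘(ℝ, E) :=
    ContMDiffVectorBundle.of_le hn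
  refine ((trivializationAt E (TangentSpace 𝓘(ℝ, E)) p).contMDiffAt_section_iff
    (IB := 𝓘(ℝ, E)) (n := n) (s := W) (x₀ := q)
    (by simpa using mem_extChartAt_source' hq)).2 ?_
  have h2 := hW.contMDiffAt.comp q
    (contMDiffAt_extChartAt' (I := 𝓘(ℝ, E)) (n := n) (mem_extChartAt_source' hq))
  refine h2.congr_of_eventuallyEq ?_
  filter_upwards [(isOpen_extChartAt_source (I := 𝓘(ℝ, E)) p).mem_nhds hq] with r hr
  have hr' := mem_extChartAt_source' hr
  have h3 := TangentBundle.continuousLinearMapAt_trivializationAt (I := 𝓘(ℝ, E)) hr'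
  have h4 : ∀ r', r' = r → (dChart p r' (W r') : E) = dChart p r (W r) := by
    rintro _ rfl; rfl
  simp only [Function.comp]
  rw [fieldInChart, h4 _ ((extChartAt 𝓘(ℝ, E) p).left_inv hr), dChart, ← h3,
    Bundle.Trivialization.continuousLinearMapAt_apply,
    Bundle.Trivialization.linearMapAt_apply, if_pos (by simpa using hr')]

lemma contDiffAt_fieldInChart {n : WithTop ℕ∞} (hn : n ≤ ∞)
    {W : ∀ q : M, TangentSpace 𝓘(ℝ, E) q} {p : M} {y : E}
    (hy : y ∈ (extChartAt 𝓘(ℝ, E) p).target)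
    (hW : ContMDiffAt 𝓘(ℝ, E) 𝓘(ℝ, E).tangent n (fun q => (⟨q, W q⟩ : TangentBundle 𝓘(ℝ, E) M))
      ((extChartAt 𝓘(ℝ, E) p).symm y)) :
    ContDiffAt ℝ n (fieldInChart W p) y := by
  have : IsManifold 𝓘(ℝ, E) 1 M := IsManifold.of_le (n := ∞) (by norm_cast)
  have : IsManifold 𝓘(ℝ, E) n M := IsManifold.of_le hn
  have : ContMDiffVectorBundle n E (TangentSpace 𝓘(ℝ, E) : M → Type _) 𝓘(ℝ, E) :=
    ContMDiffVectorBundle.of_le hn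
  have hs := (extChartAt 𝓘(ℝ, E) p).map_target hy
  have h1 := ((trivializationAt E (TangentSpace 𝓘(ℝ, E)) p).contMDiffAt_section_iff
    (IB := 𝓘(ℝ, E)) (n := n) (s := W) (x₀ := (extChartAt 𝓘(ℝ, E) p).symm y)
    (by simpa using mem_extChartAt_source' hs)).1 hW
  have h2 := h1.comp y ((contMDiffAt_extChartAt_symm p hy).of_le hn)
  refine h2.contDiffAt.congr_of_eventuallyEq ?_
  filter_upwards [(isOpen_extChartAt_target p).mem_nhds hy] with z hz
  have hz' := mem_extChartAt_source' ((extChartAt 𝓘(ℝ, E) p).map_target hz)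
  have h3 := TangentBundle.continuousLinearMapAt_trivializationAt (I := 𝓘(ℝ, E)) hz'
  simp only [Function.comp, fieldInChart, dChart, ← h3]
  rw [Bundle.Trivialization.continuousLinearMapAt_apply,
    Bundle.Trivialization.linearMapAt_apply, if_pos (by simpa using hz')]

end ChartMetric

/-- A positive bilinear form on a finite dimensional space identifies it with its dual. -/
lemma isInvertible_of_pos {V : Type*} [AddCommGroup V] [TopologicalSpace V] [IsTopologicalAddGroup V]
    [Module ℝ V] [ContinuousSMul ℝ V] [T2Space V] [FiniteDimensional ℝ V] (B : V →L[ℝ] V →L[ℝ] ℝ)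
    (hB : ∀ v, v ≠ 0 → 0 < B v v) : B.IsInvertible := by
  have hi : Function.Injective B := by
    rw [injective_iff_map_eq_zero]
    intro v hv
    by_contra h
    have := hB v h
    rw [hv] at this
    simp at this
  have hf : Module.finrank ℝ V = Module.finrank ℝ (V →L[ℝ] ℝ) := by
    rw [← (LinearMap.toContinuousLinearMap (𝕜 := ℝ) (E := V) (F' := ℝ)).finrank_eq]
    exact (Subspace.dual_finrank_eq (K := ℝ) (V := V)).symm
  have : FiniteDimensional ℝ (V →L[ℝ] ℝ) :=
    (LinearMap.toContinuousLinearMap (𝕜 := ℝ) (E := V) (F' := ℝ)).finiteDimensional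
  refine ⟨(LinearEquiv.ofInjectiveOfFinrankEq (B : V →ₗ[ℝ] (V →L[ℝ] ℝ)) hi
    hf).toContinuousLinearEquiv, ?_⟩
  ext v w
  rfl

lemma apply_inverse_of_pos {V : Type*} [AddCommGroup V] [TopologicalSpace V]
    [IsTopologicalAddGroup V]
    [Module ℝ V] [ContinuousSMul ℝ V] [T2Space V] [FiniteDimensional ℝ V] (B : V →L[ℝ] V →L[ℝ] ℝ)
    (hB : ∀ v, v ≠ 0 → 0 < B v v) (α : V →L[ℝ] ℝ) : B (B.inverse α) = α :=
  (isInvertible_of_pos B hB).self_apply_inverse α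

section ChartCalculus

variable {M : Type*} [TopologicalSpace M] [ChartedSpace E3 M] [IsManifold (𝓡 3) ∞ M]

/-- The covariant derivative of a vector field given by its coordinates `A` in the preferred
chart around `p`, in that chart. -/
def nabla (g : Metric E3 M) (p : M) (A : E3 → E3) (y u : E3) : E3 :=
  fderiv ℝ A y u + christoffel g p y u (A y)

variable (g : Metric E3 M) (p : M) {y : E3}

lemma koszul (hy : y ∈ (extChartAt (𝓡 3) p).target) (u v w : E3) :
    2 * metricInChart g p y (christoffel g p y u v) w =
      fderiv ℝ (metricInChart g p) y u v w + fderiv ℝ (metricInChart g p) y v u w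
        - fderiv ℝ (metricInChart g p) y w u v := by
  have hG := (contDiffAt_metricInChart g p hy).differentiableAt (by simp)
  have h : ∀ a b, fderiv ℝ (fun z => metricInChart g p z a) y b
      = fderiv ℝ (metricInChart g p) y b a := by
    intro a b
    have := (hG.hasFDerivAt.clm_apply (hasFDerivAt_const a y)).fderiv
    rw [this]; simp
  have h' : fderiv ℝ (fun z => metricInChart g p z u v) y w
      = fderiv ℝ (metricInChart g p) y w u v := by
    have := ((hG.hasFDerivAt.clm_apply (hasFDerivAt_const u y)).clm_apply
      (hasFDerivAt_const v y)).fderiv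
    rw [this]; simp
  unfold christoffel
  rw [apply_inverse_of_pos _ (fun v hv => metricInChart_pos g p hy hv)]
  simp only [_root_.smul_apply, _root_.sub_apply, _root_.add_apply, h, h', smul_eq_mul]
  ring

lemma fderiv_metricInChart_symm (hy : y ∈ (extChartAt (𝓡 3) p).target) (u v w : E3) :
    fderiv ℝ (metricInChart g p) y u v w = fderiv ℝ (metricInChart g p) y u w v := by
  have hG := (contDiffAt_metricInChart g p hy).differentiableAt (by simp)
  have h : ∀ a b, fderiv ℝ (fun z => metricInChart g p z a b) y u
      = fderiv ℝ (metricInChart g p) y u a b := by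
    intro a b
    have := ((hG.hasFDerivAt.clm_apply (hasFDerivAt_const a y)).clm_apply
      (hasFDerivAt_const b y)).fderiv
    rw [this]; simp
  rw [← h, ← h]
  congr 2
  ext z
  exact metricInChart_symm g p z v w

lemma metricInChart_christoffel (hy : y ∈ (extChartAt (𝓡 3) p).target) (u v w : E3) :
    fderiv ℝ (metricInChart g p) y u v w = metricInChart g p y (christoffel g p y u v) w
      + metricInChart g p y v (christoffel g p y u w) := by
  have h1 := koszul g p hy u v w
  have h2 := koszul g p hy u w v
  rw [metricInChart_symm g p y v]
  have h3 := fderiv_metricInChart_symm g p hy u v w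
  have h4 := fderiv_metricInChart_symm g p hy v u w
  have h5 := fderiv_metricInChart_symm g p hy w u v
  linarith

lemma metricInChart_ext (hy : y ∈ (extChartAt (𝓡 3) p).target) {a b : E3}
    (h : ∀ w, metricInChart g p y a w = metricInChart g p y b w) : a = b := by
  by_contra hab
  have := metricInChart_pos g p hy (sub_ne_zero.2 hab)
  have h2 := h (a - b)
  have h3 : metricInChart g p y (a - b) (a - b)
    = metricInChart g p y a (a - b) - metricInChart g p y b (a - b) := by simp
  linarith

lemma christoffel_symm (hy : y ∈ (extChartAt (𝓡 3) p).target) (u v : E3) :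
    christoffel g p y u v = christoffel g p y v u := by
  apply metricInChart_ext g p hy
  intro w
  have h1 := koszul g p hy u v w
  have h2 := koszul g p hy v u w
  have h5 := fderiv_metricInChart_symm g p hy w u v
  linarith

lemma trilinear_add_smul {E : Type*} [NormedAddCommGroup E] [NormedSpace ℝ E]
    (D : E →L[ℝ] E →L[ℝ] E →L[ℝ] ℝ) (u u' v w : E) (c : ℝ) :
    D (u + c • u') v w = D u v w + c * D u' v w ∧ D v (u + c • u') w = D v u w + c * D v u' w ∧
      D w (u + c • u') v = D w u v + c * D w u' v := by
  refine ⟨?_, ?_, ?_⟩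
  · rw [D.map_add u (c • u'), D.map_smul c u']; rfl
  · rw [(D v).map_add u (c • u'), (D v).map_smul c u']; rfl
  · rw [(D w).map_add u (c • u'), (D w).map_smul c u']; rfl

lemma christoffel_add_smul_left (hy : y ∈ (extChartAt (𝓡 3) p).target) (u v : E3) (c : ℝ)
    (u' : E3) :
    christoffel g p y (u + c • u') v = christoffel g p y u v + c • christoffel g p y u' v := by
  apply metricInChart_ext g p hy
  intro w
  have h1 := koszul g p hy (u + c • u') v w
  have h2 := koszul g p hy u v w
  have h3 := koszul g p hy u' v w
  obtain ⟨e1, e2, e3⟩ := trilinear_add_smul (fderiv ℝ (metricInChart g p) y) u u' v w c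
  have e4 : metricInChart g p y (christoffel g p y u v + c • christoffel g p y u' v) w
      = metricInChart g p y (christoffel g p y u v) w
        + c * metricInChart g p y (christoffel g p y u' v) w := by
    simp
  rw [e4]
  linear_combination (h1 - h2 - c * h3 + e1 + e2 - e3) / 2

/-- The Christoffel symbols as a bilinear map depending smoothly on the point. -/
lemma exists_christoffel_clm (hy : y ∈ (extChartAt (𝓡 3) p).target) :
    ∃ Γ : E3 → E3 →L[ℝ] E3 →L[ℝ] E3, ContDiffAt ℝ 1 Γ y ∧
      ∀ z ∈ (extChartAt (𝓡 3) p).target, ∀ u v, christoffel g p z u v = Γ z u v := by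
  have key : ∀ z ∈ (extChartAt (𝓡 3) p).target, ∀ (u v : E3) (c : ℝ) (u' v' : E3),
      christoffel g p z (u + c • u') v = christoffel g p z u v + c • christoffel g p z u' v ∧
      christoffel g p z u (v + c • v') = christoffel g p z u v + c • christoffel g p z u v' := by
    intro z hz u v c u' v'
    refine ⟨christoffel_add_smul_left g p hz u v c u', ?_⟩
    rw [christoffel_symm g p hz, christoffel_add_smul_left g p hz, christoffel_symm g p hz v,
      christoffel_symm g p hz v']
  have hadd : ∀ z ∈ (extChartAt (𝓡 3) p).target, ∀ u u' v,
      christoffel g p z (u + u') v = christoffel g p z u v + christoffel g p z u' v := by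
    intro z hz u u' v
    simpa using (key z hz u v 1 u' v).1
  have hadd' : ∀ z ∈ (extChartAt (𝓡 3) p).target, ∀ u v v',
      christoffel g p z u (v + v') = christoffel g p z u v + christoffel g p z u v' := by
    intro z hz u v v'
    simpa using (key z hz u v 1 u v').2
  have hzero : ∀ z ∈ (extChartAt (𝓡 3) p).target, ∀ v, christoffel g p z 0 v = 0 := by
    intro z hz v
    simpa using hadd z hz 0 0 v
  have hzero' : ∀ z ∈ (extChartAt (𝓡 3) p).target, ∀ v, christoffel g p z v 0 = 0 := by
    intro z hz v
    simpa using hadd' z hz v 0 0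
  classical
  let Γ : E3 → E3 →L[ℝ] E3 →L[ℝ] E3 := fun z =>
    if hz : z ∈ (extChartAt (𝓡 3) p).target then
      LinearMap.toContinuousLinearMap
        { toFun := fun u => LinearMap.toContinuousLinearMap
            { toFun := fun v => christoffel g p z u v
              map_add' := fun v v' => hadd' z hz u v v'
              map_smul' := fun c v => by
                simpa [hzero' z hz] using (key z hz u 0 c u v).2 }
          map_add' := fun u u' => by ext1 v; exact hadd z hz u u' v
          map_smul' := fun c u => by
            ext1 v
            simpa [hzero z hz] using (key z hz 0 v c u v).1 }
    else 0
  have hΓ : ∀ z ∈ (extChartAt (𝓡 3) p).target, ∀ u v, christoffel g p z u v = Γ z u v := by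
    intro z hz u v
    simp only [Γ]
    rw [dif_pos hz]
    rfl
  refine ⟨Γ, ?_, hΓ⟩
  have ho := isOpen_extChartAt_target (I := 𝓡 3) p
  suffices h : ContDiffOn ℝ 1 Γ (extChartAt (𝓡 3) p).target from h.contDiffAt (ho.mem_nhds hy)
  rw [contDiffOn_clm_apply]
  intro u
  rw [contDiffOn_clm_apply]
  intro v
  have h1 : ContDiffOn ℝ 1 (fun z => christoffel g p z u v) (extChartAt (𝓡 3) p).target := by
    intro z hz
    apply ContDiffAt.contDiffWithinAt
    have hG := contDiffAt_metricInChart g p hz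
    have hc : ∀ a b, ContDiffAt ℝ 1 (fun z' => fderiv ℝ (fun z => metricInChart g p z a) z' b) z := by
      intro a b
      exact ((hG.clm_apply contDiffAt_const).fderiv_right (m := 1) (by norm_cast)).clm_apply
        contDiffAt_const
    have hc' : ContDiffAt ℝ 1 (fun z' => fderiv ℝ (fun z => metricInChart g p z u v) z') z :=
      ((hG.clm_apply contDiffAt_const).clm_apply contDiffAt_const).fderiv_right (m := 1)
        (by norm_cast)
    unfold christoffel
    obtain ⟨e, he⟩ := isInvertible_of_pos _ (fun v hv => metricInChart_pos g p hz hv)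
    have hinv : ContDiffAt ℝ 1 (fun z' => (metricInChart g p z').inverse) z := by
      have := contDiffAt_map_inverse (𝕜 := ℝ) (n := 1) e
      rw [he] at this
      exact this.comp z (hG.of_le (by norm_cast))
    exact hinv.clm_apply ((((hc v u).add (hc u v)).sub hc').const_smul (1 / 2 : ℝ))
  exact h1.congr fun z hz => (hΓ z hz u v).symm

lemma hasFDerivAt_metricInChart_apply₂ (hy : y ∈ (extChartAt (𝓡 3) p).target) {A B : E3 → E3}
    (hA : DifferentiableAt ℝ A y) (hB : DifferentiableAt ℝ B y) (u : E3) :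
    fderiv ℝ (fun z => metricInChart g p z (A z) (B z)) y u =
      metricInChart g p y (nabla g p A y u) (B y) + metricInChart g p y (A y) (nabla g p B y u) := by
  have hG := (contDiffAt_metricInChart g p hy).differentiableAt (by simp)
  have h := ((hG.hasFDerivAt.clm_apply hA.hasFDerivAt).clm_apply hB.hasFDerivAt).fderiv
  have h2 := DFunLike.congr_fun h u
  refine h2.trans ?_
  have h3 := metricInChart_christoffel g p hy u (A y) (B y)
  simp [nabla, h3]
  ring

/-- The Levi-Civita connection is torsion free. -/
lemma fderiv_metricInChart_field_antisymm (hy : y ∈ (extChartAt (𝓡 3) p).target) {A : E3 → E3}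
    (hA : DifferentiableAt ℝ A y) (u v : E3) :
    fderiv ℝ (fun z => metricInChart g p z (A z)) y u v
      - fderiv ℝ (fun z => metricInChart g p z (A z)) y v u =
      metricInChart g p y (nabla g p A y u) v - metricInChart g p y (nabla g p A y v) u := by
  have hG := (contDiffAt_metricInChart g p hy).differentiableAt (by simp)
  have h := (hG.hasFDerivAt.clm_apply hA.hasFDerivAt).fderiv
  have h3 := metricInChart_christoffel g p hy u (A y) v
  have h4 := metricInChart_christoffel g p hy v (A y) u
  rw [christoffel_symm g p hy v u] at h4
  rw [h]
  simp [nabla, h3, h4]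
  ring

/-- The curvature tensor in the preferred chart around `p`, applied to constant fields. -/
def curvature (y u v b : E3) : E3 :=
  fderiv ℝ (fun z => christoffel g p z v b) y u - fderiv ℝ (fun z => christoffel g p z u b) y v
    + christoffel g p y u (christoffel g p y v b) - christoffel g p y v (christoffel g p y u b)

/-- The exterior derivative of the connection form `⟨∇B, A⟩` of two vector fields. -/
lemma fderiv_connection_antisymm (hy : y ∈ (extChartAt (𝓡 3) p).target) {A B : E3 → E3}
    (hA : DifferentiableAt ℝ A y) (hB : ContDiffAt ℝ 2 B y) (u v : E3) :
    fderiv ℝ (fun z => metricInChart g p z (nabla g p B z v) (A z)) y u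
      - fderiv ℝ (fun z => metricInChart g p z (nabla g p B z u) (A z)) y v =
      metricInChart g p y (curvature g p y u v (B y)) (A y)
      + metricInChart g p y (nabla g p B y v) (nabla g p A y u)
      - metricInChart g p y (nabla g p B y u) (nabla g p A y v) := by
  obtain ⟨Γ, hΓ, hΓe⟩ := exists_christoffel_clm g p hy
  have ho := isOpen_extChartAt_target (I := 𝓡 3) p
  have hΓd := hΓ.differentiableAt (by simp)
  have hBd := hB.differentiableAt (by simp)
  have hB2 : DifferentiableAt ℝ (fderiv ℝ B) y :=
    (hB.fderiv_right (m := 1) (by norm_num)).differentiableAt (by simp)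
  have hsym : IsSymmSndFDerivAt ℝ B y := hB.isSymmSndFDerivAt (by simp)
  have hn : ∀ w, HasFDerivAt (fun z => nabla g p B z w)
      (((fderiv ℝ (fderiv ℝ B) y).flip w) + ((Γ y w).comp (fderiv ℝ B y)
        + ((fderiv ℝ Γ y).flip w).flip (B y))) y := by
    intro w
    have h1 := (hB2.hasFDerivAt.clm_apply (hasFDerivAt_const w y))
    have h2 := (hΓd.hasFDerivAt.clm_apply (hasFDerivAt_const w y)).clm_apply hBd.hasFDerivAt
    have h3 := h1.add h2
    refine (h3.congr_of_eventuallyEq ?_).congr_fderiv ?_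
    · filter_upwards [ho.mem_nhds hy] with z hz
      simp [nabla, hΓe z hz]
    · ext1 a; simp
  have hc : ∀ w b, fderiv ℝ (fun z => christoffel g p z w b) y
      = ((fderiv ℝ Γ y).flip w).flip b := by
    intro w b
    have h2 := (hΓd.hasFDerivAt.clm_apply (hasFDerivAt_const w y)).clm_apply
      (hasFDerivAt_const b y)
    rw [(h2.congr_of_eventuallyEq (f₁ := fun z => christoffel g p z w b) ?_).fderiv]
    · ext1 a; simp
    · filter_upwards [ho.mem_nhds hy] with z hz
      simp [hΓe z hz]
  rw [hasFDerivAt_metricInChart_apply₂ g p hy (hn v).differentiableAt hA,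
    hasFDerivAt_metricInChart_apply₂ g p hy (hn u).differentiableAt hA]
  have h5 : nabla g p (fun z => nabla g p B z v) y u - nabla g p (fun z => nabla g p B z u) y v
      = curvature g p y u v (B y) := by
    simp only [nabla, curvature, hc]
    have e1 := (hn v).fderiv
    have e2 := (hn u).fderiv
    simp only [nabla] at e1 e2
    rw [e1, e2]
    simp only [hΓe y hy, _root_.add_apply, ContinuousLinearMap.flip_apply, map_add,
      ContinuousLinearMap.comp_apply]
    rw [hsym.eq u v]
    abel
  rw [← h5, map_sub, _root_.sub_apply]
  ring

lemma sectional_eq_curvature (u v : TangentSpace (𝓡 3) p) :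
    sectional g p u v = metricInChart g p (extChartAt (𝓡 3) p p)
      (curvature g p (extChartAt (𝓡 3) p p) (dChart p p u) (dChart p p v) (dChart p p v))
      (dChart p p u) := rfl

end ChartCalculus

/-! ### Covariant derivatives along maps -/

section CovDeriv

variable {M : Type*} [TopologicalSpace M] [ChartedSpace E3 M] [IsManifold (𝓡 3) ∞ M]

lemma hasMFDerivAt_smul_vector {E' H' : Type*} [NormedAddCommGroup E'] [NormedSpace ℝ E']
    [TopologicalSpace H'] {I' : ModelWithCorners ℝ E' H'} {N : Type*} [TopologicalSpace N]
    [ChartedSpace H' N] {F : Type*} [NormedAddCommGroup F] [NormedSpace ℝ F] {a : N → ℝ} {h : N → F}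
    {p : N} {a' : E' →L[ℝ] ℝ} {h' : E' →L[ℝ] F}
    (ha : HasMFDerivAt I' 𝓘(ℝ, ℝ) a p a') (hh : HasMFDerivAt I' 𝓘(ℝ, F) h p h') :
    HasMFDerivAt I' 𝓘(ℝ, F) (fun q => a q • h q) p (a p • h' + a'.smulRight (h p) : E' →L[ℝ] F) := by
  refine ⟨ha.1.smul hh.1, ?_⟩
  have := ha.2.smul hh.2
  simpa [writtenInExtChartAt] using! this

/-- The chart coordinates of the covariant derivative of `∑ aᵢ (Wᵢ ∘ f)` along `f`. -/
lemma covDeriv_sum (g : Metric E3 M) {E' H' : Type*} [NormedAddCommGroup E'] [NormedSpace ℝ E']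
    [TopologicalSpace H'] {I' : ModelWithCorners ℝ E' H'} {N : Type*} [TopologicalSpace N]
    [ChartedSpace H' N] {f : N → M} {Y : ∀ q : N, TangentSpace (𝓡 3) (f q)} {p : N}
    {n : ℕ} {a : Fin n → N → ℝ} {W : Fin n → ∀ q : M, TangentSpace (𝓡 3) q}
    {df : E' →L[ℝ] E3} (hf : HasMFDerivAt I' (𝓡 3) f p df)
    {da : Fin n → E' →L[ℝ] ℝ} (ha : ∀ i, HasMFDerivAt I' 𝓘(ℝ, ℝ) (a i) p (da i))
    (hW : ∀ i, DifferentiableAt ℝ (fieldInChart (W i) (f p)) (extChartAt (𝓡 3) (f p) (f p)))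
    (hY : ∀ᶠ q in 𝓝 p, Y q = ∑ i, a i q • W i (f q)) {w : Fin n → E3}
    (hw : ∀ i, W i (f p) = w i) (v : E') :
    (covDeriv g I' f Y p v : E3) = ∑ i, (da i v • w i
      + a i p • nabla g (f p) (fieldInChart (W i) (f p)) (extChartAt (𝓡 3) (f p) (f p))
        (df v)) := by
  have h1M : IsManifold (𝓡 3) 1 M := IsManifold.of_le (n := ∞) (by norm_cast)
  set x := extChartAt (𝓡 3) (f p) with hx
  have hs := mem_extChartAt_source (I := 𝓡 3) (f p)
  have hc : HasMFDerivAt I' 𝓘(ℝ, E3) (fun q => x (f q)) p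
      df := by
    have h1 := (mdifferentiableAt_extChartAt (I := 𝓡 3) (mem_extChartAt_source' hs)).hasMFDerivAt.comp
      p hf
    have h2 : mfderiv (𝓡 3) 𝓘(ℝ, E3) x (f p) = ContinuousLinearMap.id ℝ E3 := dChart_self (f p)
    rw [← hx, h2] at h1
    exact h1
  have hWi : ∀ i, HasMFDerivAt I' 𝓘(ℝ, E3) (fun q => fieldInChart (W i) (f p) (x (f q))) p
      ((fderiv ℝ (fieldInChart (W i) (f p)) (x (f p))).comp
        df) := by
    intro i
    exact (hW i).hasFDerivAt.hasMFDerivAt.comp p hc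
  have hsum : HasMFDerivAt I' 𝓘(ℝ, E3)
      (∑ i, fun q => a i q • fieldInChart (W i) (f p) (x (f q))) p
      (∑ i, (a i p • ((fderiv ℝ (fieldInChart (W i) (f p)) (x (f p))).comp
        df)
        + (da i).smulRight
          (fieldInChart (W i) (f p) (x (f p)))) : E' →L[ℝ] E3) :=
    HasMFDerivAt.sum (t := Finset.univ) fun i _ => hasMFDerivAt_smul_vector (ha i) (hWi i)
  have hfi : ∀ i q, f q ∈ x.source →
      (dChart (f p) (f q) (W i (f q)) : E3) = fieldInChart (W i) (f p) (x (f q)) := by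
    intro i q hq
    have : ∀ r, r = f q → (dChart (f p) r (W i r) : E3) = dChart (f p) (f q) (W i (f q)) := by
      rintro _ rfl; rfl
    exact (this _ (x.left_inv hq)).symm
  have heq : (fun q => (dChart (f p) (f q) (Y q) : E3)) =ᶠ[𝓝 p]
      ∑ i, fun q => a i q • fieldInChart (W i) (f p) (x (f q)) := by
    have : ∀ᶠ q in 𝓝 p, f q ∈ x.source :=
      hf.continuousAt.eventually ((isOpen_extChartAt_source (f p)).mem_nhds hs)
    filter_upwards [hY, this] with q hq hq'
    rw [hq, map_sum, Finset.sum_apply]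
    refine Finset.sum_congr rfl fun i _ => ?_
    rw [map_smul, hfi i q hq']
  have hm := (hsum.congr_of_eventuallyEq heq).mfderiv
  have hself : ∀ v : E3, (dChart (f p) (f p) v : E3) = v := fun v => by
    exact DFunLike.congr_fun (dChart_self (f p)) v
  have hW0 : ∀ i, fieldInChart (W i) (f p) (x (f p)) = W i (f p) := by
    intro i; rw [← hfi i p hs]; exact hself _
  obtain ⟨Γ, -, hΓ⟩ := exists_christoffel_clm g (f p) (mem_extChartAt_target (I := 𝓡 3) (f p))
  have hinv : ((dChart (f p) (f p)).inverse : E3 → E3) = id := by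
    have h2 : (dChart (f p) (f p) : E3 →L[ℝ] E3).inverse = ContinuousLinearMap.id ℝ E3 := by
      rw [dChart_self]; exact ContinuousLinearMap.inverse_id
    ext1 v
    exact DFunLike.congr_fun h2 v
  let m₀ : E3 := mfderiv I' 𝓘(ℝ, E3) (fun q => (dChart (f p) (f q) (Y q) : E3)) p v
  let m₁ : E3 := mfderiv I' (𝓡 3) f p v
  have h3 : (covDeriv g I' f Y p v : E3) =
      m₀ + christoffel g (f p) (x (f p)) (dChart (f p) (f p) m₁) (dChart (f p) (f p) (Y p)) :=
    congrFun hinv (m₀ + christoffel g (f p) (x (f p)) (dChart (f p) (f p) m₁)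
      (dChart (f p) (f p) (Y p)))
  have hm₁ : m₁ = df v := DFunLike.congr_fun hf.mfderiv v
  have hm₀ : m₀ = _ := DFunLike.congr_fun hm v
  rw [h3, hm₀, hm₁]
  have h4 : (dChart (f p) (f p) (Y p) : E3) = ∑ i, a i p • w i := by
    refine (hself _).trans ?_
    rw [hY.self_of_nhds]
    simp only [hw]
    rfl
  have h5 : (dChart (f p) (f p) (df v) : E3) = df v :=
    hself _
  rw [h4, h5, hΓ _ (mem_extChartAt_target (f p)), map_sum]
  have h6 : ∀ (L : Fin n → E' →L[ℝ] E3) (w : E'), (∑ i, L i) w = ∑ i, L i w := fun L w => by simp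
  refine (congrArg₂ (fun a b : E3 => a + b) (h6 _ _) rfl).trans
    ((Finset.sum_add_distrib (M := E3)).symm.trans ?_)
  refine Finset.sum_congr rfl fun i _ => ?_
  rw [map_smul, nabla, hΓ _ (mem_extChartAt_target (f p)), ← hx, hW0, hw]
  simp only [_root_.add_apply, _root_.smul_apply, ContinuousLinearMap.comp_apply,
    ContinuousLinearMap.smulRight_apply, smul_add]
  abel

end CovDeriv

/-! ### Horizontal orthonormal frames -/

section Frames

variable {M : Type*} [TopologicalSpace M] [ChartedSpace E3 M] [IsManifold (𝓡 3) ∞ M]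

/-- The `1`-form metrically dual to a vector field. -/
def flat (g : Metric E3 M) (W : ∀ q : M, TangentSpace (𝓡 3) q) (q : M) :
    TangentSpace (𝓡 3) q →L[ℝ] ℝ := g.inner q (W q)

lemma inner_eq_metricInChart (g : Metric E3 M) (A B : ∀ q : M, TangentSpace (𝓡 3) q) {p : M}
    {z : E3} (hz : z ∈ (extChartAt (𝓡 3) p).target) :
    g.inner ((extChartAt (𝓡 3) p).symm z) (A ((extChartAt (𝓡 3) p).symm z))
      (B ((extChartAt (𝓡 3) p).symm z))
      = metricInChart g p z (fieldInChart A p z) (fieldInChart B p z) := by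
  rw [metricInChart_apply, dChartSymm_fieldInChart A hz, dChartSymm_fieldInChart B hz]

lemma formInChart_flat (g : Metric E3 M) (W : ∀ q : M, TangentSpace (𝓡 3) q) {p : M} {z : E3}
    (hz : z ∈ (extChartAt (𝓡 3) p).target) :
    formInChart (flat g W) p z = metricInChart g p z (fieldInChart W p z) := by
  ext1 v
  rw [metricInChart_apply, dChartSymm_fieldInChart W hz]
  rfl

/-- An oriented orthonormal frame `A`, `B` of the horizontal planes over the open set `O`. -/
structure IsHorFrame (X : SasakianStructure M) (O : Set M)
    (A B : ∀ q : M, TangentSpace (𝓡 3) q) : Prop where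
  isOpen : IsOpen O
  smoothA : ∀ q ∈ O, ContMDiffAt (𝓡 3) (𝓡 3).tangent 3
    (fun q => (⟨q, A q⟩ : TangentBundle (𝓡 3) M)) q
  smoothB : ∀ q ∈ O, ContMDiffAt (𝓡 3) (𝓡 3).tangent 3
    (fun q => (⟨q, B q⟩ : TangentBundle (𝓡 3) M)) q
  AA : ∀ q ∈ O, X.g.inner q (A q) (A q) = 1
  BB : ∀ q ∈ O, X.g.inner q (B q) (B q) = 1
  AB : ∀ q ∈ O, X.g.inner q (A q) (B q) = 0
  AT : ∀ q ∈ O, X.g.inner q (A q) (X.T q) = 0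
  BT : ∀ q ∈ O, X.g.inner q (B q) (X.T q) = 0
  dη_AB : ∀ q ∈ O, X.dη q (A q) (B q) = 1

lemma extD_antisymm {α : ∀ q : M, TangentSpace (𝓡 3) q →L[ℝ] ℝ} (p : M)
    (u v : TangentSpace (𝓡 3) p) : extD α p u v = - extD α p v u := by
  simp only [extD]
  change (1 / 2 : ℝ) * ((fderiv ℝ (formInChart α p) (extChartAt (𝓡 3) p p) (dChart p p u)
    (dChart p p v)) - (fderiv ℝ (formInChart α p) (extChartAt (𝓡 3) p p) (dChart p p v)
    (dChart p p u))) = - ((1 / 2 : ℝ) * ((fderiv ℝ (formInChart α p) (extChartAt (𝓡 3) p p)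
    (dChart p p v) (dChart p p u)) - (fderiv ℝ (formInChart α p) (extChartAt (𝓡 3) p p)
    (dChart p p u) (dChart p p v))))
  ring

/-- Two vector fields given by coordinates in one chart. -/
lemma exists_field_of_chart (p : M) (V : E3 → E3) :
    ∃ A : ∀ q : M, TangentSpace (𝓡 3) q, ∀ z ∈ (extChartAt (𝓡 3) p).target,
      fieldInChart A p z = V z := by
  let f : E3 → E3 := fun y => (dChartSymm p y (V y) : E3)
  refine ⟨fun q => f (extChartAt (𝓡 3) p q), fun z hz => ?_⟩
  have h : (f (extChartAt (𝓡 3) p ((extChartAt (𝓡 3) p).symm z)) : E3) = f z := by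
    rw [(extChartAt (𝓡 3) p).right_inv hz]
  have h2 : (fieldInChart (fun q => (f (extChartAt (𝓡 3) p q) : TangentSpace (𝓡 3) q)) p z : E3)
      = dChart p ((extChartAt (𝓡 3) p).symm z) (f z) := by
    rw [← h]; rfl
  rw [h2]
  exact dChart_dChartSymm hz _

/-- Two further nonzero vectors which, together with `t`, are pairwise orthogonal; they are the
starting vectors for the construction of a horizontal frame. -/
lemma exists_orthonormal_pair (G : E3 →L[ℝ] E3 →L[ℝ] ℝ) (t : E3) :
    ∃ w w' : E3, w ≠ 0 ∧ w' ≠ 0 ∧ G w t = 0 ∧ G w' t = 0 ∧ G w' w = 0 := by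
  have h1 : ∃ w : E3, w ≠ 0 ∧ G w t = 0 := by
    have : (LinearMap.ker ((G.flip t : E3 →L[ℝ] ℝ) : E3 →ₗ[ℝ] ℝ)) ≠ ⊥ :=
      LinearMap.ker_ne_bot_of_finrank_lt (by simp)
    obtain ⟨w, hw, hw0⟩ := (Submodule.ne_bot_iff _).1 this
    exact ⟨w, hw0, hw⟩
  obtain ⟨w, hw, hwt⟩ := h1
  have : (LinearMap.ker (((G.flip t).prod (G.flip w) : E3 →L[ℝ] ℝ × ℝ) : E3 →ₗ[ℝ] ℝ × ℝ)) ≠ ⊥ :=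
    LinearMap.ker_ne_bot_of_finrank_lt (by simp)
  obtain ⟨w', hw', hw0'⟩ := (Submodule.ne_bot_iff _).1 this
  have h3 : (G w' t, G w' w) = ((0 : ℝ), (0 : ℝ)) := hw'
  simp only [Prod.mk.injEq] at h3
  exact ⟨w, w', hw, hw0', hwt, h3.1, h3.2⟩

variable (X : SasakianStructure M)

lemma contDiffAt_T (p : M) {z : E3} (hz : z ∈ (extChartAt (𝓡 3) p).target) :
    ContDiffAt ℝ ∞ (fieldInChart X.T p) z :=
  contDiffAt_fieldInChart le_rfl hz (X.smooth_T _)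

lemma contDiffAt_formInChart_flat {n : WithTop ℕ∞} (hn : n ≤ ∞)
    (W : ∀ q : M, TangentSpace (𝓡 3) q) {p : M} {z : E3}
    (hz : z ∈ (extChartAt (𝓡 3) p).target) (hW : ContDiffAt ℝ n (fieldInChart W p) z) :
    ContDiffAt ℝ n (formInChart (flat X.g W) p) z := by
  have h := ((contDiffAt_metricInChart X.g p hz).of_le hn).clm_apply hW
  refine h.congr_of_eventuallyEq ?_
  filter_upwards [(isOpen_extChartAt_target p).mem_nhds hz] with y hy
  exact formInChart_flat X.g W hy

/-- The exterior derivative of a form at a point computed in any chart. -/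
lemma extD_eq_chart {α : ∀ q : M, TangentSpace (𝓡 3) q →L[ℝ] ℝ} {p : M} {z : E3}
    (hz : z ∈ (extChartAt (𝓡 3) p).target) {n : WithTop ℕ∞} (hn : n + 1 ≤ ∞) (hn1 : 1 ≤ n)
    (hα : ContDiffAt ℝ n (formInChart α p) z) (u v : E3) :
    2 * extD α ((extChartAt (𝓡 3) p).symm z) (dChartSymm p z u) (dChartSymm p z v) =
      fderiv ℝ (formInChart α p) z u v - fderiv ℝ (formInChart α p) z v u := by
  have hs := (extChartAt (𝓡 3) p).map_target hz
  have h1 := contMDiffAt_extChartAt_symm p hz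
  rw [formInChart_eq_pullForm]
  refine (fderiv_pullForm_antisymm (h1.of_le (by norm_cast)) ?_ u v).symm
  have hy : (extChartAt (𝓡 3) ((extChartAt (𝓡 3) p).symm z)).symm
      (extChartAt (𝓡 3) ((extChartAt (𝓡 3) p).symm z) ((extChartAt (𝓡 3) p).symm z))
      = (extChartAt (𝓡 3) p).symm z := by simp
  refine ContDiffAt.differentiableAt (n := n) ?_ (by rintro rfl; simp at hn1)
  rw [formInChart_eq_pullForm]
  refine contDiffAt_pullForm (p := p) hn ?_ (by rwa [hy]) ?_
  · exact (contMDiffAt_extChartAt_symm _ (mem_extChartAt_target _)).of_le hn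
  · rw [hy, (extChartAt (𝓡 3) p).right_inv hz]
    exact hα

/-- Every point has a neighbourhood with an oriented horizontal orthonormal frame. -/
lemma exists_isHorFrame (p : M) :
    ∃ (O : Set M) (A B : ∀ q : M, TangentSpace (𝓡 3) q), p ∈ O ∧ IsHorFrame X O A B := by
  set x := extChartAt (𝓡 3) p with hx
  set y := x p with hy
  set G := metricInChart X.g p with hG
  set T := fieldInChart X.T p with hT
  have hyt : y ∈ x.target := mem_extChartAt_target p
  have hGs : ContDiffAt ℝ ∞ G y := contDiffAt_metricInChart X.g p hyt
  have hTs : ContDiffAt ℝ ∞ T y := contDiffAt_T X p hyt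
  have ho : x.target ∈ 𝓝 y := (isOpen_extChartAt_target p).mem_nhds hyt
  have hsymm : ∀ z a b, G z a b = G z b a := fun z a b => metricInChart_symm X.g p z a b
  have hTT : ∀ z ∈ x.target, G z (T z) (T z) = 1 := by
    intro z hz
    rw [hG, hT, ← inner_eq_metricInChart X.g _ _ hz, X.unit_T]
  obtain ⟨w, w', hw, hw', hwt, hwt', hww⟩ := exists_orthonormal_pair (G y) (T y)
  -- Gram–Schmidt applied to `T` and the coordinate fields `w`, `w'`
  let V : E3 → E3 := fun z => w - G z w (T z) • T z
  let A : E3 → E3 := fun z => (√(G z (V z) (V z)))⁻¹ • V z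
  let V' : E3 → E3 := fun z => w' - G z w' (T z) • T z - G z w' (A z) • A z
  let B : E3 → E3 := fun z => (√(G z (V' z) (V' z)))⁻¹ • V' z
  have hVy : V y = w := by simp [V, hwt]
  have hwp : 0 < G y w w := metricInChart_pos X.g p hyt hw
  have hwp' : 0 < G y w' w' := metricInChart_pos X.g p hyt hw'
  have hV'y : V' y = w' := by simp [V', A, hVy, hwt', hww]
  have hVs : ContDiffAt ℝ ∞ V y := by
    exact contDiffAt_const.sub (((hGs.clm_apply contDiffAt_const).clm_apply hTs).smul hTs)
  have hAs : ContDiffAt ℝ ∞ A y := by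
    have h1 := (hGs.clm_apply hVs).clm_apply hVs
    refine ContDiffAt.smul (ContDiffAt.inv (h1.sqrt ?_) ?_) hVs
    · rw [hVy]; exact hwp.ne'
    · rw [hVy]; exact (Real.sqrt_pos.2 hwp).ne'
  have hVs' : ContDiffAt ℝ ∞ V' y := by
    exact (contDiffAt_const.sub (((hGs.clm_apply contDiffAt_const).clm_apply hTs).smul hTs)).sub
      (((hGs.clm_apply contDiffAt_const).clm_apply hAs).smul hAs)
  have hBs : ContDiffAt ℝ ∞ B y := by
    have h1 := (hGs.clm_apply hVs').clm_apply hVs'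
    refine ContDiffAt.smul (ContDiffAt.inv (h1.sqrt ?_) ?_) hVs'
    · rw [hV'y]; exact hwp'.ne'
    · rw [hV'y]; exact (Real.sqrt_pos.2 hwp').ne'
  have hn1 : ∀ᶠ z in 𝓝 y, 0 < G z (V z) (V z) := by
    have := ((hGs.clm_apply hVs).clm_apply hVs).continuousAt
    refine this.eventually (lt_mem_nhds ?_)
    simpa only [hVy] using hwp
  have hn2 : ∀ᶠ z in 𝓝 y, 0 < G z (V' z) (V' z) := by
    have := ((hGs.clm_apply hVs').clm_apply hVs').continuousAt
    refine this.eventually (lt_mem_nhds ?_)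
    simpa only [hV'y] using hwp'
  have e1 : ∀ᶠ z in 𝓝 y, ContDiffAt ℝ 3 A z := (hAs.of_le (by norm_cast)).eventually (by simp)
  have e2 : ∀ᶠ z in 𝓝 y, ContDiffAt ℝ 3 B z := (hBs.of_le (by norm_cast)).eventually (by simp)
  obtain ⟨A', hA'⟩ := exists_field_of_chart p A
  obtain ⟨B', hB'⟩ := exists_field_of_chart p B
  have unit : ∀ z v, 0 < G z v v → G z ((√(G z v v))⁻¹ • v) ((√(G z v v))⁻¹ • v) = 1 := by
    intro z v hv
    simp only [map_smul, _root_.smul_apply, smul_eq_mul]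
    have h0 := (Real.sqrt_pos.2 hv).ne'
    have h1 := Real.mul_self_sqrt hv.le
    field_simp
    nlinarith
  have hAT : ∀ z ∈ x.target, G z (A z) (T z) = 0 := by
    intro z hz
    simp [A, V, hTT z hz]
  have hAA : ∀ z ∈ x.target, 0 < G z (V z) (V z) → G z (A z) (A z) = 1 := fun z _ h => unit z _ h
  have hBT : ∀ z ∈ x.target, G z (B z) (T z) = 0 := by
    intro z hz
    simp only [B, V', map_smul, map_sub, _root_.smul_apply, _root_.sub_apply, smul_eq_mul,
      hAT z hz, hTT z hz]
    ring
  have hAB : ∀ z ∈ x.target, 0 < G z (V z) (V z) → G z (A z) (B z) = 0 := by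
    intro z hz h
    rw [hsymm]
    simp only [B, V', map_smul, map_sub, _root_.smul_apply, _root_.sub_apply, smul_eq_mul,
      hAA z hz h, hsymm z (T z), hAT z hz]
    ring
  have hηs : ∀ z ∈ x.target, ContDiffAt ℝ ∞ (formInChart X.η p) z := fun z hz =>
    contDiffAt_formInChart_flat X le_rfl X.T hz (contDiffAt_T X p hz)
  have hdη : ∀ z ∈ x.target, 2 * X.dη (x.symm z) (A' (x.symm z)) (B' (x.symm z)) =
      fderiv ℝ (formInChart X.η p) z (A z) (B z) - fderiv ℝ (formInChart X.η p) z (B z) (A z) := by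
    intro z hz
    rw [← extD_eq_chart hz (n := ∞) (by simp) (by norm_cast) (hηs z hz), ← hA' z hz, ← hB' z hz]
    erw [dChartSymm_fieldInChart A' hz, dChartSymm_fieldInChart B' hz]
    rfl
  have inner_eq : ∀ z ∈ x.target, X.g.inner (x.symm z) (A' (x.symm z)) (A' (x.symm z))
        = G z (A z) (A z) ∧ X.g.inner (x.symm z) (B' (x.symm z)) (B' (x.symm z)) = G z (B z) (B z) ∧
      X.g.inner (x.symm z) (A' (x.symm z)) (B' (x.symm z)) = G z (A z) (B z) ∧
      X.g.inner (x.symm z) (A' (x.symm z)) (X.T (x.symm z)) = G z (A z) (T z) ∧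
      X.g.inner (x.symm z) (B' (x.symm z)) (X.T (x.symm z)) = G z (B z) (T z) := by
    intro z hz
    rw [← hA' z hz, ← hB' z hz]
    refine ⟨?_, ?_, ?_, ?_, ?_⟩ <;> exact inner_eq_metricInChart X.g _ _ hz
  -- `δ` is the value of `dη` on the frame; it is `1` or `-1` according to the orientation.
  set δ : E3 → ℝ := fun z => (fderiv ℝ (formInChart X.η p) z (A z) (B z)
    - fderiv ℝ (formInChart X.η p) z (B z) (A z)) / 2 with hδ
  have hδc : ContinuousAt δ y := by
    have h1 : ContinuousAt (fderiv ℝ (formInChart X.η p)) y :=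
      ((hηs y hyt).fderiv_right (m := 0) (by norm_cast)).continuousAt
    exact (((h1.clm_apply hAs.continuousAt).clm_apply hBs.continuousAt).sub
      ((h1.clm_apply hBs.continuousAt).clm_apply hAs.continuousAt)).div_const 2
  have hδ2 : ∀ z ∈ x.target, 0 < G z (V z) (V z) → 0 < G z (V' z) (V' z) → δ z ^ 2 = 1 := by
    intro z hz h1 h2
    obtain ⟨i1, i2, i3, i4, i5⟩ := inner_eq z hz
    have := X.normalized (x.symm z) (A' (x.symm z)) (B' (x.symm z))
      (by rw [etaForm, X.g.symm, i4, hAT z hz]) (by rw [etaForm, X.g.symm, i5, hBT z hz])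
    rw [i1, i2, i3, hAA z hz h1, hAB z hz h1, show G z (B z) (B z) = 1 from unit z _ h2] at this
    have h3 : δ z = extD (etaForm X.g X.T) (x.symm z) (A' (x.symm z)) (B' (x.symm z)) := by
      have := hdη z hz
      simp only [hδ]
      rw [← this]
      change 2 * extD (etaForm X.g X.T) (x.symm z) (A' (x.symm z)) (B' (x.symm z)) / 2 = _
      ring
    rw [h3, this]; norm_num
  -- the sign of the frame is locally constant
  have key : ∀ σ : ℝ, (σ = 1 ∨ σ = -1) → δ y = σ → ∀ᶠ z in 𝓝 y, δ z = σ := by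
    intro σ hσ hδy
    have h1 : ∀ᶠ z in 𝓝 y, 0 < σ * δ z := by
      refine (hδc.const_mul σ).eventually (lt_mem_nhds ?_)
      simp only [hδy]
      rcases hσ with rfl | rfl <;> norm_num
    filter_upwards [h1, hn1, hn2, ho] with z h1 h2 h3 h4
    have h5 := hδ2 z h4 h2 h3
    rcases sq_eq_one_iff.1 h5 with h | h <;> rcases hσ with rfl | rfl <;>
      first | exact h | (rw [h] at h1; norm_num at h1)
  have hσ : δ y = 1 ∨ δ y = -1 :=
    sq_eq_one_iff.1 (hδ2 y hyt hn1.self_of_nhds hn2.self_of_nhds)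
  have hev := (((((key (δ y) hσ rfl).and hn1).and hn2).and e1).and e2).and ho
  obtain ⟨Ω, hΩ, hΩo, hyΩ⟩ := eventually_nhds_iff.1 hev
  have hO : IsOpen (x.source ∩ x ⁻¹' Ω) :=
    (continuousOn_extChartAt p).isOpen_inter_preimage (isOpen_extChartAt_source p) hΩo
  have hpO : p ∈ x.source ∩ x ⁻¹' Ω := ⟨mem_extChartAt_source p, hyΩ⟩
  have facts : ∀ q ∈ x.source ∩ x ⁻¹' Ω, X.g.inner q (A' q) (A' q) = 1 ∧
      X.g.inner q (B' q) (B' q) = 1 ∧ X.g.inner q (A' q) (B' q) = 0 ∧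
      X.g.inner q (A' q) (X.T q) = 0 ∧ X.g.inner q (B' q) (X.T q) = 0 ∧
      X.dη q (A' q) (B' q) = δ y := by
    intro q hq
    obtain ⟨z, hz, rfl⟩ : ∃ z ∈ Ω, x.symm z = q := ⟨x q, hq.2, x.left_inv hq.1⟩
    obtain ⟨⟨⟨⟨⟨h1, h2⟩, h3⟩, h4⟩, h5⟩, h6⟩ := hΩ z hz
    obtain ⟨i1, i2, i3, i4, i5⟩ := inner_eq z h6
    refine ⟨?_, ?_, ?_, ?_, ?_, ?_⟩
    · rw [i1, hAA z h6 h2]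
    · rw [i2]; exact unit z _ h3
    · rw [i3, hAB z h6 h2]
    · rw [i4, hAT z h6]
    · rw [i5, hBT z h6]
    · have := hdη z h6
      rw [← h1]
      simp only [hδ]
      linarith
  have smA : ∀ q ∈ x.source ∩ x ⁻¹' Ω, ContMDiffAt (𝓡 3) (𝓡 3).tangent 3
      (fun q => (⟨q, A' q⟩ : TangentBundle (𝓡 3) M)) q := by
    intro q hq
    refine contMDiffAt_of_fieldInChart (by norm_cast) hq.1 ?_
    refine (hΩ _ hq.2).1.1.2.congr_of_eventuallyEq ?_
    filter_upwards [(isOpen_extChartAt_target p).mem_nhds (hΩ _ hq.2).2] with z hz using hA' z hz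
  have smB : ∀ q ∈ x.source ∩ x ⁻¹' Ω, ContMDiffAt (𝓡 3) (𝓡 3).tangent 3
      (fun q => (⟨q, B' q⟩ : TangentBundle (𝓡 3) M)) q := by
    intro q hq
    refine contMDiffAt_of_fieldInChart (by norm_cast) hq.1 ?_
    refine (hΩ _ hq.2).1.2.congr_of_eventuallyEq ?_
    filter_upwards [(isOpen_extChartAt_target p).mem_nhds (hΩ _ hq.2).2] with z hz using hB' z hz
  rcases hσ with h | h
  · exact ⟨_, A', B', hpO, hO, smA, smB, fun q hq => (facts q hq).1, fun q hq => (facts q hq).2.1,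
      fun q hq => (facts q hq).2.2.1, fun q hq => (facts q hq).2.2.2.1,
      fun q hq => (facts q hq).2.2.2.2.1, fun q hq => by rw [(facts q hq).2.2.2.2.2, h]⟩
  · refine ⟨_, B', A', hpO, hO, smB, smA, fun q hq => (facts q hq).2.1, fun q hq => (facts q hq).1,
      fun q hq => ?_, fun q hq => (facts q hq).2.2.2.2.1,
      fun q hq => (facts q hq).2.2.2.1, fun q hq => ?_⟩
    · rw [X.g.symm, (facts q hq).2.2.1]
    · have h1 := (facts q hq).2.2.2.2.2
      have h2 : X.dη q (B' q) (A' q) = - X.dη q (A' q) (B' q) := extD_antisymm q _ _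
      rw [h2, h1, h, neg_neg]

end Frames

/-! ### The connection form of a horizontal frame -/

section FrameCalculus

variable {M : Type*} [TopologicalSpace M] [ChartedSpace E3 M] [IsManifold (𝓡 3) ∞ M]

/-- At the centre of the preferred chart the coordinate expression of the metric is the metric. -/
lemma metricInChart_self (g : Metric E3 M) (q : M) (u v : TangentSpace (𝓡 3) q) :
    metricInChart g q (extChartAt (𝓡 3) q q) u v = g.inner q u v := by
  have hr : (extChartAt (𝓡 3) q).symm (extChartAt (𝓡 3) q q) = q := extChartAt_to_inv q
  have h1 : ∀ w : E3, (dChartSymm q (extChartAt (𝓡 3) q q) w : E3) = w := by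
    intro w
    have h2 := dChart_dChartSymm (mem_extChartAt_target (I := 𝓡 3) q) w
    have h3 : ∀ r, r = q → ∀ a : E3, (dChart q r a : E3) = a := by
      rintro _ rfl a
      exact DFunLike.congr_fun (dChart_self _) a
    exact (h3 _ hr _).symm.trans h2
  have h4 : ∀ r, r = q → ∀ a b : E3, g.inner r a b = g.inner q a b := by
    rintro _ rfl a b; rfl
  refine Eq.trans (h4 _ hr (dChartSymm q (extChartAt (𝓡 3) q q) u)
    (dChartSymm q (extChartAt (𝓡 3) q q) v)) ?_
  exact congrArg₂ (fun a b : E3 => g.inner q a b) (h1 u) (h1 v)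

lemma dChart_self_apply (q : M) (u : TangentSpace (𝓡 3) q) : (dChart q q u : E3) = u :=
  DFunLike.congr_fun (dChart_self q) u

lemma fieldInChart_self (W : ∀ q : M, TangentSpace (𝓡 3) q) (q : M) :
    fieldInChart W q (extChartAt (𝓡 3) q q) = W q := by
  have hr : (extChartAt (𝓡 3) q).symm (extChartAt (𝓡 3) q q) = q := extChartAt_to_inv q
  have h : ∀ r, r = q → (dChart q r (W r) : E3) = W q := by
    rintro _ rfl; exact dChart_self_apply _ _
  exact h _ hr

lemma extD_self (α : ∀ q : M, TangentSpace (𝓡 3) q →L[ℝ] ℝ) (q : M)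
    (u v : TangentSpace (𝓡 3) q) :
    2 * extD α q u v = fderiv ℝ (formInChart α q) (extChartAt (𝓡 3) q q) u v
      - fderiv ℝ (formInChart α q) (extChartAt (𝓡 3) q q) v u := by
  have h : extD α q u v = (1 / 2 : ℝ) * (fderiv ℝ (formInChart α q) (extChartAt (𝓡 3) q q)
    (dChart q q u) (dChart q q v) - fderiv ℝ (formInChart α q) (extChartAt (𝓡 3) q q)
    (dChart q q v) (dChart q q u)) := rfl
  rw [h, dChart_self_apply, dChart_self_apply]
  ring

variable {X : SasakianStructure M} {O : Set M} {A B : ∀ q : M, TangentSpace (𝓡 3) q}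

/-- The Levi-Civita connection form `⟨DA, B⟩` of the horizontal frame, written in terms of the
exterior derivatives of the dual coframe. -/
def connForm (X : SasakianStructure M) (A B : ∀ q : M, TangentSpace (𝓡 3) q) (q : M) :
    TangentSpace (𝓡 3) q →L[ℝ] ℝ :=
  (2 * extD (flat X.g A) q (A q) (B q)) • flat X.g A q
    + (2 * extD (flat X.g B) q (A q) (B q)) • flat X.g B q
    + (extD (flat X.g A) q (X.T q) (B q) - extD (flat X.g B) q (X.T q) (A q)
      + extD (flat X.g X.T) q (A q) (B q)) • flat X.g X.T q

namespace IsHorFrame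

variable (hf : IsHorFrame X O A B)
include hf

lemma expand {q : M} (hq : q ∈ O) (v : TangentSpace (𝓡 3) q) :
    v = X.g.inner q (A q) v • A q + X.g.inner q (B q) v • B q + X.g.inner q (X.T q) v • X.T q := by
  let L : TangentSpace (𝓡 3) q →ₗ[ℝ] (Fin 3 → ℝ) :=
    LinearMap.pi ![(X.g.inner q (A q) : TangentSpace (𝓡 3) q →ₗ[ℝ] ℝ),
      (X.g.inner q (B q) : TangentSpace (𝓡 3) q →ₗ[ℝ] ℝ),
      (X.g.inner q (X.T q) : TangentSpace (𝓡 3) q →ₗ[ℝ] ℝ)]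
  have hAA := hf.AA q hq
  have hBB := hf.BB q hq
  have hAB := hf.AB q hq
  have hAT := hf.AT q hq
  have hBT := hf.BT q hq
  have hTT := X.unit_T q
  have hBA : X.g.inner q (B q) (A q) = 0 := by rw [X.g.symm, hAB]
  have hTA : X.g.inner q (X.T q) (A q) = 0 := by rw [X.g.symm, hAT]
  have hTB : X.g.inner q (X.T q) (B q) = 0 := by rw [X.g.symm, hBT]
  have hL : ∀ v, L v = ![X.g.inner q (A q) v, X.g.inner q (B q) v, X.g.inner q (X.T q) v] := by
    intro v
    ext i
    fin_cases i <;> rfl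
  have hs : ∀ c : Fin 3 → ℝ, L (c 0 • A q + c 1 • B q + c 2 • X.T q) = c := by
    intro c
    rw [hL]
    ext i
    fin_cases i <;> simp [hAA, hBB, hAB, hAT, hBT, hTT, hBA, hTA, hTB]
  have hsurj : Function.Surjective L := fun c => ⟨_, hs c⟩
  have hfin : Module.finrank ℝ (TangentSpace (𝓡 3) q) = Module.finrank ℝ (Fin 3 → ℝ) := by
    have : Module.finrank ℝ E3 = Module.finrank ℝ (Fin 3 → ℝ) := by simp
    exact this
  have : FiniteDimensional ℝ (TangentSpace (𝓡 3) q) :=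
    inferInstanceAs (FiniteDimensional ℝ E3)
  have hinj : Function.Injective L :=
    (LinearMap.injective_iff_surjective_of_finrank_eq_finrank hfin).2 hsurj
  apply hinj
  have e0 : L v 0 = X.g.inner q (A q) v := by rw [hL]; rfl
  have e1 : L v 1 = X.g.inner q (B q) v := by rw [hL]; rfl
  have e2 : L v 2 = X.g.inner q (X.T q) v := by rw [hL]; rfl
  rw [← e0, ← e1, ← e2]
  exact (hs (L v)).symm

lemma inner_eq {q : M} (hq : q ∈ O) (u v : TangentSpace (𝓡 3) q) :
    X.g.inner q u v = X.g.inner q (A q) u * X.g.inner q (A q) v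
      + X.g.inner q (B q) u * X.g.inner q (B q) v
      + X.g.inner q (X.T q) u * X.g.inner q (X.T q) v := by
  conv_lhs => rw [X.g.symm, hf.expand hq u]
  simp only [map_add, map_smul, _root_.add_apply, _root_.smul_apply, smul_eq_mul, X.g.symm q v]

lemma ext_inner {q : M} (hq : q ∈ O) {u v : TangentSpace (𝓡 3) q}
    (h1 : X.g.inner q (A q) u = X.g.inner q (A q) v)
    (h2 : X.g.inner q (B q) u = X.g.inner q (B q) v)
    (h3 : X.g.inner q (X.T q) u = X.g.inner q (X.T q) v) : u = v := by
  rw [hf.expand hq u, hf.expand hq v, h1, h2, h3]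

lemma dη_eq {q : M} (hq : q ∈ O) (u v : TangentSpace (𝓡 3) q) :
    X.dη q u v = X.g.inner q (A q) u * X.g.inner q (B q) v
      - X.g.inner q (B q) u * X.g.inner q (A q) v := by
  have anti : ∀ a b, X.dη q a b = - X.dη q b a := fun a b => extD_antisymm q a b
  have hT : ∀ b, X.dη q (X.T q) b = 0 := fun b => X.reeb q b
  have hT' : ∀ b, X.dη q b (X.T q) = 0 := fun b => by rw [anti, hT, neg_zero]
  have self : ∀ a, X.dη q a a = 0 := fun a => by linarith [anti a a]
  have hAB := hf.dη_AB q hq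
  have hBA : X.dη q (B q) (A q) = -1 := by rw [anti, hAB]
  have e : ∀ a, X.dη q a v = X.g.inner q (A q) v * X.dη q a (A q)
      + X.g.inner q (B q) v * X.dη q a (B q) := by
    intro a
    conv_lhs => rw [hf.expand hq v]
    simp only [map_add, map_smul, smul_eq_mul, hT', mul_zero, add_zero]
  have e' : ∀ b, X.dη q b u = X.g.inner q (A q) u * X.dη q b (A q)
      + X.g.inner q (B q) u * X.dη q b (B q) := by
    intro a
    conv_lhs => rw [hf.expand hq u]
    simp only [map_add, map_smul, smul_eq_mul, hT', mul_zero, add_zero]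
  rw [e u, anti u (A q), anti u (B q), e' (A q), e' (B q), self, self, hAB, hBA]
  ring

lemma contDiffAt_A {p : M} {z : E3} (hz : z ∈ (extChartAt (𝓡 3) p).target)
    (hzO : (extChartAt (𝓡 3) p).symm z ∈ O) : ContDiffAt ℝ 3 (fieldInChart A p) z :=
  contDiffAt_fieldInChart (by norm_cast) hz (hf.smoothA _ hzO)

lemma contDiffAt_B {p : M} {z : E3} (hz : z ∈ (extChartAt (𝓡 3) p).target)
    (hzO : (extChartAt (𝓡 3) p).symm z ∈ O) : ContDiffAt ℝ 3 (fieldInChart B p) z :=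
  contDiffAt_fieldInChart (by norm_cast) hz (hf.smoothB _ hzO)

lemma contDiffAt_flatA {p : M} {z : E3} (hz : z ∈ (extChartAt (𝓡 3) p).target)
    (hzO : (extChartAt (𝓡 3) p).symm z ∈ O) : ContDiffAt ℝ 3 (formInChart (flat X.g A) p) z :=
  contDiffAt_formInChart_flat X (by norm_cast) A hz (hf.contDiffAt_A hz hzO)

lemma contDiffAt_flatB {p : M} {z : E3} (hz : z ∈ (extChartAt (𝓡 3) p).target)
    (hzO : (extChartAt (𝓡 3) p).symm z ∈ O) : ContDiffAt ℝ 3 (formInChart (flat X.g B) p) z :=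
  contDiffAt_formInChart_flat X (by norm_cast) B hz (hf.contDiffAt_B hz hzO)

omit hf in
lemma contDiffAt_flatT {p : M} {z : E3} (hz : z ∈ (extChartAt (𝓡 3) p).target) :
    ContDiffAt ℝ 3 (formInChart (flat X.g X.T) p) z :=
  contDiffAt_formInChart_flat X (by norm_cast) X.T hz ((contDiffAt_T X p hz).of_le (by norm_cast))

lemma isOpen_chart (p : M) :
    IsOpen ((extChartAt (𝓡 3) p).target ∩ (extChartAt (𝓡 3) p).symm ⁻¹' O) :=
  (continuousOn_extChartAt_symm p).isOpen_inter_preimage (isOpen_extChartAt_target p) hf.isOpen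

/-- Metric compatibility for two fields whose inner product is constant on `O`. -/
lemma nabla_antisymm {P Q : ∀ q : M, TangentSpace (𝓡 3) q} {c : ℝ}
    (hPQ : ∀ q ∈ O, X.g.inner q (P q) (Q q) = c) {p : M} {z : E3}
    (hz : z ∈ (extChartAt (𝓡 3) p).target) (hzO : (extChartAt (𝓡 3) p).symm z ∈ O)
    (hP : DifferentiableAt ℝ (fieldInChart P p) z) (hQ : DifferentiableAt ℝ (fieldInChart Q p) z)
    (u : E3) :
    metricInChart X.g p z (nabla X.g p (fieldInChart P p) z u) (fieldInChart Q p z)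
      = - metricInChart X.g p z (nabla X.g p (fieldInChart Q p) z u) (fieldInChart P p z) := by
  have h := hasFDerivAt_metricInChart_apply₂ X.g p hz hP hQ u
  have h2 : (fun z => metricInChart X.g p z (fieldInChart P p z) (fieldInChart Q p z))
      =ᶠ[𝓝 z] fun _ => c := by
    filter_upwards [(hf.isOpen_chart p).mem_nhds ⟨hz, hzO⟩] with y hy
    rw [← inner_eq_metricInChart X.g _ _ hy.1, hPQ _ hy.2]
  rw [h2.fderiv_eq] at h
  simp only [fderiv_fun_const, Pi.zero_apply, _root_.zero_apply] at h
  rw [metricInChart_symm X.g p z (fieldInChart P p z)] at h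
  linarith

omit hf in
lemma extD_flat_chart {W : ∀ q : M, TangentSpace (𝓡 3) q} {p : M} {z : E3}
    (hz : z ∈ (extChartAt (𝓡 3) p).target)
    (hW : ContDiffAt ℝ 3 (fieldInChart W p) z) (u v : E3) :
    2 * extD (flat X.g W) ((extChartAt (𝓡 3) p).symm z) (dChartSymm p z u) (dChartSymm p z v) =
      metricInChart X.g p z (nabla X.g p (fieldInChart W p) z u) v
      - metricInChart X.g p z (nabla X.g p (fieldInChart W p) z v) u := by
  rw [extD_eq_chart hz (n := 3) (by norm_cast) (by norm_cast)
    (contDiffAt_formInChart_flat X (by norm_cast) W hz hW)]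
  rw [← fderiv_metricInChart_field_antisymm X.g p hz (hW.differentiableAt (by simp))]
  have : formInChart (flat X.g W) p =ᶠ[𝓝 z] fun z => metricInChart X.g p z (fieldInChart W p z) := by
    filter_upwards [(isOpen_extChartAt_target p).mem_nhds hz] with y hy
    exact formInChart_flat X.g W hy
  rw [this.fderiv_eq]

omit hf in
lemma nabla_add_smul {p : M} {z : E3} (hz : z ∈ (extChartAt (𝓡 3) p).target) (V : E3 → E3)
    (a b c : ℝ) (u v w : E3) :
    nabla X.g p V z (a • u + b • v + c • w)
      = a • nabla X.g p V z u + b • nabla X.g p V z v + c • nabla X.g p V z w := by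
  obtain ⟨Γ, -, hΓ⟩ := exists_christoffel_clm X.g p hz
  simp only [nabla, hΓ z hz, map_add, map_smul, _root_.add_apply, _root_.smul_apply, smul_add]
  abel

/-- In any chart, `connForm` is the connection form `⟨∇A, B⟩` of the Levi-Civita connection of
that chart. In particular the latter does not depend on the chart. -/
lemma formInChart_connForm {p : M} {z : E3} (hz : z ∈ (extChartAt (𝓡 3) p).target)
    (hzO : (extChartAt (𝓡 3) p).symm z ∈ O) (v : E3) :
    formInChart (connForm X A B) p z v = metricInChart X.g p z
      (nabla X.g p (fieldInChart A p) z v) (fieldInChart B p z) := by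
  set G := metricInChart X.g p z with hG
  set a := fieldInChart A p z with ha
  set b := fieldInChart B p z with hb
  set t := fieldInChart X.T p z with ht
  set NA := nabla X.g p (fieldInChart A p) z with hNA
  set NB := nabla X.g p (fieldInChart B p) z with hNB
  set NT := nabla X.g p (fieldInChart X.T p) z with hNT
  set r := (extChartAt (𝓡 3) p).symm z with hr
  have eA : dChartSymm p z a = A r := dChartSymm_fieldInChart A hz
  have eB : dChartSymm p z b = B r := dChartSymm_fieldInChart B hz
  have eT : dChartSymm p z t = X.T r := dChartSymm_fieldInChart X.T hz
  have cA := hf.contDiffAt_A hz hzO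
  have cB := hf.contDiffAt_B hz hzO
  have cT : ContDiffAt ℝ 3 (fieldInChart X.T p) z := (contDiffAt_T X p hz).of_le (by norm_cast)
  have dA := cA.differentiableAt (by simp)
  have dB := cB.differentiableAt (by simp)
  have dT := cT.differentiableAt (by simp)
  have mAA : ∀ u, G (NA u) a = 0 := fun u => by
    linarith [hf.nabla_antisymm hf.AA hz hzO dA dA u]
  have mBB : ∀ u, G (NB u) b = 0 := fun u => by
    linarith [hf.nabla_antisymm hf.BB hz hzO dB dB u]
  have mAB : ∀ u, G (NB u) a = - G (NA u) b := fun u => by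
    linarith [hf.nabla_antisymm hf.AB hz hzO dA dB u]
  have mAT : ∀ u, G (NT u) a = - G (NA u) t := fun u => by
    linarith [hf.nabla_antisymm hf.AT hz hzO dA dT u]
  have mBT : ∀ u, G (NT u) b = - G (NB u) t := fun u => by
    linarith [hf.nabla_antisymm hf.BT hz hzO dB dT u]
  have xA := extD_flat_chart (X := X) hz cA
  have xB := extD_flat_chart (X := X) hz cB
  have xT := extD_flat_chart (X := X) hz cT
  have x1 : 2 * extD (flat X.g A) r (A r) (B r) = G (NA a) b := by
    rw [← eA, ← eB, xA, ← hG, ← hNA, mAA]; ring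
  have x2 : 2 * extD (flat X.g B) r (A r) (B r) = G (NA b) b := by
    rw [← eA, ← eB, xB, ← hG, ← hNB, mBB, mAB]; ring
  have x3 : extD (flat X.g A) r (X.T r) (B r) - extD (flat X.g B) r (X.T r) (A r)
      + extD (flat X.g X.T) r (A r) (B r) = G (NA t) b := by
    have y1 := xA t b
    have y2 := xB t a
    have y3 := xT a b
    rw [eA, eT, mAB] at y2
    rw [eB, eT] at y1
    rw [eA, eB, mAT, mBT] at y3
    linarith
  have hv : v = G a v • a + G b v • b + G t v • t := by
    have h0 := hf.expand hzO (dChartSymm p z v)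
    have h1 := congrArg (dChart p r) h0
    simp only [map_add, map_smul] at h1
    have h2 : (dChart p r (dChartSymm p z v) : E3) = v := dChart_dChartSymm hz v
    rw [h2] at h1
    have e1 : X.g.inner r (A r) (dChartSymm p z v) = G a v := by
      rw [hG, metricInChart_apply, eA]
    have e2 : X.g.inner r (B r) (dChartSymm p z v) = G b v := by
      rw [hG, metricInChart_apply, eB]
    have e3 : X.g.inner r (X.T r) (dChartSymm p z v) = G t v := by
      rw [hG, metricInChart_apply, eT]
    rw [e1, e2, e3] at h1
    exact h1
  have hl : formInChart (connForm X A B) p z v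
      = (G (NA a) b) * G a v + (G (NA b) b) * G b v + (G (NA t) b) * G t v := by
    rw [← x1, ← x2, ← x3, hG, metricInChart_apply, metricInChart_apply, metricInChart_apply,
      eA, eB, eT]
    rfl
  rw [hl]
  conv_rhs => rw [hv]
  rw [hNA, nabla_add_smul hz, ← hNA]
  simp only [map_add, map_smul, _root_.add_apply, _root_.smul_apply, smul_eq_mul]
  ring

lemma contDiffAt_connForm {p : M} {z : E3} (hz : z ∈ (extChartAt (𝓡 3) p).target)
    (hzO : (extChartAt (𝓡 3) p).symm z ∈ O) :
    ContDiffAt ℝ 1 (formInChart (connForm X A B) p) z := by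
  have ho := hf.isOpen_chart p
  suffices h : ContDiffOn ℝ 1 (formInChart (connForm X A B) p)
    ((extChartAt (𝓡 3) p).target ∩ (extChartAt (𝓡 3) p).symm ⁻¹' O) from
      h.contDiffAt (ho.mem_nhds ⟨hz, hzO⟩)
  rw [contDiffOn_clm_apply]
  intro v
  have h1 : ContDiffOn ℝ 1 (fun z => metricInChart X.g p z
      (nabla X.g p (fieldInChart A p) z v) (fieldInChart B p z))
      ((extChartAt (𝓡 3) p).target ∩ (extChartAt (𝓡 3) p).symm ⁻¹' O) := by
    intro y hy
    apply ContDiffAt.contDiffWithinAt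
    obtain ⟨Γ, hΓ, hΓe⟩ := exists_christoffel_clm X.g p hy.1
    have cA := hf.contDiffAt_A hy.1 hy.2
    have cB := hf.contDiffAt_B hy.1 hy.2
    have hn : ContDiffAt ℝ 1 (nabla X.g p (fieldInChart A p) · v) y := by
      have h1 : ContDiffAt ℝ 1 (fun z => fderiv ℝ (fieldInChart A p) z v) y :=
        (cA.fderiv_right (m := 1) (by norm_cast)).clm_apply contDiffAt_const
      have h2 : ContDiffAt ℝ 1 (fun z => Γ z v (fieldInChart A p z)) y :=
        (hΓ.clm_apply contDiffAt_const).clm_apply (cA.of_le (by norm_cast))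
      refine (h1.add h2).congr_of_eventuallyEq ?_
      filter_upwards [ho.mem_nhds hy] with z' hz'
      simp [nabla, hΓe z' hz'.1]
    exact (((contDiffAt_metricInChart X.g p hy.1).of_le (by norm_cast)).clm_apply hn).clm_apply
      (cB.of_le (by norm_cast))
  exact h1.congr fun y hy => hf.formInChart_connForm hy.1 hy.2 v

end IsHorFrame

end FrameCalculus

/-! ### The structure equations of a Sasakian 3-manifold -/

/-- The identity `d(β ∧ γ) = 0` for a `2`-form `β ∧ γ = dα`. -/
lemma cyclic_of_exact {E : Type*} [NormedAddCommGroup E] [NormedSpace ℝ E]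
    {α β γ : E → E →L[ℝ] ℝ} {z : E} (hα : ContDiffAt ℝ 2 α z) (hβ : DifferentiableAt ℝ β z)
    (hγ : DifferentiableAt ℝ γ z)
    (h : ∀ᶠ y in 𝓝 z, ∀ u v, fderiv ℝ α y u v - fderiv ℝ α y v u = β y u * γ y v - β y v * γ y u)
    (u v w : E) :
    (fderiv ℝ β z u v - fderiv ℝ β z v u) * γ z w + (fderiv ℝ β z v w - fderiv ℝ β z w v) * γ z u
      + (fderiv ℝ β z w u - fderiv ℝ β z u w) * γ z v
    = β z u * (fderiv ℝ γ z v w - fderiv ℝ γ z w v) + β z v * (fderiv ℝ γ z w u - fderiv ℝ γ z u w)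
      + β z w * (fderiv ℝ γ z u v - fderiv ℝ γ z v u) := by
  have hD : DifferentiableAt ℝ (fderiv ℝ α) z :=
    (hα.fderiv_right (m := 1) (by norm_num)).differentiableAt (by simp)
  have hsym : IsSymmSndFDerivAt ℝ α z := hα.isSymmSndFDerivAt (by simp)
  have key : ∀ a b c, fderiv ℝ (fderiv ℝ α) z c a b - fderiv ℝ (fderiv ℝ α) z c b a =
      fderiv ℝ β z c a * γ z b + β z a * fderiv ℝ γ z c b
        - fderiv ℝ β z c b * γ z a - β z b * fderiv ℝ γ z c a := by
    intro a b c
    have hl : ∀ a b, HasFDerivAt (fun y => fderiv ℝ α y a b)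
        (((fderiv ℝ (fderiv ℝ α) z).flip a).flip b) z := by
      intro a b
      have := (hD.hasFDerivAt.clm_apply (hasFDerivAt_const a z)).clm_apply (hasFDerivAt_const b z)
      refine this.congr_fderiv ?_
      ext1 c; simp
    have hβ' : ∀ a, HasFDerivAt (fun y => β y a) ((fderiv ℝ β z).flip a) z := by
      intro a
      refine (hβ.hasFDerivAt.clm_apply (hasFDerivAt_const a z)).congr_fderiv ?_
      ext1 c; simp
    have hγ' : ∀ a, HasFDerivAt (fun y => γ y a) ((fderiv ℝ γ z).flip a) z := by
      intro a
      refine (hγ.hasFDerivAt.clm_apply (hasFDerivAt_const a z)).congr_fderiv ?_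
      ext1 c; simp
    have h1 := (hl a b).sub (hl b a)
    have h2 := ((hβ' a).mul (hγ' b)).sub ((hβ' b).mul (hγ' a))
    have h3 := h1.unique (h2.congr_of_eventuallyEq (by filter_upwards [h] with y hy using hy a b))
    have h4 := DFunLike.congr_fun h3 c
    simp at h4
    linarith
  have k1 := key u v w
  have k2 := key v w u
  have k3 := key w u v
  have s : ∀ a b c, fderiv ℝ (fderiv ℝ α) z a b c = fderiv ℝ (fderiv ℝ α) z b a c := fun a b c => by
    rw [hsym.eq a b]
  rw [s u v w] at k2
  rw [s v w u] at k3
  rw [s w u v] at k1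
  linarith

section StructureEquations

variable {M : Type*} [TopologicalSpace M] [ChartedSpace E3 M] [IsManifold (𝓡 3) ∞ M]
  {X : SasakianStructure M} {O : Set M} {A B : ∀ q : M, TangentSpace (𝓡 3) q}

/-- The connection form of the Tanaka–Webster connection in the frame `A`, `B`. -/
def websterForm (X : SasakianStructure M) (A B : ∀ q : M, TangentSpace (𝓡 3) q) (q : M) :
    TangentSpace (𝓡 3) q →L[ℝ] ℝ := connForm X A B q - flat X.g X.T q

/-- The covariant derivative `D_u W` at `q` of a vector field of `M`, computed in the preferred
chart around `q`. -/
def covAt (g : Metric E3 M) (W : ∀ q : M, TangentSpace (𝓡 3) q) (q : M)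
    (u : TangentSpace (𝓡 3) q) : TangentSpace (𝓡 3) q :=
  nabla g q (fieldInChart W q) (extChartAt (𝓡 3) q q) u

namespace IsHorFrame

omit [IsManifold (𝓡 3) ∞ M] in
lemma symm_center_mem {q : M} (hq : q ∈ O) :
    (extChartAt (𝓡 3) q).symm (extChartAt (𝓡 3) q q) ∈ O := by
  rwa [extChartAt_to_inv]

lemma covDeriv_id (g : Metric E3 M) {W : ∀ q : M, TangentSpace (𝓡 3) q} {q : M}
    (hW : DifferentiableAt ℝ (fieldInChart W q) (extChartAt (𝓡 3) q q))
    (u : TangentSpace (𝓡 3) q) :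
    covDeriv g (𝓡 3) (fun q => q) W q u = covAt g W q u := by
  have h := covDeriv_sum g (I' := 𝓡 3) (f := fun q : M => q) (Y := W) (p := q) (n := 1)
    (a := fun _ _ => 1) (W := fun _ => W) (df := ContinuousLinearMap.id ℝ E3)
    (hasMFDerivAt_id q) (da := fun _ => 0) (fun _ => hasMFDerivAt_const (1 : ℝ) q) (fun _ => hW)
    (by simp) (fun _ => rfl) u
  refine h.trans ?_
  rw [Fin.sum_univ_one]
  let b : E3 := covAt g W q u
  let w : E3 := W q
  change (0 : ℝ) • w + (1 : ℝ) • b = b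
  rw [zero_smul, one_smul, zero_add]

lemma contDiffAt_T_center (q : M) :
    ContDiffAt ℝ 3 (fieldInChart X.T q) (extChartAt (𝓡 3) q q) :=
  (contDiffAt_T X q (mem_extChartAt_target q)).of_le (by norm_cast)

/-- The connection is torsion free: the exterior derivative of the form dual to `W` is the
antisymmetric part of `DW`. -/
lemma extD_flat_center {W : ∀ q : M, TangentSpace (𝓡 3) q} {q : M}
    (hW : ContDiffAt ℝ 3 (fieldInChart W q) (extChartAt (𝓡 3) q q)) (u v : TangentSpace (𝓡 3) q) :
    2 * extD (flat X.g W) q u v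
      = X.g.inner q (covAt X.g W q u) v - X.g.inner q (covAt X.g W q v) u := by
  have hz := mem_extChartAt_target (I := 𝓡 3) q
  rw [extD_self]
  have : formInChart (flat X.g W) q =ᶠ[𝓝 (extChartAt (𝓡 3) q q)]
      fun z => metricInChart X.g q z (fieldInChart W q z) := by
    filter_upwards [(isOpen_extChartAt_target q).mem_nhds hz] with y hy
    exact formInChart_flat X.g W hy
  rw [this.fderiv_eq]
  have h := fderiv_metricInChart_field_antisymm X.g q hz (hW.differentiableAt (by simp)) u v
  refine h.trans ?_
  exact congrArg₂ (fun a b : ℝ => a - b) (metricInChart_self X.g q _ v)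
    (metricInChart_self X.g q _ u)

/-- Since `T` is a Killing field, `DT` is antisymmetric, hence equal to its antisymmetric part,
which is `dη`. -/
lemma inner_covAt_T {q : M} (u v : TangentSpace (𝓡 3) q) :
    X.g.inner q (covAt X.g X.T q u) v = X.dη q u v := by
  have hT : DifferentiableAt ℝ (fieldInChart X.T q) (extChartAt (𝓡 3) q q) :=
    (contDiffAt_T_center q).differentiableAt (by simp)
  have h1 := X.killing q u v
  rw [covDeriv_id X.g hT, covDeriv_id X.g hT, X.g.symm q u] at h1
  have h2 := extD_flat_center (X := X) (W := X.T) (contDiffAt_T_center (X := X) q) u v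
  change 2 * X.dη q u v = _ at h2
  linarith

variable (hf : IsHorFrame X O A B)
include hf

/-- Metric compatibility at the centre of the preferred chart, for two fields of constant inner
product. -/
lemma center {P Q : ∀ q : M, TangentSpace (𝓡 3) q} {c : ℝ}
    (hPQ : ∀ q ∈ O, X.g.inner q (P q) (Q q) = c) {q : M} (hq : q ∈ O)
    (hP : DifferentiableAt ℝ (fieldInChart P q) (extChartAt (𝓡 3) q q))
    (hQ : DifferentiableAt ℝ (fieldInChart Q q) (extChartAt (𝓡 3) q q)) 
    (u : TangentSpace (𝓡 3) q) :
    X.g.inner q (covAt X.g P q u) (Q q) = - X.g.inner q (covAt X.g Q q u) (P q) := by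
  have h := hf.nabla_antisymm hPQ (mem_extChartAt_target q) (symm_center_mem hq) hP hQ u
  rw [fieldInChart_self, fieldInChart_self] at h
  refine (metricInChart_self X.g q _ _).symm.trans (h.trans ?_)
  exact congrArg (fun a : ℝ => -a) (metricInChart_self X.g q _ _)

/-- The form `connForm` is the connection form `⟨DA, B⟩` of the Levi-Civita connection. -/
lemma connForm_eq {q : M} (hq : q ∈ O) (u : TangentSpace (𝓡 3) q) :
    connForm X A B q u = X.g.inner q (covAt X.g A q u) (B q) := by
  have h := hf.formInChart_connForm (mem_extChartAt_target q) (symm_center_mem hq) u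
  rw [fieldInChart_self] at h
  refine Eq.trans ?_ (h.trans (metricInChart_self X.g q _ _))
  have h2 := dChart_dChartSymm (mem_extChartAt_target (I := 𝓡 3) q) u
  have h3 : ∀ r, r = q → ∀ a : E3, (dChart q r a : E3) = a := by
    rintro _ rfl a; exact dChart_self_apply _ _
  have h4 : ∀ r, r = q → ∀ a : E3, connForm X A B r a = connForm X A B q a := by
    rintro _ rfl a; rfl
  have h5 : (dChartSymm q (extChartAt (𝓡 3) q q) u : E3) = u :=
    (h3 _ (extChartAt_to_inv q) _).symm.trans h2
  refine Eq.trans ?_ (h4 _ (extChartAt_to_inv q) (dChartSymm q (extChartAt (𝓡 3) q q) u)).symm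
  exact congrArg (fun a : E3 => connForm X A B q a) h5.symm

lemma diffA {q : M} (hq : q ∈ O) :
    ContDiffAt ℝ 3 (fieldInChart A q) (extChartAt (𝓡 3) q q) :=
  hf.contDiffAt_A (mem_extChartAt_target q) (symm_center_mem hq)

lemma diffB {q : M} (hq : q ∈ O) :
    ContDiffAt ℝ 3 (fieldInChart B q) (extChartAt (𝓡 3) q q) :=
  hf.contDiffAt_B (mem_extChartAt_target q) (symm_center_mem hq)

/-- The formula `D_u T = J(u)`. -/
lemma covAt_T {q : M} (hq : q ∈ O) (u : TangentSpace (𝓡 3) q) :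
    covAt X.g X.T q u = X.g.inner q (A q) u • B q - X.g.inner q (B q) u • A q := by
  have h : ∀ v, X.g.inner q v (covAt X.g X.T q u)
      = X.g.inner q v (X.g.inner q (A q) u • B q - X.g.inner q (B q) u • A q) := by
    intro v
    rw [X.g.symm, inner_covAt_T, hf.dη_eq hq, map_sub, map_smul, map_smul, smul_eq_mul,
      smul_eq_mul, X.g.symm q v, X.g.symm q v]
  exact hf.ext_inner hq (h _) (h _) (h _)

lemma covAt_A {q : M} (hq : q ∈ O) (u : TangentSpace (𝓡 3) q) :
    covAt X.g A q u = connForm X A B q u • B q + X.g.inner q (B q) u • X.T q := by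
  have dA := (hf.diffA hq).differentiableAt (by simp)
  have dT := (contDiffAt_T_center (X := X) q).differentiableAt (by simp)
  have h1 := hf.center hf.AA hq dA dA u
  have h2 := hf.center hf.AT hq dA dT u
  rw [hf.covAt_T hq] at h2
  have e1 := hf.AA q hq
  have e2 := hf.BB q hq
  have e3 := hf.AB q hq
  have e4 := hf.AT q hq
  have e5 := hf.BT q hq
  have e6 := X.unit_T q
  have e7 : X.g.inner q (B q) (A q) = 0 := by rw [X.g.symm, e3]
  have e8 : X.g.inner q (X.T q) (A q) = 0 := by rw [X.g.symm, e4]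
  have e9 : X.g.inner q (X.T q) (B q) = 0 := by rw [X.g.symm, e5]
  apply hf.ext_inner hq
  · rw [X.g.symm]
    simp only [map_add, map_smul, smul_eq_mul, e3, e4]
    linarith
  · rw [X.g.symm, ← hf.connForm_eq hq]
    simp [e2, e5]
  · rw [X.g.symm, h2]
    simp [e1, e6, e7, e9]

lemma covAt_B {q : M} (hq : q ∈ O) (u : TangentSpace (𝓡 3) q) :
    covAt X.g B q u = -(connForm X A B q u) • A q - X.g.inner q (A q) u • X.T q := by
  have dA := (hf.diffA hq).differentiableAt (by simp)
  have dB := (hf.diffB hq).differentiableAt (by simp)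
  have dT := (contDiffAt_T_center (X := X) q).differentiableAt (by simp)
  have h1 := hf.center hf.BB hq dB dB u
  have h2 := hf.center hf.BT hq dB dT u
  have h3 := hf.center hf.AB hq dA dB u
  rw [hf.covAt_T hq] at h2
  rw [← hf.connForm_eq hq] at h3
  have e1 := hf.AA q hq
  have e2 := hf.BB q hq
  have e3 := hf.AB q hq
  have e4 := hf.AT q hq
  have e5 := hf.BT q hq
  have e6 := X.unit_T q
  have e7 : X.g.inner q (B q) (A q) = 0 := by rw [X.g.symm, e3]
  have e8 : X.g.inner q (X.T q) (A q) = 0 := by rw [X.g.symm, e4]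
  have e9 : X.g.inner q (X.T q) (B q) = 0 := by rw [X.g.symm, e5]
  apply hf.ext_inner hq
  · rw [X.g.symm]
    simp only [map_sub, map_smul, smul_eq_mul, e1, e4]
    linarith
  · rw [X.g.symm]
    simp only [map_sub, map_smul, smul_eq_mul, e7, e5]
    linarith
  · rw [X.g.symm, h2]
    simp [e2, e3, e6, e8]

/-- The structure equation `dθ₁ = w ∧ θ₂` for the form `θ₁` dual to `A`. -/
lemma extD_flatA {q : M} (hq : q ∈ O) (u v : TangentSpace (𝓡 3) q) :
    2 * extD (flat X.g A) q u v = websterForm X A B q u * flat X.g B q v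
      - websterForm X A B q v * flat X.g B q u := by
  rw [extD_flat_center (hf.diffA hq), hf.covAt_A hq, hf.covAt_A hq]
  simp only [map_add, map_smul, _root_.add_apply, _root_.smul_apply, smul_eq_mul, websterForm, flat,
    _root_.sub_apply]
  ring

/-- The structure equation `dθ₂ = -w ∧ θ₁` for the form `θ₂` dual to `B`. -/
lemma extD_flatB {q : M} (hq : q ∈ O) (u v : TangentSpace (𝓡 3) q) :
    2 * extD (flat X.g B) q u v = -(websterForm X A B q u * flat X.g A q v
      - websterForm X A B q v * flat X.g A q u) := by
  rw [extD_flat_center (hf.diffB hq), hf.covAt_B hq, hf.covAt_B hq]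
  simp only [map_sub, map_smul, _root_.smul_apply, smul_eq_mul, websterForm, flat,
    _root_.sub_apply]
  ring

omit hf in
lemma nabla_linear_comb {p : M} {z : E3} (hz : z ∈ (extChartAt (𝓡 3) p).target) {P Q : E3 → E3}
    (hP : DifferentiableAt ℝ P z) (hQ : DifferentiableAt ℝ Q z) (a b : ℝ) (u : E3) :
    nabla X.g p (fun t => a • P t + b • Q t) z u
      = a • nabla X.g p P z u + b • nabla X.g p Q z u := by
  obtain ⟨Γ, -, hΓ⟩ := exists_christoffel_clm X.g p hz
  have h := (((hP.hasFDerivAt.const_smul a).add (hQ.hasFDerivAt.const_smul b))).fderiv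
  have h1 : fderiv ℝ (fun t => a • P t + b • Q t) z u
      = a • fderiv ℝ P z u + b • fderiv ℝ Q z u := DFunLike.congr_fun h u
  simp only [nabla, h1, hΓ z hz, map_add, map_smul, smul_add]
  abel

/-- The sectional curvature of a horizontal plane in terms of the connection form. -/
lemma sectional_eq {q : M} (hq : q ∈ O) (x y z w : ℝ) :
    sectional X.g q (x • A q + y • B q) (z • A q + w • B q)
      = -(x * w - y * z) ^ 2 * (2 * extD (connForm X A B) q (A q) (B q) + 1) := by
  set o := extChartAt (𝓡 3) q q with ho
  have hot : o ∈ (extChartAt (𝓡 3) q).target := mem_extChartAt_target q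
  have hoO : (extChartAt (𝓡 3) q).symm o ∈ O := symm_center_mem hq
  have hdA := hf.diffA hq
  have hdB := hf.diffB hq
  have dA := hdA.differentiableAt (by simp)
  have dB := hdB.differentiableAt (by simp)
  let a : E3 := A q
  let b : E3 := B q
  let t : E3 := X.T q
  let u : E3 := x • a + y • b
  let v : E3 := z • a + w • b
  have hU : DifferentiableAt ℝ (fun t => x • fieldInChart A q t + y • fieldInChart B q t) o :=
    (dA.const_smul x).add (dB.const_smul y)
  have hV : ContDiffAt ℝ 2 (fun t => z • fieldInChart A q t + w • fieldInChart B q t) o :=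
    ((hdA.const_smul z).add (hdB.const_smul w)).of_le (by norm_num)
  have h1 := fderiv_connection_antisymm X.g q hot hU hV u v
  -- The connection form of the pair of fields `zA + wB`, `xA + yB` is a constant multiple of the
  -- one of `A`, `B`, because `⟨DA, A⟩ = ⟨DB, B⟩ = 0`.
  have hω : ∀ a : E3, (fun t => metricInChart X.g q t
      (nabla X.g q (fun t => z • fieldInChart A q t + w • fieldInChart B q t) t a)
      (x • fieldInChart A q t + y • fieldInChart B q t)) =ᶠ[𝓝 o]
      fun t => -(x * w - y * z) * formInChart (connForm X A B) q t a := by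
    intro a
    filter_upwards [(hf.isOpen_chart q).mem_nhds ⟨hot, hoO⟩] with t ht
    obtain ⟨ht, htO⟩ := ht
    have dA := (hf.contDiffAt_A ht htO).differentiableAt (by simp)
    have dB := (hf.contDiffAt_B ht htO).differentiableAt (by simp)
    have k1 := hf.nabla_antisymm hf.AA ht htO dA dA a
    have k2 := hf.nabla_antisymm hf.BB ht htO dB dB a
    have k3 := hf.nabla_antisymm hf.AB ht htO dA dB a
    have k3' := (neg_eq_iff_eq_neg.mpr k3).symm
    rw [nabla_linear_comb ht dA dB, hf.formInChart_connForm ht htO]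
    simp only [map_add, map_smul, _root_.add_apply, _root_.smul_apply, smul_eq_mul]
    linear_combination (z * x / 2) * k1 + (w * y / 2) * k2 + (w * x) * k3'
  have hd : ∀ a b : E3, fderiv ℝ (fun t => metricInChart X.g q t
      (nabla X.g q (fun t => z • fieldInChart A q t + w • fieldInChart B q t) t a)
      (x • fieldInChart A q t + y • fieldInChart B q t)) o b
      = -(x * w - y * z) * fderiv ℝ (formInChart (connForm X A B) q) o b a := by
    intro a b
    rw [(hω a).fderiv_eq]
    have h2 := (hf.contDiffAt_connForm hot (symm_center_mem hq)).differentiableAt (by simp)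
    have h3 := ((h2.hasFDerivAt.clm_apply (hasFDerivAt_const a o)).const_mul
      (-(x * w - y * z))).fderiv
    have h4 := DFunLike.congr_fun h3 b
    refine h4.trans ?_
    simp
  let cf : E3 →L[ℝ] ℝ := connForm X A B q
  let G : E3 →L[ℝ] E3 →L[ℝ] ℝ := metricInChart X.g q o
  have hG : ∀ c d : E3, G c d = X.g.inner q c d := metricInChart_self X.g q
  have ea : fieldInChart A q o = a := fieldInChart_self A q
  have eb : fieldInChart B q o = b := fieldInChart_self B q
  have cA : ∀ c : E3, nabla X.g q (fieldInChart A q) o c = cf c • b + G b c • t := fun c => by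
    rw [hG]; exact hf.covAt_A hq c
  have cB : ∀ c : E3, nabla X.g q (fieldInChart B q) o c = -(cf c) • a - G a c • t := fun c => by
    rw [hG]; exact hf.covAt_B hq c
  have e1 : G a a = 1 := (hG _ _).trans (hf.AA q hq)
  have e2 : G b b = 1 := (hG _ _).trans (hf.BB q hq)
  have e3 : G a b = 0 := (hG _ _).trans (hf.AB q hq)
  have e4 : G a t = 0 := (hG _ _).trans (hf.AT q hq)
  have e5 : G b t = 0 := (hG _ _).trans (hf.BT q hq)
  have e6 : G t t = 1 := (hG _ _).trans (X.unit_T q)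
  have sy : ∀ c d, G c d = G d c := fun c d =>
    (hG c d).trans ((X.g.symm q c d).trans (hG d c).symm)
  have e7 : G b a = 0 := by rw [sy, e3]
  have e8 : G t a = 0 := by rw [sy, e4]
  have e9 : G t b = 0 := by rw [sy, e5]
  have e : 2 * extD (connForm X A B) q (A q) (B q) = _ := extD_self (connForm X A B) q (A q) (B q)
  have hs : sectional X.g q (x • A q + y • B q) (z • A q + w • B q)
      = G (curvature X.g q o u v v) u := by
    rw [sectional_eq_curvature, dChart_self_apply, dChart_self_apply]
    rfl
  rw [hd, hd, nabla_linear_comb hot dA dB, nabla_linear_comb hot dA dB, nabla_linear_comb hot dA dB,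
    nabla_linear_comb hot dA dB, cA, cA, cB, cB, ea, eb] at h1
  change _ = G (curvature X.g q o u v v) u + G _ _ - G _ _ at h1
  rw [hs, e]
  let Dω : E3 →L[ℝ] E3 →L[ℝ] ℝ := fderiv ℝ (formInChart (connForm X A B) q) o
  change -(x * w - y * z) * Dω u v - -(x * w - y * z) * Dω v u = _ at h1
  change _ = -(x * w - y * z) ^ 2 * ((Dω a b - Dω b a) + 1)
  simp only [u, v, map_add, map_sub, map_smul, _root_.add_apply, _root_.sub_apply,
    _root_.smul_apply, smul_eq_mul, e1, e2, e3, e4, e5, e6, e7, e8, e9] at h1 ⊢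
  linear_combination -h1

/-- The curvature of the horizontal plane through the connection form. -/
lemma extD_connForm {q : M} (hq : q ∈ O) :
    2 * extD (connForm X A B) q (A q) (B q) = -(X.horSectional q + 1) := by
  set κ := 2 * extD (connForm X A B) q (A q) (B q) with hκ
  -- All orthonormal bases of the horizontal plane have the same sectional curvature, so the set
  -- whose supremum defines `horSectional` is a singleton.
  have hset : {k | ∃ u v : TangentSpace (𝓡 3) q, X.η q u = 0 ∧ X.η q v = 0 ∧ X.g.inner q u u = 1 ∧
    X.g.inner q v v = 1 ∧ X.g.inner q u v = 0 ∧ k = sectional X.g q u v} = {-(κ + 1)} := by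
    apply eq_singleton_iff_unique_mem.mpr
    constructor
    · refine ⟨A q, B q, ?_, ?_, hf.AA q hq, hf.BB q hq, hf.AB q hq, ?_⟩
      · exact (X.g.symm q _ _).trans (hf.AT q hq)
      · exact (X.g.symm q _ _).trans (hf.BT q hq)
      · have h := hf.sectional_eq hq 1 0 0 1
        simp only [one_smul, zero_smul, add_zero, zero_add] at h
        rw [h, ← hκ]; ring
    · rintro k ⟨u, v, hu, hv, huu, hvv, huv, rfl⟩
      have hu' : X.g.inner q (X.T q) u = 0 := hu
      have hv' : X.g.inner q (X.T q) v = 0 := hv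
      have eu := hf.expand hq u
      have ev := hf.expand hq v
      rw [hu', zero_smul, add_zero] at eu
      rw [hv', zero_smul, add_zero] at ev
      rw [hf.inner_eq hq, hu', zero_mul, add_zero] at huu
      rw [hf.inner_eq hq, hv', zero_mul, add_zero] at hvv
      rw [hf.inner_eq hq, hu', zero_mul, add_zero] at huv
      set x := X.g.inner q (A q) u
      set y := X.g.inner q (B q) u
      set z := X.g.inner q (A q) v
      set w := X.g.inner q (B q) v
      rw [eu, ev, hf.sectional_eq hq, ← hκ]
      have : (x * w - y * z) ^ 2 = 1 := by
        linear_combination huu * (z * z + w * w) + hvv - huv * (x * z + y * w)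
      rw [this]; ring
  rw [SasakianStructure.horSectional, hset, csSup_singleton]
  ring

lemma contDiffAt_websterForm {p : M} {z : E3} (hz : z ∈ (extChartAt (𝓡 3) p).target)
    (hzO : (extChartAt (𝓡 3) p).symm z ∈ O) :
    ContDiffAt ℝ 1 (formInChart (websterForm X A B) p) z :=
  (hf.contDiffAt_connForm hz hzO).sub ((contDiffAt_flatT hz).of_le (by norm_num))

/-- The structure equation `dw = -4 K θ₁ ∧ θ₂` of the Tanaka–Webster connection. -/
lemma extD_websterForm {q : M} (hq : q ∈ O) (u v : TangentSpace (𝓡 3) q) :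
    2 * extD (websterForm X A B) q u v = -4 * X.webster q *
      (flat X.g A q u * flat X.g B q v - flat X.g A q v * flat X.g B q u) := by
  set o := extChartAt (𝓡 3) q q with ho
  have hot : o ∈ (extChartAt (𝓡 3) q).target := mem_extChartAt_target q
  have hoO : (extChartAt (𝓡 3) q).symm o ∈ O := symm_center_mem hq
  let a : E3 → E3 →L[ℝ] ℝ := formInChart (flat X.g A) q
  let b : E3 → E3 →L[ℝ] ℝ := formInChart (flat X.g B) q
  let c : E3 → E3 →L[ℝ] ℝ := formInChart (websterForm X A B) q
  have ha : ContDiffAt ℝ 3 a o := hf.contDiffAt_flatA hot hoO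
  have hb : ContDiffAt ℝ 3 b o := hf.contDiffAt_flatB hot hoO
  have hc : ContDiffAt ℝ 1 c o := hf.contDiffAt_websterForm hot hoO
  have sa : ∀ᶠ y in 𝓝 o, ∀ u v, fderiv ℝ a y u v - fderiv ℝ a y v u
      = c y u * b y v - c y v * b y u := by
    filter_upwards [(hf.isOpen_chart q).mem_nhds ⟨hot, hoO⟩] with y hy u v
    rw [← extD_eq_chart hy.1 (n := 3) (by norm_cast) (by norm_cast)
      (hf.contDiffAt_flatA hy.1 hy.2), hf.extD_flatA hy.2]
    rfl
  have sb : ∀ᶠ y in 𝓝 o, ∀ u v, fderiv ℝ b y u v - fderiv ℝ b y v u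
      = c y v * a y u - c y u * a y v := by
    filter_upwards [(hf.isOpen_chart q).mem_nhds ⟨hot, hoO⟩] with y hy u v
    rw [← extD_eq_chart hy.1 (n := 3) (by norm_cast) (by norm_cast)
      (hf.contDiffAt_flatB hy.1 hy.2), hf.extD_flatB hy.2, neg_sub]
    rfl
  -- Expand `d(dθ₁) = d(w ∧ θ₂) = 0` and `d(dθ₂) = d(θ₁ ∧ w) = 0`. These identities determine the
  -- value of `dw` on the pairs `(A, T)` and `(B, T)`; its value on `(A, B)` is the curvature.
  have ca := cyclic_of_exact (ha.of_le (by norm_num)) (hc.differentiableAt (by simp))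
    (hb.differentiableAt (by simp)) sa
  have sb' : ∀ᶠ y in 𝓝 o, ∀ u v, fderiv ℝ b y u v - fderiv ℝ b y v u
      = a y u * c y v - a y v * c y u := by
    filter_upwards [sb] with y hy u v
    rw [hy]; ring
  have cb := cyclic_of_exact (hb.of_le (by norm_num)) (ha.differentiableAt (by simp))
    (hc.differentiableAt (by simp)) sb'
  have sa := sa.self_of_nhds
  have sb := sb.self_of_nhds
  let A₀ : E3 := A q
  let B₀ : E3 := B q
  let T₀ : E3 := X.T q
  have fa : ∀ W : ∀ q : M, TangentSpace (𝓡 3) q, ∀ v : E3, formInChart (flat X.g W) q o v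
      = X.g.inner q (W q) v := fun W v => by
    rw [formInChart_flat X.g W hot, fieldInChart_self]; exact metricInChart_self X.g q _ _
  have a1 : a o A₀ = 1 := (fa A A₀).trans (hf.AA q hq)
  have a2 : a o B₀ = 0 := (fa A B₀).trans (hf.AB q hq)
  have a3 : a o T₀ = 0 := (fa A T₀).trans (hf.AT q hq)
  have b1 : b o A₀ = 0 := (fa B A₀).trans ((X.g.symm q _ _).trans (hf.AB q hq))
  have b2 : b o B₀ = 1 := (fa B B₀).trans (hf.BB q hq)
  have b3 : b o T₀ = 0 := (fa B T₀).trans (hf.BT q hq)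
  let Dc : E3 →L[ℝ] E3 →L[ℝ] ℝ := fderiv ℝ c o
  have hAT : Dc A₀ T₀ - Dc T₀ A₀ = 0 := by
    have h := ca A₀ T₀ B₀
    rw [sb, sb, sb, b1, b2, b3] at h
    linear_combination h
  have hBT : Dc B₀ T₀ - Dc T₀ B₀ = 0 := by
    have h := cb B₀ T₀ A₀
    rw [sa, sa, sa, a1, a2, a3] at h
    linear_combination -h
  have hAB : Dc A₀ B₀ - Dc B₀ A₀ = -4 * X.webster q := by
    have h1 := extD_self (connForm X A B) q (A q) (B q)
    have h2 := extD_self (flat X.g X.T) q (A q) (B q)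
    have h3 := hf.extD_connForm hq
    have h4 : extD (flat X.g X.T) q (A q) (B q) = 1 := hf.dη_AB q hq
    have h5 := ((hf.contDiffAt_connForm hot hoO).differentiableAt (by simp)).hasFDerivAt.sub
      ((contDiffAt_flatT (X := X) hot).differentiableAt (by simp)).hasFDerivAt
    have h6 : Dc = _ := h5.fderiv
    have e1 : Dc A₀ B₀ = fderiv ℝ (formInChart (connForm X A B) q) o (A q) (B q)
      - fderiv ℝ (formInChart (flat X.g X.T) q) o (A q) (B q) := by rw [h6]; rfl
    have e2 : Dc B₀ A₀ = fderiv ℝ (formInChart (connForm X A B) q) o (B q) (A q)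
      - fderiv ℝ (formInChart (flat X.g X.T) q) o (B q) (A q) := by rw [h6]; rfl
    rw [e1, e2, SasakianStructure.webster]
    linarith
  have key : ∀ x y z x' y' z' : ℝ, Dc (x • A₀ + y • B₀ + z • T₀) (x' • A₀ + y' • B₀ + z' • T₀)
      - Dc (x' • A₀ + y' • B₀ + z' • T₀) (x • A₀ + y • B₀ + z • T₀)
      = -4 * X.webster q * (x * y' - x' * y) := by
    intro x y z x' y' z'
    simp only [map_add, map_smul, _root_.add_apply, _root_.smul_apply, smul_eq_mul]
    linear_combination (x * y' - x' * y) * hAB + (x * z' - z * x') * hAT + (y * z' - z * y') * hBT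
  have hu : (u : E3) = flat X.g A q u • A₀ + flat X.g B q u • B₀ + flat X.g X.T q u • T₀ :=
    hf.expand hq u
  have hv : (v : E3) = flat X.g A q v • A₀ + flat X.g B q v • B₀ + flat X.g X.T q v • T₀ :=
    hf.expand hq v
  refine (extD_self (websterForm X A B) q u v).trans ?_
  refine Eq.trans ?_ (key (flat X.g A q u) (flat X.g B q u) (flat X.g X.T q u)
    (flat X.g A q v) (flat X.g B q v) (flat X.g X.T q v))
  exact congrArg₂ (fun u v : E3 => Dc u v - Dc v u) hu hv

end IsHorFrame

end StructureEquations

/-! ### Calculus in an adapted coframe -/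

/-- Four `1`-forms on a vector space and three vectors: the first vector is the direction of the
deformation parameter, the other two span the slices. -/
structure Coframe (V : Type*) [NormedAddCommGroup V] [NormedSpace ℝ V] where
  η : V → V →L[ℝ] ℝ
  α : V → V →L[ℝ] ℝ
  β : V → V →L[ℝ] ℝ
  ζ : V → V →L[ℝ] ℝ
  b0 : V
  b1 : V
  b2 : V

namespace Coframe

variable {V : Type*} [NormedAddCommGroup V] [NormedSpace ℝ V] (c : Coframe V)

/-- The value of `η ∧ α` on the slices. -/
def m (z : V) : ℝ := c.η z c.b1 * c.α z c.b2 - c.η z c.b2 * c.α z c.b1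

/-- The derivative along the field of the slices on which `η` vanishes and `α` is `1`. -/
def E (F : V → ℝ) (z : V) : ℝ :=
  (c.η z c.b1 * fderiv ℝ F z c.b2 - c.η z c.b2 * fderiv ℝ F z c.b1) / c.m z

/-- The ratio of `β` and `η` on the slices. -/
def lam (z : V) : ℝ := (c.β z c.b1 * c.α z c.b2 - c.β z c.b2 * c.α z c.b1) / c.m z

/-- The connection form `ζ` evaluated on the field of `E`, with the opposite sign. For the coframe
of a surface it is twice the mean curvature. -/
def h (z : V) : ℝ := -(c.η z c.b1 * c.ζ z c.b2 - c.η z c.b2 * c.ζ z c.b1) / c.m z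

/-- The transversal component of the velocity: the value on `b0` of `β - lam • η`, which is the
combination of `η` and `β` that annihilates the slices. -/
def v (z : V) : ℝ := c.β z c.b0 - c.lam z * c.η z c.b0

/-- The restriction to the slices of the contraction of `η ∧ α` with the velocity. -/
def κ (b : V) (z : V) : ℝ := c.η z c.b0 * c.α z b - c.α z c.b0 * c.η z b

/-- The value of `ζ` on the field of the slices on which `η` is `1` and `α` vanishes. -/
def ρ (z : V) : ℝ := c.E c.lam z + 2 * c.lam z ^ 2

/-- The potential of the Jacobi operator. -/
def Q (K : V → ℝ) (z : V) : ℝ := 4 * c.E c.lam z + 4 * c.lam z ^ 2 + 4 * K z + c.h z ^ 2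

/-- The structure equations of a Sasakian `3`-manifold, pulled back to `Ω`, for a frame adapted to
the slices. -/
structure IsCartan (Ω : Set V) (K : V → ℝ) : Prop where
  isOpen : IsOpen Ω
  cη : ∀ z ∈ Ω, ContDiffAt ℝ 2 c.η z
  cα : ∀ z ∈ Ω, ContDiffAt ℝ 2 c.α z
  cβ : ∀ z ∈ Ω, ContDiffAt ℝ 2 c.β z
  cζ : ∀ z ∈ Ω, ContDiffAt ℝ 1 c.ζ z
  dη : ∀ z ∈ Ω, ∀ u v, fderiv ℝ c.η z u v - fderiv ℝ c.η z v u
    = 2 * (c.α z u * c.β z v - c.α z v * c.β z u)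
  dα : ∀ z ∈ Ω, ∀ u v, fderiv ℝ c.α z u v - fderiv ℝ c.α z v u
    = c.ζ z u * c.β z v - c.ζ z v * c.β z u
  dβ : ∀ z ∈ Ω, ∀ u v, fderiv ℝ c.β z u v - fderiv ℝ c.β z v u
    = -(c.ζ z u * c.α z v - c.ζ z v * c.α z u)
  dζ : ∀ z ∈ Ω, ∀ u v, fderiv ℝ c.ζ z u v - fderiv ℝ c.ζ z v u
    = -4 * K z * (c.α z u * c.β z v - c.α z v * c.β z u)
  slice : ∀ z ∈ Ω, c.η z c.b1 * c.β z c.b2 = c.η z c.b2 * c.β z c.b1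
  m_ne : ∀ z ∈ Ω, c.m z ≠ 0

lemma hasFDerivAt_form_apply {A : V → V →L[ℝ] ℝ} {z : V} (hA : DifferentiableAt ℝ A z) (b : V) :
    HasFDerivAt (fun y => A y b) ((fderiv ℝ A z).flip b) z := by
  refine (hA.hasFDerivAt.clm_apply (hasFDerivAt_const b z)).congr_fderiv ?_
  ext1 u; simp

lemma fderiv_form_apply {A : V → V →L[ℝ] ℝ} {z : V} (hA : DifferentiableAt ℝ A z) (b u : V) :
    fderiv ℝ (fun y => A y b) z u = fderiv ℝ A z u b := by
  rw [(hasFDerivAt_form_apply hA b).fderiv]; rfl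

lemma fderiv_mul_apply {F G : V → ℝ} {z : V} (hF : DifferentiableAt ℝ F z)
    (hG : DifferentiableAt ℝ G z) (u : V) :
    fderiv ℝ (fun y => F y * G y) z u = F z * fderiv ℝ G z u + G z * fderiv ℝ F z u := by
  rw [fderiv_fun_mul hF hG]; simp

lemma fderiv_add_apply {F G : V → ℝ} {z : V} (hF : DifferentiableAt ℝ F z)
    (hG : DifferentiableAt ℝ G z) (u : V) :
    fderiv ℝ (fun y => F y + G y) z u = fderiv ℝ F z u + fderiv ℝ G z u := by
  rw [fderiv_fun_add hF hG]; simp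

lemma fderiv_sub_apply {F G : V → ℝ} {z : V} (hF : DifferentiableAt ℝ F z)
    (hG : DifferentiableAt ℝ G z) (u : V) :
    fderiv ℝ (fun y => F y - G y) z u = fderiv ℝ F z u - fderiv ℝ G z u := by
  rw [fderiv_fun_sub hF hG]; simp

namespace IsCartan

variable {c} {Ω : Set V} {K : V → ℝ} (hc : c.IsCartan Ω K) {z : V} (hz : z ∈ Ω)
include hc hz

lemma contDiffAt_η (b : V) : ContDiffAt ℝ 2 (fun y => c.η y b) z :=
  (hc.cη z hz).clm_apply contDiffAt_const

lemma contDiffAt_α (b : V) : ContDiffAt ℝ 2 (fun y => c.α y b) z :=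
  (hc.cα z hz).clm_apply contDiffAt_const

lemma contDiffAt_β (b : V) : ContDiffAt ℝ 2 (fun y => c.β y b) z :=
  (hc.cβ z hz).clm_apply contDiffAt_const

lemma contDiffAt_ζ (b : V) : ContDiffAt ℝ 1 (fun y => c.ζ y b) z :=
  (hc.cζ z hz).clm_apply contDiffAt_const

lemma contDiffAt_m : ContDiffAt ℝ 2 c.m z :=
  ((hc.contDiffAt_η hz _).mul (hc.contDiffAt_α hz _)).sub
    ((hc.contDiffAt_η hz _).mul (hc.contDiffAt_α hz _))

lemma contDiffAt_lam : ContDiffAt ℝ 2 c.lam z :=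
  (((hc.contDiffAt_β hz _).mul (hc.contDiffAt_α hz _)).sub
    ((hc.contDiffAt_β hz _).mul (hc.contDiffAt_α hz _))).div (hc.contDiffAt_m hz) (hc.m_ne z hz)

lemma contDiffAt_h : ContDiffAt ℝ 1 c.h z :=
  (((((hc.contDiffAt_η hz _).of_le (by norm_num)).mul (hc.contDiffAt_ζ hz _)).sub
    (((hc.contDiffAt_η hz _).of_le (by norm_num)).mul (hc.contDiffAt_ζ hz _))).neg).div
      ((hc.contDiffAt_m hz).of_le (by norm_num)) (hc.m_ne z hz)

lemma contDiffAt_v : ContDiffAt ℝ 2 c.v z :=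
  (hc.contDiffAt_β hz _).sub ((hc.contDiffAt_lam hz).mul (hc.contDiffAt_η hz _))

lemma contDiffAt_κ (b : V) : ContDiffAt ℝ 2 (c.κ b) z :=
  ((hc.contDiffAt_η hz _).mul (hc.contDiffAt_α hz _)).sub
    ((hc.contDiffAt_α hz _).mul (hc.contDiffAt_η hz _))

lemma contDiffAt_E {F : V → ℝ} (hF : ContDiffAt ℝ 2 F z) : ContDiffAt ℝ 1 (c.E F) z := by
  have h1 : ∀ b, ContDiffAt ℝ 1 (fun y => fderiv ℝ F y b) z := fun b =>
    (hF.fderiv_right (m := 1) (by norm_num)).clm_apply contDiffAt_const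
  exact ((((hc.contDiffAt_η hz _).of_le (by norm_num)).mul (h1 _)).sub
    (((hc.contDiffAt_η hz _).of_le (by norm_num)).mul (h1 _))).div
      ((hc.contDiffAt_m hz).of_le (by norm_num)) (hc.m_ne z hz)

lemma contDiffAt_ρ : ContDiffAt ℝ 1 c.ρ z :=
  (hc.contDiffAt_E hz (hc.contDiffAt_lam hz)).add
    (contDiffAt_const.mul (((hc.contDiffAt_lam hz).of_le (by norm_num)).pow 2))

lemma m_mul_E (F : V → ℝ) :
    c.m z * c.E F z = c.η z c.b1 * fderiv ℝ F z c.b2 - c.η z c.b2 * fderiv ℝ F z c.b1 :=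
  mul_div_cancel₀ _ (hc.m_ne z hz)

/-- On the slices `β = lam • η`. Here and in `ζ1` and `ζ0` the numeral is the index of the vector
among `b0`, `b1`, `b2`. -/
lemma β1 : c.β z c.b1 = c.lam z * c.η z c.b1 := by
  have hm := hc.m_ne z hz
  have h := hc.slice z hz
  rw [lam]
  field_simp
  rw [m]
  linear_combination c.α z c.b1 * (h)

lemma β2 : c.β z c.b2 = c.lam z * c.η z c.b2 := by
  have hm := hc.m_ne z hz
  have h := hc.slice z hz
  rw [lam]
  field_simp
  rw [m]
  linear_combination c.α z c.b2 * (h)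

omit hc hz in
lemma β0 : c.β z c.b0 = c.v z + c.lam z * c.η z c.b0 := by rw [v]; ring

lemma ηζ : c.η z c.b1 * c.ζ z c.b2 - c.η z c.b2 * c.ζ z c.b1 = -(c.h z * c.m z) := by
  have hm := hc.m_ne z hz
  rw [h]; field_simp

/-- The first variation of `m`. -/
lemma fderiv_m :
    fderiv ℝ c.m z c.b0 = c.h z * (c.v z * c.m z)
      + (fderiv ℝ (c.κ c.b2) z c.b1 - fderiv ℝ (c.κ c.b1) z c.b2) := by
  have dη := (hc.cη z hz).differentiableAt (by simp)
  have dα := (hc.cα z hz).differentiableAt (by simp)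
  have sη := fun b => (hc.contDiffAt_η hz b).differentiableAt (by simp)
  have sα := fun b => (hc.contDiffAt_α hz b).differentiableAt (by simp)
  have em : c.m = fun y => c.η y c.b1 * c.α y c.b2 - c.η y c.b2 * c.α y c.b1 := rfl
  have eκ : ∀ b, c.κ b = fun y => c.η y c.b0 * c.α y b - c.α y c.b0 * c.η y b := fun b => rfl
  have key : ∀ b b' u, fderiv ℝ (fun y => c.η y b * c.α y b') z u
      = c.η z b * fderiv ℝ c.α z u b' + c.α z b' * fderiv ℝ c.η z u b := fun b b' u => by
    rw [fderiv_mul_apply (sη b) (sα b'), fderiv_form_apply dη, fderiv_form_apply dα]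
  have key' : ∀ b b' u, fderiv ℝ (fun y => c.α y b * c.η y b') z u
      = c.α z b * fderiv ℝ c.η z u b' + c.η z b' * fderiv ℝ c.α z u b := fun b b' u => by
    rw [fderiv_mul_apply (sα b) (sη b'), fderiv_form_apply dη, fderiv_form_apply dα]
  have pηα : ∀ b b', DifferentiableAt ℝ (fun y => c.η y b * c.α y b') z := fun b b' =>
    (sη b).mul (sα b')
  have pαη : ∀ b b', DifferentiableAt ℝ (fun y => c.α y b * c.η y b') z := fun b b' =>
    (sα b).mul (sη b')
  rw [eκ, eκ, fderiv_sub_apply (pηα _ _) (pαη _ _), fderiv_sub_apply (pηα _ _) (pαη _ _)]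
  have h1 : fderiv ℝ c.m z c.b0 = fderiv ℝ (fun y => c.η y c.b1 * c.α y c.b2) z c.b0
      - fderiv ℝ (fun y => c.η y c.b2 * c.α y c.b1) z c.b0 :=
    fderiv_sub_apply (pηα _ _) (pηα _ _) _
  rw [h1]
  simp only [key, key']
  have e1 := hc.dη z hz c.b0 c.b1
  have e2 := hc.dη z hz c.b0 c.b2
  have e3 := hc.dη z hz c.b1 c.b2
  have e4 := hc.dα z hz c.b0 c.b1
  have e5 := hc.dα z hz c.b0 c.b2
  have e6 := hc.dα z hz c.b1 c.b2
  have b1 := hc.β1 hz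
  have b2 := hc.β2 hz
  have b0 := β0 (c := c) (z := z)
  have k := hc.ηζ hz
  rw [b1, b2] at e3 e6
  rw [b0, b1] at e1 e4
  rw [b0, b2] at e2 e5
  linear_combination c.α z c.b2 * e1 - c.α z c.b1 * e2 + c.α z c.b0 * e3 - c.η z c.b2 * e4
    + c.η z c.b1 * e5 - c.η z c.b0 * e6 - c.v z * k

/-- The exterior derivative of `G η` on the slices. -/
lemma curl_mul_η {G : V → ℝ} (hG : DifferentiableAt ℝ G z) :
    fderiv ℝ (fun y => G y * c.η y c.b2) z c.b1 - fderiv ℝ (fun y => G y * c.η y c.b1) z c.b2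
      = -(c.m z * (c.E G z + 2 * c.lam z * G z)) := by
  have dη := (hc.cη z hz).differentiableAt (by simp)
  have sη := fun b => (hc.contDiffAt_η hz b).differentiableAt (by simp)
  rw [fderiv_mul_apply hG (sη _), fderiv_mul_apply hG (sη _), fderiv_form_apply dη,
    fderiv_form_apply dη]
  have e3 := hc.dη z hz c.b1 c.b2
  have b1 := hc.β1 hz
  have b2 := hc.β2 hz
  have hE := hc.m_mul_E hz G
  rw [b1, b2] at e3
  have em : c.m z = c.η z c.b1 * c.α z c.b2 - c.η z c.b2 * c.α z c.b1 := rfl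
  linear_combination G z * e3 + hE + 2 * c.lam z * G z * em

omit hc hz in
lemma E_add {F G : V → ℝ} (hF : DifferentiableAt ℝ F z) (hG : DifferentiableAt ℝ G z) :
    c.E (fun y => F y + G y) z = c.E F z + c.E G z := by
  rw [E, E, E, fderiv_add_apply hF hG, fderiv_add_apply hF hG]; ring

omit hc hz in
lemma E_sub {F G : V → ℝ} (hF : DifferentiableAt ℝ F z) (hG : DifferentiableAt ℝ G z) :
    c.E (fun y => F y - G y) z = c.E F z - c.E G z := by
  rw [E, E, E, fderiv_sub_apply hF hG, fderiv_sub_apply hF hG]; ring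

omit hc hz in
lemma E_mul {F G : V → ℝ} (hF : DifferentiableAt ℝ F z) (hG : DifferentiableAt ℝ G z) :
    c.E (fun y => F y * G y) z = F z * c.E G z + G z * c.E F z := by
  rw [E, E, E, fderiv_mul_apply hF hG, fderiv_mul_apply hF hG]; ring

lemma fderiv_β1 (u : V) : fderiv ℝ c.β z u c.b1
    = c.lam z * fderiv ℝ c.η z u c.b1 + c.η z c.b1 * fderiv ℝ c.lam z u := by
  have h : (fun y => c.β y c.b1) =ᶠ[𝓝 z] fun y => c.lam y * c.η y c.b1 := by
    filter_upwards [hc.isOpen.mem_nhds hz] with y hy using hc.β1 hy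
  rw [← fderiv_form_apply ((hc.cβ z hz).differentiableAt (by simp)), h.fderiv_eq,
    fderiv_mul_apply ((hc.contDiffAt_lam hz).differentiableAt (by simp))
      ((hc.contDiffAt_η hz _).differentiableAt (by simp)),
    fderiv_form_apply ((hc.cη z hz).differentiableAt (by simp))]

lemma fderiv_β2 (u : V) : fderiv ℝ c.β z u c.b2
    = c.lam z * fderiv ℝ c.η z u c.b2 + c.η z c.b2 * fderiv ℝ c.lam z u := by
  have h : (fun y => c.β y c.b2) =ᶠ[𝓝 z] fun y => c.lam y * c.η y c.b2 := by
    filter_upwards [hc.isOpen.mem_nhds hz] with y hy using hc.β2 hy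
  rw [← fderiv_form_apply ((hc.cβ z hz).differentiableAt (by simp)), h.fderiv_eq,
    fderiv_mul_apply ((hc.contDiffAt_lam hz).differentiableAt (by simp))
      ((hc.contDiffAt_η hz _).differentiableAt (by simp)),
    fderiv_form_apply ((hc.cη z hz).differentiableAt (by simp))]

lemma fderiv_β0 (u : V) : fderiv ℝ c.β z u c.b0 = fderiv ℝ c.v z u
    + (c.lam z * fderiv ℝ c.η z u c.b0 + c.η z c.b0 * fderiv ℝ c.lam z u) := by
  have h : (fun y => c.β y c.b0) = fun y => c.v y + c.lam y * c.η y c.b0 := by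
    ext y; exact β0
  have d1 : DifferentiableAt ℝ (fun y => c.lam y * c.η y c.b0) z :=
    ((hc.contDiffAt_lam hz).differentiableAt (by simp)).mul
      ((hc.contDiffAt_η hz _).differentiableAt (by simp))
  rw [← fderiv_form_apply ((hc.cβ z hz).differentiableAt (by simp)), h,
    fderiv_add_apply ((hc.contDiffAt_v hz).differentiableAt (by simp)) d1,
    fderiv_mul_apply ((hc.contDiffAt_lam hz).differentiableAt (by simp))
      ((hc.contDiffAt_η hz _).differentiableAt (by simp)),
    fderiv_form_apply ((hc.cη z hz).differentiableAt (by simp))]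

/-- The structure equation for `β`, restricted to a slice, determines the component of `ζ` along
`η`. -/
lemma ζα : c.ζ z c.b1 * c.α z c.b2 - c.ζ z c.b2 * c.α z c.b1 = c.m z * c.ρ z := by
  have e1 := hc.dβ z hz c.b1 c.b2
  have e2 := hc.dη z hz c.b1 c.b2
  rw [hc.fderiv_β1 hz, hc.fderiv_β2 hz] at e1
  rw [hc.β1 hz, hc.β2 hz] at e2
  have hE := hc.m_mul_E hz c.lam
  have em : c.m z = c.η z c.b1 * c.α z c.b2 - c.η z c.b2 * c.α z c.b1 := rfl
  rw [ρ]
  linear_combination e1 - hE - c.lam z * e2 - 2 * c.lam z ^ 2 * em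

/-- On the slices `ζ = ρ η - h α`. -/
lemma ζ1 : c.ζ z c.b1 = c.ρ z * c.η z c.b1 - c.h z * c.α z c.b1 := by
  have h1 := hc.ηζ hz
  have h2 := hc.ζα hz
  have em : c.m z = c.η z c.b1 * c.α z c.b2 - c.η z c.b2 * c.α z c.b1 := rfl
  refine mul_left_cancel₀ (hc.m_ne z hz) ?_
  linear_combination c.ζ z c.b1 * em + c.α z c.b1 * h1 + c.η z c.b1 * h2

lemma ζ2 : c.ζ z c.b2 = c.ρ z * c.η z c.b2 - c.h z * c.α z c.b2 := by
  have h1 := hc.ηζ hz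
  have h2 := hc.ζα hz
  have em : c.m z = c.η z c.b1 * c.α z c.b2 - c.η z c.b2 * c.α z c.b1 := rfl
  refine mul_left_cancel₀ (hc.m_ne z hz) ?_
  linear_combination c.ζ z c.b2 * em + c.α z c.b2 * h1 + c.η z c.b2 * h2

/-- The component of the structure equation for `β` that involves the velocity determines the value
of `ζ` on the velocity. -/
lemma ζ0 : c.ζ z c.b0 = c.E c.v z + 2 * (c.lam z * c.v z)
    + (c.ρ z * c.η z c.b0 - c.h z * c.α z c.b0) := by
  have e1 := hc.dβ z hz c.b0 c.b1
  have e2 := hc.dβ z hz c.b0 c.b2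
  have f1 := hc.dη z hz c.b0 c.b1
  have f2 := hc.dη z hz c.b0 c.b2
  rw [hc.fderiv_β1 hz, hc.fderiv_β0 hz] at e1
  rw [hc.fderiv_β2 hz, hc.fderiv_β0 hz] at e2
  rw [hc.β1 hz, β0] at f1
  rw [hc.β2 hz, β0] at f2
  have hE := hc.m_mul_E hz c.lam
  have hEv := hc.m_mul_E hz c.v
  have em : c.m z = c.η z c.b1 * c.α z c.b2 - c.η z c.b2 * c.α z c.b1 := rfl
  have k := hc.ηζ hz
  refine mul_left_cancel₀ (hc.m_ne z hz) ?_
  rw [ρ]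
  linear_combination c.η z c.b1 * e2 - c.η z c.b2 * e1
    - c.lam z * (c.η z c.b1 * f2 - c.η z c.b2 * f1)
    + (c.ζ z c.b0 - 2 * c.lam z * (c.v z + c.lam z * c.η z c.b0)) * em - hEv - c.η z c.b0 * hE
    + c.α z c.b0 * k

lemma fderiv_ζ_slice {b : V} (hb : ∀ y ∈ Ω, c.ζ y b = c.ρ y * c.η y b - c.h y * c.α y b) (u : V) :
    fderiv ℝ c.ζ z u b = c.ρ z * fderiv ℝ c.η z u b + c.η z b * fderiv ℝ c.ρ z u
      - (c.h z * fderiv ℝ c.α z u b + c.α z b * fderiv ℝ c.h z u) := by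
  have h : (fun y => c.ζ y b) =ᶠ[𝓝 z] fun y => c.ρ y * c.η y b - c.h y * c.α y b := by
    filter_upwards [hc.isOpen.mem_nhds hz] with y hy using hb y hy
  have dρ := (hc.contDiffAt_ρ hz).differentiableAt (by simp)
  have dh := (hc.contDiffAt_h hz).differentiableAt (by simp)
  have dη := (hc.contDiffAt_η hz b).differentiableAt (by simp)
  have dα := (hc.contDiffAt_α hz b).differentiableAt (by simp)
  have dρη : DifferentiableAt ℝ (fun y => c.ρ y * c.η y b) z := dρ.mul dη
  have dhα : DifferentiableAt ℝ (fun y => c.h y * c.α y b) z := dh.mul dα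
  rw [← fderiv_form_apply ((hc.cζ z hz).differentiableAt (by simp)), h.fderiv_eq,
    fderiv_sub_apply dρη dhα, fderiv_mul_apply dρ dη, fderiv_mul_apply dh dα,
    fderiv_form_apply ((hc.cη z hz).differentiableAt (by simp)),
    fderiv_form_apply ((hc.cα z hz).differentiableAt (by simp))]

/-- The Codazzi equation along the characteristic curves of a slice of constant mean curvature. -/
lemma codazzi (h1 : fderiv ℝ c.h z c.b1 = 0) (h2 : fderiv ℝ c.h z c.b2 = 0) :
    c.E c.ρ z + (2 * c.ρ z + c.h z ^ 2 + 4 * K z) * c.lam z = 0 := by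
  have e := hc.dζ z hz c.b1 c.b2
  have fη := hc.dη z hz c.b1 c.b2
  have fα := hc.dα z hz c.b1 c.b2
  rw [hc.fderiv_ζ_slice hz (fun y hy => hc.ζ1 hy), hc.fderiv_ζ_slice hz (fun y hy => hc.ζ2 hy),
    h1, h2, hc.β1 hz, hc.β2 hz] at e
  rw [hc.β1 hz, hc.β2 hz] at fη fα
  have hE := hc.m_mul_E hz c.ρ
  have em : c.m z = c.η z c.b1 * c.α z c.b2 - c.η z c.b2 * c.α z c.b1 := rfl
  have k := hc.ηζ hz
  refine mul_left_cancel₀ (hc.m_ne z hz) ?_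
  linear_combination -e + c.ρ z * fη - c.h z * fα + hE + c.h z * c.lam z * k
    + (4 * K z * c.lam z + 2 * c.ρ z * c.lam z) * em

lemma E_ρ : c.E c.ρ z = c.E (c.E c.lam) z + 4 * (c.lam z * c.E c.lam z) := by
  have dl := (hc.contDiffAt_lam hz).differentiableAt (by simp)
  have dE := (hc.contDiffAt_E hz (hc.contDiffAt_lam hz)).differentiableAt (by simp)
  have hρ : c.ρ = fun y => c.E c.lam y + (2 * c.lam y) * c.lam y := by
    ext y; rw [ρ]; ring
  have d2 : DifferentiableAt ℝ (fun y => 2 * c.lam y) z := dl.const_mul 2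
  have d3 : DifferentiableAt ℝ (fun y => (2 * c.lam y) * c.lam y) z := d2.mul dl
  have d4 : c.E (fun y => 2 * c.lam y) z = 2 * c.E c.lam z := by
    rw [E, E, fderiv_const_mul dl]; simp; ring
  rw [hρ, E_add dE d3, E_mul d2 dl, d4]; ring

/-- The ratio `lam` is a Jacobi function on a slice of constant mean curvature. -/
lemma jacobi_lam (h1 : fderiv ℝ c.h z c.b1 = 0) (h2 : fderiv ℝ c.h z c.b2 = 0) :
    c.E (c.E c.lam) z + 2 * c.lam z * c.E c.lam z + c.Q K z * c.lam z = 0 := by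
  have h := hc.codazzi hz h1 h2
  rw [hc.E_ρ hz, ρ] at h
  rw [Q]
  linear_combination h

/-- The variation of the mean curvature of a slice of constant mean curvature. -/
lemma fderiv_h (h1 : fderiv ℝ c.h z c.b1 = 0) (h2 : fderiv ℝ c.h z c.b2 = 0) :
    fderiv ℝ c.h z c.b0 = -(c.E (c.E c.v) z + 2 * c.lam z * c.E c.v z + c.Q K z * c.v z) := by
  have hcod := hc.codazzi hz h1 h2
  have dl := (hc.contDiffAt_lam hz).differentiableAt (by simp)
  have dv := (hc.contDiffAt_v hz).differentiableAt (by simp)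
  have dρ := (hc.contDiffAt_ρ hz).differentiableAt (by simp)
  have dh := (hc.contDiffAt_h hz).differentiableAt (by simp)
  have dη := (hc.contDiffAt_η hz c.b0).differentiableAt (by simp)
  have dα := (hc.contDiffAt_α hz c.b0).differentiableAt (by simp)
  have dE := (hc.contDiffAt_E hz (hc.contDiffAt_v hz)).differentiableAt (by simp)
  have d1 : DifferentiableAt ℝ (fun y => c.lam y * c.v y) z := dl.mul dv
  have d1' : DifferentiableAt ℝ (fun y => 2 * (c.lam y * c.v y)) z := d1.const_mul 2
  have d2 : DifferentiableAt ℝ (fun y => c.ρ y * c.η y c.b0) z := dρ.mul dη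
  have d3 : DifferentiableAt ℝ (fun y => c.h y * c.α y c.b0) z := dh.mul dα
  have d4 : c.E (fun y => 2 * (c.lam y * c.v y)) z = 2 * c.E (fun y => c.lam y * c.v y) z := by
    rw [E, E, fderiv_const_mul d1]; simp; ring
  have hEh : c.E c.h z = 0 := by rw [E, h1, h2]; simp
  -- Differentiate the formula for `ζ(b0)` along the slice; the derivative of `h` drops out.
  have hζ : (fun y => c.ζ y c.b0) =ᶠ[𝓝 z] fun y => (c.E c.v y + 2 * (c.lam y * c.v y))
      + (c.ρ y * c.η y c.b0 - c.h y * c.α y c.b0) := by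
    filter_upwards [hc.isOpen.mem_nhds hz] with y hy using hc.ζ0 hy
  have hEζ : c.E (fun y => c.ζ y c.b0) z = c.E (c.E c.v) z
      + 2 * (c.lam z * c.E c.v z + c.v z * c.E c.lam z)
      + (c.ρ z * c.E (fun y => c.η y c.b0) z + c.η z c.b0 * c.E c.ρ z
        - c.h z * c.E (fun y => c.α y c.b0) z) := by
    have : c.E (fun y => c.ζ y c.b0) z = c.E (fun y => (c.E c.v y + 2 * (c.lam y * c.v y))
      + (c.ρ y * c.η y c.b0 - c.h y * c.α y c.b0)) z := by rw [E, E, hζ.fderiv_eq]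
    rw [this, E_add (dE.fun_add d1') (d2.fun_sub d3), E_add dE d1', d4, E_mul dl dv, E_sub d2 d3,
      E_mul dρ dη, E_mul dh dα, hEh]
    ring
  have eζ := hc.m_mul_E hz (fun y => c.ζ y c.b0)
  have eη := hc.m_mul_E hz (fun y => c.η y c.b0)
  have eα := hc.m_mul_E hz (fun y => c.α y c.b0)
  rw [fderiv_form_apply ((hc.cζ z hz).differentiableAt (by simp)),
    fderiv_form_apply ((hc.cζ z hz).differentiableAt (by simp)), hEζ] at eζ
  rw [fderiv_form_apply ((hc.cη z hz).differentiableAt (by simp)),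
    fderiv_form_apply ((hc.cη z hz).differentiableAt (by simp))] at eη
  rw [fderiv_form_apply ((hc.cα z hz).differentiableAt (by simp)),
    fderiv_form_apply ((hc.cα z hz).differentiableAt (by simp))] at eα
  have e1 := hc.dζ z hz c.b0 c.b1
  have e2 := hc.dζ z hz c.b0 c.b2
  rw [hc.fderiv_ζ_slice hz (fun y hy => hc.ζ1 hy)] at e1
  rw [hc.fderiv_ζ_slice hz (fun y hy => hc.ζ2 hy)] at e2
  have f1 := hc.dη z hz c.b0 c.b1
  have f2 := hc.dη z hz c.b0 c.b2
  have g1 := hc.dα z hz c.b0 c.b1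
  have g2 := hc.dα z hz c.b0 c.b2
  rw [hc.β1 hz, β0] at e1 f1 g1
  rw [hc.β2 hz, β0] at e2 f2 g2
  have em : c.m z = c.η z c.b1 * c.α z c.b2 - c.η z c.b2 * c.α z c.b1 := rfl
  have k := hc.ηζ hz
  have hQ : c.Q K z = 2 * c.E c.lam z + 2 * c.ρ z + 4 * K z + c.h z ^ 2 := by rw [Q, ρ]; ring
  refine mul_left_cancel₀ (hc.m_ne z hz) ?_
  rw [hQ]
  -- The components of the structure equations for `ζ`, `η` and `α` that involve the velocity,
  -- combined along the field of `E`. The multiple of `η(b0)` is the equation of Codazzi.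
  linear_combination -(c.η z c.b1 * e2 - c.η z c.b2 * e1)
    + c.ρ z * (c.η z c.b1 * f2 - c.η z c.b2 * f1) - c.h z * (c.η z c.b1 * g2 - c.η z c.b2 * g1)
    + eζ - c.ρ z * eη + c.h z * eα + c.h z * (c.v z + c.lam z * c.η z c.b0) * k
    + (fderiv ℝ c.h z c.b0 + (4 * K z + 2 * c.ρ z) * (c.v z + c.lam z * c.η z c.b0)) * em
    - c.m z * c.η z c.b0 * hcod


/-- The second variation of `m` for a slice of constant mean curvature, with the quadratic form of
the Jacobi operator completed to a square by means of a function `g`. -/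
lemma second_variation (h1 : fderiv ℝ c.h z c.b1 = 0) (h2 : fderiv ℝ c.h z c.b2 = 0)
    {g : V → ℝ} (hg : ContDiffAt ℝ 2 g z) (hg0 : g z ≠ 0) :
    -fderiv ℝ (fun y => fderiv ℝ c.m y c.b0) z c.b0
        + c.h z * fderiv ℝ (fun y => c.v y * c.m y) z c.b0
      = -c.m z * ((c.E c.v z - c.v z * (c.E g z / g z)) ^ 2
          - c.v z ^ 2 * ((c.E (c.E g) z + 2 * c.lam z * c.E g z + c.Q K z * g z) / g z))
        - (fderiv ℝ (fun y => fderiv ℝ (c.κ c.b2) y c.b0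
              + (c.v y * c.E c.v y - c.v y ^ 2 * (c.E g y / g y)) * c.η y c.b2) z c.b1
          - fderiv ℝ (fun y => fderiv ℝ (c.κ c.b1) y c.b0
              + (c.v y * c.E c.v y - c.v y ^ 2 * (c.E g y / g y)) * c.η y c.b1) z c.b2) := by
  have dm := (hc.contDiffAt_m hz).differentiableAt (by simp)
  have dv := (hc.contDiffAt_v hz).differentiableAt (by simp)
  have dh := (hc.contDiffAt_h hz).differentiableAt (by simp)
  have dEv := (hc.contDiffAt_E hz (hc.contDiffAt_v hz)).differentiableAt (by simp)
  have dEg := (hc.contDiffAt_E hz hg).differentiableAt (by simp)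
  have dg := hg.differentiableAt (by simp)
  have dvm : DifferentiableAt ℝ (fun y => c.v y * c.m y) z := dv.mul dm
  have dEgg : DifferentiableAt ℝ (fun y => c.E g y / g y) z := by
    simpa only [div_eq_mul_inv] using! dEg.mul (dg.inv hg0)
  have dv2 : DifferentiableAt ℝ (fun y => c.v y ^ 2) z := dv.pow 2
  have dvEv : DifferentiableAt ℝ (fun y => c.v y * c.E c.v y) z := dv.mul dEv
  have dG2 : DifferentiableAt ℝ (fun y => c.v y ^ 2 * (c.E g y / g y)) z := dv2.mul dEgg
  have dG : DifferentiableAt ℝ (fun y => c.v y * c.E c.v y - c.v y ^ 2 * (c.E g y / g y)) z :=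
    dvEv.sub dG2
  have dη := fun b => (hc.contDiffAt_η hz b).differentiableAt (by simp)
  have dGη : ∀ b, DifferentiableAt ℝ (fun y =>
      (c.v y * c.E c.v y - c.v y ^ 2 * (c.E g y / g y)) * c.η y b) z := fun b => dG.mul (dη b)
  have dfκ : ∀ b, DifferentiableAt ℝ (fderiv ℝ (c.κ b)) z := fun b =>
    ((hc.contDiffAt_κ hz b).fderiv_right (m := 1) (by norm_num)).differentiableAt (by simp)
  have dκ : ∀ b u, DifferentiableAt ℝ (fun y => fderiv ℝ (c.κ b) y u) z := fun b u =>
    (dfκ b).clm_apply (differentiableAt_const u)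
  have sκ : ∀ b u w, fderiv ℝ (fun y => fderiv ℝ (c.κ b) y u) z w
      = fderiv ℝ (fun y => fderiv ℝ (c.κ b) y w) z u := fun b u w => by
    rw [fderiv_form_apply (dfκ b), fderiv_form_apply (dfκ b),
      ((hc.contDiffAt_κ hz b).isSymmSndFDerivAt (by simp)).eq w u]
  -- Differentiate the first variation once more. The derivative of `h` in the direction of the
  -- velocity produces the Jacobi operator, and `curl_mul_η` turns the remainder into an exact form
  -- plus the square.
  have hm : (fun y => fderiv ℝ c.m y c.b0) =ᶠ[𝓝 z] fun y => c.h y * (c.v y * c.m y)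
      + (fderiv ℝ (c.κ c.b2) y c.b1 - fderiv ℝ (c.κ c.b1) y c.b2) := by
    filter_upwards [hc.isOpen.mem_nhds hz] with y hy using hc.fderiv_m hy
  have hfh := hc.fderiv_h hz h1 h2
  have dhvm : DifferentiableAt ℝ (fun y => c.h y * (c.v y * c.m y)) z := dh.mul dvm
  rw [hm.fderiv_eq, fderiv_add_apply dhvm ((dκ _ _).fun_sub (dκ _ _)),
    fderiv_sub_apply (dκ _ _) (dκ _ _), fderiv_mul_apply dh dvm, hfh,
    fderiv_add_apply (dκ _ _) (dGη _), fderiv_add_apply (dκ _ _) (dGη _)]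
  have hcurl := hc.curl_mul_η hz dG
  rw [E_sub dvEv dG2, E_mul dv dEv, E_mul dv2 dEgg] at hcurl
  have e1 : c.E (fun y => c.v y ^ 2) z = 2 * c.v z * c.E c.v z := by
    have : (fun y => c.v y ^ 2) = fun y => c.v y * c.v y := by ext y; ring
    rw [this, E_mul dv dv]; ring
  have e2 : c.E (fun y => c.E g y / g y) z = c.E (c.E g) z / g z - (c.E g z / g z) ^ 2 := by
    have h3 := E_mul (c := c) dEgg dg
    have h4 : (fun y => c.E g y / g y * g y) =ᶠ[𝓝 z] c.E g := by
      filter_upwards [hg.continuousAt.eventually_ne hg0] with y hy using div_mul_cancel₀ _ hy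
    have h5 : c.E (fun y => c.E g y / g y * g y) z = c.E (c.E g) z := by
      rw [E, h4.fderiv_eq, E]
    rw [h5] at h3
    rw [h3]
    field_simp
    ring
  rw [e1, e2] at hcurl
  have e3 : (c.E (c.E g) z + 2 * c.lam z * c.E g z + c.Q K z * g z) / g z
      = c.E (c.E g) z / g z + 2 * c.lam z * (c.E g z / g z) + c.Q K z := by
    field_simp
  rw [e3, sκ c.b2 c.b1 c.b0, sκ c.b1 c.b2 c.b0]
  linear_combination hcurl

end IsCartan

end Coframe

/-! ### Pullback and rotation of the structure equations -/

variable {V : Type*} [NormedAddCommGroup V] [NormedSpace ℝ V]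

/-- The pull-back to an open subset `Ω` of a vector space of the structure equations of a Sasakian
`3`-manifold for a horizontal orthonormal frame. -/
structure IsStructureSystem (Ω : Set V) (η θ₁ θ₂ w : V → V →L[ℝ] ℝ) (K : V → ℝ) : Prop where
  isOpen : IsOpen Ω
  cη : ∀ z ∈ Ω, ContDiffAt ℝ 2 η z
  cθ₁ : ∀ z ∈ Ω, ContDiffAt ℝ 2 θ₁ z
  cθ₂ : ∀ z ∈ Ω, ContDiffAt ℝ 2 θ₂ z
  cw : ∀ z ∈ Ω, ContDiffAt ℝ 1 w z
  dη : ∀ z ∈ Ω, ∀ u v, fderiv ℝ η z u v - fderiv ℝ η z v u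
    = 2 * (θ₁ z u * θ₂ z v - θ₁ z v * θ₂ z u)
  dθ₁ : ∀ z ∈ Ω, ∀ u v, fderiv ℝ θ₁ z u v - fderiv ℝ θ₁ z v u = w z u * θ₂ z v - w z v * θ₂ z u
  dθ₂ : ∀ z ∈ Ω, ∀ u v, fderiv ℝ θ₂ z u v - fderiv ℝ θ₂ z v u
    = -(w z u * θ₁ z v - w z v * θ₁ z u)
  dw : ∀ z ∈ Ω, ∀ u v, fderiv ℝ w z u v - fderiv ℝ w z v u
    = -4 * K z * (θ₁ z u * θ₂ z v - θ₁ z v * θ₂ z u)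

/-- The coframe obtained from `θ₁`, `θ₂` by the rotation which makes it adapted to the slices
spanned by `b1`, `b2`, with `η ∧ α` of sign `-σ` on the slices. -/
def adapted (η θ₁ θ₂ w : V → V →L[ℝ] ℝ) (b0 b1 b2 : V) (σ : ℝ) : Coframe V :=
  let p : V → ℝ := fun z => η z b1 * θ₁ z b2 - η z b2 * θ₁ z b1
  let q : V → ℝ := fun z => η z b1 * θ₂ z b2 - η z b2 * θ₂ z b1
  let c : V → ℝ := fun z => p z / (-σ * √(p z ^ 2 + q z ^ 2))
  let d : V → ℝ := fun z => q z / (-σ * √(p z ^ 2 + q z ^ 2))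
  { η := η
    α := fun z => c z • θ₁ z + d z • θ₂ z
    β := fun z => c z • θ₂ z - d z • θ₁ z
    ζ := fun z => (c z • fderiv ℝ d z - d z • fderiv ℝ c z) + w z
    b0 := b0
    b1 := b1
    b2 := b2 }

section Adapted

variable {Ω : Set V} {η θ₁ θ₂ w : V → V →L[ℝ] ℝ} {K : V → ℝ} {b1 b2 : V} {σ : ℝ}

lemma adapted_m (b0 : V) (hσ : σ ^ 2 = 1) {z : V}
    (hP : (η z b1 * θ₁ z b2 - η z b2 * θ₁ z b1) ^ 2
      + (η z b1 * θ₂ z b2 - η z b2 * θ₂ z b1) ^ 2 ≠ 0) :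
    (adapted η θ₁ θ₂ w b0 b1 b2 σ).m z = -σ * √((η z b1 * θ₁ z b2 - η z b2 * θ₁ z b1) ^ 2
      + (η z b1 * θ₂ z b2 - η z b2 * θ₂ z b1) ^ 2) := by
  simp only [adapted, Coframe.m, _root_.add_apply, _root_.smul_apply, smul_eq_mul]
  set p := η z b1 * θ₁ z b2 - η z b2 * θ₁ z b1 with hp
  set q := η z b1 * θ₂ z b2 - η z b2 * θ₂ z b1 with hq
  have h0 : 0 < p ^ 2 + q ^ 2 := lt_of_le_of_ne (by positivity) hP.symm
  set r := √(p ^ 2 + q ^ 2) with hr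
  have hr0 : 0 < r := Real.sqrt_pos.mpr h0
  have hr2 : r ^ 2 = p ^ 2 + q ^ 2 := Real.sq_sqrt h0.le
  have hσ0 : σ ≠ 0 := by rintro rfl; norm_num at hσ
  have e : -σ * r ≠ 0 := mul_ne_zero (neg_ne_zero.mpr hσ0) hr0.ne'
  field_simp
  linear_combination p * hp + q * hq + hr2 + r ^ 2 * hσ

/-- Rotating the frame preserves the structure equations. -/
lemma IsStructureSystem.isCartan (hs : IsStructureSystem Ω η θ₁ θ₂ w K) (b0 : V) (hσ : σ ^ 2 = 1)
    (hP : ∀ z ∈ Ω, (η z b1 * θ₁ z b2 - η z b2 * θ₁ z b1) ^ 2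
      + (η z b1 * θ₂ z b2 - η z b2 * θ₂ z b1) ^ 2 ≠ 0) :
    (adapted η θ₁ θ₂ w b0 b1 b2 σ).IsCartan Ω K := by
  have hσ0 : σ ≠ 0 := by rintro rfl; norm_num at hσ
  have hm0 : ∀ z ∈ Ω, (adapted η θ₁ θ₂ w b0 b1 b2 σ).m z ≠ 0 := by
    intro z hz
    rw [adapted_m b0 hσ (hP z hz)]
    have h0 := lt_of_le_of_ne (by positivity) (hP z hz).symm
    exact mul_ne_zero (neg_ne_zero.mpr hσ0) (Real.sqrt_pos.mpr h0).ne'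
  set p : V → ℝ := fun z => η z b1 * θ₁ z b2 - η z b2 * θ₁ z b1 with hp
  set q : V → ℝ := fun z => η z b1 * θ₂ z b2 - η z b2 * θ₂ z b1 with hq
  -- `c` and `d` are the cosine and the sine of the angle of rotation.
  set c : V → ℝ := fun z => p z / (-σ * √(p z ^ 2 + q z ^ 2)) with hc
  set d : V → ℝ := fun z => q z / (-σ * √(p z ^ 2 + q z ^ 2)) with hd
  have happ : ∀ {A : V → V →L[ℝ] ℝ} {z : V} (b : V), ContDiffAt ℝ 2 A z →
      ContDiffAt ℝ 2 (fun y => A y b) z := fun b h => h.clm_apply contDiffAt_const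
  have cp : ∀ z ∈ Ω, ContDiffAt ℝ 2 p z := fun z hz =>
    ((happ _ (hs.cη z hz)).mul (happ _ (hs.cθ₁ z hz))).sub
      ((happ _ (hs.cη z hz)).mul (happ _ (hs.cθ₁ z hz)))
  have cq : ∀ z ∈ Ω, ContDiffAt ℝ 2 q z := fun z hz =>
    ((happ _ (hs.cη z hz)).mul (happ _ (hs.cθ₂ z hz))).sub
      ((happ _ (hs.cη z hz)).mul (happ _ (hs.cθ₂ z hz)))
  have cr : ∀ z ∈ Ω, ContDiffAt ℝ 2 (fun z => -σ * √(p z ^ 2 + q z ^ 2)) z := fun z hz =>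
    contDiffAt_const.mul ((((cp z hz).pow 2).add ((cq z hz).pow 2)).sqrt (hP z hz))
  have r0 : ∀ z ∈ Ω, -σ * √(p z ^ 2 + q z ^ 2) ≠ 0 := by
    intro z hz
    have h0 := lt_of_le_of_ne (by positivity) (hP z hz).symm
    exact mul_ne_zero (neg_ne_zero.mpr hσ0) (Real.sqrt_pos.mpr h0).ne'
  have cc : ∀ z ∈ Ω, ContDiffAt ℝ 2 c z := fun z hz => (cp z hz).div (cr z hz) (r0 z hz)
  have cd : ∀ z ∈ Ω, ContDiffAt ℝ 2 d z := fun z hz => (cq z hz).div (cr z hz) (r0 z hz)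
  have hcd : ∀ z ∈ Ω, c z * c z + d z * d z = 1 := by
    intro z hz
    have h0 := lt_of_le_of_ne (by positivity) (hP z hz).symm
    have hr2 : √(p z ^ 2 + q z ^ 2) ^ 2 = p z ^ 2 + q z ^ 2 := Real.sq_sqrt h0.le
    have := r0 z hz
    simp only [hc, hd]
    rw [div_mul_div_comm, div_mul_div_comm, ← add_div, div_eq_one_iff_eq (mul_ne_zero this this)]
    linear_combination -hr2 - √(p z ^ 2 + q z ^ 2) ^ 2 * hσ
  have hdcd : ∀ z ∈ Ω, ∀ u, c z * fderiv ℝ c z u + d z * fderiv ℝ d z u = 0 := by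
    intro z hz u
    have dc := (cc z hz).differentiableAt (by simp)
    have dd := (cd z hz).differentiableAt (by simp)
    have h1 : (fun z => c z * c z + d z * d z) =ᶠ[𝓝 z] fun _ => 1 := by
      filter_upwards [hs.isOpen.mem_nhds hz] with y hy using hcd y hy
    have h2 : fderiv ℝ (fun z => c z * c z + d z * d z) z u = 0 := by
      rw [h1.fderiv_eq]; simp
    rw [Coframe.fderiv_add_apply (dc.fun_mul dc) (dd.fun_mul dd), Coframe.fderiv_mul_apply dc dc,
      Coframe.fderiv_mul_apply dd dd] at h2
    linarith
  have hα : ∀ {f g : V → ℝ} {A B : V → V →L[ℝ] ℝ} {z : V}, DifferentiableAt ℝ f z →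
      DifferentiableAt ℝ g z → DifferentiableAt ℝ A z → DifferentiableAt ℝ B z → ∀ u v,
      fderiv ℝ (fun z => f z • A z + g z • B z) z u v = f z * fderiv ℝ A z u v
        + fderiv ℝ f z u * A z v + (g z * fderiv ℝ B z u v + fderiv ℝ g z u * B z v) := by
    intro f g A B z df dg dA dB u v
    have h := (df.hasFDerivAt.smul dA.hasFDerivAt).add (dg.hasFDerivAt.smul dB.hasFDerivAt)
    have h2 : fderiv ℝ (fun z => f z • A z + g z • B z) z = _ := h.fderiv
    rw [h2]
    simp
  refine ⟨hs.isOpen, hs.cη, ?_, ?_, ?_, ?_, ?_, ?_, ?_, ?_, hm0⟩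
  · intro z hz
    exact ((cc z hz).smul (hs.cθ₁ z hz)).add ((cd z hz).smul (hs.cθ₂ z hz))
  · intro z hz
    exact ((cc z hz).smul (hs.cθ₂ z hz)).sub ((cd z hz).smul (hs.cθ₁ z hz))
  · intro z hz
    exact ((((cc z hz).of_le (by norm_num)).smul ((cd z hz).fderiv_right (by norm_num))).sub
      (((cd z hz).of_le (by norm_num)).smul ((cc z hz).fderiv_right (by norm_num)))).add (hs.cw z hz)
  · intro z hz u v
    change fderiv ℝ η z u v - fderiv ℝ η z v u
      = 2 * ((c z * θ₁ z u + d z * θ₂ z u) * (c z * θ₂ z v - d z * θ₁ z v)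
        - (c z * θ₁ z v + d z * θ₂ z v) * (c z * θ₂ z u - d z * θ₁ z u))
    rw [hs.dη z hz]
    linear_combination -2 * (θ₁ z u * θ₂ z v - θ₁ z v * θ₂ z u) * hcd z hz
  · intro z hz u v
    have dc := (cc z hz).differentiableAt (by simp)
    have dd := (cd z hz).differentiableAt (by simp)
    have d1 := (hs.cθ₁ z hz).differentiableAt (by simp)
    have d2 := (hs.cθ₂ z hz).differentiableAt (by simp)
    change fderiv ℝ (fun z => c z • θ₁ z + d z • θ₂ z) z u v
        - fderiv ℝ (fun z => c z • θ₁ z + d z • θ₂ z) z v u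
      = ((c z * fderiv ℝ d z u - d z * fderiv ℝ c z u) + w z u) * (c z * θ₂ z v - d z * θ₁ z v)
        - ((c z * fderiv ℝ d z v - d z * fderiv ℝ c z v) + w z v) * (c z * θ₂ z u - d z * θ₁ z u)
    rw [hα dc dd d1 d2, hα dc dd d1 d2]
    have e1 := hs.dθ₁ z hz u v
    have e2 := hs.dθ₂ z hz u v
    have k := hcd z hz
    have ku := hdcd z hz u
    have kv := hdcd z hz v
    linear_combination c z * e1 + d z * e2
      - (fderiv ℝ c z u * θ₁ z v - fderiv ℝ c z v * θ₁ z u + fderiv ℝ d z u * θ₂ z v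
          - fderiv ℝ d z v * θ₂ z u) * k
      + (c z * θ₁ z v + d z * θ₂ z v) * ku - (c z * θ₁ z u + d z * θ₂ z u) * kv
  · intro z hz u v
    have dc := (cc z hz).differentiableAt (by simp)
    have dd := (cd z hz).differentiableAt (by simp)
    have d1 := (hs.cθ₁ z hz).differentiableAt (by simp)
    have d2 := (hs.cθ₂ z hz).differentiableAt (by simp)
    have hβ : (adapted η θ₁ θ₂ w b0 b1 b2 σ).β = fun z => c z • θ₂ z + (-d z) • θ₁ z := by
      ext1 z
      change c z • θ₂ z - d z • θ₁ z = _
      ext1 u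
      simp [sub_eq_add_neg]
    rw [hβ]
    change _ = -(((c z * fderiv ℝ d z u - d z * fderiv ℝ c z u) + w z u)
        * (c z * θ₁ z v + d z * θ₂ z v)
        - ((c z * fderiv ℝ d z v - d z * fderiv ℝ c z v) + w z v) * (c z * θ₁ z u + d z * θ₂ z u))
    have hn : ∀ u, fderiv ℝ (fun z => -d z) z u = -fderiv ℝ d z u := fun u => by
      rw [fderiv_fun_neg]; rfl
    rw [hα dc dd.fun_neg d2 d1, hα dc dd.fun_neg d2 d1, hn, hn]
    have e1 := hs.dθ₁ z hz u v
    have e2 := hs.dθ₂ z hz u v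
    have k := hcd z hz
    have ku := hdcd z hz u
    have kv := hdcd z hz v
    linear_combination c z * e2 - d z * e1
      - (fderiv ℝ c z u * θ₂ z v - fderiv ℝ c z v * θ₂ z u - fderiv ℝ d z u * θ₁ z v
          + fderiv ℝ d z v * θ₁ z u) * k
      + (c z * θ₂ z v - d z * θ₁ z v) * ku - (c z * θ₂ z u - d z * θ₁ z u) * kv
  · intro z hz u v
    have dc := (cc z hz).differentiableAt (by simp)
    have dd := (cd z hz).differentiableAt (by simp)
    have d2c := ((cc z hz).fderiv_right (m := 1) (by norm_num)).differentiableAt (by simp)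
    have d2d := ((cd z hz).fderiv_right (m := 1) (by norm_num)).differentiableAt (by simp)
    have sc := ((cc z hz).isSymmSndFDerivAt (by simp)).eq u v
    have sd := ((cd z hz).isSymmSndFDerivAt (by simp)).eq u v
    have hζ : (adapted η θ₁ θ₂ w b0 b1 b2 σ).ζ
        = fun z => (c z • fderiv ℝ d z + (-d z) • fderiv ℝ c z) + w z := by
      ext1 z
      change (c z • fderiv ℝ d z - d z • fderiv ℝ c z) + w z = _
      ext1 u
      simp [sub_eq_add_neg]
    have hadd : ∀ u v, fderiv ℝ (fun z => (c z • fderiv ℝ d z + (-d z) • fderiv ℝ c z) + w z) z u v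
        = fderiv ℝ (fun z => c z • fderiv ℝ d z + (-d z) • fderiv ℝ c z) z u v
          + fderiv ℝ w z u v := fun u v => by
      rw [fderiv_fun_add ((dc.fun_smul d2d).fun_add (dd.fun_neg.fun_smul d2c))
        ((hs.cw z hz).differentiableAt (by simp))]
      rfl
    have hn : ∀ u, fderiv ℝ (fun z => -d z) z u = -fderiv ℝ d z u := fun u => by
      rw [fderiv_fun_neg]; rfl
    rw [hζ, hadd, hadd, hα dc dd.fun_neg d2d d2c, hα dc dd.fun_neg d2d d2c, hn, hn]
    change _ = -4 * K z * ((c z * θ₁ z u + d z * θ₂ z u) * (c z * θ₂ z v - d z * θ₁ z v)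
        - (c z * θ₁ z v + d z * θ₂ z v) * (c z * θ₂ z u - d z * θ₁ z u))
    have e := hs.dw z hz u v
    have k := hcd z hz
    have ku := hdcd z hz u
    have kv := hdcd z hz v
    -- `dc ∧ dd` vanishes since `c dc + d dd = 0`
    have kk : fderiv ℝ c z u * fderiv ℝ d z v - fderiv ℝ c z v * fderiv ℝ d z u = 0 := by
      linear_combination -(fderiv ℝ c z u * fderiv ℝ d z v - fderiv ℝ c z v * fderiv ℝ d z u) * k
        + (c z * fderiv ℝ d z v - d z * fderiv ℝ c z v) * ku
        - (c z * fderiv ℝ d z u - d z * fderiv ℝ c z u) * kv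
    linear_combination e + c z * sd - d z * sc + 2 * kk
      + 4 * K z * (θ₁ z u * θ₂ z v - θ₁ z v * θ₂ z u) * k
  · intro z hz
    change η z b1 * (c z * θ₂ z b2 - d z * θ₁ z b2) = η z b2 * (c z * θ₂ z b1 - d z * θ₁ z b1)
    have : c z * q z - d z * p z = 0 := by simp only [hc, hd]; ring
    simp only [hp, hq] at this
    linear_combination this

end Adapted

section PullBack

variable {M : Type*} [TopologicalSpace M] [ChartedSpace E3 M] [IsManifold (𝓡 3) ∞ M]
  {X : SasakianStructure M} {O : Set M} {A B : ∀ q : M, TangentSpace (𝓡 3) q}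

/-- The structure equations pulled back by a map of class `C³`. -/
lemma IsHorFrame.isStructureSystem (hf : IsHorFrame X O A B) {k : V → M} {Ω : Set V}
    (hΩ : IsOpen Ω) (hk : ∀ z ∈ Ω, ContMDiffAt 𝓘(ℝ, V) (𝓡 3) 3 k z) (hO : ∀ z ∈ Ω, k z ∈ O) :
    IsStructureSystem Ω (pullForm X.η k) (pullForm (flat X.g A) k) (pullForm (flat X.g B) k)
      (pullForm (websterForm X A B) k) (fun z => X.webster (k z)) := by
  have hT : ∀ z, ContDiffAt ℝ 3 (formInChart X.η (k z)) (extChartAt (𝓡 3) (k z) (k z)) :=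
    fun z => contDiffAt_flatT (mem_extChartAt_target (k z))
  have hA : ∀ z ∈ Ω, ContDiffAt ℝ 3 (formInChart (flat X.g A) (k z))
      (extChartAt (𝓡 3) (k z) (k z)) := fun z hz =>
    hf.contDiffAt_flatA (mem_extChartAt_target (k z)) (symm_center_mem (hO z hz))
  have hB : ∀ z ∈ Ω, ContDiffAt ℝ 3 (formInChart (flat X.g B) (k z))
      (extChartAt (𝓡 3) (k z) (k z)) := fun z hz =>
    hf.contDiffAt_flatB (mem_extChartAt_target (k z)) (symm_center_mem (hO z hz))
  have hw : ∀ z ∈ Ω, ContDiffAt ℝ 1 (formInChart (websterForm X A B) (k z))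
      (extChartAt (𝓡 3) (k z) (k z)) := fun z hz =>
    hf.contDiffAt_websterForm (mem_extChartAt_target (k z)) (symm_center_mem (hO z hz))
  have hk2 : ∀ z ∈ Ω, ContMDiffAt 𝓘(ℝ, V) (𝓡 3) 2 k z := fun z hz =>
    (hk z hz).of_le (by norm_num)
  have h21 : (2 : WithTop ℕ∞) + 1 = 3 := by norm_num
  have h11 : (1 : WithTop ℕ∞) + 1 = 2 := by norm_num
  refine ⟨hΩ, ?_, ?_, ?_, ?_, ?_, ?_, ?_, ?_⟩
  · exact fun z hz => contDiffAt_pullForm (n := 2) (by norm_cast) (h21 ▸ hk z hz)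
      (mem_extChartAt_source (k z)) ((hT z).of_le (by norm_num))
  · exact fun z hz => contDiffAt_pullForm (n := 2) (by norm_cast) (h21 ▸ hk z hz)
      (mem_extChartAt_source (k z)) ((hA z hz).of_le (by norm_num))
  · exact fun z hz => contDiffAt_pullForm (n := 2) (by norm_cast) (h21 ▸ hk z hz)
      (mem_extChartAt_source (k z)) ((hB z hz).of_le (by norm_num))
  · exact fun z hz => contDiffAt_pullForm (n := 1) (by norm_cast) (h11 ▸ hk2 z hz)
      (mem_extChartAt_source (k z)) (hw z hz)
  · intro z hz u v
    rw [fderiv_pullForm_antisymm (hk2 z hz) ((hT z).differentiableAt (by simp))]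
    refine congrArg (2 * ·) ((hf.dη_eq (hO z hz) _ _).trans ?_)
    change _ = X.g.inner (k z) (A (k z)) (dMap k z u) * X.g.inner (k z) (B (k z)) (dMap k z v)
      - X.g.inner (k z) (A (k z)) (dMap k z v) * X.g.inner (k z) (B (k z)) (dMap k z u)
    ring
  · intro z hz u v
    rw [fderiv_pullForm_antisymm (hk2 z hz) ((hA z hz).differentiableAt (by simp))]
    exact hf.extD_flatA (hO z hz) _ _
  · intro z hz u v
    rw [fderiv_pullForm_antisymm (hk2 z hz) ((hB z hz).differentiableAt (by simp))]
    exact hf.extD_flatB (hO z hz) _ _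
  · intro z hz u v
    rw [fderiv_pullForm_antisymm (hk2 z hz) ((hw z hz).differentiableAt (by simp))]
    exact hf.extD_websterForm (hO z hz) _ _

end PullBack

/-! ### The area element in charts -/

section PlaneAlgebra

lemma e2_expand (v : E2) : v = v 0 • e₁ + v 1 • e₂ := by
  ext i
  fin_cases i <;> simp [e₁, e₂]

lemma det_eq_apply (L : E2 →L[ℝ] E2) : L.det = L e₁ 0 * L e₂ 1 - L e₁ 1 * L e₂ 0 := by
  rw [ContinuousLinearMap.det, ← LinearMap.det_toMatrix (EuclideanSpace.basisFun (Fin 2) ℝ).toBasis,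
    Matrix.det_fin_two]
  simp only [LinearMap.toMatrix_apply, OrthonormalBasis.coe_toBasis, EuclideanSpace.basisFun_apply,
    OrthonormalBasis.coe_toBasis_repr_apply, EuclideanSpace.basisFun_repr]
  simp only [e₁, e₂, ContinuousLinearMap.coe_coe]
  ring

/-- Alternating bilinear maps on the plane scale with the determinant. -/
lemma alternating_apply {G : Type*} [AddCommGroup G] [Module ℝ G] (W : E2 → E2 → G)
    (h1 : ∀ (a b : ℝ) (u v w : E2), W (a • u + b • v) w = a • W u w + b • W v w)
    (h2 : ∀ u v, W u v = - W v u) (L : E2 →L[ℝ] E2) :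
    W (L e₁) (L e₂) = L.det • W e₁ e₂ := by
  have h0 : ∀ u, W u u = 0 := by
    intro u
    have h : (2 : ℝ) • W u u = 0 := by
      rw [two_smul]; nth_rewrite 1 [h2 u u]; simp
    simpa using h
  have h3 : ∀ (a b : ℝ) (u v w : E2), W w (a • u + b • v) = a • W w u + b • W w v := by
    intro a b u v w
    rw [h2, h1, h2 u, h2 v]; simp; abel
  conv_lhs => rw [e2_expand (L e₁), e2_expand (L e₂)]
  rw [h1, h3, h3, h0, h0, h2 e₂ e₁, det_eq_apply]
  module

end PlaneAlgebra

section AreaDensity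

variable {M : Type*} [TopologicalSpace M] [ChartedSpace E3 M] [IsManifold (𝓡 3) ∞ M]
  (g : Metric E3 M)

/-- The Gram determinant of two tangent vectors. -/
def gram (q : M) (a b : TangentSpace (𝓡 3) q) : ℝ :=
  g.inner q a a * g.inner q b b - g.inner q a b ^ 2

lemma gram_comp (q : M) (A : E2 →L[ℝ] TangentSpace (𝓡 3) q) (L : E2 →L[ℝ] E2) :
    gram g q (A (L e₁)) (A (L e₂)) = L.det ^ 2 * gram g q (A e₁) (A e₂) := by
  conv_lhs => rw [e2_expand (L e₁), e2_expand (L e₂)]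
  rw [det_eq_apply]
  simp only [gram, map_add, map_smul, _root_.add_apply, _root_.smul_apply, smul_eq_mul,
    g.symm q (A e₂) (A e₁)]
  ring

/-- The Gram determinant of two independent vectors is positive: the strict Cauchy–Schwarz
inequality. -/
lemma gram_pos {q : M} {a b : TangentSpace (𝓡 3) q}
    (h : ∀ x y : ℝ, x • a + y • b = 0 → x = 0 ∧ y = 0) : 0 < gram g q a b := by
  have hb : b ≠ 0 := by
    rintro rfl
    have := (h 0 1 (by simp)).2
    norm_num at this
  have hbb := g.pos q b hb
  set u := g.inner q b b • a - g.inner q a b • b with hu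
  have hu0 : u ≠ 0 := by
    intro h0
    have := (h (g.inner q b b) (-(g.inner q a b)) (by rw [← h0, hu, neg_smul, sub_eq_add_neg])).1
    exact hbb.ne' this
  have hp := g.pos q u hu0
  have e : g.inner q u u = g.inner q b b * gram g q a b := by
    simp only [hu, gram, map_sub, map_smul, _root_.sub_apply, _root_.smul_apply, smul_eq_mul,
      g.symm q b a]
    ring
  rw [e] at hp
  exact pos_of_mul_pos_right hp hbb.le

lemma gram_pos_of_injective {q : M} {A : E2 →L[ℝ] TangentSpace (𝓡 3) q}
    (h : Function.Injective A) : 0 < gram g q (A e₁) (A e₂) := by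
  apply gram_pos
  intro x y hxy
  have h0 : A (x • e₁ + y • e₂) = A 0 := by rw [map_add, map_smul, map_smul, hxy, map_zero]
  have h1 := h h0
  have h2 := congrArg (fun v : E2 => v 0) h1
  have h3 := congrArg (fun v : E2 => v 1) h1
  simp [e₁, e₂] at h2 h3
  exact ⟨h2, h3⟩

lemma areaDensity_nonneg (k : E2 → M) (y : E2) : 0 ≤ areaDensity g k y := Real.sqrt_nonneg _

lemma areaDensity_congr {k k' : E2 → M} {y : E2} (h : k =ᶠ[𝓝 y] k') :
    areaDensity g k y = areaDensity g k' y := by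
  have h1 : (dMap k y : E2 →L[ℝ] E3) = dMap k' y := h.mfderiv_eq
  have h2 : ∀ q, q = k' y → ∀ a b : E3, gram g q a b = gram g (k' y) a b := by
    rintro _ rfl a b; rfl
  have h3 : ∀ j : E2 → M, areaDensity g j y
      = √(gram g (j y) ((dMap j y : E2 →L[ℝ] E3) e₁) ((dMap j y : E2 →L[ℝ] E3) e₂)) := fun j => rfl
  rw [h3, h3, h1]
  exact congrArg Real.sqrt (h2 _ h.self_of_nhds _ _)

lemma areaDensity_comp {k : E2 → M} {τ : E2 → E2} {y : E2}
    (hk : MDifferentiableAt (𝓡 2) (𝓡 3) k (τ y)) (hτ : DifferentiableAt ℝ τ y) :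
    areaDensity g (k ∘ τ) y = |(fderiv ℝ τ y).det| * areaDensity g k (τ y) := by
  have h1 : (dMap (k ∘ τ) y : E2 →L[ℝ] E3) = (dMap k (τ y) : E2 →L[ℝ] E3).comp (fderiv ℝ τ y) :=
    dMap_comp hk hτ
  have h2 : areaDensity g (k ∘ τ) y = √(gram g (k (τ y))
      ((dMap (k ∘ τ) y : E2 →L[ℝ] E3) e₁) ((dMap (k ∘ τ) y : E2 →L[ℝ] E3) e₂)) := rfl
  rw [h2, h1]
  have h3 := gram_comp g (k (τ y)) (dMap k (τ y)) (fderiv ℝ τ y)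
  refine (congrArg Real.sqrt h3).trans ?_
  rw [Real.sqrt_mul (sq_nonneg _), Real.sqrt_sq_eq_abs]
  rfl

end AreaDensity

section ChartMeasure

variable {M : Type*} [TopologicalSpace M] [ChartedSpace E3 M] [IsManifold (𝓡 3) ∞ M]
  (g : Metric E3 M) {S : Type*} [TopologicalSpace S] [ChartedSpace E2 S]

section

variable [IsManifold (𝓡 2) 2 S]

lemma contMDiffAt_chart_symm {e : OpenPartialHomeomorph S E2} (he : e ∈ atlas E2 S) {y : E2}
    (hy : y ∈ e.target) : ContMDiffAt (𝓡 2) (𝓡 2) 2 e.symm y :=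
  (contMDiffOn_symm_of_mem_maximalAtlas (IsManifold.subset_maximalAtlas he)).contMDiffAt
    (e.open_target.mem_nhds hy)

lemma contMDiffAt_chart {e : OpenPartialHomeomorph S E2} (he : e ∈ atlas E2 S) {p : S}
    (hp : p ∈ e.source) : ContMDiffAt (𝓡 2) (𝓡 2) 2 e p :=
  (contMDiffOn_of_mem_maximalAtlas (IsManifold.subset_maximalAtlas he)).contMDiffAt
    (e.open_source.mem_nhds hp)

lemma contDiffAt_transition {e e' : OpenPartialHomeomorph S E2} (he : e ∈ atlas E2 S)
    (he' : e' ∈ atlas E2 S) {y : E2} (hy : y ∈ e.target) (hy' : e.symm y ∈ e'.source) :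
    ContDiffAt ℝ 2 (e' ∘ e.symm) y :=
  ((contMDiffAt_chart he' hy').comp y (contMDiffAt_chart_symm he hy)).contDiffAt

lemma areaDensity_transition {h : S → M} (hh : MDifferentiable (𝓡 2) (𝓡 3) h)
    {e e' : OpenPartialHomeomorph S E2} (he : e ∈ atlas E2 S)
    (he' : e' ∈ atlas E2 S) {y : E2} (hy : y ∈ e.target) (hy' : e.symm y ∈ e'.source) :
    areaDensity g (h ∘ e.symm) y = |(fderiv ℝ (e' ∘ e.symm) y).det|
      * areaDensity g (h ∘ e'.symm) (e' (e.symm y)) := by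
  have hyt : e' (e.symm y) ∈ e'.target := e'.map_source hy'
  refine Eq.trans ?_ (areaDensity_comp g (τ := e' ∘ e.symm) (k := h ∘ e'.symm) ?_ ?_)
  · apply areaDensity_congr
    have h1 : e.symm ⁻¹' e'.source ∈ 𝓝 y :=
      (e.continuousAt_symm hy).preimage_mem_nhds (e'.open_source.mem_nhds hy')
    filter_upwards [h1] with z hz
    simp [e'.left_inv hz]
  · exact (hh _).comp _ ((contMDiffAt_chart_symm he' hyt).mdifferentiableAt (by simp))
  · exact (contDiffAt_transition he he' hy hy').differentiableAt (by simp)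

end

variable [MeasurableSpace S] [BorelSpace S]

/-- The Riemannian area of the domain of a chart. -/
def chartMeasure (h : S → M) (e : OpenPartialHomeomorph S E2) : Measure S :=
  Measure.map e.symm ((volume.restrict e.target).withDensity
    (fun y => ENNReal.ofReal (areaDensity g (h ∘ e.symm) y)))

omit [ChartedSpace E2 S] in
lemma measurableSet_chart_preimage (e : OpenPartialHomeomorph S E2) {A : Set S}
    (hA : MeasurableSet A) : MeasurableSet (e.target ∩ e.symm ⁻¹' A) := by
  have h := e.open_target.measurableSet.subtype_image
    (e.continuousOn_symm.domRestrict.measurable hA)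
  convert h using 1
  ext y
  simp [and_comm]

omit [ChartedSpace E2 S] in
lemma aemeasurable_chart_symm (h : S → M) (e : OpenPartialHomeomorph S E2) :
    AEMeasurable e.symm ((volume.restrict e.target).withDensity
      (fun y => ENNReal.ofReal (areaDensity g (h ∘ e.symm) y))) :=
  (e.continuousOn_symm.aemeasurable e.open_target.measurableSet).mono_ac
    (withDensity_absolutelyContinuous _ _)

lemma chartMeasure_apply (h : S → M) (e : OpenPartialHomeomorph S E2) {A : Set S}
    (hA : MeasurableSet A) : chartMeasure g h e A
      = ∫⁻ y in e.target ∩ e.symm ⁻¹' A, ENNReal.ofReal (areaDensity g (h ∘ e.symm) y) := by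
  rw [chartMeasure, Measure.map_apply_of_aemeasurable (aemeasurable_chart_symm g h e) hA]
  have hm := measurableSet_chart_preimage e hA
  have h1 : e.symm ⁻¹' A =ᵐ[(volume.restrict e.target).withDensity
      (fun y => ENNReal.ofReal (areaDensity g (h ∘ e.symm) y))]
      (e.target ∩ e.symm ⁻¹' A : Set E2) := by
    refine (withDensity_absolutelyContinuous _ _).ae_le ?_
    filter_upwards [ae_restrict_mem e.open_target.measurableSet] with y hy
    exact propext ⟨fun h => ⟨hy, h⟩, fun h => h.2⟩
  rw [measure_congr h1, withDensity_apply _ hm, Measure.restrict_restrict hm,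
    inter_eq_left.mpr inter_subset_left]

lemma chartMeasure_eq [IsManifold (𝓡 2) 2 S] {h : S → M} (hh : MDifferentiable (𝓡 2) (𝓡 3) h)
    {e e' : OpenPartialHomeomorph S E2} (he : e ∈ atlas E2 S)
    (he' : e' ∈ atlas E2 S) {A : Set S} (hA : MeasurableSet A) (h1 : A ⊆ e.source)
    (h2 : A ⊆ e'.source) : chartMeasure g h e A = chartMeasure g h e' A := by
  rw [chartMeasure_apply g h e hA, chartMeasure_apply g h e' hA]
  have himg : (e' ∘ e.symm) '' (e.target ∩ e.symm ⁻¹' A) = e'.target ∩ e'.symm ⁻¹' A := by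
    ext z
    constructor
    · rintro ⟨y, ⟨hy, hyA⟩, rfl⟩
      have h3 : e.symm y ∈ e'.source := h2 hyA
      refine ⟨e'.map_source h3, ?_⟩
      simpa [e'.left_inv h3] using hyA
    · rintro ⟨hz, hzA⟩
      have h3 : e'.symm z ∈ e.source := h1 hzA
      refine ⟨e (e'.symm z), ⟨e.map_source h3, ?_⟩, ?_⟩
      · simpa [e.left_inv h3] using hzA
      · simp [e.left_inv h3, e'.right_inv hz]
  rw [← himg, lintegral_image_eq_lintegral_abs_det_fderiv_mul volume
    (f' := fun y => fderiv ℝ (e' ∘ e.symm) y) (measurableSet_chart_preimage e hA)]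
  · refine setLIntegral_congr_fun (measurableSet_chart_preimage e hA) ?_
    intro y hy
    have := areaDensity_transition g hh he he' hy.1 (h2 hy.2)
    simp only [this, ENNReal.ofReal_mul (abs_nonneg _)]
    rfl
  · intro y hy
    exact ((contDiffAt_transition he he' hy.1 (h2 hy.2)).differentiableAt
      (by simp)).hasFDerivAt.hasFDerivWithinAt
  · intro y hy z hz hyz
    have h3 : e.symm y ∈ e'.source := h2 hy.2
    have h4 : e.symm z ∈ e'.source := h2 hz.2
    exact e.symm.injOn hy.1 hz.1 (e'.injOn h3 h4 hyz)

lemma chartMeasure_inter_source (h : S → M) (e : OpenPartialHomeomorph S E2) {A : Set S}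
    (hA : MeasurableSet A) : chartMeasure g h e A = chartMeasure g h e (A ∩ e.source) := by
  rw [chartMeasure_apply g h e hA, chartMeasure_apply g h e (hA.inter e.open_source.measurableSet)]
  congr 2
  ext y
  simp only [mem_inter_iff, mem_preimage]
  exact ⟨fun hy => ⟨hy.1, hy.2, e.map_target hy.1⟩, fun hy => ⟨hy.1, hy.2.1⟩⟩

/-- The area element over the domain of a chart. -/
lemma areaMeasure_restrict_source [IsManifold (𝓡 2) 2 S] {h : S → M}
    (hh : MDifferentiable (𝓡 2) (𝓡 3) h)
    {e : OpenPartialHomeomorph S E2} (he : e ∈ atlas E2 S) :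
    (areaMeasure g h).restrict e.source = chartMeasure g h e := by
  have hle : ∀ e' ∈ atlas E2 S, chartMeasure g h e' ≤ areaMeasure g h := fun e' he' =>
    le_iSup₂_of_le e' he' le_rfl
  have hes := e.open_source.measurableSet
  have hge : areaMeasure g h ≤ (areaMeasure g h).restrict e.sourceᶜ + chartMeasure g h e := by
    refine iSup₂_le fun e' he' => ?_
    refine Measure.le_iff.mpr fun A hA => ?_
    change chartMeasure g h e' A ≤ _
    rw [← measure_inter_add_sdiff A hes, add_comm, Measure.add_apply, Measure.restrict_apply hA,
      ← sdiff_eq]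
    refine add_le_add (hle e' he' _) ?_
    rw [chartMeasure_inter_source g h e' (hA.inter hes)]
    rw [chartMeasure_eq g hh he' he ((hA.inter hes).inter e'.open_source.measurableSet)
      inter_subset_right (inter_subset_left.trans inter_subset_right)]
    exact measure_mono (inter_subset_left.trans inter_subset_left)
  ext A hA
  rw [Measure.restrict_apply hA, chartMeasure_inter_source g h e hA]
  refine le_antisymm ?_ (hle e he _)
  refine (hge _).trans ?_
  rw [Measure.add_apply, Measure.restrict_apply (hA.inter hes)]
  have : A ∩ e.source ∩ e.sourceᶜ = ∅ := by
    rw [inter_assoc, inter_compl_self, inter_empty]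
  rw [this, measure_empty, zero_add]

end ChartMeasure

/-! ### Continuity and finiteness of the area element -/

section ChartIntegral

variable {M : Type*} [TopologicalSpace M] [ChartedSpace E3 M] [IsManifold (𝓡 3) ∞ M]
  (X : SasakianStructure M)

lemma contDiffAt_pullForm_frame {P : Type*} [NormedAddCommGroup P] [NormedSpace ℝ P]
    {n : WithTop ℕ∞} (hn : n ≤ 3) {k : P → M} {z : P}
    (hk : ContMDiffAt 𝓘(ℝ, P) (𝓡 3) (n + 1) k z) {O : Set M}
    {A B : ∀ q : M, TangentSpace (𝓡 3) q} (hf : IsHorFrame X O A B) (hO : k z ∈ O) :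
    ContDiffAt ℝ n (pullForm (flat X.g A) k) z ∧ ContDiffAt ℝ n (pullForm (flat X.g B) k) z ∧
      ContDiffAt ℝ n (pullForm X.η k) z := by
  have hp := mem_extChartAt_source (I := 𝓡 3) (k z)
  have hz := mem_extChartAt_target (I := 𝓡 3) (k z)
  have hn1 : n + 1 ≤ ∞ := (add_le_add_left hn 1).trans (by norm_cast)
  exact ⟨contDiffAt_pullForm hn1 hk hp ((hf.contDiffAt_flatA hz (IsHorFrame.symm_center_mem hO)).of_le hn),
    contDiffAt_pullForm hn1 hk hp ((hf.contDiffAt_flatB hz (IsHorFrame.symm_center_mem hO)).of_le hn),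
    contDiffAt_pullForm hn1 hk hp ((IsHorFrame.contDiffAt_flatT hz).of_le hn)⟩

lemma continuousAt_inner_dMap {P : Type*} [NormedAddCommGroup P] [NormedSpace ℝ P]
    {k : P → M} {z : P} (hk : ContMDiffAt 𝓘(ℝ, P) (𝓡 3) 1 k z) (u v : P) :
    ContinuousAt (fun y => X.g.inner (k y) (dMap k y u) (dMap k y v)) z := by
  obtain ⟨O, A, B, hO, hf⟩ := exists_isHorFrame X (k z)
  obtain ⟨h1, h2, h3⟩ := contDiffAt_pullForm_frame X (n := 0) (by simp) (by simpa using hk) hf hO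
  have h4 : ∀ {β : P → P →L[ℝ] ℝ}, ContDiffAt ℝ 0 β z →
      ContinuousAt (fun y => β y u * β y v) z := fun h =>
    (h.continuousAt.clm_apply continuousAt_const).mul (h.continuousAt.clm_apply continuousAt_const)
  refine (((h4 h1).add (h4 h2)).add (h4 h3)).congr ?_
  filter_upwards [hk.continuousAt.eventually (hf.isOpen.mem_nhds hO)] with y hy
  exact (hf.inner_eq hy _ _).symm

lemma continuousAt_areaDensity {k : E2 → M} {z : E2} (hk : ContMDiffAt (𝓡 2) (𝓡 3) 1 k z) :
    ContinuousAt (areaDensity X.g k) z := by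
  have h := fun u v => continuousAt_inner_dMap X hk u v
  exact (((h e₁ e₁).mul (h e₂ e₂)).sub ((h e₁ e₂).pow 2)).sqrt

lemma areaDensity_pos {k : E2 → M} {z : E2} (hk : Function.Injective (dMap (E := E3) k z)) :
    0 < areaDensity X.g k z := Real.sqrt_pos.mpr (gram_pos_of_injective X.g hk)

variable {S : Type*} [TopologicalSpace S] [ChartedSpace E2 S] [IsManifold (𝓡 2) 2 S]

/-- The coordinate expression of a map of class at most `C²`, the order of smoothness of the
transition maps. -/
lemma contMDiffAt_comp_chart_symm {h : S → M} {n : WithTop ℕ∞} (hn : n ≤ 2)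
    {e : OpenPartialHomeomorph S E2} (he : e ∈ atlas E2 S) {y : E2} (hy : y ∈ e.target)
    (hh : ContMDiffAt (𝓡 2) (𝓡 3) n h (e.symm y)) :
    ContMDiffAt (𝓡 2) (𝓡 3) n (h ∘ e.symm) y :=
  hh.comp y ((contMDiffAt_chart_symm he hy).of_le hn)

lemma mfderiv_chart_symm_injective {e : OpenPartialHomeomorph S E2} (he : e ∈ atlas E2 S) {y : E2}
    (hy : y ∈ e.target) : Function.Injective (mfderiv (𝓡 2) (𝓡 2) e.symm y) := by
  have h1 := (contMDiffAt_chart_symm he hy).mdifferentiableAt (by simp)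
  have h2 := (contMDiffAt_chart he (e.map_target hy)).mdifferentiableAt (by simp)
  have h3 := mfderiv_comp y h2 h1
  have h4 : (e ∘ e.symm) =ᶠ[𝓝 y] id := by
    filter_upwards [e.open_target.mem_nhds hy] with z hz using e.right_inv hz
  have h5 : mfderiv (𝓡 2) (𝓡 2) (e ∘ e.symm) y = ContinuousLinearMap.id ℝ E2 :=
    h4.mfderiv_eq.trans mfderiv_id
  intro a b hab
  have h6 : ∀ v : E2, mfderiv (𝓡 2) (𝓡 2) (e ∘ e.symm) y v
    = mfderiv (𝓡 2) (𝓡 2) e (e.symm y) (mfderiv (𝓡 2) (𝓡 2) e.symm y v) := fun v => by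
    rw [h3]; rfl
  have h7 := (h6 a).trans ((congrArg _ hab).trans (h6 b).symm)
  have h8 : ∀ v : E2, (mfderiv (𝓡 2) (𝓡 2) (e ∘ e.symm) y v : E2) = v := fun v =>
    DFunLike.congr_fun h5 v
  exact (h8 a).symm.trans (h7.trans (h8 b))

lemma dMap_comp_chart_symm {h : S → M} {e : OpenPartialHomeomorph S E2} (he : e ∈ atlas E2 S)
    {y : E2} (hy : y ∈ e.target) (hh : MDifferentiableAt (𝓡 2) (𝓡 3) h (e.symm y)) (v : E2) :
    dMap (h ∘ e.symm) y v
      = mfderiv (𝓡 2) (𝓡 3) h (e.symm y) (mfderiv (𝓡 2) (𝓡 2) e.symm y v) := by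
  have := mfderiv_comp y hh ((contMDiffAt_chart_symm he hy).mdifferentiableAt (by simp))
  exact DFunLike.congr_fun this v

lemma dMap_comp_chart_symm_injective {h : S → M} {e : OpenPartialHomeomorph S E2}
    (he : e ∈ atlas E2 S)
    {y : E2} (hy : y ∈ e.target) (hh : MDifferentiableAt (𝓡 2) (𝓡 3) h (e.symm y))
    (hi : Function.Injective (mfderiv (𝓡 2) (𝓡 3) h (e.symm y))) :
    Function.Injective (dMap (E := E3) (h ∘ e.symm) y) := by
  intro a b hab
  rw [dMap_comp_chart_symm he hy hh, dMap_comp_chart_symm he hy hh] at hab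
  exact mfderiv_chart_symm_injective he hy (hi hab)

variable [MeasurableSpace S] [BorelSpace S]

section

variable {h : S → M} (hh : ContMDiff (𝓡 2) (𝓡 3) 1 h)
include hh

lemma continuousOn_areaDensity {e : OpenPartialHomeomorph S E2} (he : e ∈ atlas E2 S) :
    ContinuousOn (areaDensity X.g (h ∘ e.symm)) e.target := fun _ hy =>
  (continuousAt_areaDensity X
    (contMDiffAt_comp_chart_symm (by norm_num) he hy hh.contMDiffAt)).continuousWithinAt

lemma setIntegral_chart {e : OpenPartialHomeomorph S E2} (he : e ∈ atlas E2 S) {G : S → ℝ}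
    (hG : AEStronglyMeasurable G ((areaMeasure X.g h).restrict e.source)) :
    ∫ p in e.source, G p ∂(areaMeasure X.g h)
      = ∫ y in e.target, areaDensity X.g (h ∘ e.symm) y * G (e.symm y) := by
  have hhd : MDifferentiable (𝓡 2) (𝓡 3) h := hh.mdifferentiable (by simp)
  rw [areaMeasure_restrict_source X.g hhd he, chartMeasure] at hG ⊢
  rw [integral_map (aemeasurable_chart_symm X.g h e) hG,
    integral_withDensity_eq_integral_toReal_smul₀]
  · refine integral_congr_ae (ae_of_all _ fun y => ?_)
    simp only [ENNReal.toReal_ofReal (areaDensity_nonneg X.g _ y), smul_eq_mul]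
  · exact ((continuousOn_areaDensity X hh he).aemeasurable
      e.open_target.measurableSet).ennreal_ofReal
  · exact ae_of_all _ fun y => ENNReal.ofReal_lt_top

lemma isLocallyFiniteMeasure_areaMeasure : IsLocallyFiniteMeasure (areaMeasure X.g h) := by
  have hhd : MDifferentiable (𝓡 2) (𝓡 3) h := hh.mdifferentiable (by simp)
  refine ⟨fun p => ?_⟩
  let e := chartAt E2 p
  have he : e ∈ atlas E2 S := chart_mem_atlas E2 p
  have hp : p ∈ e.source := mem_chart_source E2 p
  have hc : ContinuousAt (areaDensity X.g (h ∘ e.symm)) (e p) :=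
    (continuousOn_areaDensity X hh he).continuousAt (e.open_target.mem_nhds (e.map_source hp))
  have h1 : ∀ᶠ y in 𝓝 (e p), areaDensity X.g (h ∘ e.symm) y
      < areaDensity X.g (h ∘ e.symm) (e p) + 1 := hc.eventually (gt_mem_nhds (by linarith))
  obtain ⟨r, hr, hball⟩ := Metric.eventually_nhds_iff_ball.mp h1
  have hopen : IsOpen (e.source ∩ e ⁻¹' Metric.ball (e p) r) :=
    e.isOpen_inter_preimage Metric.isOpen_ball
  refine ⟨e.source ∩ e ⁻¹' Metric.ball (e p) r, hopen.mem_nhds ⟨hp, Metric.mem_ball_self hr⟩, ?_⟩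
  rw [← Measure.restrict_eq_self _ (inter_subset_left : _ ⊆ e.source),
    areaMeasure_restrict_source X.g hhd he, chartMeasure_apply X.g h e hopen.measurableSet]
  have hsub : e.target ∩ e.symm ⁻¹' (e.source ∩ e ⁻¹' Metric.ball (e p) r)
      ⊆ Metric.ball (e p) r := by
    rintro y ⟨hy, -, hy2⟩
    simpa [e.right_inv hy] using hy2
  refine (lintegral_mono_set hsub).trans_lt ?_
  refine (setLIntegral_mono' (g := fun _ =>
    ENNReal.ofReal (areaDensity X.g (h ∘ e.symm) (e p) + 1)) measurableSet_ball
    fun y hy => ENNReal.ofReal_le_ofReal (hball y hy).le).trans_lt ?_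
  rw [setLIntegral_const]
  exact ENNReal.mul_lt_top ENNReal.ofReal_lt_top measure_ball_lt_top

lemma isOpenPosMeasure_areaMeasure
    (hi : ∀ p, Function.Injective (mfderiv (𝓡 2) (𝓡 3) h p)) :
    (areaMeasure X.g h).IsOpenPosMeasure := by
  have hhd : MDifferentiable (𝓡 2) (𝓡 3) h := hh.mdifferentiable (by simp)
  refine ⟨fun W hW ⟨p, hp⟩ => ?_⟩
  let e := chartAt E2 p
  have he : e ∈ atlas E2 S := chart_mem_atlas E2 p
  have hps : p ∈ e.source := mem_chart_source E2 p
  intro h0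
  have h1 : areaMeasure X.g h (W ∩ e.source) = 0 := measure_mono_null inter_subset_left h0
  rw [← Measure.restrict_eq_self _ (inter_subset_right : W ∩ e.source ⊆ e.source),
    areaMeasure_restrict_source X.g hhd he,
    chartMeasure_apply X.g h e (hW.inter e.open_source).measurableSet] at h1
  have hopen : IsOpen (e.target ∩ e.symm ⁻¹' (W ∩ e.source)) :=
    e.symm.isOpen_inter_preimage (hW.inter e.open_source)
  have hne : (e.target ∩ e.symm ⁻¹' (W ∩ e.source)).Nonempty :=
    ⟨e p, e.map_source hps, by simp [e.left_inv hps, hp, hps]⟩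
  have hm : AEMeasurable (fun y => ENNReal.ofReal (areaDensity X.g (h ∘ e.symm) y))
      (volume.restrict (e.target ∩ e.symm ⁻¹' (W ∩ e.source))) :=
    (((continuousOn_areaDensity X hh he).mono inter_subset_left).aemeasurable
      hopen.measurableSet).ennreal_ofReal
  rw [lintegral_eq_zero_iff' hm] at h1
  have h2 : ∀ᵐ y ∂(volume.restrict (e.target ∩ e.symm ⁻¹' (W ∩ e.source))), False := by
    filter_upwards [h1, ae_restrict_mem hopen.measurableSet] with y hy hy2
    have h3 := areaDensity_pos X (dMap_comp_chart_symm_injective he hy2.1 (hhd _) (hi _))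
    have h4 : ENNReal.ofReal (areaDensity X.g (h ∘ e.symm) y) = 0 := hy
    rw [ENNReal.ofReal_eq_zero] at h4
    exact absurd h4 (not_le.mpr h3)
  rw [ae_iff] at h2
  simp only [not_false_eq_true, ofPred_true, Measure.restrict_apply_univ] at h2
  exact (hopen.measure_pos volume hne).ne' h2

end

end ChartIntegral

/-! ### Sub-Riemannian area as an integral over a fixed surface -/

section PointwiseAlgebra

variable {M : Type*} [TopologicalSpace M] [ChartedSpace E3 M] [IsManifold (𝓡 3) ∞ M]
  (X : SasakianStructure M)

lemma inner_sharp (g : Metric E3 M) (q : M) (α : TangentSpace (𝓡 3) q →L[ℝ] ℝ)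
    (v : TangentSpace (𝓡 3) q) : g.inner q (sharp g q α) v = α v := by
  have : FiniteDimensional ℝ (TangentSpace (𝓡 3) q) := inferInstanceAs (FiniteDimensional ℝ E3)
  have : T2Space (TangentSpace (𝓡 3) q) := inferInstanceAs (T2Space E3)
  have h := apply_inverse_of_pos (V := TangentSpace (𝓡 3) q) (g.inner q)
    (fun v hv => g.pos q v hv) α
  exact DFunLike.congr_fun h v

lemma len_smul (g : Metric E3 M) {q : M} (c : ℝ) (v : TangentSpace (𝓡 3) q) :
    len g (c • v) = |c| * len g v := by
  simp only [len, map_smul, _root_.smul_apply, smul_eq_mul]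
  rw [← mul_assoc, Real.sqrt_mul (mul_self_nonneg c), Real.sqrt_mul_self_eq_abs]

lemma len_sq (g : Metric E3 M) {q : M} (v : TangentSpace (𝓡 3) q) :
    len g v ^ 2 = g.inner q v v := by
  refine Real.sq_sqrt ?_
  by_cases hv : v = 0
  · rw [hv]; simp
  · exact (g.pos q v hv).le

lemma len_pos (g : Metric E3 M) {q : M} {v : TangentSpace (𝓡 3) q} (hv : v ≠ 0) : 0 < len g v :=
  Real.sqrt_pos.mpr (g.pos q v hv)

/-- The contraction of `a ∧ b` with `η`. -/
def cross (q : M) (a b : TangentSpace (𝓡 3) q) : TangentSpace (𝓡 3) q :=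
  X.η q a • b - X.η q b • a

lemma vol_apply (q : M) (a b c : TangentSpace (𝓡 3) q) :
    X.vol q a b c = X.η q a * X.dη q b c - X.η q b * X.dη q a c + X.dη q a b * X.η q c := by
  simp [SasakianStructure.vol]

namespace IsHorFrame

variable {X} {O : Set M} {A B : ∀ q : M, TangentSpace (𝓡 3) q} (hf : IsHorFrame X O A B) {q : M}
  (hq : q ∈ O)
include hf hq

lemma vol_eq (a b c : TangentSpace (𝓡 3) q) : X.vol q a b c =
    X.η q a * (X.g.inner q (A q) b * X.g.inner q (B q) c - X.g.inner q (B q) b * X.g.inner q (A q) c)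
    - X.η q b * (X.g.inner q (A q) a * X.g.inner q (B q) c
      - X.g.inner q (B q) a * X.g.inner q (A q) c)
    + (X.g.inner q (A q) a * X.g.inner q (B q) b - X.g.inner q (B q) a * X.g.inner q (A q) b)
      * X.η q c := by
  rw [vol_apply, hf.dη_eq hq, hf.dη_eq hq, hf.dη_eq hq]

/-- The squared length of the vector product, expressed by the components of the two vectors in the
frame. -/
lemma inner_cross (a b : TangentSpace (𝓡 3) q) :
    X.g.inner q (cross X q a b) (cross X q a b) =
      (X.η q a * X.g.inner q (A q) b - X.η q b * X.g.inner q (A q) a) ^ 2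
      + (X.η q a * X.g.inner q (B q) b - X.η q b * X.g.inner q (B q) a) ^ 2 := by
  rw [hf.inner_eq hq]
  have h : X.g.inner q (X.T q) (cross X q a b) = 0 := by
    simp only [cross, map_sub, map_smul, smul_eq_mul]
    change X.η q a * X.η q b - X.η q b * X.η q a = 0
    ring
  rw [h]
  simp only [cross, map_sub, map_smul, smul_eq_mul]
  ring

lemma gram_eq (a b : TangentSpace (𝓡 3) q) : gram X.g q a b =
      (X.η q a * X.g.inner q (A q) b - X.η q b * X.g.inner q (A q) a) ^ 2
      + (X.η q a * X.g.inner q (B q) b - X.η q b * X.g.inner q (B q) a) ^ 2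
      + (X.g.inner q (A q) a * X.g.inner q (B q) b
          - X.g.inner q (B q) a * X.g.inner q (A q) b) ^ 2 := by
  rw [gram, hf.inner_eq hq a a, hf.inner_eq hq b b, hf.inner_eq hq a b]
  change (_ + _ + X.η q a * X.η q a) * (_ + _ + X.η q b * X.η q b)
    - (_ + _ + X.η q a * X.η q b) ^ 2 = _
  ring

/-- The squared volume of a unit normal and a basis of a plane is the Gram determinant. -/
lemma sq_vol_eq {a b n : TangentSpace (𝓡 3) q} (hn : X.g.inner q n n = 1)
    (ha : X.g.inner q n a = 0) (hb : X.g.inner q n b = 0) : X.vol q a b n ^ 2 = gram X.g q a b := by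
  rw [hf.inner_eq hq n n] at hn
  rw [hf.inner_eq hq n a] at ha
  rw [hf.inner_eq hq n b] at hb
  rw [hf.gram_eq hq, hf.vol_eq hq]
  change _ + _ + X.η q n * X.η q n = 1 at hn
  change _ + _ + X.η q n * X.η q a = 0 at ha
  change _ + _ + X.η q n * X.η q b = 0 at hb
  set a1 := X.g.inner q (A q) a
  set a2 := X.g.inner q (B q) a
  set a0 := X.η q a
  set b1 := X.g.inner q (A q) b
  set b2 := X.g.inner q (B q) b
  set b0 := X.η q b
  set n1 := X.g.inner q (A q) n
  set n2 := X.g.inner q (B q) n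
  set n0 := X.η q n
  have e1 : (a2 * b0 - a0 * b2) * n2 - (a0 * b1 - a1 * b0) * n1 = 0 := by
    linear_combination b0 * ha - a0 * hb
  have e2 : (a0 * b1 - a1 * b0) * n0 - (a1 * b2 - a2 * b1) * n2 = 0 := by
    linear_combination b1 * ha - a1 * hb
  have e3 : (a1 * b2 - a2 * b1) * n1 - (a2 * b0 - a0 * b2) * n0 = 0 := by
    linear_combination b2 * ha - a2 * hb
  linear_combination ((a2 * b0 - a0 * b2) ^ 2 + (a0 * b1 - a1 * b0) ^ 2
      + (a1 * b2 - a2 * b1) ^ 2) * hn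
    - ((a2 * b0 - a0 * b2) * n2 - (a0 * b1 - a1 * b0) * n1) * e1
    - ((a0 * b1 - a1 * b0) * n0 - (a1 * b2 - a2 * b1) * n2) * e2
    - ((a1 * b2 - a2 * b1) * n1 - (a2 * b0 - a0 * b2) * n0) * e3

/-- The length of the horizontal part of the unit normal is the ratio of the sub-Riemannian to the
Riemannian area of the parallelogram spanned by `a` and `b`. A `90` degree rotation takes the
horizontal part of the normal to a multiple of the vector product `cross`. -/
lemma len_hor_normal {a b : TangentSpace (𝓡 3) q} (hab : 0 < gram X.g q a b) :
    len X.g (X.hor ((len X.g (sharp X.g q (X.vol q a b)))⁻¹ • sharp X.g q (X.vol q a b)))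
      = len X.g (cross X q a b) / √(gram X.g q a b) := by
  set n := sharp X.g q (X.vol q a b) with hn
  have e1 : X.g.inner q (A q) n = X.vol q a b (A q) := by rw [X.g.symm, hn, inner_sharp]
  have e2 : X.g.inner q (B q) n = X.vol q a b (B q) := by rw [X.g.symm, hn, inner_sharp]
  have e3 : X.g.inner q (X.T q) n = X.vol q a b (X.T q) := by rw [X.g.symm, hn, inner_sharp]
  have f1 := hf.AA q hq
  have f2 := hf.BB q hq
  have f3 := hf.AB q hq
  have f4 : X.g.inner q (B q) (A q) = 0 := by rw [X.g.symm, f3]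
  have f5 : X.η q (A q) = 0 := (X.g.symm q _ _).trans (hf.AT q hq)
  have f6 : X.η q (B q) = 0 := (X.g.symm q _ _).trans (hf.BT q hq)
  have f7 : X.η q (X.T q) = 1 := X.unit_T q
  have f8 := hf.AT q hq
  have f9 := hf.BT q hq
  rw [hf.vol_eq hq, f1, f4, f5] at e1
  rw [hf.vol_eq hq, f2, f3, f6] at e2
  rw [hf.vol_eq hq, f7, f8, f9] at e3
  have hnn : X.g.inner q n n = gram X.g q a b := by
    rw [hf.inner_eq hq, e1, e2, e3, hf.gram_eq hq]; ring
  have hln : len X.g n = √(gram X.g q a b) := by rw [len, hnn]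
  have hh : X.hor ((len X.g n)⁻¹ • n) = (len X.g n)⁻¹ • X.hor n := by
    simp only [SasakianStructure.hor, map_smul, _root_.smul_apply, smul_eq_mul, smul_sub, mul_smul]
  have hs := Real.sqrt_pos.mpr hab
  rw [hh, len_smul, hln, abs_of_pos (inv_pos.mpr hs), div_eq_inv_mul]
  rw [len, len, hf.inner_cross hq, hf.inner_eq hq (X.hor n)]
  have k1 : X.g.inner q (A q) (X.hor n) = X.g.inner q (A q) n := by
    simp [SasakianStructure.hor, f8]
  have k2 : X.g.inner q (B q) (X.hor n) = X.g.inner q (B q) n := by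
    simp [SasakianStructure.hor, f9]
  have k3 : X.g.inner q (X.T q) (X.hor n) = 0 := by
    simp [SasakianStructure.hor, X.unit_T q, X.g.symm q n]
  rw [k1, k2, k3, e1, e2]
  congr 2
  ring

end IsHorFrame

lemma len_hor_unit_normal {q : M} {a b : TangentSpace (𝓡 3) q} (hab : 0 < gram X.g q a b) :
    len X.g (X.hor ((len X.g (sharp X.g q (X.vol q a b)))⁻¹ • sharp X.g q (X.vol q a b)))
      = len X.g (cross X q a b) / √(gram X.g q a b) := by
  obtain ⟨O, A, B, hO, hf⟩ := exists_isHorFrame X q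
  exact hf.len_hor_normal hO hab

lemma sq_vol {q : M} {a b n : TangentSpace (𝓡 3) q} (hn : X.g.inner q n n = 1)
    (ha : X.g.inner q n a = 0) (hb : X.g.inner q n b = 0) : X.vol q a b n ^ 2 = gram X.g q a b := by
  obtain ⟨O, A, B, hO, hf⟩ := exists_isHorFrame X q
  exact hf.sq_vol_eq hO hn ha hb

end PointwiseAlgebra

section AreaRatio

variable {M : Type*} [TopologicalSpace M] [ChartedSpace E3 M] [IsManifold (𝓡 3) ∞ M]
  (X : SasakianStructure M) {S : Type*} [TopologicalSpace S] [ChartedSpace E2 S]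

/-- The Riemannian area of the parallelogram spanned by the images of the coordinate basis of the
tangent plane. -/
def areaUnit (h : S → M) (p : S) : ℝ :=
  √(gram X.g (h p) (mfderiv (𝓡 2) (𝓡 3) h p e₁) (mfderiv (𝓡 2) (𝓡 3) h p e₂))

/-- The length of the contraction of `η` with the images of the coordinate basis of the tangent
plane; it is the sub-Riemannian area of their parallelogram. -/
def subAreaUnit (h : S → M) (p : S) : ℝ :=
  len X.g (cross X (h p) (mfderiv (𝓡 2) (𝓡 3) h p e₁) (mfderiv (𝓡 2) (𝓡 3) h p e₂))

lemma areaUnit_pos {h : S → M} {p : S} (hi : Function.Injective (mfderiv (𝓡 2) (𝓡 3) h p)) :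
    0 < areaUnit X h p := Real.sqrt_pos.mpr (gram_pos_of_injective X.g hi)

lemma len_hor_unitNormal {h : S → M} {p : S}
    (hi : Function.Injective (mfderiv (𝓡 2) (𝓡 3) h p)) :
    len X.g (X.hor (unitNormal X h p)) = subAreaUnit X h p / areaUnit X h p :=
  len_hor_unit_normal X (gram_pos_of_injective X.g hi)

variable [IsManifold (𝓡 2) 2 S]

/-- The Jacobian of the inverse of a chart with respect to the preferred chart. -/
def chartDet (e : OpenPartialHomeomorph S E2) (y : E2) : ℝ :=
  ContinuousLinearMap.det (mfderiv (𝓡 2) (𝓡 2) e.symm y : E2 →L[ℝ] E2)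

lemma chartDet_ne_zero {e : OpenPartialHomeomorph S E2} (he : e ∈ atlas E2 S) {y : E2}
    (hy : y ∈ e.target) : chartDet e y ≠ 0 := by
  intro h0
  let L : E2 →L[ℝ] E2 := mfderiv (𝓡 2) (𝓡 2) e.symm y
  have hi : Function.Injective (L : E2 →ₗ[ℝ] E2) := mfderiv_chart_symm_injective he hy
  have h1 := LinearMap.bot_lt_ker_of_det_eq_zero (f := (L : E2 →ₗ[ℝ] E2)) h0
  rw [LinearMap.ker_eq_bot.mpr hi] at h1
  exact lt_irrefl _ h1

lemma areaDensity_chart_symm {h : S → M} {e : OpenPartialHomeomorph S E2} (he : e ∈ atlas E2 S)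
    {y : E2} (hy : y ∈ e.target) (hh : MDifferentiableAt (𝓡 2) (𝓡 3) h (e.symm y)) :
    areaDensity X.g (h ∘ e.symm) y = |chartDet e y| * areaUnit X h (e.symm y) := by
  have h1 : areaDensity X.g (h ∘ e.symm) y = √(gram X.g (h (e.symm y))
      (dMap (h ∘ e.symm) y e₁) (dMap (h ∘ e.symm) y e₂)) := rfl
  have h2 := gram_comp X.g (h (e.symm y)) (mfderiv (𝓡 2) (𝓡 3) h (e.symm y))
    (mfderiv (𝓡 2) (𝓡 2) e.symm y)
  rw [h1, dMap_comp_chart_symm he hy hh, dMap_comp_chart_symm he hy hh]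
  refine (congrArg Real.sqrt h2).trans ?_
  rw [Real.sqrt_mul (sq_nonneg _), Real.sqrt_sq_eq_abs]
  rfl

variable [MeasurableSpace S] [BorelSpace S]

variable {h f : S → M} (hh : ContMDiff (𝓡 2) (𝓡 3) 1 h) (hf : ContMDiff (𝓡 2) (𝓡 3) 1 f)
  (hhi : ∀ p, Function.Injective (mfderiv (𝓡 2) (𝓡 3) h p))
  (hfi : ∀ p, Function.Injective (mfderiv (𝓡 2) (𝓡 3) f p))
include hh hf hhi hfi

/-- The ratio of the area elements of two immersions, computed in any chart. -/
lemma areaUnit_ratio {e : OpenPartialHomeomorph S E2} (he : e ∈ atlas E2 S)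
    {y : E2} (hy : y ∈ e.target) : areaUnit X h (e.symm y) / areaUnit X f (e.symm y)
      = areaDensity X.g (h ∘ e.symm) y / areaDensity X.g (f ∘ e.symm) y := by
  rw [areaDensity_chart_symm X he hy (hh.mdifferentiable (by simp) _),
    areaDensity_chart_symm X he hy (hf.mdifferentiable (by simp) _),
    mul_div_mul_left _ _ (abs_ne_zero.mpr (chartDet_ne_zero he hy))]

lemma continuous_areaUnit_ratio : Continuous (fun p => areaUnit X h p / areaUnit X f p) := by
  rw [continuous_iff_continuousAt]
  intro p
  let e := chartAt E2 p
  have he : e ∈ atlas E2 S := chart_mem_atlas E2 p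
  have hp : p ∈ e.source := mem_chart_source E2 p
  have ht := e.open_target.mem_nhds (e.map_source hp)
  have hpos := areaDensity_pos X (dMap_comp_chart_symm_injective he (e.map_source hp)
    (hf.mdifferentiable (by simp) _) (hfi _))
  have h1 := ((continuousOn_areaDensity X hh he).continuousAt ht).div
    ((continuousOn_areaDensity X hf he).continuousAt ht) hpos.ne'
  have h2 := ContinuousAt.comp (f := e) h1 (e.continuousAt hp)
  refine h2.congr ?_
  filter_upwards [e.open_source.mem_nhds hp] with q hq
  have h3 := areaUnit_ratio X hh hf hhi hfi he (e.map_source hq)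
  rw [e.left_inv hq] at h3
  exact h3.symm

/-- The area element of an immersion has a density with respect to that of another immersion. -/
lemma areaMeasure_eq_withDensity [SecondCountableTopology S] : areaMeasure X.g h
    = (areaMeasure X.g f).withDensity
      (fun p => ENNReal.ofReal (areaUnit X h p / areaUnit X f p)) := by
  obtain ⟨c, hc, hcu⟩ := TopologicalSpace.countable_cover_nhds
    (f := fun p : S => (chartAt E2 p).source)
    (fun p => (chartAt E2 p).open_source.mem_nhds (mem_chart_source E2 p))
  refine (Measure.ext_iff_of_biUnion_eq_univ hc hcu).mpr fun p _ => ?_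
  let e := chartAt E2 p
  have he : e ∈ atlas E2 S := chart_mem_atlas E2 p
  have hr := continuous_areaUnit_ratio X hh hf hhi hfi
  have hrm : Measurable (fun p => ENNReal.ofReal (areaUnit X h p / areaUnit X f p)) :=
    hr.measurable.ennreal_ofReal
  rw [restrict_withDensity e.open_source.measurableSet,
    areaMeasure_restrict_source X.g (hh.mdifferentiable (by simp)) he,
    areaMeasure_restrict_source X.g (hf.mdifferentiable (by simp)) he]
  ext A hA
  rw [chartMeasure_apply X.g h e hA, withDensity_apply _ hA, ← lintegral_indicator hA, chartMeasure,
    lintegral_map' ((hrm.indicator hA).aemeasurable) (aemeasurable_chart_symm X.g f e),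
    lintegral_withDensity_eq_lintegral_mul_non_measurable₀]
  · have hm := measurableSet_chart_preimage e hA
    rw [← inter_eq_left.mpr (inter_subset_left : e.target ∩ e.symm ⁻¹' A ⊆ e.target),
      ← Measure.restrict_restrict hm, ← lintegral_indicator hm]
    refine setLIntegral_congr_fun e.open_target.measurableSet fun y hy => ?_
    by_cases hyA : e.symm y ∈ A
    · rw [indicator_of_mem (show y ∈ e.target ∩ e.symm ⁻¹' A from ⟨hy, hyA⟩), Pi.mul_apply,
        indicator_of_mem hyA, areaUnit_ratio X hh hf hhi hfi he hy,
        ← ENNReal.ofReal_mul (areaDensity_nonneg X.g _ y), mul_div_cancel₀]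
      exact (areaDensity_pos X (dMap_comp_chart_symm_injective he hy
        (hf.mdifferentiable (by simp) _) (hfi _))).ne'
    · rw [indicator_of_notMem (fun h => hyA h.2), Pi.mul_apply, indicator_of_notMem hyA, mul_zero]
  · exact ((continuousOn_areaDensity X hf he).aemeasurable
      e.open_target.measurableSet).ennreal_ofReal
  · exact ae_of_all _ fun y => ENNReal.ofReal_lt_top

/-- The sub-Riemannian area as an integral over the reference immersion `f`. -/
lemma subArea_eq [SecondCountableTopology S] {C : Set S} (hC : MeasurableSet C) :
    subArea X h C = ∫ p in C, subAreaUnit X h p / areaUnit X f p ∂(areaMeasure X.g f) := by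
  have hr := continuous_areaUnit_ratio X hh hf hhi hfi
  rw [subArea, areaMeasure_eq_withDensity X hh hf hhi hfi,
    setIntegral_withDensity_eq_setIntegral_toReal_smul hr.measurable.ennreal_ofReal
      (ae_of_all _ fun y => ENNReal.ofReal_lt_top) _ hC]
  refine setIntegral_congr_fun hC fun p _ => ?_
  have h1 := areaUnit_pos X (hhi p)
  have h2 := areaUnit_pos X (hfi p)
  simp only [smul_eq_mul]
  rw [ENNReal.toReal_ofReal (by positivity), len_hor_unitNormal X (hhi p)]
  field_simp

end AreaRatio

/-! ### Stokes' theorem on a surface -/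

lemma integral_fderiv_eq_zero {ψ : E2 → ℝ} (hψ : ContDiff ℝ 1 ψ) (hs : HasCompactSupport ψ)
    (b : E2) : ∫ y, fderiv ℝ ψ y b = 0 := by
  have hc : Continuous (fun y => fderiv ℝ ψ y b) :=
    (hψ.continuous_fderiv (by simp)).clm_apply continuous_const
  have hi : Integrable (fun y => fderiv ℝ ψ y b) :=
    hc.integrable_of_hasCompactSupport (hs.fderiv_apply (𝕜 := ℝ) b)
  have h := integral_mul_fderiv_eq_neg_fderiv_mul_of_integrable (μ := (volume : Measure E2))
    (f := fun _ => (1 : ℝ)) (g := ψ) (v := b) (by simp) (by simpa using hi)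
    (by simpa using hψ.continuous.integrable_of_hasCompactSupport hs)
    (fun x _ => differentiableAt_const _) (fun x _ => hψ.differentiable (by simp) x)
  simpa using h

section Stokes

variable {S : Type*} [TopologicalSpace S] [ChartedSpace E2 S]

/-- The coordinate expression of a `1`-form on a surface. -/
def chartForm (τ : ∀ p : S, TangentSpace (𝓡 2) p →L[ℝ] ℝ) (e : OpenPartialHomeomorph S E2)
    (y : E2) : E2 →L[ℝ] ℝ := (τ (e.symm y)).comp (mfderiv (𝓡 2) (𝓡 2) e.symm y)

/-- The `2`-form `dρ ∧ τ` divided by the area form whose value on the coordinate basis is `D`. -/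
def wedgeRatio (D : S → ℝ) (ρ : S → ℝ) (τ : ∀ p : S, TangentSpace (𝓡 2) p →L[ℝ] ℝ) (p : S) : ℝ :=
  let dρ : E2 →L[ℝ] ℝ := mfderiv (𝓡 2) 𝓘(ℝ, ℝ) ρ p
  let t : E2 →L[ℝ] ℝ := τ p
  (dρ e₁ * t e₂ - dρ e₂ * t e₁) / D p

lemma wedgeRatio_eq_zero {D : S → ℝ} {ρ : S → ℝ} {τ : ∀ p : S, TangentSpace (𝓡 2) p →L[ℝ] ℝ}
    {p : S} (h : (mfderiv (𝓡 2) 𝓘(ℝ, ℝ) ρ p : E2 →L[ℝ] ℝ) = 0 ∨ (τ p : E2 →L[ℝ] ℝ) = 0) :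
    wedgeRatio D ρ τ p = 0 := by
  let dρ : E2 →L[ℝ] ℝ := mfderiv (𝓡 2) 𝓘(ℝ, ℝ) ρ p
  let t : E2 →L[ℝ] ℝ := τ p
  change (dρ e₁ * t e₂ - dρ e₂ * t e₁) / D p = 0
  rcases h with h | h
  · rw [show dρ = 0 from h]; simp
  · rw [show t = 0 from h]; simp

variable [IsManifold (𝓡 2) 2 S]

lemma wedgeRatio_chart {D : S → ℝ} {ρ : S → ℝ} (τ : ∀ p : S, TangentSpace (𝓡 2) p →L[ℝ] ℝ)
    {e : OpenPartialHomeomorph S E2} (he : e ∈ atlas E2 S) {y : E2} (hy : y ∈ e.target)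
    (hρ : MDifferentiableAt (𝓡 2) 𝓘(ℝ, ℝ) ρ (e.symm y)) (hD : D (e.symm y) ≠ 0) :
    wedgeRatio D ρ τ (e.symm y) * (chartDet e y * D (e.symm y)) =
      fderiv ℝ (ρ ∘ e.symm) y e₁ * chartForm τ e y e₂
        - fderiv ℝ (ρ ∘ e.symm) y e₂ * chartForm τ e y e₁ := by
  let dρ : E2 →L[ℝ] ℝ := mfderiv (𝓡 2) 𝓘(ℝ, ℝ) ρ (e.symm y)
  let t : E2 →L[ℝ] ℝ := τ (e.symm y)
  let L : E2 →L[ℝ] E2 := mfderiv (𝓡 2) (𝓡 2) e.symm y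
  have h1 : ∀ b, fderiv ℝ (ρ ∘ e.symm) y b = dρ (L b) := by
    intro b
    have h2 := mfderiv_comp y hρ ((contMDiffAt_chart_symm he hy).mdifferentiableAt (by simp))
    have h3 : fderiv ℝ (ρ ∘ e.symm) y = mfderiv (𝓡 2) 𝓘(ℝ, ℝ) (ρ ∘ e.symm) y :=
      mfderiv_eq_fderiv.symm
    rw [h3]
    exact DFunLike.congr_fun h2 b
  have h4 := alternating_apply (fun u v => dρ u * t v - dρ v * t u)
    (fun a b u v w => by simp only [map_add, map_smul, smul_eq_mul]; ring) (fun u v => by ring) L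
  have h5 : wedgeRatio D ρ τ (e.symm y) = (dρ e₁ * t e₂ - dρ e₂ * t e₁) / D (e.symm y) := rfl
  rw [h1, h1, h5]
  have h6 : L.det = chartDet e y := rfl
  have h7 : ∀ b, chartForm τ e y b = t (L b) := fun _ => rfl
  rw [h7, h7]
  refine Eq.trans ?_ h4.symm
  rw [h6, smul_eq_mul]
  field_simp

/-- `F` times the area form is `dτ`, with everything supported in the compact set `C`. -/
structure IsCurl (D F : S → ℝ) (τ : ∀ p : S, TangentSpace (𝓡 2) p →L[ℝ] ℝ) (C : Set S) :
    Prop where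
  isCompact : IsCompact C
  F_zero : ∀ p ∉ C, F p = 0
  τ_zero : ∀ p ∉ C, τ p = 0
  D_ne : ∀ p, D p ≠ 0
  cont_D : ∀ e ∈ atlas E2 S, ContinuousOn (fun y => chartDet e y * D (e.symm y)) e.target
  curl : ∀ p ∈ C, ∀ᶠ y in 𝓝 (chartAt E2 p p), ContDiffAt ℝ 1 (chartForm τ (chartAt E2 p)) y ∧
    F ((chartAt E2 p).symm y) * (chartDet (chartAt E2 p) y * D ((chartAt E2 p).symm y))
      = fderiv ℝ (chartForm τ (chartAt E2 p)) y e₁ e₂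
        - fderiv ℝ (chartForm τ (chartAt E2 p)) y e₂ e₁

namespace IsCurl

variable [T2Space S] {D F : S → ℝ} {τ : ∀ p : S, TangentSpace (𝓡 2) p →L[ℝ] ℝ} {C : Set S}
  (hc : IsCurl D F τ C)
include hc

lemma continuous_F : Continuous F := by
  rw [continuous_iff_continuousAt]
  intro p
  by_cases hp : p ∈ C
  · let e := chartAt E2 p
    have he : e ∈ atlas E2 S := chart_mem_atlas E2 p
    have hps : p ∈ e.source := mem_chart_source E2 p
    have ht := e.map_source hps
    have hev := hc.curl p hp
    have hτ := hev.self_of_nhds.1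
    have hD := (hc.cont_D e he).continuousAt (e.open_target.mem_nhds ht)
    have hD0 : chartDet e (e p) * D (e.symm (e p)) ≠ 0 :=
      mul_ne_zero (chartDet_ne_zero he ht) (hc.D_ne _)
    have hfd : ContinuousAt (fderiv ℝ (chartForm τ e)) (e p) :=
      (hτ.fderiv_right (m := 0) (by norm_num)).continuousAt
    have h1 := (((hfd.clm_apply (continuousAt_const (y := e₁))).clm_apply
      (continuousAt_const (y := e₂))).sub ((hfd.clm_apply (continuousAt_const (y := e₂))).clm_apply
      (continuousAt_const (y := e₁)))).div hD hD0
    refine (ContinuousAt.comp (f := e) h1 (e.continuousAt hps)).congr ?_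
    filter_upwards [e.open_source.mem_nhds hps, (e.continuousAt hps).eventually hev] with q hq hq2
    have hq0 : chartDet e (e q) * D (e.symm (e q)) ≠ 0 :=
      mul_ne_zero (chartDet_ne_zero he (e.map_source hq)) (hc.D_ne _)
    have h2 := hq2.2
    change F (e.symm (e q)) * (chartDet e (e q) * D (e.symm (e q))) = _ at h2
    change (_ - _) / (chartDet e (e q) * D (e.symm (e q))) = _
    rw [div_eq_iff hq0]
    rw [e.left_inv hq] at h2 ⊢
    exact h2.symm
  · have : F =ᶠ[𝓝 p] fun _ => 0 := by
      filter_upwards [hc.isCompact.isClosed.isOpen_compl.mem_nhds hp] with q hq using hc.F_zero q hq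
    exact continuousAt_const.congr this.symm

lemma wedgeRatio_eq {ρ : S → ℝ} (hρ : ContMDiff (𝓡 2) 𝓘(ℝ, ℝ) 1 ρ)
    {e : OpenPartialHomeomorph S E2} (he : e ∈ atlas E2 S) {y : E2} (hy : y ∈ e.target) :
    wedgeRatio D ρ τ (e.symm y) * (chartDet e y * D (e.symm y))
      = fderiv ℝ (ρ ∘ e.symm) y e₁ * chartForm τ e y e₂
        - fderiv ℝ (ρ ∘ e.symm) y e₂ * chartForm τ e y e₁ := by
  exact wedgeRatio_chart τ he hy (hρ.mdifferentiable (by simp) _) (hc.D_ne (e.symm y))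

lemma continuous_wedgeRatio {ρ : S → ℝ} (hρ : ContMDiff (𝓡 2) 𝓘(ℝ, ℝ) 1 ρ) :
    Continuous (wedgeRatio D ρ τ) := by
  rw [continuous_iff_continuousAt]
  intro p
  by_cases hp : p ∈ C
  · let e := chartAt E2 p
    have he : e ∈ atlas E2 S := chart_mem_atlas E2 p
    have hps : p ∈ e.source := mem_chart_source E2 p
    have ht := e.map_source hps
    have hτ := (hc.curl p hp).self_of_nhds.1.continuousAt
    have hD := (hc.cont_D e he).continuousAt (e.open_target.mem_nhds ht)
    have hD0 : chartDet e (e p) * D (e.symm (e p)) ≠ 0 :=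
      mul_ne_zero (chartDet_ne_zero he ht) (hc.D_ne _)
    have hρe : ContDiffAt ℝ 1 (ρ ∘ e.symm) (e p) :=
      (hρ.contMDiffAt.comp _ ((contMDiffAt_chart_symm he ht).of_le (by norm_num))).contDiffAt
    have hfd : ContinuousAt (fderiv ℝ (ρ ∘ e.symm)) (e p) :=
      (hρe.fderiv_right (m := 0) (by norm_num)).continuousAt
    have h1 := (((hfd.clm_apply (continuousAt_const (y := e₁))).mul
      (hτ.clm_apply (continuousAt_const (y := e₂)))).sub
      ((hfd.clm_apply (continuousAt_const (y := e₂))).mul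
      (hτ.clm_apply (continuousAt_const (y := e₁))))).div hD hD0
    refine (ContinuousAt.comp (f := e) h1 (e.continuousAt hps)).congr ?_
    filter_upwards [e.open_source.mem_nhds hps] with q hq
    have hq0 : chartDet e (e q) * D (e.symm (e q)) ≠ 0 :=
      mul_ne_zero (chartDet_ne_zero he (e.map_source hq)) (hc.D_ne _)
    have h2 := hc.wedgeRatio_eq hρ he (e.map_source hq)
    change (_ - _) / (chartDet e (e q) * D (e.symm (e q))) = _
    rw [div_eq_iff hq0]
    rw [e.left_inv hq] at h2 ⊢
    exact h2.symm
  · have : wedgeRatio D ρ τ =ᶠ[𝓝 p] fun _ => 0 := by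
      filter_upwards [hc.isCompact.isClosed.isOpen_compl.mem_nhds hp] with q hq
      exact wedgeRatio_eq_zero (Or.inr (hc.τ_zero q hq))
    exact continuousAt_const.congr this.symm

variable {M : Type*} [TopologicalSpace M] [ChartedSpace E3 M] [IsManifold (𝓡 3) ∞ M]
  {X : SasakianStructure M} [MeasurableSpace S] [BorelSpace S] {f : S → M}
  (hf : ContMDiff (𝓡 2) (𝓡 3) 1 f)
  (hD : ∀ p, |D p| = areaUnit X f p)
include hf hD

/-- Stokes' theorem for a form supported in the domain of a chart. -/
lemma integral_eq_zero_of_chart {ρ : S → ℝ} (hρ : ContMDiff (𝓡 2) 𝓘(ℝ, ℝ) 1 ρ)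
    (hρc : HasCompactSupport ρ)
    {e : OpenPartialHomeomorph S E2} (he : e ∈ atlas E2 S) {W : Set E2} (hW : IsOpen W)
    (hWe : W ⊆ e.target) (hρW : tsupport ρ ⊆ e.source ∩ e ⁻¹' W) {σ : ℝ} (hσ : σ ^ 2 = 1)
    (hloc : ∀ y ∈ W, ContDiffAt ℝ 1 (chartForm τ e) y ∧
      F (e.symm y) * (chartDet e y * D (e.symm y))
        = fderiv ℝ (chartForm τ e) y e₁ e₂ - fderiv ℝ (chartForm τ e) y e₂ e₁ ∧
      0 < σ * (chartDet e y * D (e.symm y))) :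
    ∫ p, (ρ p * F p + wedgeRatio D ρ τ p) ∂(areaMeasure X.g f) = 0 := by
  have hcont : Continuous (fun p => ρ p * F p + wedgeRatio D ρ τ p) :=
    (hρ.continuous.mul hc.continuous_F).add (hc.continuous_wedgeRatio hρ)
  have hzero : ∀ p ∉ tsupport ρ, ρ p * F p + wedgeRatio D ρ τ p = 0 := by
    intro p hp
    have h1 : ρ =ᶠ[𝓝 p] fun _ => 0 := notMem_tsupport_iff_eventuallyEq.mp hp
    have h2 : (mfderiv (𝓡 2) 𝓘(ℝ, ℝ) ρ p : E2 →L[ℝ] ℝ) = 0 :=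
      h1.mfderiv_eq.trans (mfderiv_const)
    have h3 : wedgeRatio D ρ τ p = 0 := wedgeRatio_eq_zero (Or.inl h2)
    rw [h3, h1.self_of_nhds]
    simp
  rw [← setIntegral_eq_integral_of_forall_compl_eq_zero (s := e.source)
    (fun p hp => hzero p fun h => hp (hρW h).1),
    setIntegral_chart X hf he hcont.aestronglyMeasurable]
  -- the coordinate expressions of `ρ τ`
  let ψ : E2 → E2 → ℝ := fun b => W.indicator (fun y => ρ (e.symm y) * chartForm τ e y b)
  set K := e '' tsupport ρ with hK
  have hKc : IsCompact K := hρc.isCompact.image_of_continuousOn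
    (e.continuousOn.mono fun p hp => (hρW hp).1)
  have hKW : K ⊆ W := by rintro _ ⟨p, hp, rfl⟩; exact (hρW hp).2
  have hρK : ∀ y ∈ e.target, y ∉ K → e.symm y ∉ tsupport ρ := by
    intro y hy hyK h
    exact hyK ⟨e.symm y, h, e.right_inv hy⟩
  have hψ0 : ∀ b, ∀ y ∉ K, ψ b y = 0 := by
    intro b y hy
    by_cases hyW : y ∈ W
    · simp only [ψ, indicator_of_mem hyW]
      rw [image_eq_zero_of_notMem_tsupport (hρK y (hWe hyW) hy), zero_mul]
    · simp only [ψ, indicator_of_notMem hyW]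
  have hψs : ∀ b, HasCompactSupport (ψ b) := fun b => HasCompactSupport.intro hKc (hψ0 b)
  have hψe : ∀ b, ∀ y ∈ W, ψ b =ᶠ[𝓝 y] fun y => (ρ ∘ e.symm) y * chartForm τ e y b := by
    intro b y hy
    filter_upwards [hW.mem_nhds hy] with z hz
    simp only [ψ, indicator_of_mem hz]; rfl
  have hρe : ∀ y ∈ e.target, ContDiffAt ℝ 1 (ρ ∘ e.symm) y := fun y hy =>
    (hρ.contMDiffAt.comp _ ((contMDiffAt_chart_symm he hy).of_le (by norm_num))).contDiffAt
  have hψc : ∀ b, ContDiff ℝ 1 (ψ b) := by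
    intro b
    rw [contDiff_iff_contDiffAt]
    intro y
    by_cases hy : y ∈ W
    · exact ((hρe y (hWe hy)).mul ((hloc y hy).1.clm_apply contDiffAt_const)).congr_of_eventuallyEq
        (hψe b y hy)
    · have h1 : ψ b =ᶠ[𝓝 y] fun _ => 0 := by
        filter_upwards [hKc.isClosed.isOpen_compl.mem_nhds (fun h => hy (hKW h))] with z hz
        exact hψ0 b z hz
      exact contDiffAt_const.congr_of_eventuallyEq h1
  have hfin : ∀ y, (e.target.indicator (fun y => areaDensity X.g (f ∘ e.symm) y *
      (ρ (e.symm y) * F (e.symm y) + wedgeRatio D ρ τ (e.symm y)))) y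
      = σ * (fderiv ℝ (ψ e₂) y e₁ - fderiv ℝ (ψ e₁) y e₂) := by
    intro y
    by_cases hy : y ∈ W
    · obtain ⟨hτ, hcurl, hpos⟩ := hloc y hy
      rw [indicator_of_mem (hWe hy), areaDensity_chart_symm X he (hWe hy)
        (hf.mdifferentiable (by simp) _), ← hD, ← abs_mul]
      have habs : |chartDet e y * D (e.symm y)| = σ * (chartDet e y * D (e.symm y)) := by
        have h1 : |σ| = 1 := by
          rw [← abs_one, ← sq_eq_sq_iff_abs_eq_abs, hσ, one_pow]
        rw [← abs_of_pos hpos, abs_mul σ, h1, one_mul]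
      have hd : ∀ b u, fderiv ℝ (ψ b) y u = ρ (e.symm y) * fderiv ℝ (chartForm τ e) y u b
          + chartForm τ e y b * fderiv ℝ (ρ ∘ e.symm) y u := by
        intro b u
        rw [(hψe b y hy).fderiv_eq, Coframe.fderiv_mul_apply ((hρe y (hWe hy)).differentiableAt
          (by simp)) ((hτ.differentiableAt (by simp)).clm_apply (differentiableAt_const b)),
          Coframe.fderiv_form_apply (hτ.differentiableAt (by simp))]
        rfl
      have hw := hc.wedgeRatio_eq hρ he (hWe hy)
      rw [habs, hd, hd]
      linear_combination σ * hw + σ * ρ (e.symm y) * hcurl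
    · have hyK : y ∉ K := fun h => hy (hKW h)
      have h1 : ∀ b, fderiv ℝ (ψ b) y = 0 := fun b => by
        have h1 : ψ b =ᶠ[𝓝 y] fun _ => 0 := by
          filter_upwards [hKc.isClosed.isOpen_compl.mem_nhds hyK] with z hz
          exact hψ0 b z hz
        rw [h1.fderiv_eq]; simp
      rw [h1, h1]
      by_cases hyt : y ∈ e.target
      · rw [indicator_of_mem hyt, hzero _ (hρK y hyt hyK)]; simp
      · rw [indicator_of_notMem hyt]; simp
  rw [← integral_indicator e.open_target.measurableSet, integral_congr_ae (ae_of_all _ hfin),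
    integral_const_mul, integral_sub, integral_fderiv_eq_zero (hψc _) (hψs _),
    integral_fderiv_eq_zero (hψc _) (hψs _)]
  · simp
  · exact (((hψc _).continuous_fderiv (by simp)).clm_apply
      continuous_const).integrable_of_hasCompactSupport ((hψs _).fderiv_apply (𝕜 := ℝ) _)
  · exact (((hψc _).continuous_fderiv (by simp)).clm_apply
      continuous_const).integrable_of_hasCompactSupport ((hψs _).fderiv_apply (𝕜 := ℝ) _)

/-- A cut-off function supported in a chart where the area form has constant sign, so that the
localized form of Stokes' theorem holds for its products with all other functions. -/
lemma exists_cutoff {p : S} (hp : p ∈ C) : ∃ χ : S → ℝ, ContMDiff (𝓡 2) 𝓘(ℝ, ℝ) 1 χ ∧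
    χ =ᶠ[𝓝 p] 1 ∧ ∀ ρ : S → ℝ, ContMDiff (𝓡 2) 𝓘(ℝ, ℝ) 1 ρ →
      ∫ q, ((ρ * χ) q * F q + wedgeRatio D (ρ * χ) τ q) ∂(areaMeasure X.g f) = 0 := by
  let e := chartAt E2 p
  have he : e ∈ atlas E2 S := chart_mem_atlas E2 p
  have hps : p ∈ e.source := mem_chart_source E2 p
  have ht := e.map_source hps
  let De : E2 → ℝ := fun y => chartDet e y * D (e.symm y)
  have hDc : ContinuousAt De (e p) := (hc.cont_D e he).continuousAt (e.open_target.mem_nhds ht)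
  have hD0 : De (e p) ≠ 0 := mul_ne_zero (chartDet_ne_zero he ht) (hc.D_ne _)
  obtain ⟨σ, hσ, hpos⟩ : ∃ σ : ℝ, σ ^ 2 = 1 ∧ 0 < σ * De (e p) := by
    rcases lt_or_gt_of_ne hD0 with h | h
    · exact ⟨-1, by norm_num, by linarith⟩
    · exact ⟨1, by norm_num, by linarith⟩
  have hev : ∀ᶠ y in 𝓝 (e p), y ∈ e.target ∧ ContDiffAt ℝ 1 (chartForm τ e) y ∧
      F (e.symm y) * (chartDet e y * D (e.symm y))
        = fderiv ℝ (chartForm τ e) y e₁ e₂ - fderiv ℝ (chartForm τ e) y e₂ e₁ ∧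
      0 < σ * (chartDet e y * D (e.symm y)) := by
    filter_upwards [e.open_target.mem_nhds ht, hc.curl p hp,
      (continuousAt_const.mul hDc).eventually (lt_mem_nhds hpos)] with y h1 h2 h3
    exact ⟨h1, h2.1, h2.2, h3⟩
  obtain ⟨W, hWs, hW, hpW⟩ := eventually_nhds_iff.mp hev
  have hnhds : e.source ∩ e ⁻¹' W ∈ 𝓝 p := (e.isOpen_inter_preimage hW).mem_nhds ⟨hps, hpW⟩
  obtain ⟨χ, -, hχ⟩ := (SmoothBumpFunction.nhds_basis_tsupport (I := 𝓡 2) p).mem_iff.mp hnhds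
  have hχc : ContMDiff (𝓡 2) 𝓘(ℝ, ℝ) 1 χ := by
    refine contMDiff_of_tsupport fun x hx => ?_
    have hx2 : x ∈ (chartAt E2 p).source := χ.tsupport_subset_chartAt_source hx
    refine ContMDiffAt.congr_of_eventuallyEq ?_ <| χ.eqOn_source.eventuallyEq_of_mem <|
      (chartAt E2 p).open_source.mem_nhds hx2
    exact (χ.contDiffAt.contMDiffAt (n := 1)).comp _ (contMDiffAt_extChartAt' hx2)
  refine ⟨χ, hχc, χ.eventuallyEq_one, fun ρ hρ => ?_⟩
  have hsub : tsupport (ρ * (χ : S → ℝ)) ⊆ tsupport χ := tsupport_mul_subset_right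
  exact hc.integral_eq_zero_of_chart (ρ := ρ * (χ : S → ℝ)) hf hD (hρ.mul hχc) χ.hasCompactSupport.mul_left he hW
    (fun y hy => (hWs y hy).1) (hsub.trans hχ) hσ fun y hy => (hWs y hy).2

/-- Stokes' theorem for a compactly supported form. -/
lemma integral_eq_zero [SecondCountableTopology S] :
    ∫ q, F q ∂(areaMeasure X.g f) = 0 := by
  have hlf := isLocallyFiniteMeasure_areaMeasure X hf
  -- `I ρ` is the integral of `d(ρ τ)`. It is additive in `ρ` and vanishes on multiples of the
  -- cut-off functions `χ p`; so `ρ` may be multiplied by `1 - χ p` for finitely many points `p`.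
  -- When the `χ p` equal `1` on a cover of `C`, the product of these factors vanishes near `C`.
  let I : (S → ℝ) → ℝ := fun ρ => ∫ q, (ρ q * F q + wedgeRatio D ρ τ q) ∂(areaMeasure X.g f)
  have hint : ∀ ρ : S → ℝ, ContMDiff (𝓡 2) 𝓘(ℝ, ℝ) 1 ρ →
      Integrable (fun q => ρ q * F q + wedgeRatio D ρ τ q) (areaMeasure X.g f) := by
    intro ρ hρ
    refine ((hρ.continuous.mul hc.continuous_F).add
      (hc.continuous_wedgeRatio hρ)).integrable_of_hasCompactSupport
      (HasCompactSupport.intro hc.isCompact fun q hq => ?_)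
    change ρ q * F q + wedgeRatio D ρ τ q = 0
    rw [hc.F_zero q hq, wedgeRatio_eq_zero (Or.inr (hc.τ_zero q hq))]
    simp
  have hadd : ∀ ρ ρ' : S → ℝ, ContMDiff (𝓡 2) 𝓘(ℝ, ℝ) 1 ρ → ContMDiff (𝓡 2) 𝓘(ℝ, ℝ) 1 ρ' →
      I (ρ + ρ') = I ρ + I ρ' := by
    intro ρ ρ' hρ hρ'
    rw [← integral_add (hint ρ hρ) (hint ρ' hρ')]
    refine integral_congr_ae (ae_of_all _ fun q => ?_)
    have h1 := mfderiv_add (hρ.mdifferentiable (by simp) q) (hρ'.mdifferentiable (by simp) q)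
    let d : E2 →L[ℝ] ℝ := mfderiv (𝓡 2) 𝓘(ℝ, ℝ) ρ q
    let d' : E2 →L[ℝ] ℝ := mfderiv (𝓡 2) 𝓘(ℝ, ℝ) ρ' q
    let d'' : E2 →L[ℝ] ℝ := mfderiv (𝓡 2) 𝓘(ℝ, ℝ) (ρ + ρ') q
    let t : E2 →L[ℝ] ℝ := τ q
    have h2 : ∀ v, d'' v = d v + d' v := fun v => DFunLike.congr_fun h1 v
    change (ρ q + ρ' q) * F q + (d'' e₁ * t e₂ - d'' e₂ * t e₁) / D q
      = (ρ q * F q + (d e₁ * t e₂ - d e₂ * t e₁) / D q)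
        + (ρ' q * F q + (d' e₁ * t e₂ - d' e₂ * t e₁) / D q)
    rw [h2, h2]
    ring
  choose! χ hχ hχ1 hχI using fun p (hp : p ∈ C) => hc.exists_cutoff hf hD hp
  have hprod : ∀ t : Finset S, (∀ p ∈ t, p ∈ C) → ∀ ρ : S → ℝ, ContMDiff (𝓡 2) 𝓘(ℝ, ℝ) 1 ρ →
      I ρ = I (ρ * ∏ p ∈ t, (1 - χ p)) := by
    classical
    intro t
    induction t using Finset.induction_on with
    | empty => intro _ ρ _; simp
    | insert a t ha ih =>
      intro ht ρ hρ
      have haC := ht a (Finset.mem_insert_self a t)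
      have h1 : ContMDiff (𝓡 2) 𝓘(ℝ, ℝ) 1 (ρ * (1 - χ a)) :=
        hρ.mul (contMDiff_const.sub (hχ a haC))
      have h2 : ρ = ρ * χ a + ρ * (1 - χ a) := by ring
      rw [Finset.prod_insert ha, ← mul_assoc,
        ← ih (fun p hp => ht p (Finset.mem_insert_of_mem hp)) _ h1]
      conv_lhs => rw [h2]
      rw [hadd _ _ (hρ.mul (hχ a haC)) h1]
      have h3 : I (ρ * χ a) = 0 := hχI a haC ρ hρ
      rw [h3, zero_add]
  obtain ⟨t, htC, htcov⟩ := hc.isCompact.elim_nhds_subcover (fun p => {q | χ p =ᶠ[𝓝 q] 1})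
    (fun p hp => eventually_eventually_nhds.mpr (hχ1 p hp))
  have h1 : I 1 = ∫ q, F q ∂(areaMeasure X.g f) := by
    refine integral_congr_ae (ae_of_all _ fun q => ?_)
    have h2 : (mfderiv (𝓡 2) 𝓘(ℝ, ℝ) (1 : S → ℝ) q : E2 →L[ℝ] ℝ) = 0 := mfderiv_const
    change 1 * F q + wedgeRatio D 1 τ q = F q
    rw [wedgeRatio_eq_zero (Or.inl h2)]
    ring
  rw [← h1, hprod t htC 1 contMDiff_const]
  refine (integral_congr_ae (g := fun _ => (0 : ℝ)) (ae_of_all _ fun q => ?_)).trans (by simp)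
  by_cases hq : q ∈ C
  · obtain ⟨p, hp, hpq⟩ := mem_iUnion₂.mp (htcov hq)
    have h3 : (1 * ∏ p ∈ t, (1 - χ p)) =ᶠ[𝓝 q] fun _ => (0 : ℝ) := by
      filter_upwards [hpq] with z hz
      have h4 : ∏ p ∈ t, (1 - χ p) z = 0 := Finset.prod_eq_zero hp (by simp [hz])
      simp only [one_mul, Finset.prod_apply, h4]
    have h5 : (mfderiv (𝓡 2) 𝓘(ℝ, ℝ) (1 * ∏ p ∈ t, (1 - χ p)) q : E2 →L[ℝ] ℝ) = 0 :=
      h3.mfderiv_eq.trans mfderiv_const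
    change (1 * ∏ p ∈ t, (1 - χ p)) q * F q + wedgeRatio D (1 * ∏ p ∈ t, (1 - χ p)) τ q = 0
    rw [h3.self_of_nhds, wedgeRatio_eq_zero (Or.inl h5)]
    ring
  · change (1 * ∏ p ∈ t, (1 - χ p)) q * F q + wedgeRatio D (1 * ∏ p ∈ t, (1 - χ p)) τ q = 0
    rw [hc.F_zero q hq, wedgeRatio_eq_zero (Or.inr (hc.τ_zero q hq))]
    ring

end IsCurl

end Stokes

/-! ### Integrals depending on a parameter -/

section Parametric

lemma contDiffAt_two_of_hasDerivAt {f f' f'' : ℝ → ℝ} {x : ℝ}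
    (h1 : ∀ᶠ s in 𝓝 x, HasDerivAt f (f' s) s) (h2 : ∀ᶠ s in 𝓝 x, HasDerivAt f' (f'' s) s)
    (h3 : ∀ᶠ s in 𝓝 x, ContinuousAt f'' s) :
    ContDiffAt ℝ 2 f x ∧ iteratedDeriv 2 f x = f'' x := by
  obtain ⟨W, hW, hWo, hxW⟩ := eventually_nhds_iff.mp (h1.and (h2.and h3))
  have hd : ∀ s ∈ W, deriv f s = f' s := fun s hs => (hW s hs).1.deriv
  have hd2 : ∀ s ∈ W, deriv f' s = f'' s := fun s hs => (hW s hs).2.1.deriv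
  have hc1 : ContDiffOn ℝ 1 f' W := by
    rw [show (1 : WithTop ℕ∞) = 0 + 1 from rfl, contDiffOn_succ_iff_deriv_of_isOpen hWo]
    refine ⟨fun s hs => (hW s hs).2.1.differentiableAt.differentiableWithinAt, by simp, ?_⟩
    rw [contDiffOn_zero]
    exact ContinuousOn.congr (fun s hs => (hW s hs).2.2.continuousWithinAt) hd2
  have hc2 : ContDiffOn ℝ 2 f W := by
    rw [show (2 : WithTop ℕ∞) = 1 + 1 by norm_num, contDiffOn_succ_iff_deriv_of_isOpen hWo]
    exact ⟨fun s hs => (hW s hs).1.differentiableAt.differentiableWithinAt, by simp,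
      hc1.congr hd⟩
  refine ⟨hc2.contDiffAt (hWo.mem_nhds hxW), ?_⟩
  rw [iteratedDeriv_succ, iteratedDeriv_one]
  have : deriv f =ᶠ[𝓝 x] f' := by
    filter_upwards [hWo.mem_nhds hxW] with s hs using hd s hs
  rw [this.deriv_eq, hd2 x hxW]

variable {S : Type*} [TopologicalSpace S]

/-- Near `{0} × C` the function `b` has the continuous partial derivative `b'` with respect to the
parameter. -/
def HasParamDeriv (b b' : ℝ → S → ℝ) (C : Set S) : Prop :=
  ∀ p ∈ C, ∀ᶠ z in 𝓝 ((0 : ℝ), p), HasDerivAt (fun t => b t z.2) (b' z.1 z.2) z.1 ∧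
    ContinuousAt (fun w : ℝ × S => b w.1 w.2) z ∧ ContinuousAt (fun w : ℝ × S => b' w.1 w.2) z

variable [MeasurableSpace S] [BorelSpace S] [SecondCountableTopology S] [T2Space S]
  {μ : Measure S} [IsLocallyFiniteMeasure μ] {C : Set S}

/-- By compactness, a function continuous along `{s} × C` is bounded on a neighbourhood of it. -/
lemma exists_uniform_bound (hC : IsCompact C) {b : ℝ → S → ℝ} {s : ℝ}
    (h : ∀ p ∈ C, ContinuousAt (fun w : ℝ × S => b w.1 w.2) (s, p)) :
    ∃ B, ∀ᶠ t in 𝓝 s, ∀ p ∈ C, |b t p| ≤ B := by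
  have hc : ContinuousOn (b s) C := fun p hp =>
    (ContinuousAt.comp (f := fun q => (s, q)) (h p hp) (by fun_prop)).continuousWithinAt
  obtain ⟨B, hB⟩ := hC.exists_bound_of_continuousOn hc
  refine ⟨B + 1, hC.eventually_forall_of_forall_eventually fun p hp => ?_⟩
  have h1 : ‖b s p‖ < B + 1 := by linarith [hB p hp]
  filter_upwards [(h p hp).norm.eventually (gt_mem_nhds h1)] with z hz
  exact hz.le

lemma continuousAt_setIntegral (hC : IsCompact C) {b : ℝ → S → ℝ} {s : ℝ}
    (h : ∀ᶠ t in 𝓝 s, ∀ p ∈ C, ContinuousAt (fun w : ℝ × S => b w.1 w.2) (t, p)) :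
    ContinuousAt (fun t => ∫ p in C, b t p ∂μ) s := by
  obtain ⟨B, hB⟩ := exists_uniform_bound hC h.self_of_nhds
  have hfin : IsFiniteMeasure (μ.restrict C) := ⟨by simpa using hC.measure_lt_top⟩
  refine continuousAt_of_dominated (bound := fun _ => B) ?_ ?_ (integrable_const B) ?_
  · filter_upwards [h] with t ht
    exact ContinuousOn.aestronglyMeasurable (fun p hp => (ContinuousAt.comp (f := fun q => (t, q))
      (ht p hp) (by fun_prop)).continuousWithinAt) hC.measurableSet
  · filter_upwards [hB] with t ht
    filter_upwards [ae_restrict_mem hC.measurableSet] with p hp using ht p hp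
  · filter_upwards [ae_restrict_mem hC.measurableSet] with p hp
    exact ContinuousAt.comp (f := fun t => (t, p)) (h.self_of_nhds p hp) (by fun_prop)

namespace HasParamDeriv

variable {b b' : ℝ → S → ℝ} (hb : HasParamDeriv b b' C) (hC : IsCompact C)
include hb hC

lemma eventually : ∀ᶠ s in 𝓝 (0 : ℝ), ∀ p ∈ C, HasDerivAt (fun t => b t p) (b' s p) s ∧
    ContinuousAt (fun w : ℝ × S => b w.1 w.2) (s, p) ∧
    ContinuousAt (fun w : ℝ × S => b' w.1 w.2) (s, p) :=
  hC.eventually_forall_of_forall_eventually hb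

/-- Differentiation under the integral sign over a compact set. -/
lemma setIntegral : ∀ᶠ s in 𝓝 (0 : ℝ),
    HasDerivAt (fun t => ∫ p in C, b t p ∂μ) (∫ p in C, b' s p ∂μ) s ∧
    ContinuousAt (fun t => ∫ p in C, b' t p ∂μ) s := by
  have hfin : IsFiniteMeasure (μ.restrict C) := ⟨by simpa using hC.measure_lt_top⟩
  filter_upwards [eventually_eventually_nhds.mpr (hb.eventually hC)] with s hs
  have hm : ∀ᶠ t in 𝓝 s, AEStronglyMeasurable (b t) (μ.restrict C) := by
    filter_upwards [hs] with t ht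
    exact ContinuousOn.aestronglyMeasurable (fun p hp => (ContinuousAt.comp (f := fun q => (t, q))
      (ht p hp).2.1 (by fun_prop)).continuousWithinAt) hC.measurableSet
  have hs0 := hs.self_of_nhds
  obtain ⟨B, hB⟩ := exists_uniform_bound hC fun p hp => (hs0 p hp).2.2
  refine ⟨?_, continuousAt_setIntegral hC (hs.mono fun t ht p hp => (ht p hp).2.2)⟩
  refine (hasDerivAt_integral_of_dominated_loc_of_deriv_le (bound := fun _ => B)
    (F' := b') (hB.and hs) hm ?_ ?_ ?_ (integrable_const B) ?_).2
  · have hc : ContinuousOn (b s) C := fun p hp =>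
      (ContinuousAt.comp (f := fun q => (s, q)) (hs0 p hp).2.1 (by fun_prop)).continuousWithinAt
    exact hc.integrableOn_compact hC
  · exact ContinuousOn.aestronglyMeasurable (fun p hp => (ContinuousAt.comp (f := fun q => (s, q))
      (hs0 p hp).2.2 (by fun_prop)).continuousWithinAt) hC.measurableSet
  · filter_upwards [ae_restrict_mem hC.measurableSet] with p hp t ht using ht.1 p hp
  · filter_upwards [ae_restrict_mem hC.measurableSet] with p hp t ht using (ht.2 p hp).1

/-- The primitive of a parametric integral. -/
lemma primitive : ∀ᶠ s in 𝓝 (0 : ℝ),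
    HasDerivAt (fun s => ∫ t in (0 : ℝ)..s, ∫ p in C, b t p ∂μ) (∫ p in C, b s p ∂μ) s := by
  obtain ⟨r, hr, hball⟩ := Metric.eventually_nhds_iff_ball.mp (hb.setIntegral (μ := μ) hC)
  have hc : ContinuousOn (fun t => ∫ p in C, b t p ∂μ) (Metric.ball 0 r) := fun t ht =>
    (hball t ht).1.continuousAt.continuousWithinAt
  filter_upwards [Metric.ball_mem_nhds (0 : ℝ) hr] with s hs
  refine intervalIntegral.integral_hasDerivAt_right ?_ ?_ (hball s hs).1.continuousAt
  · exact (hc.mono ((convex_ball (0 : ℝ) r).ordConnected.uIcc_subset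
      (Metric.mem_ball_self hr) hs)).intervalIntegrable
  · exact hc.stronglyMeasurableAtFilter Metric.isOpen_ball s hs

end HasParamDeriv

end Parametric

/-! ### Vector algebra in a horizontal frame -/

section NormalAlgebra

variable {M : Type*} [TopologicalSpace M] [ChartedSpace E3 M] [IsManifold (𝓡 3) ∞ M]
  {X : SasakianStructure M} {O : Set M} {A B : ∀ q : M, TangentSpace (𝓡 3) q}

namespace IsHorFrame

variable (hf : IsHorFrame X O A B) {q : M} (hq : q ∈ O)
include hf hq

/-- The vector product of two vectors is a multiple of their common unit normal. -/
lemma vol_mul_normal {a b n : TangentSpace (𝓡 3) q} (hn : X.g.inner q n n = 1)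
    (ha : X.g.inner q n a = 0) (hb : X.g.inner q n b = 0) :
    X.vol q a b n * X.g.inner q (A q) n
        = -(X.η q a * X.g.inner q (B q) b - X.η q b * X.g.inner q (B q) a) ∧
      X.vol q a b n * X.g.inner q (B q) n
        = X.η q a * X.g.inner q (A q) b - X.η q b * X.g.inner q (A q) a ∧
      X.vol q a b n * X.g.inner q (X.T q) n
        = X.g.inner q (A q) a * X.g.inner q (B q) b
          - X.g.inner q (B q) a * X.g.inner q (A q) b := by
  rw [hf.inner_eq hq n n] at hn
  rw [hf.inner_eq hq n a] at ha
  rw [hf.inner_eq hq n b] at hb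
  rw [hf.vol_eq hq]
  change _ + _ + X.η q n * X.η q n = 1 at hn
  change _ + _ + X.η q n * X.η q a = 0 at ha
  change _ + _ + X.η q n * X.η q b = 0 at hb
  change _ ∧ _ ∧ _ * X.η q n = _
  set a1 := X.g.inner q (A q) a
  set a2 := X.g.inner q (B q) a
  set a0 := X.η q a
  set b1 := X.g.inner q (A q) b
  set b2 := X.g.inner q (B q) b
  set b0 := X.η q b
  set n1 := X.g.inner q (A q) n
  set n2 := X.g.inner q (B q) n
  set n0 := X.η q n
  refine ⟨?_, ?_, ?_⟩
  · linear_combination (a2 * b0 - a0 * b2) * hn + (n2 * a0 - n0 * a2) * hb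
      - (n2 * b0 - n0 * b2) * ha
  · linear_combination (a0 * b1 - a1 * b0) * hn + (n0 * a1 - n1 * a0) * hb
      - (n0 * b1 - n1 * b0) * ha
  · linear_combination (a1 * b2 - a2 * b1) * hn + (n1 * a2 - n2 * a1) * hb
      - (n1 * b2 - n2 * b1) * ha

lemma hor_eq (v : TangentSpace (𝓡 3) q) :
    X.hor v = X.g.inner q (A q) v • A q + X.g.inner q (B q) v • B q := by
  have h := hf.expand hq v
  rw [SasakianStructure.hor, X.g.symm q v (X.T q)]
  nth_rewrite 1 [h]
  abel

lemma J_eq (v : TangentSpace (𝓡 3) q) :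
    X.J q v = X.g.inner q (A q) v • B q - X.g.inner q (B q) v • A q := by
  have h : ∀ w, X.g.inner q w (X.J q v)
      = X.g.inner q w (X.g.inner q (A q) v • B q - X.g.inner q (B q) v • A q) := by
    intro w
    rw [X.g.symm, SasakianStructure.J, inner_sharp, hf.dη_eq hq]
    simp only [map_sub, map_smul, smul_eq_mul]
    rw [X.g.symm q w, X.g.symm q w]
  exact hf.ext_inner hq (h _) (h _) (h _)

/-- The inner products of a linear combination of the frame with the frame. -/
lemma inner_comb (x y t : ℝ) :
    X.g.inner q (A q) (x • A q + y • B q + t • X.T q) = x ∧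
    X.g.inner q (B q) (x • A q + y • B q + t • X.T q) = y ∧
    X.g.inner q (X.T q) (x • A q + y • B q + t • X.T q) = t := by
  have e7 : X.g.inner q (B q) (A q) = 0 := by rw [X.g.symm, hf.AB q hq]
  have e8 : X.g.inner q (X.T q) (A q) = 0 := by rw [X.g.symm, hf.AT q hq]
  have e9 : X.g.inner q (X.T q) (B q) = 0 := by rw [X.g.symm, hf.BT q hq]
  simp [hf.AA q hq, hf.BB q hq, hf.AB q hq, hf.AT q hq, hf.BT q hq, X.unit_T q, e7, e8, e9]

end IsHorFrame

variable {S : Type*} [TopologicalSpace S] [ChartedSpace E2 S]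

/-- The covariant derivative of a vector field along a map in terms of its components with respect
to the frame `A, B, T`. -/
lemma IsHorFrame.covDeriv_comb (hf : IsHorFrame X O A B) {f : S → M} {p : S} (hq : f p ∈ O)
    (hfp : MDifferentiableAt (𝓡 2) (𝓡 3) f p)
    {Y : ∀ q : S, TangentSpace (𝓡 3) (f q)} {a b t : S → ℝ} {a' b' t' : E2 →L[ℝ] ℝ}
    (ha : HasMFDerivAt (𝓡 2) 𝓘(ℝ, ℝ) a p a') (hb : HasMFDerivAt (𝓡 2) 𝓘(ℝ, ℝ) b p b')
    (ht : HasMFDerivAt (𝓡 2) 𝓘(ℝ, ℝ) t p t')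
    (hY : ∀ᶠ q in 𝓝 p, Y q = a q • A (f q) + b q • B (f q) + t q • X.T (f q)) (v : E2) :
    let u := mfderiv (𝓡 2) (𝓡 3) f p v
    covDeriv X.g (𝓡 2) f Y p v
      = (a' v - b p * connForm X A B (f p) u - t p * X.g.inner (f p) (B (f p)) u) • A (f p)
        + (b' v + a p * connForm X A B (f p) u + t p * X.g.inner (f p) (A (f p)) u) • B (f p)
        + (t' v + a p * X.g.inner (f p) (B (f p)) u - b p * X.g.inner (f p) (A (f p)) u)
          • X.T (f p) := by
  intro u
  have h := covDeriv_sum X.g (I' := 𝓡 2) (f := f) (Y := Y) (p := p) (n := 3)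
    (a := ![a, b, t]) (W := ![A, B, X.T]) (df := mfderiv (𝓡 2) (𝓡 3) f p)
    hfp.hasMFDerivAt (da := ![a', b', t']) (by intro i; fin_cases i <;> assumption)
    (by
      intro i
      fin_cases i
      · exact (hf.diffA hq).differentiableAt (by simp)
      · exact (hf.diffB hq).differentiableAt (by simp)
      · exact (contDiffAt_T_center (X := X) (f p)).differentiableAt (by simp))
    (by
      filter_upwards [hY] with q hq
      rw [hq, Fin.sum_univ_three]; rfl)
    (w := ![A (f p), B (f p), X.T (f p)]) (by intro i; fin_cases i <;> rfl) v
  rw [Fin.sum_univ_three] at h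
  let A0 : TangentSpace (𝓡 3) (f p) := A (f p)
  let B0 : TangentSpace (𝓡 3) (f p) := B (f p)
  let T0 : TangentSpace (𝓡 3) (f p) := X.T (f p)
  have h2 : covDeriv X.g (𝓡 2) f Y p v = (a' v • A0 + a p • covAt X.g A (f p) u)
      + (b' v • B0 + b p • covAt X.g B (f p) u) + (t' v • T0 + t p • covAt X.g X.T (f p) u) := h
  rw [h2, hf.covAt_A hq, hf.covAt_B hq, hf.covAt_T hq]
  change _ = _ • A0 + _ • B0 + _ • T0
  change (a' v • A0 + a p • (connForm X A B (f p) u • B0 + _ • T0))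
    + (b' v • B0 + b p • (-(connForm X A B (f p) u) • A0 - _ • T0))
    + (t' v • T0 + t p • (_ • B0 - _ • A0)) = _
  module

end NormalAlgebra

/-! ### The characteristic field, mean curvature and shape operator -/

section SurfaceGeometry

variable {M : Type*} [TopologicalSpace M] [ChartedSpace E3 M] [IsManifold (𝓡 3) ∞ M]
  {X : SasakianStructure M} {S : Type*} [TopologicalSpace S] [ChartedSpace E2 S]

namespace OrientedSurface

variable (F : OrientedSurface X S)

/-- The volume of the images of the coordinate basis of the tangent plane and the unit normal. -/
def normalDet (p : S) : ℝ :=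
  X.vol (F.f p) (mfderiv (𝓡 2) (𝓡 3) F.f p e₁) (mfderiv (𝓡 2) (𝓡 3) F.f p e₂) (F.N p)

lemma sq_normalDet (p : S) : F.normalDet p ^ 2
    = gram X.g (F.f p) (mfderiv (𝓡 2) (𝓡 3) F.f p e₁) (mfderiv (𝓡 2) (𝓡 3) F.f p e₂) :=
  sq_vol X (F.unit_N p) (F.normal_N p _) (F.normal_N p _)

lemma abs_normalDet (p : S) : |F.normalDet p| = areaUnit X F.f p := by
  rw [areaUnit, ← F.sq_normalDet, Real.sqrt_sq_eq_abs]

lemma normalDet_ne_zero (p : S) : F.normalDet p ≠ 0 := by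
  have := areaUnit_pos X (F.immersion p)
  rw [← F.abs_normalDet] at this
  exact abs_pos.mp this

lemma sq_normNh_add_sq_NT (p : S) : F.normNh p ^ 2 + F.NT p ^ 2 = 1 := by
  obtain ⟨O, A, B, hO, hf⟩ := exists_isHorFrame X (F.f p)
  have h1 := F.unit_N p
  have h2 := len_sq X.g (X.hor (F.N p))
  have h3 : X.hor (F.N p) = X.g.inner _ (A (F.f p)) (F.N p) • A (F.f p)
      + X.g.inner _ (B (F.f p)) (F.N p) • B (F.f p) + (0 : ℝ) • X.T (F.f p) := by
    rw [hf.hor_eq hO]; simp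
  obtain ⟨h4, h5, h6⟩ := hf.inner_comb hO (X.g.inner _ (A (F.f p)) (F.N p))
    (X.g.inner _ (B (F.f p)) (F.N p)) 0
  rw [hf.inner_eq hO, h3, h4, h5, h6, ← h3] at h2
  rw [hf.inner_eq hO] at h1
  rw [normNh, NT, h2, X.g.symm (F.f p) (F.N p)]
  linear_combination h1

lemma normNh_nonneg (p : S) : 0 ≤ F.normNh p := Real.sqrt_nonneg _

/-- The volume spanned by a vector and the tangent plane measures the normal component. -/
lemma vol_eq_normalDet_mul (p : S) (w : TangentSpace (𝓡 3) (F.f p)) :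
    X.vol (F.f p) w (mfderiv (𝓡 2) (𝓡 3) F.f p e₁) (mfderiv (𝓡 2) (𝓡 3) F.f p e₂)
      = F.normalDet p * X.g.inner (F.f p) (F.N p) w := by
  obtain ⟨O, A, B, hO, hf⟩ := exists_isHorFrame X (F.f p)
  obtain ⟨h1, h2, h3⟩ := hf.vol_mul_normal hO (F.unit_N p) (F.normal_N p e₁) (F.normal_N p e₂)
  change F.normalDet p * _ = _ at h1
  change F.normalDet p * _ = _ at h2
  change F.normalDet p * _ = _ at h3
  rw [hf.inner_eq hO (F.N p) w, hf.vol_eq hO]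
  have e : X.g.inner (F.f p) (X.T (F.f p)) w = X.η (F.f p) w := rfl
  rw [e]
  linear_combination -(X.g.inner (F.f p) (A (F.f p)) w) * h1
    - (X.g.inner (F.f p) (B (F.f p)) w) * h2 - X.η (F.f p) w * h3

/-- The tangent plane is the orthogonal complement of the normal. -/
lemma exists_mfderiv_eq {p : S} {w : TangentSpace (𝓡 3) (F.f p)}
    (hw : X.g.inner (F.f p) (F.N p) w = 0) : ∃ v, mfderiv (𝓡 2) (𝓡 3) F.f p v = w := by
  let L : E2 →L[ℝ] E3 := mfderiv (𝓡 2) (𝓡 3) F.f p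
  let n : E3 →L[ℝ] ℝ := X.g.inner (F.f p) (F.N p)
  let N : E3 := F.N p
  have hL : Function.Injective (L : E2 →ₗ[ℝ] E3) := F.immersion p
  have h1 : LinearMap.range (L : E2 →ₗ[ℝ] E3) ≤ LinearMap.ker (n : E3 →ₗ[ℝ] ℝ) := by
    rintro _ ⟨v, rfl⟩
    exact F.normal_N p v
  have h2 : Module.finrank ℝ (LinearMap.range (L : E2 →ₗ[ℝ] E3)) = 2 := by
    rw [LinearMap.finrank_range_of_inj hL]; simp
  have h3 : LinearMap.range (n : E3 →ₗ[ℝ] ℝ) = ⊤ := by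
    rw [LinearMap.range_eq_top]
    intro c
    refine ⟨c • N, ?_⟩
    have : n N = 1 := F.unit_N p
    simp [this]
  have h4 := LinearMap.finrank_range_add_finrank_ker (n : E3 →ₗ[ℝ] ℝ)
  rw [h3, finrank_top] at h4
  have h5 : Module.finrank ℝ (LinearMap.ker (n : E3 →ₗ[ℝ] ℝ)) = 2 := by
    simp at h4; omega
  have h6 := Submodule.eq_of_le_of_finrank_eq h1 (h2.trans h5.symm)
  have h7 : (w : E3) ∈ LinearMap.ker (n : E3 →ₗ[ℝ] ℝ) := hw
  rw [← h6] at h7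
  exact h7

/-- On the regular set the normal is not a multiple of `T`, since the tangent plane is not
horizontal. -/
lemma normNh_pos {p : S} (hp : p ∈ F.regularSet) : 0 < F.normNh p := by
  refine lt_of_le_of_ne (F.normNh_nonneg p) fun h0 => ?_
  obtain ⟨v, hv⟩ := hp
  refine hv ?_
  have h1 : X.hor (F.N p) = 0 := by
    by_contra h
    exact (len_pos X.g h).ne h0
  have h2 : F.N p = X.g.inner (F.f p) (F.N p) (X.T (F.f p)) • X.T (F.f p) := sub_eq_zero.mp h1
  have h3 := F.normal_N p v
  have h4 := F.unit_N p
  rw [h2] at h3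
  simp only [map_smul, _root_.smul_apply, smul_eq_mul] at h3
  rcases mul_eq_zero.mp h3 with h | h
  · rw [h] at h2
    rw [h2] at h4
    simp at h4
  · exact h

lemma not_isVertical_ne_zero {p : S} (h : ¬ F.IsVertical p) : F.NT p ≠ 0 := fun h0 =>
  h (F.exists_mfderiv_eq h0)

lemma firstForm_apply (p : S) (u v : TangentSpace (𝓡 2) p) : F.firstForm p u v
    = X.g.inner (F.f p) (mfderiv (𝓡 2) (𝓡 3) F.f p u) (mfderiv (𝓡 2) (𝓡 3) F.f p v) := rfl

lemma inner_mfderiv_lift (p : S) (w : TangentSpace (𝓡 3) (F.f p)) (v : TangentSpace (𝓡 2) p) :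
    X.g.inner (F.f p) (mfderiv (𝓡 2) (𝓡 3) F.f p (F.lift p w)) (mfderiv (𝓡 2) (𝓡 3) F.f p v)
      = X.g.inner (F.f p) w (mfderiv (𝓡 2) (𝓡 3) F.f p v) := by
  have : FiniteDimensional ℝ (TangentSpace (𝓡 2) p) := inferInstanceAs (FiniteDimensional ℝ E2)
  have : T2Space (TangentSpace (𝓡 2) p) := inferInstanceAs (T2Space E2)
  have hpos : ∀ v, v ≠ 0 → 0 < F.firstForm p v v := by
    intro v hv
    rw [F.firstForm_apply]
    refine X.g.pos _ _ fun h => hv (F.immersion p ?_)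
    rw [h, map_zero]
  have h := apply_inverse_of_pos (V := TangentSpace (𝓡 2) p) (F.firstForm p) hpos
    ((X.g.inner (F.f p) w).comp (mfderiv (𝓡 2) (𝓡 3) F.f p))
  exact DFunLike.congr_fun h v

lemma lift_mfderiv (p : S) (v : TangentSpace (𝓡 2) p) :
    F.lift p (mfderiv (𝓡 2) (𝓡 3) F.f p v) = v := by
  have h := fun w => F.inner_mfderiv_lift p (mfderiv (𝓡 2) (𝓡 3) F.f p v) w
  refine F.immersion p (sub_eq_zero.mp ?_)
  by_contra h0
  have h1 := X.g.pos _ _ h0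
  rw [← map_sub, ] at h1
  have h2 := h (F.lift p (mfderiv (𝓡 2) (𝓡 3) F.f p v) - v)
  rw [map_sub (mfderiv (𝓡 2) (𝓡 3) F.f p)] at h1
  simp only [map_sub, _root_.sub_apply] at h1 h2
  linarith

section Frame

variable {F} {O : Set M} {A B : ∀ q : M, TangentSpace (𝓡 3) q} (hf : IsHorFrame X O A B)
include hf

/-- The angle of `ν` and `Z` with the frame is described by the functions `c` and `d`: here
`ν = d A - c B`, and `Z = c A + d B` in `Z_eq`. -/
lemma ν_eq {p : S} (hO : F.f p ∈ O) {c d : ℝ} (hn : F.normNh p ≠ 0)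
    (hA : X.g.inner (F.f p) (A (F.f p)) (F.N p) = d * F.normNh p)
    (hB : X.g.inner (F.f p) (B (F.f p)) (F.N p) = -c * F.normNh p) :
    F.ν p = d • A (F.f p) + (-c) • B (F.f p) + (0 : ℝ) • X.T (F.f p) := by
  rw [ν, hf.hor_eq hO, hA, hB, smul_add, smul_smul, smul_smul, zero_smul, add_zero]
  congr 2 <;> field_simp

lemma Z_eq {p : S} (hO : F.f p ∈ O) {c d : ℝ} (hn : F.normNh p ≠ 0)
    (hA : X.g.inner (F.f p) (A (F.f p)) (F.N p) = d * F.normNh p)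
    (hB : X.g.inner (F.f p) (B (F.f p)) (F.N p) = -c * F.normNh p) :
    F.Z p = c • A (F.f p) + d • B (F.f p) + (0 : ℝ) • X.T (F.f p) := by
  have h1 := ν_eq hf hO hn hA hB
  obtain ⟨h4, h5, h6⟩ := hf.inner_comb hO d (-c) 0
  rw [Z, hf.J_eq hO, h1, h4, h5]
  module

/-- The characteristic field in terms of the images of the coordinate basis. -/
lemma mfderiv_eq_Z_aux {p : S} (hO : F.f p ∈ O) (hn : F.normNh p ≠ 0) :
    F.Z p = -(F.normalDet p * F.normNh p)⁻¹ • cross X (F.f p)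
      (mfderiv (𝓡 2) (𝓡 3) F.f p e₁) (mfderiv (𝓡 2) (𝓡 3) F.f p e₂) := by
  obtain ⟨h1, h2, h3⟩ := hf.vol_mul_normal hO (F.unit_N p) (F.normal_N p e₁) (F.normal_N p e₂)
  change F.normalDet p * _ = _ at h1
  change F.normalDet p * _ = _ at h2
  have hD := F.normalDet_ne_zero p
  set x := X.g.inner (F.f p) (A (F.f p)) (F.N p) with hx
  set y := X.g.inner (F.f p) (B (F.f p)) (F.N p) with hy
  have hZ := Z_eq (c := -y / F.normNh p) (d := x / F.normNh p) hf hO hn (by field_simp; rfl)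
    (by field_simp; exact hy.symm)
  obtain ⟨h4, h5, h6⟩ := hf.inner_comb hO (-y / F.normNh p) (x / F.normNh p) 0
  rw [← hZ] at h4 h5 h6
  refine hf.ext_inner hO ?_ ?_ ?_
  · rw [h4, map_smul, cross, map_sub, map_smul, map_smul]
    simp only [smul_eq_mul]
    rw [← h2]; field_simp
  · rw [h5, map_smul, cross, map_sub, map_smul, map_smul]
    simp only [smul_eq_mul]
    field_simp
    linear_combination h1
  · rw [h6, map_smul, cross, map_sub, map_smul, map_smul]
    have e : ∀ w, X.g.inner (F.f p) (X.T (F.f p)) w = X.η (F.f p) w := fun w => rfl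
    simp only [smul_eq_mul, e]
    ring

end Frame

/-- The tangent vector of the surface which is mapped to the characteristic field. -/
def charVec (p : S) : E2 :=
  -(F.normalDet p * F.normNh p)⁻¹ • (X.η (F.f p) (mfderiv (𝓡 2) (𝓡 3) F.f p e₁) • e₂
    - X.η (F.f p) (mfderiv (𝓡 2) (𝓡 3) F.f p e₂) • e₁)

lemma mfderiv_charVec {p : S} (hn : F.normNh p ≠ 0) :
    mfderiv (𝓡 2) (𝓡 3) F.f p (F.charVec p) = F.Z p := by
  obtain ⟨O, A, B, hO, hf⟩ := exists_isHorFrame X (F.f p)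
  rw [mfderiv_eq_Z_aux hf hO hn]
  let L : E2 →L[ℝ] E3 := mfderiv (𝓡 2) (𝓡 3) F.f p
  let η : E3 →L[ℝ] ℝ := X.η (F.f p)
  change L (-(F.normalDet p * F.normNh p)⁻¹ • (η (L e₁) • e₂ - η (L e₂) • e₁))
    = -(F.normalDet p * F.normNh p)⁻¹ • (η (L e₁) • L e₂ - η (L e₂) • L e₁)
  simp only [map_smul, map_sub]

lemma lift_Z {p : S} (hn : F.normNh p ≠ 0) : F.lift p (F.Z p) = F.charVec p := by
  rw [← F.mfderiv_charVec hn]; exact F.lift_mfderiv p _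

section Derivatives

variable {F} {O : Set M} {A B : ∀ q : M, TangentSpace (𝓡 3) q} (hf : IsHorFrame X O A B)
  {p : S} (hO : F.f p ∈ O) (hn : F.normNh p ≠ 0) {c d : S → ℝ} {c' d' : E2 →L[ℝ] ℝ}
  (hc : HasMFDerivAt (𝓡 2) 𝓘(ℝ, ℝ) c p c') (hd : HasMFDerivAt (𝓡 2) 𝓘(ℝ, ℝ) d p d')
  (hcd : ∀ᶠ q in 𝓝 p, c q ^ 2 + d q ^ 2 = 1)
  (hN : ∀ᶠ q in 𝓝 p, F.f q ∈ O ∧ F.normNh q ≠ 0 ∧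
    X.g.inner (F.f q) (A (F.f q)) (F.N q) = d q * F.normNh q ∧
    X.g.inner (F.f q) (B (F.f q)) (F.N q) = -c q * F.normNh q)
include hc hd hcd

omit [IsManifold (𝓡 3) ∞ M] in
lemma orth_deriv (v : E2) : c p * c' v + d p * d' v = 0 := by
  have h1 : HasMFDerivAt (𝓡 2) 𝓘(ℝ, ℝ) (fun q => c q • c q + d q • d q) p
      ((c p • c' + c'.smulRight (c p)) + (d p • d' + d'.smulRight (d p)) : E2 →L[ℝ] ℝ) :=
    (hasMFDerivAt_smul_vector hc hc).add (hasMFDerivAt_smul_vector hd hd)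
  have h2 : (fun q => c q • c q + d q • d q) =ᶠ[𝓝 p] fun _ => 1 := by
    filter_upwards [hcd] with q hq
    simp only [smul_eq_mul]; linarith
  have h3 := h1.mfderiv.symm.trans (h2.mfderiv_eq.trans (mfderiv_const))
  have h4 := DFunLike.congr_fun h3 v
  change (c p * c' v + c' v * c p) + (d p * d' v + d' v * d p) = 0 at h4
  linarith

include hf hO hn hN

/-- The covariant derivative of the horizontal Gauss map `ν = d A - c B`. -/
lemma D_ν_eq (hfp : MDifferentiableAt (𝓡 2) (𝓡 3) F.f p) (v : E2) :
    covDeriv X.g (𝓡 2) F.f F.ν p v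
      = (d' v + c p * connForm X A B (F.f p) (mfderiv (𝓡 2) (𝓡 3) F.f p v)) • A (F.f p)
        + (-c' v + d p * connForm X A B (F.f p) (mfderiv (𝓡 2) (𝓡 3) F.f p v)) • B (F.f p)
        + (d p * X.g.inner (F.f p) (B (F.f p)) (mfderiv (𝓡 2) (𝓡 3) F.f p v)
            + c p * X.g.inner (F.f p) (A (F.f p)) (mfderiv (𝓡 2) (𝓡 3) F.f p v)) • X.T (F.f p) := by
  have hY : ∀ᶠ q in 𝓝 p, F.ν q = d q • A (F.f q) + (-c) q • B (F.f q) + (0 : ℝ) • X.T (F.f q) := by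
    filter_upwards [hN] with q hq
    exact ν_eq hf hq.1 hq.2.1 hq.2.2.1 hq.2.2.2
  have h := hf.covDeriv_comb hO hfp hd hc.neg (hasMFDerivAt_const (0 : ℝ) p) hY v
  rw [h]
  simp only [Pi.neg_apply]
  congr 2
  · congr 1; ring
  · congr 1
    change -c' v + _ + _ = _
    ring
  · change (0 : ℝ) + _ - _ = _
    ring

/-- The mean curvature is the rotation of the characteristic field with respect to a horizontal
frame, corrected by the connection form of the frame. The term `⟨D_S ν, S⟩` vanishes. -/
lemma meanCurvature_eq (hfp : MDifferentiableAt (𝓡 2) (𝓡 3) F.f p) : F.meanCurvature p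
    = -(c p * d' (F.charVec p) - d p * c' (F.charVec p) + connForm X A B (F.f p) (F.Z p)) / 2 := by
  have hp := hN.self_of_nhds
  have hcdp := hcd.self_of_nhds
  have hZ := Z_eq hf hO hn hp.2.2.1 hp.2.2.2
  have hν := ν_eq hf hO hn hp.2.2.1 hp.2.2.2
  obtain ⟨z1, z2, z3⟩ := hf.inner_comb hO (c p) (d p) 0
  obtain ⟨n1, n2, n3⟩ := hf.inner_comb hO (d p) (-c p) 0
  rw [← hZ] at z1 z2 z3
  rw [← hν] at n1 n2 n3
  have o1 := orth_deriv hc hd hcd (F.lift p (F.Sv p))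
  -- `⟨df (lift S), Z⟩ = ⟨S, Z⟩ = 0`
  have hS : X.g.inner (F.f p) (F.Z p) (mfderiv (𝓡 2) (𝓡 3) F.f p (F.lift p (F.Sv p))) = 0 := by
    have h := F.inner_mfderiv_lift p (F.Sv p) (F.charVec p)
    rw [F.mfderiv_charVec hn] at h
    rw [X.g.symm, h, hf.inner_eq hO, z1, z2, z3, Sv]
    simp only [map_sub, map_smul, smul_eq_mul, n1, n2]
    rw [hf.AT _ hO, hf.BT _ hO]
    ring
  have e1 : X.g.inner (F.f p) (F.D F.ν p (F.Z p)) (F.Z p) = c p * d' (F.charVec p)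
      - d p * c' (F.charVec p) + connForm X A B (F.f p) (F.Z p) := by
    obtain ⟨y1, y2, y3⟩ := hf.inner_comb hO
      (d' (F.charVec p) + c p * connForm X A B (F.f p) (F.Z p))
      (-c' (F.charVec p) + d p * connForm X A B (F.f p) (F.Z p))
      (d p * X.g.inner (F.f p) (B (F.f p)) (F.Z p) + c p * X.g.inner (F.f p) (A (F.f p)) (F.Z p))
    rw [D, F.lift_Z hn, D_ν_eq hf hO hn hc hd hcd hN hfp, F.mfderiv_charVec hn, hf.inner_eq hO, y1,
      y2, y3, z1, z2, z3]
    linear_combination connForm X A B (F.f p) (F.Z p) * hcdp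
  have e2 : X.g.inner (F.f p) (F.D F.ν p (F.Sv p)) (F.Sv p) = 0 := by
    rw [D]
    set v := F.lift p (F.Sv p)
    set u := mfderiv (𝓡 2) (𝓡 3) F.f p v with hu
    rw [hf.inner_eq hO, z1, z2, z3] at hS
    obtain ⟨y1, y2, y3⟩ := hf.inner_comb hO
      (d' v + c p * connForm X A B (F.f p) u)
      (-c' v + d p * connForm X A B (F.f p) u)
      (d p * X.g.inner (F.f p) (B (F.f p)) u + c p * X.g.inner (F.f p) (A (F.f p)) u)
    refine (congrArg (fun W : TangentSpace (𝓡 3) (F.f p) => X.g.inner (F.f p) W (F.Sv p))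
      (D_ν_eq hf hO hn hc hd hcd hN hfp v)).trans ?_
    set W := (d' v + c p * connForm X A B (F.f p) u) • A (F.f p)
      + (-c' v + d p * connForm X A B (F.f p) u) • B (F.f p)
      + (d p * X.g.inner (F.f p) (B (F.f p)) u + c p * X.g.inner (F.f p) (A (F.f p)) u)
        • X.T (F.f p)
    have w1 : X.g.inner (F.f p) W (F.ν p) = 0 := by
      rw [hf.inner_eq hO, y1, y2, y3, n1, n2, n3]
      linear_combination o1
    have w2 : X.g.inner (F.f p) W (X.T (F.f p)) = 0 := by
      rw [X.g.symm, y3]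
      linear_combination hS
    rw [Sv, map_sub, map_smul, map_smul, w1, w2]
    simp
  rw [meanCurvature, e1, e2]
  ring

/-- The two expressions involving the shape operator in the Jacobi operator depend only on the
derivatives of `|N_h|` and `⟨N, T⟩` along the characteristic field, and on the mean curvature. -/
lemma B_Z_eq (hfp : MDifferentiableAt (𝓡 2) (𝓡 3) F.f p) {n' t' : E2 →L[ℝ] ℝ}
    (hn' : HasMFDerivAt (𝓡 2) 𝓘(ℝ, ℝ) F.normNh p n') (ht' : HasMFDerivAt (𝓡 2) 𝓘(ℝ, ℝ) F.NT p t') :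
    X.g.inner (F.f p) (F.B p (F.Z p)) (F.Sv p) = 
      F.NT p * (F.NT p - n' (F.charVec p)) + F.normNh p * (F.normNh p + t' (F.charVec p)) ∧
    len X.g (F.B p (F.Z p) + F.Sv p) ^ 2 = (2 * F.NT p - n' (F.charVec p)) ^ 2
      + (F.normNh p * (2 * F.meanCurvature p)) ^ 2
      + (2 * F.normNh p + t' (F.charVec p)) ^ 2 := by
  have hp := hN.self_of_nhds
  have hcdp := hcd.self_of_nhds
  have hZ := Z_eq hf hO hn hp.2.2.1 hp.2.2.2
  have hν := ν_eq hf hO hn hp.2.2.1 hp.2.2.2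
  obtain ⟨z1, z2, z3⟩ := hf.inner_comb hO (c p) (d p) 0
  obtain ⟨n1, n2, n3⟩ := hf.inner_comb hO (d p) (-c p) 0
  rw [← hZ] at z1 z2 z3
  have hY : ∀ᶠ q in 𝓝 p, F.N q = (d q • F.normNh q) • A (F.f q)
      + ((-c) q • F.normNh q) • B (F.f q) + F.NT q • X.T (F.f q) := by
    filter_upwards [hN] with q hq
    rw [smul_eq_mul, smul_eq_mul, Pi.neg_apply, ← hq.2.2.1, ← hq.2.2.2, NT, X.g.symm (F.f q) (F.N q)]
    exact hf.expand hq.1 _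
  have hcov := hf.covDeriv_comb hO hfp (hasMFDerivAt_smul_vector hd hn')
    (hasMFDerivAt_smul_vector hc.neg hn') ht' hY (F.charVec p)
  simp only [F.mfderiv_charVec hn, z1, z2, Pi.neg_apply, smul_eq_mul] at hcov
  have hH := meanCurvature_eq hf hO hn hc hd hcd hN hfp
  have o := orth_deriv hc hd hcd (F.charVec p)
  set v := F.charVec p
  set ϖ := connForm X A B (F.f p) (F.Z p)
  set n := F.normNh p
  set t := F.NT p
  have hBc : F.B p (F.Z p)
      = (-(d' v * n + d p * n' v + c p * n * ϖ - t * d p)) • A (F.f p)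
        + (-(-c' v * n - c p * n' v + d p * n * ϖ + t * c p)) • B (F.f p)
        + (-(t' v + n)) • X.T (F.f p) := by
    rw [OrientedSurface.B, D, F.lift_Z hn]
    refine (congrArg (fun a => -a) hcov).trans ?_
    rw [neg_add, neg_add, ← neg_smul, ← neg_smul, ← neg_smul]
    congr 2
    · congr 2
      change (d p * n' v + d' v * n) - _ - _ = _
      ring
    · congr 2
      change (-c p * n' v + -c' v * n) + _ + _ = _
      ring
    · congr 1
      linear_combination n * hcdp
  have hSc : F.Sv p = (t * d p) • A (F.f p) + (-(t * c p)) • B (F.f p) + (-n) • X.T (F.f p) := by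
    rw [Sv, hν]; module
  obtain ⟨b1, b2, b3⟩ := hf.inner_comb hO (-(d' v * n + d p * n' v + c p * n * ϖ - t * d p))
    (-(-c' v * n - c p * n' v + d p * n * ϖ + t * c p)) (-(t' v + n))
  obtain ⟨s1, s2, s3⟩ := hf.inner_comb hO (t * d p) (-(t * c p)) (-n)
  rw [← hBc] at b1 b2 b3
  rw [← hSc] at s1 s2 s3
  refine ⟨?_, ?_⟩
  · rw [hf.inner_eq hO, b1, b2, b3, s1, s2, s3]
    linear_combination (t * (t - n' v)) * hcdp - t * n * o
  · rw [len_sq, hf.inner_eq hO, map_add, map_add, map_add, b1, b2, b3, s1, s2, s3, hH]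
    linear_combination ((2 * t - n' v) ^ 2 + n ^ 2 * ϖ ^ 2 - n ^ 2 * (c' v ^ 2 + d' v ^ 2)) * hcdp
      - 2 * n * (2 * t - n' v) * o + n ^ 2 * (c p * c' v + d p * d' v) * o

end Derivatives

end OrientedSurface

end SurfaceGeometry

/-! ### Orientation of charts -/

section Orientation

variable {M : Type*} [TopologicalSpace M] [ChartedSpace E3 M] [IsManifold (𝓡 3) ∞ M]
  {X : SasakianStructure M} {S : Type*} [TopologicalSpace S] [ChartedSpace E2 S]

namespace OrientedSurface

variable (F : OrientedSurface X S)

lemma continuousAt_inner_N {W : ∀ q : M, TangentSpace (𝓡 3) q} {p : S}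
    (hW : ContMDiffAt (𝓡 3) (𝓡 3).tangent 0 (fun q => (⟨q, W q⟩ : TangentBundle (𝓡 3) M)) (F.f p)) :
    ContinuousAt (fun q => X.g.inner (F.f q) (W (F.f q)) (F.N q)) p := by
  have hf0 : ContMDiffAt (𝓡 2) (𝓡 3) 0 F.f p := F.contMDiff_f.contMDiffAt.of_le (by simp)
  have h1 := ((X.g.contMDiff (F.f p)).of_le (m := 0) (by simp)).comp p hf0
  have hN : ContMDiffAt (𝓡 2) (𝓡 3).tangent 0
      (fun q => (⟨F.f q, F.N q⟩ : TangentBundle (𝓡 3) M)) p :=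
    contMDiff_zero_iff.mpr F.continuous_N p
  have h3 := ContMDiffAt.clm_bundle_apply₂ (F₃ := ℝ) (E₃ := Bundle.Trivial M ℝ) h1
      (hW.comp p hf0) hN
  rw [contMDiffAt_totalSpace] at h3
  exact h3.2.continuousAt

variable [IsManifold (𝓡 2) 2 S]

/-- The volume of the coordinate frame of a chart and the unit normal. -/
def frameDet (e : OpenPartialHomeomorph S E2) (y : E2) : ℝ :=
  chartDet e y * F.normalDet (e.symm y)

lemma frameDet_ne_zero {e : OpenPartialHomeomorph S E2} (he : e ∈ atlas E2 S) {y : E2}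
    (hy : y ∈ e.target) : F.frameDet e y ≠ 0 :=
  mul_ne_zero (chartDet_ne_zero he hy) (F.normalDet_ne_zero _)

lemma frameDet_eq {e : OpenPartialHomeomorph S E2} (he : e ∈ atlas E2 S) {y : E2}
    (hy : y ∈ e.target) (w : TangentSpace (𝓡 3) (F.f (e.symm y))) :
    X.vol (F.f (e.symm y)) (dMap (F.f ∘ e.symm) y e₁) (dMap (F.f ∘ e.symm) y e₂) w
      = chartDet e y * X.vol (F.f (e.symm y)) (mfderiv (𝓡 2) (𝓡 3) F.f (e.symm y) e₁)
        (mfderiv (𝓡 2) (𝓡 3) F.f (e.symm y) e₂) w := by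
  have hd := F.contMDiff_f.mdifferentiable (by simp) (e.symm y)
  rw [dMap_comp_chart_symm he hy hd, dMap_comp_chart_symm he hy hd]
  let L : E2 →L[ℝ] E3 := mfderiv (𝓡 2) (𝓡 3) F.f (e.symm y)
  let T : E2 →L[ℝ] E2 := mfderiv (𝓡 2) (𝓡 2) e.symm y
  let η : E3 →L[ℝ] ℝ := X.η (F.f (e.symm y))
  let ζ : E3 → E3 →L[ℝ] ℝ := X.dη (F.f (e.symm y))
  have anti : ∀ a b, ζ a b = - ζ b a := fun a b => extD_antisymm (F.f (e.symm y)) a b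
  have lin : ∀ (r s : ℝ) (a b c : E3), ζ (r • a + s • b) c = r * ζ a c + s * ζ b c := by
    intro r s a b c
    rw [anti, map_add, map_smul, map_smul, anti a c, anti b c, smul_eq_mul, smul_eq_mul]
    ring
  let w₀ : E3 := w
  have h := alternating_apply (fun u v => η (L u) * ζ (L v) w₀ - η (L v) * ζ (L u) w₀
      + ζ (L u) (L v) * η w₀)
    (fun a b u v w => by
      simp only [map_add, map_smul, smul_eq_mul, lin]
      ring)
    (fun u v => by rw [anti (L u) (L v)]; ring) T
  rw [vol_apply, vol_apply]
  exact h

lemma vol_dMap_N {e : OpenPartialHomeomorph S E2} (he : e ∈ atlas E2 S) {y : E2}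
    (hy : y ∈ e.target) : X.vol (F.f (e.symm y)) (dMap (F.f ∘ e.symm) y e₁)
      (dMap (F.f ∘ e.symm) y e₂) (F.N (e.symm y)) = F.frameDet e y :=
  F.frameDet_eq he hy _

lemma normal_dMap {e : OpenPartialHomeomorph S E2} (he : e ∈ atlas E2 S) {y : E2}
    (hy : y ∈ e.target) (b : E2) :
    X.g.inner (F.f (e.symm y)) (F.N (e.symm y)) (dMap (F.f ∘ e.symm) y b) = 0 := by
  rw [dMap_comp_chart_symm he hy (F.contMDiff_f.mdifferentiable (by simp) (e.symm y))]
  exact F.normal_N _ _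

lemma contMDiffAt_chartMap {e : OpenPartialHomeomorph S E2} (he : e ∈ atlas E2 S) {y : E2}
    (hy : y ∈ e.target) : ContMDiffAt (𝓡 2) (𝓡 3) 2 (F.f ∘ e.symm) y :=
  contMDiffAt_comp_chart_symm le_rfl he hy F.contMDiff_f.contMDiffAt

lemma continuousOn_frameDet {e : OpenPartialHomeomorph S E2} (he : e ∈ atlas E2 S) :
    ContinuousOn (F.frameDet e) e.target := by
  intro y hy
  obtain ⟨O, A, B, hO, hf⟩ := exists_isHorFrame X (F.f (e.symm y))
  obtain ⟨h1, h2, h3⟩ := contDiffAt_pullForm_frame X (n := 0) (by simp)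
    ((F.contMDiffAt_chartMap he hy).of_le (by simp)) hf hO
  have hcs : ContinuousAt e.symm y := e.symm.continuousAt hy
  have cA : ContinuousAt (fun z => X.g.inner (F.f (e.symm z)) (A (F.f (e.symm z)))
      (F.N (e.symm z))) y := ContinuousAt.comp (f := e.symm)
    (F.continuousAt_inner_N ((hf.smoothA _ hO).of_le (by simp))) hcs
  have cB : ContinuousAt (fun z => X.g.inner (F.f (e.symm z)) (B (F.f (e.symm z)))
      (F.N (e.symm z))) y := ContinuousAt.comp (f := e.symm)
    (F.continuousAt_inner_N ((hf.smoothB _ hO).of_le (by simp))) hcs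
  have cT : ContinuousAt (fun z => X.g.inner (F.f (e.symm z)) (X.T (F.f (e.symm z)))
      (F.N (e.symm z))) y := ContinuousAt.comp (f := e.symm)
    (F.continuousAt_inner_N ((X.smooth_T _).of_le (by simp))) hcs
  have c1 := fun b => h1.continuousAt.clm_apply (continuousAt_const (y := b))
  have c2 := fun b => h2.continuousAt.clm_apply (continuousAt_const (y := b))
  have c3 := fun b => h3.continuousAt.clm_apply (continuousAt_const (y := b))
  refine ContinuousAt.continuousWithinAt ?_
  have key := (((((c3 e₁).mul (c2 e₂)).sub ((c3 e₂).mul (c2 e₁))).neg.mul cA).add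
    ((((c3 e₁).mul (c1 e₂)).sub ((c3 e₂).mul (c1 e₁))).mul cB)).add
    ((((c1 e₁).mul (c2 e₂)).sub ((c2 e₁).mul (c1 e₂))).mul cT)
  refine key.congr ?_
  have hcf : ContinuousAt (F.f ∘ e.symm) y := (F.contMDiffAt_chartMap he hy).continuousAt
  filter_upwards [e.open_target.mem_nhds hy, hcf.eventually (hf.isOpen.mem_nhds hO)] with z hz hzO'
  have hzO : F.f (e.symm z) ∈ O := hzO'
  obtain ⟨k1, k2, k3⟩ := hf.vol_mul_normal hzO (F.unit_N (e.symm z)) (F.normal_dMap he hz e₁)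
    (F.normal_dMap he hz e₂)
  have hD := F.vol_dMap_N he hz
  have hn := F.unit_N (e.symm z)
  rw [hf.inner_eq hzO] at hn
  refine Eq.trans ?_ hD
  refine (congrArg₂ (fun a b : ℝ => a + b) (congrArg₂ (fun a b : ℝ => a + b)
    (congrArg (fun a : ℝ => a * X.g.inner (F.f (e.symm z)) (A (F.f (e.symm z))) (F.N (e.symm z))) k1.symm)
    (congrArg (fun a : ℝ => a * X.g.inner (F.f (e.symm z)) (B (F.f (e.symm z))) (F.N (e.symm z))) k2.symm))
    (congrArg (fun a : ℝ => a * X.g.inner (F.f (e.symm z)) (X.T (F.f (e.symm z))) (F.N (e.symm z))) k3.symm)).trans ?_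
  rw [mul_assoc, mul_assoc, mul_assoc, ← mul_add, ← mul_add]
  refine (congrArg (fun a : ℝ => _ * a) hn).trans (mul_one _)

end OrientedSurface

end Orientation

/-! ### Variations in charts -/

section Variation

variable {M : Type*} [TopologicalSpace M] [ChartedSpace E3 M] [IsManifold (𝓡 3) ∞ M]
  {X : SasakianStructure M} {S : Type*} [TopologicalSpace S] [ChartedSpace E2 S]
  [IsManifold (𝓡 2) 2 S]

namespace OrientedSurface

variable (F : OrientedSurface X S)

lemma isOpen_regularSet : IsOpen F.regularSet := by
  rw [isOpen_iff_mem_nhds]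
  rintro p ⟨v, hv⟩
  let e := chartAt E2 p
  have he : e ∈ atlas E2 S := chart_mem_atlas E2 p
  have hps : p ∈ e.source := mem_chart_source E2 p
  have ht := e.map_source hps
  obtain ⟨O, A, B, hO, hf⟩ := exists_isHorFrame X (F.f (e.symm (e p)))
  obtain ⟨-, -, h3⟩ := contDiffAt_pullForm_frame X (n := 0) (by simp)
    ((F.contMDiffAt_chartMap he ht).of_le (by simp)) hf hO
  have hval : ∀ z ∈ e.target, ∀ b, pullForm X.η (F.f ∘ e.symm) z b
      = X.η (F.f (e.symm z)) (mfderiv (𝓡 2) (𝓡 3) F.f (e.symm z)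
        (mfderiv (𝓡 2) (𝓡 2) e.symm z b)) := fun z hz b =>
    congrArg (X.η (F.f (e.symm z))) (dMap_comp_chart_symm he hz
      (F.contMDiff_f.mdifferentiable (by simp) (e.symm z)) b)
  let L : E2 →L[ℝ] E2 := mfderiv (𝓡 2) (𝓡 2) e.symm (e p)
  have hsurj : Function.Surjective (L : E2 →ₗ[ℝ] E2) :=
    LinearMap.injective_iff_surjective.mp (mfderiv_chart_symm_injective he ht)
  obtain ⟨b, hb⟩ := hsurj v
  have h0 : pullForm X.η (F.f ∘ e.symm) (e p) b ≠ 0 := by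
    rw [hval _ ht]
    have h1 : ∀ q, q = p → ∀ w : E2, w = v →
        X.η (F.f q) (mfderiv (𝓡 2) (𝓡 3) F.f q w) ≠ 0 := by
      rintro _ rfl _ rfl; exact hv
    exact h1 _ (e.left_inv hps) _ hb
  have h1 : ∀ᶠ z in 𝓝 (e p), pullForm X.η (F.f ∘ e.symm) z b ≠ 0 :=
    (h3.continuousAt.clm_apply (continuousAt_const (y := b))).eventually_ne h0
  filter_upwards [(e.continuousAt hps).eventually h1, e.open_source.mem_nhds hps] with q hq hqs
  rw [hval _ (e.map_source hqs)] at hq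
  have h4 : e.symm (e q) ∈ F.regularSet := ⟨_, hq⟩
  rwa [e.left_inv hqs] at h4

/-- A variation in the coordinates of a chart of the surface. -/
def chartVariation (φ : ℝ → S → M) (e : OpenPartialHomeomorph S E2) (z : ℝ × E2) : M :=
  φ z.1 (e.symm z.2)

end OrientedSurface

/-- The coordinate expression of a map of class `C³` in a chart whose transition maps are `C³`. -/
lemma contMDiffAt_three_chart {Φ : ℝ × S → M} {e : OpenPartialHomeomorph S E2} {s : ℝ} {y : E2}
    (hy : y ∈ e.target) (hτ : ContDiffAt ℝ 3 (chartAt E2 (e.symm y) ∘ e.symm) y)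
    (hΦ : ContMDiffAt (𝓘(ℝ, ℝ).prod (𝓡 2)) (𝓡 3) 3 Φ (s, e.symm y)) :
    ContMDiffAt 𝓘(ℝ, ℝ × E2) (𝓡 3) 3 (fun w : ℝ × E2 => Φ (w.1, e.symm w.2)) (s, y) := by
  rw [contMDiffAt_iff] at hΦ ⊢
  obtain ⟨hc, hd⟩ := hΦ
  have hcs : ContinuousAt (fun w : ℝ × E2 => (w.1, e.symm w.2)) (s, y) :=
    continuousAt_fst.prodMk (ContinuousAt.comp (f := Prod.snd) (e.symm.continuousAt hy)
      continuousAt_snd)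
  refine ⟨ContinuousAt.comp (f := fun w : ℝ × E2 => (w.1, e.symm w.2)) hc hcs, ?_⟩
  let e' := chartAt E2 (e.symm y)
  have hd2 : ContDiffAt ℝ 3 (extChartAt (𝓡 3) (Φ (s, e.symm y)) ∘ Φ ∘
      (extChartAt (𝓘(ℝ, ℝ).prod (𝓡 2)) (s, e.symm y)).symm) (s, e' (e.symm y)) := by
    rw [← contDiffWithinAt_univ]
    simpa using! hd
  have hτ2 : ContDiffAt ℝ 3 (fun w : ℝ × E2 => (w.1, e' (e.symm w.2))) (s, y) :=
    contDiffAt_fst.prodMk (ContDiffAt.comp (f := Prod.snd) (s, y) hτ contDiffAt_snd)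
  have h := ContDiffAt.comp (f := fun w : ℝ × E2 => (w.1, e' (e.symm w.2))) (s, y) hd2 hτ2
  simp only [extChartAt_model_space_eq_id, PartialEquiv.refl_coe, PartialEquiv.refl_symm,
    modelWithCornersSelf_coe, range_id, contDiffWithinAt_univ, Function.comp_id, id_eq]
  refine h.congr_of_eventuallyEq ?_
  have hev : ∀ᶠ w : ℝ × E2 in 𝓝 (s, y), e.symm w.2 ∈ e'.source :=
    (hcs.snd).eventually (e'.open_source.mem_nhds (mem_chart_source E2 _))
  filter_upwards [hev] with w hw
  have : (extChartAt (𝓘(ℝ, ℝ).prod (𝓡 2)) (s, e.symm y)).symm (w.1, e' (e.symm w.2))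
      = (w.1, e.symm w.2) := by
    exact Prod.ext rfl (e'.left_inv hw)
  simp only [Function.comp, this]

namespace OrientedSurface.IsVariation

variable {F : OrientedSurface X S} {I : Set ℝ} {C : Set S} {φ : ℝ → S → M}
  (hv : F.IsVariation F.regularSet I C φ) (hC3 : F.IsC3On F.regularSet)
include hv

lemma contMDiffAt_prod {s : ℝ} (hs : s ∈ I) {p : S} (hp : p ∈ F.regularSet) :
    ContMDiffAt (𝓘(ℝ, ℝ).prod (𝓡 2)) (𝓡 3) 3 (fun z : ℝ × S => φ z.1 z.2) (s, p) :=
  hv.contMDiffOn.contMDiffAt (prod_mem_nhds (hv.isOpen_I.mem_nhds hs)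
    (F.isOpen_regularSet.mem_nhds hp))

lemma eventuallyEq_off [T2Space S] {s : ℝ} (hs : s ∈ I) {p : S} (hp : p ∉ C) :
    φ s =ᶠ[𝓝 p] F.f := by
  filter_upwards [hv.isCompact_C.isClosed.isOpen_compl.mem_nhds hp] with q hq
  exact hv.off s hs q hq

lemma contMDiff [T2Space S] {s : ℝ} (hs : s ∈ I) : ContMDiff (𝓡 2) (𝓡 3) 1 (φ s) := by
  intro p
  by_cases hp : p ∈ C
  · have h1 := (hv.contMDiffAt_prod hs (hv.subset hp)).of_le (m := 1) (by norm_num)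
    exact h1.comp p (contMDiffAt_const.prodMk contMDiffAt_id)
  · exact (F.contMDiff_f.contMDiffAt.of_le (by norm_num)).congr_of_eventuallyEq
      (hv.eventuallyEq_off hs hp)

lemma injective_mfderiv [T2Space S] {s : ℝ} (hs : s ∈ I) (p : S) :
    Function.Injective (mfderiv (𝓡 2) (𝓡 3) (φ s) p) := by
  by_cases hp : p ∈ C
  · exact hv.immersion s hs p (hv.subset hp)
  · have h := (hv.eventuallyEq_off hs hp).mfderiv_eq (I := 𝓡 2) (I' := 𝓡 3)
    have h2 : (mfderiv (𝓡 2) (𝓡 3) (φ s) p : E2 →L[ℝ] E3) = mfderiv (𝓡 2) (𝓡 3) F.f p := h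
    have h3 : Function.Injective (mfderiv (𝓡 2) (𝓡 3) F.f p : E2 →L[ℝ] E3) := F.immersion p
    rw [← h2] at h3
    exact h3

variable {e : OpenPartialHomeomorph S E2} (he : e ∈ atlas E2 S) {s : ℝ} (hs : s ∈ I) {y : E2}
  (hy : y ∈ e.target)
include he hs hy

section
include hC3

lemma contMDiffAt_chart (hp : e.symm y ∈ F.regularSet) :
    ContMDiffAt 𝓘(ℝ, ℝ × E2) (𝓡 3) 3 (chartVariation φ e) (s, y) := by
  refine contMDiffAt_three_chart (Φ := fun z : ℝ × S => φ z.1 z.2) hy ?_ (hv.contMDiffAt_prod hs hp)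
  have h := hC3.1 e he (chartAt E2 (e.symm y)) (chart_mem_atlas E2 _)
  refine h.contDiffAt (IsOpen.mem_nhds ?_ ⟨?_, hp⟩)
  · have h1 : (e.symm.trans (chartAt E2 (e.symm y))).source ∩ e.symm ⁻¹' F.regularSet
      = (e.symm.trans (chartAt E2 (e.symm y))).source ∩
        (e.symm.source ∩ e.symm ⁻¹' F.regularSet) := by
      ext z
      simp only [mem_inter_iff, OpenPartialHomeomorph.trans_source]
      tauto
    rw [h1]
    exact (e.symm.trans _).open_source.inter (e.symm.isOpen_inter_preimage F.isOpen_regularSet)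
  · rw [OpenPartialHomeomorph.trans_source]
    exact ⟨hy, mem_chart_source E2 _⟩

lemma dMap_slice [T2Space S] (hp : e.symm y ∈ F.regularSet) (b : E2) :
    dMap (chartVariation φ e) (s, y) ((0 : ℝ), b)
      = mfderiv (𝓡 2) (𝓡 3) (φ s) (e.symm y) (mfderiv (𝓡 2) (𝓡 2) e.symm y b) := by
  have hk := (hv.contMDiffAt_chart hC3 he hs hy hp).mdifferentiableAt (by simp)
  have hι : HasFDerivAt (fun z : E2 => (s, z)) (ContinuousLinearMap.inr ℝ ℝ E2) y :=
    hasFDerivAt_prodMk_right s y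
  have h1 := dMap_comp (j := chartVariation φ e) (κ := fun z : E2 => (s, z)) (z := y) hk
    hι.differentiableAt
  have h2 := dMap_comp_chart_symm he hy ((hv.contMDiff hs).mdifferentiable (by simp) (e.symm y)) b
  refine Eq.trans ?_ h2
  have h3 := DFunLike.congr_fun h1 b
  rw [hι.fderiv] at h3
  exact h3.symm

lemma dMap_time (hp : e.symm y ∈ F.regularSet) :
    dMap (chartVariation φ e) (s, y) ((1 : ℝ), (0 : E2)) = velocity φ s (e.symm y) := by
  have hk := (hv.contMDiffAt_chart hC3 he hs hy hp).mdifferentiableAt (by simp)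
  have hι : HasFDerivAt (fun t : ℝ => (t, y)) (ContinuousLinearMap.inl ℝ ℝ E2) s :=
    hasFDerivAt_prodMk_left s y
  have h1 := dMap_comp (j := chartVariation φ e) (κ := fun t : ℝ => (t, y)) (z := s) hk
    hι.differentiableAt
  have h3 := DFunLike.congr_fun h1 (1 : ℝ)
  rw [hι.fderiv] at h3
  exact h3.symm

end

end OrientedSurface.IsVariation

end Variation

/-! ### The coframe adapted to a variation -/

section Rotation

variable {V : Type*} [NormedAddCommGroup V] [NormedSpace ℝ V] {Ω : Set V}
  {η θ₁ θ₂ w : V → V →L[ℝ] ℝ} {K : V → ℝ} {b1 b2 : V} {σ : ℝ}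

/-- The rotation which relates the adapted coframe to the given one. -/
lemma IsStructureSystem.exists_rotation (hs : IsStructureSystem Ω η θ₁ θ₂ w K) (b0 : V)
    (hσ : σ ^ 2 = 1)
    (hP : ∀ z ∈ Ω, (η z b1 * θ₁ z b2 - η z b2 * θ₁ z b1) ^ 2
      + (η z b1 * θ₂ z b2 - η z b2 * θ₂ z b1) ^ 2 ≠ 0) :
    ∃ c d : V → ℝ, (∀ z ∈ Ω, ContDiffAt ℝ 2 c z) ∧ (∀ z ∈ Ω, ContDiffAt ℝ 2 d z) ∧
      (∀ z ∈ Ω, c z ^ 2 + d z ^ 2 = 1) ∧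
      (∀ z ∈ Ω, c z * (adapted η θ₁ θ₂ w b0 b1 b2 σ).m z = η z b1 * θ₁ z b2 - η z b2 * θ₁ z b1) ∧
      (∀ z ∈ Ω, d z * (adapted η θ₁ θ₂ w b0 b1 b2 σ).m z = η z b1 * θ₂ z b2 - η z b2 * θ₂ z b1) ∧
      (∀ z u, (adapted η θ₁ θ₂ w b0 b1 b2 σ).α z u = c z * θ₁ z u + d z * θ₂ z u) ∧
      (∀ z u, (adapted η θ₁ θ₂ w b0 b1 b2 σ).β z u = c z * θ₂ z u - d z * θ₁ z u) ∧
      (∀ z u, (adapted η θ₁ θ₂ w b0 b1 b2 σ).ζ z u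
        = (c z * fderiv ℝ d z u - d z * fderiv ℝ c z u) + w z u) := by
  have hσ0 : σ ≠ 0 := by rintro rfl; norm_num at hσ
  let p : V → ℝ := fun z => η z b1 * θ₁ z b2 - η z b2 * θ₁ z b1
  let q : V → ℝ := fun z => η z b1 * θ₂ z b2 - η z b2 * θ₂ z b1
  have happ : ∀ {A : V → V →L[ℝ] ℝ} {z : V} (b : V), ContDiffAt ℝ 2 A z →
      ContDiffAt ℝ 2 (fun y => A y b) z := fun b h => h.clm_apply contDiffAt_const
  have cp : ∀ z ∈ Ω, ContDiffAt ℝ 2 p z := fun z hz =>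
    ((happ _ (hs.cη z hz)).mul (happ _ (hs.cθ₁ z hz))).sub
      ((happ _ (hs.cη z hz)).mul (happ _ (hs.cθ₁ z hz)))
  have cq : ∀ z ∈ Ω, ContDiffAt ℝ 2 q z := fun z hz =>
    ((happ _ (hs.cη z hz)).mul (happ _ (hs.cθ₂ z hz))).sub
      ((happ _ (hs.cη z hz)).mul (happ _ (hs.cθ₂ z hz)))
  have cr : ∀ z ∈ Ω, ContDiffAt ℝ 2 (fun z => -σ * √(p z ^ 2 + q z ^ 2)) z := fun z hz =>
    contDiffAt_const.mul ((((cp z hz).pow 2).add ((cq z hz).pow 2)).sqrt (hP z hz))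
  have r0 : ∀ z ∈ Ω, -σ * √(p z ^ 2 + q z ^ 2) ≠ 0 := by
    intro z hz
    have h0 := lt_of_le_of_ne (by positivity) (hP z hz).symm
    exact mul_ne_zero (neg_ne_zero.mpr hσ0) (Real.sqrt_pos.mpr h0).ne'
  refine ⟨fun z => p z / (-σ * √(p z ^ 2 + q z ^ 2)), fun z => q z / (-σ * √(p z ^ 2 + q z ^ 2)),
    fun z hz => (cp z hz).div (cr z hz) (r0 z hz), fun z hz => (cq z hz).div (cr z hz) (r0 z hz),
    ?_, ?_, ?_, fun _ _ => rfl, fun _ _ => rfl, fun _ _ => rfl⟩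
  · intro z hz
    have h0 := lt_of_le_of_ne (by positivity) (hP z hz).symm
    have hr2 : √(p z ^ 2 + q z ^ 2) ^ 2 = p z ^ 2 + q z ^ 2 := Real.sq_sqrt h0.le
    have := r0 z hz
    simp only
    rw [div_pow, div_pow, ← add_div, div_eq_one_iff_eq (pow_ne_zero 2 this)]
    linear_combination -hr2 - √(p z ^ 2 + q z ^ 2) ^ 2 * hσ
  · intro z hz
    rw [adapted_m b0 hσ (hP z hz)]
    exact div_mul_cancel₀ _ (r0 z hz)
  · intro z hz
    rw [adapted_m b0 hσ (hP z hz)]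
    exact div_mul_cancel₀ _ (r0 z hz)

end Rotation

section LocalModel

variable {M : Type*} [TopologicalSpace M] [ChartedSpace E3 M] [IsManifold (𝓡 3) ∞ M]
  {X : SasakianStructure M} {S : Type*} [TopologicalSpace S] [ChartedSpace E2 S]
  [IsManifold (𝓡 2) 2 S]

lemma cross_comp {q : M} (A : E2 →L[ℝ] TangentSpace (𝓡 3) q) (L : E2 →L[ℝ] E2) :
    cross X q (A (L e₁)) (A (L e₂)) = L.det • cross X q (A e₁) (A e₂) := by
  let A' : E2 →L[ℝ] E3 := A
  let η : E3 →L[ℝ] ℝ := X.η q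
  exact alternating_apply (fun u v => η (A' u) • A' v - η (A' v) • A' u)
    (fun a b u v w => by simp only [map_add, map_smul, smul_eq_mul]; module)
    (fun u v => by abel) L

lemma vol_comp {q : M} (A : E2 →L[ℝ] TangentSpace (𝓡 3) q) (L : E2 →L[ℝ] E2)
    (w : TangentSpace (𝓡 3) q) :
    X.vol q w (A (L e₁)) (A (L e₂)) = L.det * X.vol q w (A e₁) (A e₂) := by
  let A' : E2 →L[ℝ] E3 := A
  let η : E3 →L[ℝ] ℝ := X.η q
  let ζ : E3 → E3 →L[ℝ] ℝ := X.dη q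
  let w₀ : E3 := w
  have anti : ∀ a b, ζ a b = - ζ b a := fun a b => extD_antisymm q a b
  have lin : ∀ (r s : ℝ) (a b c : E3), ζ (r • a + s • b) c = r * ζ a c + s * ζ b c := by
    intro r s a b c
    rw [anti, map_add, map_smul, map_smul, anti a c, anti b c, smul_eq_mul, smul_eq_mul]
    ring
  have h := alternating_apply (fun u v => η w₀ * ζ (A' u) (A' v) - η (A' u) * ζ w₀ (A' v)
      + ζ w₀ (A' u) * η (A' v))
    (fun a b u v x => by
      simp only [map_add, map_smul, smul_eq_mul, lin]
      ring)
    (fun u v => by rw [anti (A' u) (A' v)]; ring) L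
  rw [vol_apply, vol_apply]
  exact h

namespace OrientedSurface

variable (F : OrientedSurface X S) (φ : ℝ → S → M)

/-- The integrand of the area functional with respect to the area element of the surface. -/
def areaDens (s : ℝ) (p : S) : ℝ := subAreaUnit X (φ s) p / areaUnit X F.f p

/-- The integrand of the derivative of the volume functional. -/
def volDens (s : ℝ) (p : S) : ℝ :=
  X.vol (φ s p) (velocity φ s p) (mfderiv (𝓡 2) (𝓡 3) (φ s) p e₁)
    (mfderiv (𝓡 2) (𝓡 3) (φ s) p e₂) / F.normalDet p

/-- The covector dual to the characteristic field of the surface at time `s`. -/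
def charForm (s : ℝ) (p : S) : TangentSpace (𝓡 3) (φ s p) →L[ℝ] ℝ :=
  -(F.normalDet p * F.areaDens φ s p)⁻¹ • X.g.inner (φ s p) (cross X (φ s p)
    (mfderiv (𝓡 2) (𝓡 3) (φ s) p e₁) (mfderiv (𝓡 2) (𝓡 3) (φ s) p e₂))

/-- The contraction of `η ∧ charForm` with the velocity, restricted to the surface. -/
def fluxForm (s : ℝ) (p : S) : TangentSpace (𝓡 2) p →L[ℝ] ℝ :=
  (X.η (φ s p) (velocity φ s p) • F.charForm φ s p
    - F.charForm φ s p (velocity φ s p) • X.η (φ s p)).comp (mfderiv (𝓡 2) (𝓡 3) (φ s) p)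

/-- A region in the product of the time axis and the domain of a chart where the variation is
covered by a horizontal frame and the area form of the chart has the sign `σ`. -/
structure IsAdaptedRegion (I : Set ℝ) (e : OpenPartialHomeomorph S E2) (O : Set M)
    (A B : ∀ q : M, TangentSpace (𝓡 3) q) (σ : ℝ) (Ω : Set (ℝ × E2)) : Prop where
  atlas : e ∈ atlas E2 S
  frame : IsHorFrame X O A B
  isOpen : IsOpen Ω
  time : ∀ z ∈ Ω, z.1 ∈ I
  target : ∀ z ∈ Ω, z.2 ∈ e.target
  regular : ∀ z ∈ Ω, e.symm z.2 ∈ F.regularSet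
  mem : ∀ z ∈ Ω, chartVariation φ e z ∈ O
  sign : ∀ z ∈ Ω, 0 < σ * F.frameDet e z.2
  sq_sign : σ ^ 2 = 1
  cross_ne : ∀ z ∈ Ω, subAreaUnit X (φ z.1) (e.symm z.2) ≠ 0

/-- The coframe adapted to the slices of a variation. -/
def adaptedCoframe (X : SasakianStructure M) (φ : ℝ → S → M) (e : OpenPartialHomeomorph S E2)
    (A B : ∀ q : M, TangentSpace (𝓡 3) q) (σ : ℝ) : Coframe (ℝ × E2) :=
  adapted (pullForm X.η (chartVariation φ e)) (pullForm (flat X.g A) (chartVariation φ e))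
    (pullForm (flat X.g B) (chartVariation φ e))
    (pullForm (websterForm X A B) (chartVariation φ e)) (1, 0) (0, e₁) (0, e₂) σ

namespace IsAdaptedRegion

variable {F φ} {I : Set ℝ} {C : Set S} (hv : F.IsVariation F.regularSet I C φ)
  (hC3 : F.IsC3On F.regularSet) [T2Space S] {e : OpenPartialHomeomorph S E2} {O : Set M}
  {A B : ∀ q : M, TangentSpace (𝓡 3) q} {σ : ℝ} {Ω : Set (ℝ × E2)}
  (hr : F.IsAdaptedRegion φ I e O A B σ Ω)
include hv hC3 hr

lemma isStructureSystem : IsStructureSystem Ω (pullForm X.η (chartVariation φ e))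
    (pullForm (flat X.g A) (chartVariation φ e)) (pullForm (flat X.g B) (chartVariation φ e))
    (pullForm (websterForm X A B) (chartVariation φ e))
    (fun z => X.webster (chartVariation φ e z)) :=
  hr.frame.isStructureSystem hr.isOpen
    (fun z hz => hv.contMDiffAt_chart hC3 hr.atlas (hr.time z hz) (hr.target z hz)
      (hr.regular z hz)) hr.mem

variable {z : ℝ × E2} (hz : z ∈ Ω)
include hz

lemma pullForm_slice (α : ∀ q : M, TangentSpace (𝓡 3) q →L[ℝ] ℝ) (b : E2) :
    pullForm α (chartVariation φ e) z ((0 : ℝ), b) = α (φ z.1 (e.symm z.2))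
      (mfderiv (𝓡 2) (𝓡 3) (φ z.1) (e.symm z.2) (mfderiv (𝓡 2) (𝓡 2) e.symm z.2 b)) :=
  congrArg (α (φ z.1 (e.symm z.2))) (hv.dMap_slice hC3 hr.atlas (hr.time z hz) (hr.target z hz)
    (hr.regular z hz) b)

lemma pullForm_time (α : ∀ q : M, TangentSpace (𝓡 3) q →L[ℝ] ℝ) :
    pullForm α (chartVariation φ e) z ((1 : ℝ), (0 : E2)) = α (φ z.1 (e.symm z.2))
      (velocity φ z.1 (e.symm z.2)) :=
  congrArg (α (φ z.1 (e.symm z.2))) (hv.dMap_time hC3 hr.atlas (hr.time z hz) (hr.target z hz)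
    (hr.regular z hz))

/-- The components of the vector product on the slices. -/
lemma pullForm_cross (W : ∀ q : M, TangentSpace (𝓡 3) q) :
    pullForm X.η (chartVariation φ e) z (0, e₁) * pullForm (flat X.g W) (chartVariation φ e) z (0, e₂)
      - pullForm X.η (chartVariation φ e) z (0, e₂)
        * pullForm (flat X.g W) (chartVariation φ e) z (0, e₁)
      = chartDet e z.2 * X.g.inner (φ z.1 (e.symm z.2)) (W (φ z.1 (e.symm z.2)))
        (cross X (φ z.1 (e.symm z.2)) (mfderiv (𝓡 2) (𝓡 3) (φ z.1) (e.symm z.2) e₁)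
          (mfderiv (𝓡 2) (𝓡 3) (φ z.1) (e.symm z.2) e₂)) := by
  have h := cross_comp (X := X) (mfderiv (𝓡 2) (𝓡 3) (φ z.1) (e.symm z.2))
    (mfderiv (𝓡 2) (𝓡 2) e.symm z.2)
  have h1 : ∀ v : TangentSpace (𝓡 3) (φ z.1 (e.symm z.2)), chartDet e z.2
      * X.g.inner (φ z.1 (e.symm z.2)) (W (φ z.1 (e.symm z.2))) v
      = X.g.inner (φ z.1 (e.symm z.2)) (W (φ z.1 (e.symm z.2))) (chartDet e z.2 • v) := fun v => by
    rw [map_smul, smul_eq_mul]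
  rw [h1, pullForm_slice hv hC3 hr hz, pullForm_slice hv hC3 hr hz, pullForm_slice hv hC3 hr hz,
    pullForm_slice hv hC3 hr hz]
  refine Eq.trans ?_ (congrArg (X.g.inner (φ z.1 (e.symm z.2)) (W (φ z.1 (e.symm z.2)))) h)
  rw [cross, map_sub, map_smul, map_smul]
  rfl

/-- The vector product of the coordinate fields of a slice is horizontal; its squared length is the
sum of the squares of its two components in the horizontal frame. -/
lemma sum_sq_cross :
    (pullForm X.η (chartVariation φ e) z (0, e₁) * pullForm (flat X.g A) (chartVariation φ e) z (0, e₂)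
      - pullForm X.η (chartVariation φ e) z (0, e₂)
        * pullForm (flat X.g A) (chartVariation φ e) z (0, e₁)) ^ 2
    + (pullForm X.η (chartVariation φ e) z (0, e₁) * pullForm (flat X.g B) (chartVariation φ e) z (0, e₂)
      - pullForm X.η (chartVariation φ e) z (0, e₂)
        * pullForm (flat X.g B) (chartVariation φ e) z (0, e₁)) ^ 2
      = (chartDet e z.2 * subAreaUnit X (φ z.1) (e.symm z.2)) ^ 2 := by
  have hO : φ z.1 (e.symm z.2) ∈ O := hr.mem z hz
  have h : X.g.inner (φ z.1 (e.symm z.2)) (X.T (φ z.1 (e.symm z.2)))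
      (cross X (φ z.1 (e.symm z.2)) (mfderiv (𝓡 2) (𝓡 3) (φ z.1) (e.symm z.2) e₁)
          (mfderiv (𝓡 2) (𝓡 3) (φ z.1) (e.symm z.2) e₂)) = 0 := by
    rw [cross, map_sub, map_smul, map_smul]
    exact sub_eq_zero.mpr (mul_comm _ _)
  have h2 := hr.frame.inner_eq hO (cross X (φ z.1 (e.symm z.2))
    (mfderiv (𝓡 2) (𝓡 3) (φ z.1) (e.symm z.2) e₁) (mfderiv (𝓡 2) (𝓡 3) (φ z.1) (e.symm z.2) e₂))
    (cross X (φ z.1 (e.symm z.2))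
    (mfderiv (𝓡 2) (𝓡 3) (φ z.1) (e.symm z.2) e₁) (mfderiv (𝓡 2) (𝓡 3) (φ z.1) (e.symm z.2) e₂))
  rw [pullForm_cross hv hC3 hr hz, pullForm_cross hv hC3 hr hz, mul_pow, mul_pow, mul_pow,
    subAreaUnit, len_sq]
  refine Eq.trans ?_ (congrArg (fun r : ℝ => chartDet e z.2 ^ 2 * r) h2.symm)
  rw [h]
  ring_nf

omit hz in
lemma sum_sq_ne : ∀ z ∈ Ω,
    (pullForm X.η (chartVariation φ e) z (0, e₁) * pullForm (flat X.g A) (chartVariation φ e) z (0, e₂)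
      - pullForm X.η (chartVariation φ e) z (0, e₂)
        * pullForm (flat X.g A) (chartVariation φ e) z (0, e₁)) ^ 2
    + (pullForm X.η (chartVariation φ e) z (0, e₁) * pullForm (flat X.g B) (chartVariation φ e) z (0, e₂)
      - pullForm X.η (chartVariation φ e) z (0, e₂)
        * pullForm (flat X.g B) (chartVariation φ e) z (0, e₁)) ^ 2 ≠ 0 := by
  intro z hz
  rw [sum_sq_cross hv hC3 hr hz]
  exact pow_ne_zero 2 (mul_ne_zero (chartDet_ne_zero hr.atlas (hr.target z hz)) (hr.cross_ne z hz))

omit hz in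
lemma isCartan : (adaptedCoframe X φ e A B σ).IsCartan Ω
    (fun z => X.webster (chartVariation φ e z)) :=
  (isStructureSystem hv hC3 hr).isCartan _ hr.sq_sign (sum_sq_ne hv hC3 hr)

/-- The function `m` is the sub-Riemannian area density, up to the sign of the area form of the
chart. -/
lemma m_eq : (adaptedCoframe X φ e A B σ).m z
    = -(F.frameDet e z.2 * F.areaDens φ z.1 (e.symm z.2)) := by
  rw [adaptedCoframe, adapted_m _ hr.sq_sign (sum_sq_ne hv hC3 hr z hz), sum_sq_cross hv hC3 hr hz,
    Real.sqrt_sq_eq_abs, abs_mul]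
  have hsub : |subAreaUnit X (φ z.1) (e.symm z.2)| = subAreaUnit X (φ z.1) (e.symm z.2) :=
    abs_of_nonneg (Real.sqrt_nonneg _)
  have hs := hr.sign z hz
  have h1 : σ * F.frameDet e z.2 = |chartDet e z.2| * |F.normalDet (e.symm z.2)| := by
    have hσ : |σ| = 1 := by rw [← abs_one, ← sq_eq_sq_iff_abs_eq_abs, hr.sq_sign, one_pow]
    rw [← abs_of_pos hs, abs_mul, hσ, one_mul, frameDet, abs_mul]
  have h2 : F.frameDet e z.2 = σ * (|chartDet e z.2| * |F.normalDet (e.symm z.2)|) := by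
    rw [← h1, ← mul_assoc, ← sq, hr.sq_sign, one_mul]
  have h3 : |F.normalDet (e.symm z.2)| ≠ 0 := abs_ne_zero.mpr (F.normalDet_ne_zero _)
  rw [h2, areaDens, ← F.abs_normalDet, hsub]
  field_simp

lemma areaDens_ne_zero : F.areaDens φ z.1 (e.symm z.2) ≠ 0 :=
  div_ne_zero (hr.cross_ne z hz) (areaUnit_pos X (F.immersion _)).ne'

/-- The form `α` of the adapted coframe does not depend on the choice of the horizontal frame. -/
lemma α_eq (u : ℝ × E2) : (adaptedCoframe X φ e A B σ).α z u
    = F.charForm φ z.1 (e.symm z.2) (dMap (chartVariation φ e) z u) := by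
  obtain ⟨c, d, -, -, -, hc, hd, hα, -, -⟩ := (isStructureSystem hv hC3 hr).exists_rotation
    (1, 0) hr.sq_sign (sum_sq_ne hv hC3 hr)
  have hm := m_eq hv hC3 hr hz
  have hm0 := (isCartan hv hC3 hr).m_ne z hz
  have h1 := hc z hz
  have h2 := hd z hz
  rw [pullForm_cross hv hC3 hr hz] at h1 h2
  change c z * (adaptedCoframe X φ e A B σ).m z = _ at h1
  change d z * (adaptedCoframe X φ e A B σ).m z = _ at h2
  refine (hα z u).trans ?_
  have hD := F.normalDet_ne_zero (e.symm z.2)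
  have hE := chartDet_ne_zero hr.atlas (hr.target z hz)
  have ha := areaDens_ne_zero hv hC3 hr hz
  set w : TangentSpace (𝓡 3) (φ z.1 (e.symm z.2)) := dMap (chartVariation φ e) z u with hw
  set x := cross X (φ z.1 (e.symm z.2)) (mfderiv (𝓡 2) (𝓡 3) (φ z.1) (e.symm z.2) e₁)
          (mfderiv (𝓡 2) (𝓡 3) (φ z.1) (e.symm z.2) e₂) with hx
  have h3 : F.charForm φ z.1 (e.symm z.2) w
      = -(F.normalDet (e.symm z.2) * F.areaDens φ z.1 (e.symm z.2))⁻¹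
        * X.g.inner (φ z.1 (e.symm z.2)) x w := rfl
  have h4 : X.g.inner (φ z.1 (e.symm z.2)) (X.T (φ z.1 (e.symm z.2))) x = 0 := by
    rw [hx, cross, map_sub, map_smul, map_smul]
    exact sub_eq_zero.mpr (mul_comm _ _)
  have hO : φ z.1 (e.symm z.2) ∈ O := hr.mem z hz
  rw [h3, hr.frame.inner_eq hO, h4]
  change c z * X.g.inner (φ z.1 (e.symm z.2)) (A (φ z.1 (e.symm z.2))) w
    + d z * X.g.inner (φ z.1 (e.symm z.2)) (B (φ z.1 (e.symm z.2))) w = _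
  set xA := X.g.inner (φ z.1 (e.symm z.2)) (A (φ z.1 (e.symm z.2))) x
  set xB := X.g.inner (φ z.1 (e.symm z.2)) (B (φ z.1 (e.symm z.2))) x
  rw [hm, frameDet] at h1 h2
  have h5 : c z = -(F.normalDet (e.symm z.2) * F.areaDens φ z.1 (e.symm z.2))⁻¹ * xA := by
    field_simp
    refine mul_left_cancel₀ hE ?_
    linear_combination -h1
  have h6 : d z = -(F.normalDet (e.symm z.2) * F.areaDens φ z.1 (e.symm z.2))⁻¹ * xB := by
    field_simp
    refine mul_left_cancel₀ hE ?_
    linear_combination -h2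
  rw [h5, h6]
  ring

/-- The forms `κ` of the charts are the coordinate expressions of a form on the surface. -/
lemma κ_eq (b : E2) : (adaptedCoframe X φ e A B σ).κ (0, b) z
    = F.fluxForm φ z.1 (e.symm z.2) (mfderiv (𝓡 2) (𝓡 2) e.symm z.2 b) := by
  have h1 := α_eq hv hC3 hr hz
  have hs := hv.dMap_slice hC3 hr.atlas (hr.time z hz) (hr.target z hz) (hr.regular z hz) b
  have ht := hv.dMap_time hC3 hr.atlas (hr.time z hz) (hr.target z hz) (hr.regular z hz)
  rw [Coframe.κ, h1, h1]
  refine (congrArg₂ (fun a b : ℝ => a - b) (congrArg₂ (fun a b : ℝ => a * b)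
    (pullForm_time hv hC3 hr hz X.η) (congrArg (F.charForm φ z.1 (e.symm z.2)) hs))
    (congrArg₂ (fun a b : ℝ => a * b) (congrArg (F.charForm φ z.1 (e.symm z.2)) ht)
    (pullForm_slice hv hC3 hr hz X.η b))).trans ?_
  rfl

/-- The contraction of the volume form with the velocity, which is the density of the volume
functional, expressed by the adapted coframe. -/
lemma v_mul_m : (adaptedCoframe X φ e A B σ).v z * (adaptedCoframe X φ e A B σ).m z
    = F.frameDet e z.2 * F.volDens φ z.1 (e.symm z.2) := by
  obtain ⟨c, d, -, -, hcd, -, -, hα, hβ, -⟩ := (isStructureSystem hv hC3 hr).exists_rotation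
    (1, 0) hr.sq_sign (sum_sq_ne hv hC3 hr)
  have hm0 := (isCartan hv hC3 hr).m_ne z hz
  have hsl := (isCartan hv hC3 hr).slice z hz
  have e1 : (adaptedCoframe X φ e A B σ).v z * (adaptedCoframe X φ e A B σ).m z
      = pullForm X.η (chartVariation φ e) z (1, 0)
        * (pullForm (flat X.g A) (chartVariation φ e) z (0, e₁)
            * pullForm (flat X.g B) (chartVariation φ e) z (0, e₂)
          - pullForm (flat X.g B) (chartVariation φ e) z (0, e₁)
            * pullForm (flat X.g A) (chartVariation φ e) z (0, e₂))
      - pullForm X.η (chartVariation φ e) z (0, e₁)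
        * (pullForm (flat X.g A) (chartVariation φ e) z (1, 0)
            * pullForm (flat X.g B) (chartVariation φ e) z (0, e₂)
          - pullForm (flat X.g B) (chartVariation φ e) z (1, 0)
            * pullForm (flat X.g A) (chartVariation φ e) z (0, e₂))
      + (pullForm (flat X.g A) (chartVariation φ e) z (1, 0)
            * pullForm (flat X.g B) (chartVariation φ e) z (0, e₁)
          - pullForm (flat X.g B) (chartVariation φ e) z (1, 0)
            * pullForm (flat X.g A) (chartVariation φ e) z (0, e₁))
        * pullForm X.η (chartVariation φ e) z (0, e₂) := by
    have e2 : (adaptedCoframe X φ e A B σ).v z * (adaptedCoframe X φ e A B σ).m z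
        = (adaptedCoframe X φ e A B σ).β z (1, 0) * (adaptedCoframe X φ e A B σ).m z
        - ((adaptedCoframe X φ e A B σ).β z (0, e₁) * (adaptedCoframe X φ e A B σ).α z (0, e₂)
          - (adaptedCoframe X φ e A B σ).β z (0, e₂) * (adaptedCoframe X φ e A B σ).α z (0, e₁))
          * (adaptedCoframe X φ e A B σ).η z (1, 0) := by
      rw [Coframe.v, Coframe.lam]
      field_simp
      exact congrArg₂ (· - ·) (mul_comm _ _) rfl
    rw [e2, Coframe.m]
    change (adaptedCoframe X φ e A B σ).η z (0, e₁) * (adaptedCoframe X φ e A B σ).β z (0, e₂)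
      = (adaptedCoframe X φ e A B σ).η z (0, e₂) * (adaptedCoframe X φ e A B σ).β z (0, e₁) at hsl
    change (adaptedCoframe X φ e A B σ).β z (1, 0) * ((adaptedCoframe X φ e A B σ).η z (0, e₁)
      * (adaptedCoframe X φ e A B σ).α z (0, e₂) - (adaptedCoframe X φ e A B σ).η z (0, e₂)
      * (adaptedCoframe X φ e A B σ).α z (0, e₁)) - _ = _
    have hα' : ∀ u, (adaptedCoframe X φ e A B σ).α z u = _ := hα z
    have hβ' : ∀ u, (adaptedCoframe X φ e A B σ).β z u = _ := hβ z
    have hη' : ∀ u, (adaptedCoframe X φ e A B σ).η z u = pullForm X.η (chartVariation φ e) z u :=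
      fun _ => rfl
    simp only [hα', hβ', hη'] at hsl ⊢
    have hcd' := hcd z hz
    generalize pullForm X.η (chartVariation φ e) z = H at *
    generalize pullForm (flat X.g A) (chartVariation φ e) z = P at *
    generalize pullForm (flat X.g B) (chartVariation φ e) z = Q at *
    -- A rotation of the coframe does not change `η ∧ θ₁ ∧ θ₂`.
    linear_combination (H (1, 0) * (P (0, e₁) * Q (0, e₂) - Q (0, e₁) * P (0, e₂))
      - H (0, e₁) * (P (1, 0) * Q (0, e₂) - Q (1, 0) * P (0, e₂))
      + (P (1, 0) * Q (0, e₁) - Q (1, 0) * P (0, e₁)) * H (0, e₂)) * hcd'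
      + (c z * P (1, 0) + d z * Q (1, 0)) * hsl
  rw [e1]
  simp only [pullForm_slice hv hC3 hr hz, pullForm_time hv hC3 hr hz]
  have h2 := hr.frame.vol_eq (hr.mem z hz) (velocity φ z.1 (e.symm z.2))
    (mfderiv (𝓡 2) (𝓡 3) (φ z.1) (e.symm z.2) (mfderiv (𝓡 2) (𝓡 2) e.symm z.2 e₁))
    (mfderiv (𝓡 2) (𝓡 3) (φ z.1) (e.symm z.2) (mfderiv (𝓡 2) (𝓡 2) e.symm z.2 e₂))
  refine h2.symm.trans ?_
  refine (vol_comp (X := X) (mfderiv (𝓡 2) (𝓡 3) (φ z.1) (e.symm z.2))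
    (mfderiv (𝓡 2) (𝓡 2) e.symm z.2) _).trans ?_
  rw [volDens, frameDet, mul_assoc, mul_div_cancel₀ _ (F.normalDet_ne_zero _)]
  rfl

end IsAdaptedRegion

end OrientedSurface

end LocalModel

/-! ### The Jacobi operator in an adapted coframe -/

namespace Coframe

variable {V : Type*} [NormedAddCommGroup V] [NormedSpace ℝ V] (c : Coframe V)

/-- The length of the horizontal part of the unit normal of the slices. -/
def nh (z : V) : ℝ := (√(1 + c.lam z ^ 2))⁻¹

lemma nh_pos (z : V) : 0 < c.nh z := inv_pos.mpr (Real.sqrt_pos.mpr (by positivity))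

lemma nh_sq (z : V) : c.nh z ^ 2 * (1 + c.lam z ^ 2) = 1 := by
  rw [nh, inv_pow, Real.sq_sqrt (by positivity)]
  exact inv_mul_cancel₀ (by positivity)

namespace IsCartan

variable {c} {Ω : Set V} {K : V → ℝ} (hc : c.IsCartan Ω K) {z : V} (hz : z ∈ Ω)
include hc hz

lemma contDiffAt_nh : ContDiffAt ℝ 2 c.nh z := by
  have h0 : (1 : ℝ) + c.lam z ^ 2 ≠ 0 := by positivity
  refine ContDiffAt.inv ?_ (Real.sqrt_pos.mpr (by positivity)).ne'
  exact (contDiffAt_const.add ((hc.contDiffAt_lam hz).pow 2)).sqrt h0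

lemma E_nh : c.E c.nh z = -(c.lam z * c.nh z ^ 3 * c.E c.lam z) := by
  have dn := (hc.contDiffAt_nh hz).differentiableAt (by simp)
  have dl := (hc.contDiffAt_lam hz).differentiableAt (by simp)
  have dnn : DifferentiableAt ℝ (fun y => c.nh y * c.nh y) z := dn.mul dn
  have dnl : DifferentiableAt ℝ (fun y => c.nh y * c.lam y) z := dn.mul dl
  have dnlnl : DifferentiableAt ℝ (fun y => c.nh y * c.lam y * (c.nh y * c.lam y)) z := dnl.mul dnl
  have h : (fun y => c.nh y * c.nh y + c.nh y * c.lam y * (c.nh y * c.lam y)) = fun _ => 1 := by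
    ext y; linear_combination c.nh_sq y
  have h1 := E_add (c := c) dnn dnlnl
  have h0 : c.E (fun _ : V => (1 : ℝ)) z = 0 := by simp [E]
  rw [h, h0, E_mul dnl dnl, E_mul dn dn, E_mul dn dl] at h1
  have h2 := c.nh_sq z
  have h3 : c.E c.nh z = c.nh z * (c.nh z * c.E c.nh z * (1 + c.lam z ^ 2)) := by
    linear_combination -c.E c.nh z * h2
  rw [h3]
  linear_combination -c.nh z / 2 * h1

/-- Conjugation by the length of the horizontal normal turns the Jacobi operator into
`g ↦ g'' + 2 λ g' + Q g`. -/
lemma jacobi_mul_nh (h1 : fderiv ℝ c.h z c.b1 = 0) (h2 : fderiv ℝ c.h z c.b2 = 0) {g : V → ℝ}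
    (hg : ContDiffAt ℝ 2 g z) {t t' : ℝ} (ht : t = c.lam z * c.nh z)
    (ht' : t' = c.E (fun y => c.lam y * c.nh y) z) :
    (c.nh z)⁻¹ * (c.E (c.E (fun y => c.nh y * g y)) z
      + 2 * (c.nh z)⁻¹ * t * (t * (t - c.E c.nh z) + c.nh z * (c.nh z + t'))
        * c.E (fun y => c.nh y * g y) z
      + ((2 * t - c.E c.nh z) ^ 2 + (c.nh z * c.h z) ^ 2 + (2 * c.nh z + t') ^ 2
        + 4 * (K z - 1) * c.nh z ^ 2) * (c.nh z * g z))
      = c.E (c.E g) z + 2 * c.lam z * c.E g z + c.Q K z * g z := by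
  have dn := (hc.contDiffAt_nh hz).differentiableAt (by simp)
  have dl := (hc.contDiffAt_lam hz).differentiableAt (by simp)
  have dg := hg.differentiableAt (by simp)
  have dEl := (hc.contDiffAt_E hz (hc.contDiffAt_lam hz)).differentiableAt (by simp)
  have dEn := (hc.contDiffAt_E hz (hc.contDiffAt_nh hz)).differentiableAt (by simp)
  have dEg := (hc.contDiffAt_E hz hg).differentiableAt (by simp)
  have hE1 : c.E (fun y => c.nh y * g y) =ᶠ[𝓝 z]
      fun y => c.nh y * c.E g y + g y * c.E c.nh y := by
    filter_upwards [hc.isOpen.mem_nhds hz, hg.eventually (by simp)] with y hy hgy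
    exact E_mul ((hc.contDiffAt_nh hy).differentiableAt (by simp))
      (hgy.differentiableAt (by simp))
  have hE2 : c.E (c.E (fun y => c.nh y * g y)) z = c.nh z * c.E (c.E g) z
      + 2 * c.E g z * c.E c.nh z + g z * c.E (c.E c.nh) z := by
    have d1 : DifferentiableAt ℝ (fun y => c.nh y * c.E g y) z := dn.mul dEg
    have d2 : DifferentiableAt ℝ (fun y => g y * c.E c.nh y) z := dg.mul dEn
    have : c.E (c.E (fun y => c.nh y * g y)) z
        = c.E (fun y => c.nh y * c.E g y + g y * c.E c.nh y) z := by
      rw [E, hE1.fderiv_eq, E]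
    rw [this, E_add d1 d2, E_mul dn dEg, E_mul dg dEn]
    ring
  have hEEn : c.E (c.E c.nh) z = -(c.E c.lam z ^ 2 * c.nh z ^ 3
      + c.lam z * c.nh z ^ 3 * c.E (c.E c.lam) z
      + 3 * c.lam z * c.nh z ^ 2 * c.E c.nh z * c.E c.lam z) := by
    have hE3 : c.E c.nh =ᶠ[𝓝 z] fun y => 0 - c.lam y * c.E c.lam y * (c.nh y * (c.nh y * c.nh y)) := by
      filter_upwards [hc.isOpen.mem_nhds hz] with y hy
      rw [hc.E_nh hy]; ring
    have d1 : DifferentiableAt ℝ (fun y => c.lam y * c.E c.lam y) z := dl.mul dEl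
    have d2 : DifferentiableAt ℝ (fun y => c.nh y * c.nh y) z := dn.mul dn
    have d3 : DifferentiableAt ℝ (fun y => c.nh y * (c.nh y * c.nh y)) z := dn.mul d2
    have d4 : DifferentiableAt ℝ
        (fun y => c.lam y * c.E c.lam y * (c.nh y * (c.nh y * c.nh y))) z := d1.mul d3
    have d0 : DifferentiableAt ℝ (fun _ : V => (0 : ℝ)) z := differentiableAt_const _
    have h0 : c.E (fun _ : V => (0 : ℝ)) z = 0 := by simp [E]
    have : c.E (c.E c.nh) z
        = c.E (fun y => 0 - c.lam y * c.E c.lam y * (c.nh y * (c.nh y * c.nh y))) z := by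
      rw [E, hE3.fderiv_eq, E]
    rw [this, E_sub d0 d4, h0, E_mul d1 d3, E_mul dl dEl, E_mul dn d2, E_mul dn dn]
    ring
  have hj := hc.jacobi_lam hz h1 h2
  have ht2 : t' = c.nh z ^ 3 * c.E c.lam z := by
    rw [ht', E_mul dl dn, hc.E_nh hz]
    linear_combination -c.nh z * c.E c.lam z * c.nh_sq z
  have hn0 := (c.nh_pos z).ne'
  have hn := c.nh_sq z
  have hb : t * (t - c.E c.nh z) + c.nh z * (c.nh z + t') = 1 + c.nh z ^ 2 * c.E c.lam z := by
    rw [ht, ht2, hc.E_nh hz]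
    linear_combination (1 + c.nh z ^ 2 * c.E c.lam z) * hn
  have hq : (2 * t - c.E c.nh z) ^ 2 + (2 * c.nh z + t') ^ 2
      = (2 + c.nh z ^ 2 * c.E c.lam z) ^ 2 := by
    rw [ht, ht2, hc.E_nh hz]
    linear_combination (2 + c.nh z ^ 2 * c.E c.lam z) ^ 2 * hn
  have hE1z : c.E (fun y => c.nh y * g y) z = c.nh z * c.E g z + g z * c.E c.nh z :=
    E_mul dn dg
  rw [hb, hE2, hEEn, hE1z, hc.E_nh hz, ht]
  rw [inv_mul_eq_iff_eq_mul₀ hn0]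
  have hK : (2 * (c.lam z * c.nh z) - -(c.lam z * c.nh z ^ 3 * c.E c.lam z)) ^ 2
      + (2 * c.nh z + t') ^ 2 = (2 + c.nh z ^ 2 * c.E c.lam z) ^ 2 := by
    rw [← hq, ht, hc.E_nh hz]
  have hQ : c.Q K z = 4 * c.E c.lam z + 4 * c.lam z ^ 2 + 4 * K z + c.h z ^ 2 := rfl
  have hinv : (c.nh z)⁻¹ * c.nh z = 1 := inv_mul_cancel₀ hn0
  generalize (c.nh z)⁻¹ = i at *
  generalize c.Q K z = Q at *
  generalize c.E (c.E c.lam) z = l2 at *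
  generalize c.E c.lam z = l1 at *
  generalize c.lam z = l at *
  generalize c.nh z = n at *
  generalize c.h z = h at *
  generalize K z = k at *
  generalize g z = g0 at *
  generalize c.E g z = g1 at *
  generalize c.E (c.E g) z = g2 at *
  linear_combination 2 * l * (1 + n ^ 2 * l1) * (n * g1 - g0 * (l * n ^ 3 * l1)) * hinv
    - l * n ^ 3 * g0 * hj + n * g0 * hK + (l1 ^ 2 * n ^ 3 + Q * n - 4 * n) * g0 * hn
    - n ^ 3 * g0 * hQ

end IsCartan

end Coframe

/-! ### The initial slice of a variation -/

section InitialSlice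

variable {M : Type*} [TopologicalSpace M] [ChartedSpace E3 M] [IsManifold (𝓡 3) ∞ M]
  {X : SasakianStructure M} {S : Type*} [TopologicalSpace S] [ChartedSpace E2 S]
  [IsManifold (𝓡 2) 2 S]

namespace OrientedSurface

variable {F : OrientedSurface X S} {φ : ℝ → S → M}

lemma mdifferentiable_f (F : OrientedSurface X S) : MDifferentiable (𝓡 2) (𝓡 3) F.f :=
  F.contMDiff_f.mdifferentiable (by simp)

namespace IsAdaptedRegion

variable {I : Set ℝ} {C : Set S} (hv : F.IsVariation F.regularSet I C φ)
  (hC3 : F.IsC3On F.regularSet) [T2Space S] {e : OpenPartialHomeomorph S E2} {O : Set M}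
  {A B : ∀ q : M, TangentSpace (𝓡 3) q} {σ : ℝ} {Ω : Set (ℝ × E2)}
  (hr : F.IsAdaptedRegion φ I e O A B σ Ω)
  {y : E2} (hy : ((0 : ℝ), y) ∈ Ω)

include hr hy in
lemma eventually_mem : ∀ᶠ p in 𝓝 (e.symm y), p ∈ e.source ∧ ((0 : ℝ), e p) ∈ Ω ∧
    e.symm (e p) = p := by
  have hyt : y ∈ e.target := hr.target _ hy
  have hs : e.symm y ∈ e.source := e.map_target hyt
  have hc : ContinuousAt (fun p => ((0 : ℝ), e p)) (e.symm y) :=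
    continuousAt_const.prodMk (e.continuousAt hs)
  have h1 : Ω ∈ 𝓝 ((0 : ℝ), e (e.symm y)) := by
    rw [e.right_inv hyt]; exact hr.isOpen.mem_nhds hy
  filter_upwards [e.open_source.mem_nhds hs, hc.preimage_mem_nhds h1] with p hp hp2
  exact ⟨hp, hp2, e.left_inv hp⟩

include hv hC3 hr hy

/-- The initial slice of a variation is the given immersion. -/
lemma pullForm_zero (α : ∀ q : M, TangentSpace (𝓡 3) q →L[ℝ] ℝ) (b : E2) :
    pullForm α (chartVariation φ e) ((0 : ℝ), y) ((0 : ℝ), b)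
      = α (F.f (e.symm y)) (mfderiv (𝓡 2) (𝓡 3) F.f (e.symm y)
        (mfderiv (𝓡 2) (𝓡 2) e.symm y b)) := by
  refine (pullForm_slice hv hC3 hr hy α b).trans ?_
  have h : φ 0 = F.f := funext hv.zero
  exact congrArg (fun h : S → M => α (h (e.symm y)) (mfderiv (𝓡 2) (𝓡 3) h (e.symm y)
        (mfderiv (𝓡 2) (𝓡 2) e.symm y b))) h

lemma mem_zero : F.f (e.symm y) ∈ O := by
  have h := hr.mem _ hy
  rwa [chartVariation, hv.zero] at h

/-- The normal of the initial slice is the vector product of the coordinate fields, divided by their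
area. -/
lemma frameDet_mul_normal :
    F.frameDet e y * X.g.inner (F.f (e.symm y)) (A (F.f (e.symm y))) (F.N (e.symm y))
        = -(pullForm X.η (chartVariation φ e) (0, y) (0, e₁)
            * pullForm (flat X.g B) (chartVariation φ e) (0, y) (0, e₂)
          - pullForm X.η (chartVariation φ e) (0, y) (0, e₂)
            * pullForm (flat X.g B) (chartVariation φ e) (0, y) (0, e₁)) ∧
      F.frameDet e y * X.g.inner (F.f (e.symm y)) (B (F.f (e.symm y))) (F.N (e.symm y))
        = pullForm X.η (chartVariation φ e) (0, y) (0, e₁)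
            * pullForm (flat X.g A) (chartVariation φ e) (0, y) (0, e₂)
          - pullForm X.η (chartVariation φ e) (0, y) (0, e₂)
            * pullForm (flat X.g A) (chartVariation φ e) (0, y) (0, e₁) ∧
      F.frameDet e y * F.NT (e.symm y)
        = pullForm (flat X.g A) (chartVariation φ e) (0, y) (0, e₁)
            * pullForm (flat X.g B) (chartVariation φ e) (0, y) (0, e₂)
          - pullForm (flat X.g B) (chartVariation φ e) (0, y) (0, e₁)
            * pullForm (flat X.g A) (chartVariation φ e) (0, y) (0, e₂) := by
  have hO := mem_zero hv hC3 hr hy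
  have hyt : y ∈ e.target := hr.target _ hy
  obtain ⟨h1, h2, h3⟩ := hr.frame.vol_mul_normal hO (F.unit_N (e.symm y))
    (F.normal_dMap hr.atlas hyt e₁) (F.normal_dMap hr.atlas hyt e₂)
  rw [F.vol_dMap_N hr.atlas hyt] at h1 h2 h3
  have hd := dMap_comp_chart_symm hr.atlas hyt (F.mdifferentiable_f (e.symm y))
  simp only [pullForm_zero hv hC3 hr hy]
  have hT : F.NT (e.symm y) = X.g.inner (F.f (e.symm y)) (X.T (F.f (e.symm y))) (F.N (e.symm y)) :=
    X.g.symm _ _ _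
  rw [hT]
  have hd1 := hd e₁
  have hd2 := hd e₂
  refine ⟨h1.trans ?_, h2.trans ?_, h3.trans ?_⟩
  all_goals
    rw [hd1, hd2]
    rfl

lemma sq_normNh : F.normNh (e.symm y) ^ 2
    = X.g.inner (F.f (e.symm y)) (A (F.f (e.symm y))) (F.N (e.symm y)) ^ 2
      + X.g.inner (F.f (e.symm y)) (B (F.f (e.symm y))) (F.N (e.symm y)) ^ 2 := by
  have h1 := F.sq_normNh_add_sq_NT (e.symm y)
  have h2 := hr.frame.inner_eq (mem_zero hv hC3 hr hy) (F.N (e.symm y)) (F.N (e.symm y))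
  rw [F.unit_N] at h2
  rw [NT, X.g.symm] at h1
  linear_combination h1 + h2

/-- At the initial time the sub-Riemannian area density is `|N_h|` times the area density. -/
lemma m_zero : (adaptedCoframe X φ e A B σ).m (0, y) = -(F.frameDet e y * F.normNh (e.symm y)) := by
  have h1 := m_eq hv hC3 hr hy
  have h2 := sum_sq_cross hv hC3 hr hy
  obtain ⟨h3, h4, -⟩ := frameDet_mul_normal hv hC3 hr hy
  have h5 := sq_normNh hv hC3 hr hy
  have h6 := F.frameDet_ne_zero hr.atlas (hr.target _ hy)
  have h8 : (adaptedCoframe X φ e A B σ).m (0, y) ^ 2 = (F.frameDet e y * F.normNh (e.symm y)) ^ 2 := by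
    rw [adaptedCoframe, adapted_m _ hr.sq_sign (sum_sq_ne hv hC3 hr _ hy), mul_pow,
      Real.sq_sqrt (by positivity), neg_sq, hr.sq_sign, one_mul, mul_pow, h5, ← neg_eq_iff_eq_neg.mpr h3, ← h4]
    ring
  have h7 : F.areaDens φ 0 (e.symm y) = F.normNh (e.symm y) := by
    rw [h1, neg_sq] at h8
    have h9 : F.areaDens φ 0 (e.symm y) ^ 2 = F.normNh (e.symm y) ^ 2 := by
      refine mul_left_cancel₀ (pow_ne_zero 2 h6) ?_
      linear_combination h8
    have h10 : 0 ≤ F.areaDens φ 0 (e.symm y) := div_nonneg (Real.sqrt_nonneg _) (Real.sqrt_nonneg _)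
    exact (sq_eq_sq₀ h10 (F.normNh_nonneg _)).mp h9
  rw [h1, h7]

lemma normNh_ne : F.normNh (e.symm y) ≠ 0 := by
  have h := (isCartan hv hC3 hr).m_ne _ hy
  rw [m_zero hv hC3 hr hy] at h
  intro h0
  simp [h0] at h

/-- On the initial slice `lam` is the quotient of `⟨N, T⟩` by `|N_h|`. -/
lemma lam_zero : F.NT (e.symm y) = (adaptedCoframe X φ e A B σ).lam (0, y) * F.normNh (e.symm y) := by
  obtain ⟨c, d, -, -, hcd, -, -, hα, hβ, -⟩ := (isStructureSystem hv hC3 hr).exists_rotation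
    (1, 0) hr.sq_sign (sum_sq_ne hv hC3 hr)
  obtain ⟨-, -, h3⟩ := frameDet_mul_normal hv hC3 hr hy
  have hn := normNh_ne hv hC3 hr hy
  have hD := F.frameDet_ne_zero hr.atlas (hr.target _ hy)
  have hα' : ∀ u, (adaptedCoframe X φ e A B σ).α (0, y) u = _ := hα (0, y)
  have hβ' : ∀ u, (adaptedCoframe X φ e A B σ).β (0, y) u = _ := hβ (0, y)
  have hl : (adaptedCoframe X φ e A B σ).lam (0, y) = ((adaptedCoframe X φ e A B σ).β (0, y) (0, e₁)
      * (adaptedCoframe X φ e A B σ).α (0, y) (0, e₂) - (adaptedCoframe X φ e A B σ).β (0, y) (0, e₂)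
      * (adaptedCoframe X φ e A B σ).α (0, y) (0, e₁)) / (adaptedCoframe X φ e A B σ).m (0, y) := rfl
  rw [hl, m_zero hv hC3 hr hy, hα', hα', hβ', hβ']
  field_simp
  have := hcd _ hy
  linear_combination h3 - (pullForm (flat X.g A) (chartVariation φ e) (0, y) (0, e₁)
            * pullForm (flat X.g B) (chartVariation φ e) (0, y) (0, e₂)
          - pullForm (flat X.g B) (chartVariation φ e) (0, y) (0, e₁)
            * pullForm (flat X.g A) (chartVariation φ e) (0, y) (0, e₂)) * this

lemma nh_zero : (adaptedCoframe X φ e A B σ).nh (0, y) = F.normNh (e.symm y) := by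
  have h1 := (adaptedCoframe X φ e A B σ).nh_sq (0, y)
  have h2 := F.sq_normNh_add_sq_NT (e.symm y)
  rw [lam_zero hv hC3 hr hy] at h2
  have h3 := (adaptedCoframe X φ e A B σ).nh_pos (0, y)
  have h0 : (1 + (adaptedCoframe X φ e A B σ).lam (0, y) ^ 2) ≠ 0 := by positivity
  refine (sq_eq_sq₀ h3.le (F.normNh_nonneg _)).mp (mul_right_cancel₀ h0 ?_)
  linear_combination h1 - h2

/-- The image of the characteristic vector under a `1`-form, in terms of the chart. -/
lemma apply_charVec (G : E2 →L[ℝ] ℝ) :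
    G (F.charVec (e.symm y)) = ((adaptedCoframe X φ e A B σ).η (0, y) (0, e₁)
        * G (mfderiv (𝓡 2) (𝓡 2) e.symm y e₂)
      - (adaptedCoframe X φ e A B σ).η (0, y) (0, e₂) * G (mfderiv (𝓡 2) (𝓡 2) e.symm y e₁))
        / (adaptedCoframe X φ e A B σ).m (0, y) := by
  have hη : ∀ b, (adaptedCoframe X φ e A B σ).η (0, y) (0, b) = _ := pullForm_zero hv hC3 hr hy X.η
  let L : E2 →L[ℝ] E2 := mfderiv (𝓡 2) (𝓡 2) e.symm y
  let a : E2 →L[ℝ] ℝ := (X.η (F.f (e.symm y))).comp (mfderiv (𝓡 2) (𝓡 3) F.f (e.symm y))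
  have h := alternating_apply (fun u v => a u * G v - a v * G u)
    (fun r s u v w => by simp only [map_add, map_smul, smul_eq_mul]; ring)
    (fun u v => by ring) L
  have hD := F.normalDet_ne_zero (e.symm y)
  have hE := chartDet_ne_zero hr.atlas (hr.target _ hy)
  have hn := normNh_ne hv hC3 hr hy
  have hc : G (F.charVec (e.symm y)) = -(F.normalDet (e.symm y) * F.normNh (e.symm y))⁻¹
      * (a e₁ * G e₂ - a e₂ * G e₁) := by
    rw [charVec, map_smul, map_sub, map_smul, map_smul]
    rfl
  rw [hη, hη, m_zero hv hC3 hr hy, hc, frameDet]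
  change a (L e₁) * G (L e₂) - a (L e₂) * G (L e₁) = chartDet e y * (a e₁ * G e₂ - a e₂ * G e₁) at h
  change _ = (a (L e₁) * G (L e₂) - a (L e₂) * G (L e₁)) / _
  rw [h]
  field_simp

/-- Derivatives in the characteristic direction, computed in the chart. -/
lemma Zderiv_eq {ψ : S → ℝ} {G : ℝ × E2 → ℝ} (hG : DifferentiableAt ℝ G (0, y))
    (hψ : ∀ᶠ p in 𝓝 (e.symm y), ψ p = G (0, e p)) :
    MDifferentiableAt (𝓡 2) 𝓘(ℝ, ℝ) ψ (e.symm y) ∧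
    (mfderiv (𝓡 2) 𝓘(ℝ, ℝ) ψ (e.symm y) : E2 →L[ℝ] ℝ) (F.charVec (e.symm y))
      = (adaptedCoframe X φ e A B σ).E G (0, y) ∧
    F.Zderiv ψ (e.symm y) = (adaptedCoframe X φ e A B σ).E G (0, y) := by
  have hyt : y ∈ e.target := hr.target _ hy
  have hs : e.symm y ∈ e.source := e.map_target hyt
  have hG' : DifferentiableAt ℝ (fun w : E2 => G (0, w)) (e (e.symm y)) := by
    rw [e.right_inv hyt]
    exact DifferentiableAt.comp y hG ((differentiableAt_const _).prodMk differentiableAt_id)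
  have hd : MDifferentiableAt (𝓡 2) 𝓘(ℝ, ℝ) ψ (e.symm y) := by
    have h1 : MDifferentiableAt (𝓡 2) (𝓡 2) e (e.symm y) :=
      (contMDiffAt_chart hr.atlas hs).mdifferentiableAt (by simp)
    exact (hG'.mdifferentiableAt.comp (e.symm y) h1).congr_of_eventuallyEq hψ
  have hψy : (fun w : E2 => ψ (e.symm w)) =ᶠ[𝓝 y] fun w => G (0, w) := by
    filter_upwards [(e.continuousAt_symm hyt).eventually hψ, e.open_target.mem_nhds hyt] with w hw hwt
    rw [hw, e.right_inv hwt]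
  have hb : ∀ b : E2, (mfderiv (𝓡 2) 𝓘(ℝ, ℝ) ψ (e.symm y) : E2 →L[ℝ] ℝ)
      (mfderiv (𝓡 2) (𝓡 2) e.symm y b) = fderiv ℝ G (0, y) (0, b) := by
    intro b
    have h2 : MDifferentiableAt (𝓡 2) (𝓡 2) e.symm y :=
      (contMDiffAt_chart_symm hr.atlas hyt).mdifferentiableAt (by simp)
    have h3 := mfderiv_comp y hd h2
    have h4 : mfderiv (𝓡 2) 𝓘(ℝ, ℝ) (ψ ∘ e.symm) y = fderiv ℝ (fun w : E2 => G (0, w)) y := by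
      rw [mfderiv_eq_fderiv]
      exact hψy.fderiv_eq
    have h5 : fderiv ℝ (fun w : E2 => G (0, w)) y b = fderiv ℝ G (0, y) (0, b) := by
      have h6 := hG.hasFDerivAt.comp y (hasFDerivAt_prodMk_right (0 : ℝ) y)
      rw [show fderiv ℝ (fun w : E2 => G (0, w)) y = _ from h6.fderiv]
      simp
    rw [← h5, ← h4, h3]
    rfl
  have key : (mfderiv (𝓡 2) 𝓘(ℝ, ℝ) ψ (e.symm y) : E2 →L[ℝ] ℝ) (F.charVec (e.symm y))
      = (adaptedCoframe X φ e A B σ).E G (0, y) := by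
    refine (apply_charVec hv hC3 hr hy (mfderiv (𝓡 2) 𝓘(ℝ, ℝ) ψ (e.symm y))).trans ?_
    exact congrArg₂ (fun r s : ℝ => ((adaptedCoframe X φ e A B σ).η (0, y) (0, e₁) * r
      - (adaptedCoframe X φ e A B σ).η (0, y) (0, e₂) * s) / (adaptedCoframe X φ e A B σ).m (0, y))
      (hb e₂) (hb e₁)
  refine ⟨hd, key, ?_⟩
  rw [Zderiv, F.lift_Z (normNh_ne hv hC3 hr hy)]
  exact key

end IsAdaptedRegion

end OrientedSurface

end InitialSlice

/-! ### Mean curvature and Jacobi operator of the initial slice -/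

section InitialJacobi

variable {M : Type*} [TopologicalSpace M] [ChartedSpace E3 M] [IsManifold (𝓡 3) ∞ M]
  {X : SasakianStructure M} {S : Type*} [TopologicalSpace S] [ChartedSpace E2 S]
  [IsManifold (𝓡 2) 2 S]

namespace OrientedSurface.IsAdaptedRegion

variable {F : OrientedSurface X S} {φ : ℝ → S → M}
  {I : Set ℝ} {C : Set S} (hv : F.IsVariation F.regularSet I C φ)
  (hC3 : F.IsC3On F.regularSet) [T2Space S] {e : OpenPartialHomeomorph S E2} {O : Set M}
  {A B : ∀ q : M, TangentSpace (𝓡 3) q} {σ : ℝ} {Ω : Set (ℝ × E2)}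
  (hr : F.IsAdaptedRegion φ I e O A B σ Ω)

section Pointwise

variable {y : E2} (hy : ((0 : ℝ), y) ∈ Ω)
include hv hC3 hr hy

lemma eventually_lam_nh : (∀ᶠ p in 𝓝 (e.symm y), F.normNh p
      = (adaptedCoframe X φ e A B σ).nh (0, e p)) ∧ (∀ᶠ p in 𝓝 (e.symm y), F.NT p
      = (adaptedCoframe X φ e A B σ).lam (0, e p) * (adaptedCoframe X φ e A B σ).nh (0, e p)) := by
  constructor <;>
  · filter_upwards [hr.eventually_mem hy] with p ⟨hp, hp2, hp3⟩
    have h1 := nh_zero hv hC3 hr hp2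
    have h2 := lam_zero hv hC3 hr hp2
    rw [hp3] at h1 h2
    simp only [h2, h1]

/-- The mean curvature and the shape operator in the characteristic direction, in terms of the
adapted coframe. -/
lemma meanCurvature_shape : (adaptedCoframe X φ e A B σ).h (0, y) = 2 * F.meanCurvature (e.symm y) ∧
    X.g.inner (F.f (e.symm y)) (F.B (e.symm y) (F.Z (e.symm y))) (F.Sv (e.symm y))
      = F.NT (e.symm y) * (F.NT (e.symm y)
          - (adaptedCoframe X φ e A B σ).E (adaptedCoframe X φ e A B σ).nh (0, y))
        + F.normNh (e.symm y) * (F.normNh (e.symm y) + (adaptedCoframe X φ e A B σ).E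
          (fun z => (adaptedCoframe X φ e A B σ).lam z * (adaptedCoframe X φ e A B σ).nh z) (0, y)) ∧
    len X.g (F.B (e.symm y) (F.Z (e.symm y)) + F.Sv (e.symm y)) ^ 2
      = (2 * F.NT (e.symm y)
          - (adaptedCoframe X φ e A B σ).E (adaptedCoframe X φ e A B σ).nh (0, y)) ^ 2
        + (F.normNh (e.symm y) * (2 * F.meanCurvature (e.symm y))) ^ 2
        + (2 * F.normNh (e.symm y) + (adaptedCoframe X φ e A B σ).E
          (fun z => (adaptedCoframe X φ e A B σ).lam z * (adaptedCoframe X φ e A B σ).nh z)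
            (0, y)) ^ 2 := by
  have hcar := isCartan hv hC3 hr
  obtain ⟨c, d, hcs, hds, hcd, hcm, hdm, -, -, hζ⟩ :=
    (isStructureSystem hv hC3 hr).exists_rotation (1, 0) hr.sq_sign (sum_sq_ne hv hC3 hr)
  have hnormal : ∀ w, ((0 : ℝ), w) ∈ Ω → F.f (e.symm w) ∈ O ∧ F.normNh (e.symm w) ≠ 0 ∧
      X.g.inner (F.f (e.symm w)) (A (F.f (e.symm w))) (F.N (e.symm w))
        = d (0, w) * F.normNh (e.symm w) ∧
      X.g.inner (F.f (e.symm w)) (B (F.f (e.symm w))) (F.N (e.symm w))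
        = -c (0, w) * F.normNh (e.symm w) := by
    intro w hw
    obtain ⟨h1, h2, -⟩ := frameDet_mul_normal hv hC3 hr hw
    have h3 := F.frameDet_ne_zero hr.atlas (hr.target _ hw)
    have h4 := hcm _ hw
    have h5 := hdm _ hw
    have h6 := m_zero hv hC3 hr hw
    rw [adaptedCoframe] at h6
    rw [h6] at h4 h5
    refine ⟨mem_zero hv hC3 hr hw, normNh_ne hv hC3 hr hw, mul_left_cancel₀ h3 ?_,
      mul_left_cancel₀ h3 ?_⟩
    · linear_combination h1 + h5
    · linear_combination h2 - h4
  obtain ⟨dc, dc', -⟩ := Zderiv_eq hv hC3 hr hy ((hcs _ hy).differentiableAt (by simp))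
    (ψ := fun p => c (0, e p)) (Eventually.of_forall fun _ => rfl)
  obtain ⟨dd, dd', -⟩ := Zderiv_eq hv hC3 hr hy ((hds _ hy).differentiableAt (by simp))
    (ψ := fun p => d (0, e p)) (Eventually.of_forall fun _ => rfl)
  obtain ⟨hn, ht⟩ := eventually_lam_nh hv hC3 hr hy
  have dn0 := (hcar.contDiffAt_nh hy).differentiableAt (by simp)
  obtain ⟨dn, dn', -⟩ := Zderiv_eq hv hC3 hr hy dn0 hn
  obtain ⟨dt, dt', -⟩ := Zderiv_eq hv hC3 hr hy (ψ := F.NT)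
    (G := fun z => (adaptedCoframe X φ e A B σ).lam z * (adaptedCoframe X φ e A B σ).nh z)
    (((hcar.contDiffAt_lam hy).differentiableAt (by simp)).mul dn0) ht
  obtain ⟨hO, hn0, -, -⟩ := hnormal y hy
  have hcd' : ∀ᶠ p in 𝓝 (e.symm y), c (0, e p) ^ 2 + d (0, e p) ^ 2 = 1 := by
    filter_upwards [hr.eventually_mem hy] with p hp using hcd _ hp.2.1
  have hN : ∀ᶠ q in 𝓝 (e.symm y), F.f q ∈ O ∧ F.normNh q ≠ 0 ∧
      X.g.inner (F.f q) (A (F.f q)) (F.N q) = d (0, e q) * F.normNh q ∧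
      X.g.inner (F.f q) (B (F.f q)) (F.N q) = -c (0, e q) * F.normNh q := by
    filter_upwards [hr.eventually_mem hy] with p ⟨hp, hp2, hp3⟩
    have h := hnormal _ hp2
    rwa [hp3] at h
  have hfp := F.mdifferentiable_f (e.symm y)
  have hyt : e (e.symm y) = y := e.right_inv (hr.target _ hy)
  refine ⟨?_, ?_⟩
  · have hm := meanCurvature_eq hr.frame hO hn0 dc.hasMFDerivAt dd.hasMFDerivAt hcd' hN hfp
    have hm2 : F.meanCurvature (e.symm y) = -(c (0, y) * (adaptedCoframe X φ e A B σ).E d (0, y)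
        - d (0, y) * (adaptedCoframe X φ e A B σ).E c (0, y)
        + connForm X A B (F.f (e.symm y)) (F.Z (e.symm y))) / 2 := by
      rw [hm, hyt]
      exact congrArg₂ (fun r s : ℝ => -(c (0, y) * r - d (0, y) * s
        + connForm X A B (F.f (e.symm y)) (F.Z (e.symm y))) / 2) dd' dc'
    have hZ := F.mfderiv_charVec hn0
    have hw1 := apply_charVec hv hC3 hr hy ((websterForm X A B (F.f (e.symm y))).comp
      (mfderiv (𝓡 2) (𝓡 3) F.f (e.symm y)))
    have hw2 := apply_charVec hv hC3 hr hy ((X.η (F.f (e.symm y))).comp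
      (mfderiv (𝓡 2) (𝓡 3) F.f (e.symm y)))
    have hw : connForm X A B (F.f (e.symm y)) (F.Z (e.symm y))
        = websterForm X A B (F.f (e.symm y)) (F.Z (e.symm y))
          + X.η (F.f (e.symm y)) (F.Z (e.symm y)) := by
      rw [websterForm, _root_.sub_apply]
      exact (sub_add_cancel _ _).symm
    have hη : ∀ b, (adaptedCoframe X φ e A B σ).η (0, y) (0, b) = X.η (F.f (e.symm y))
        (mfderiv (𝓡 2) (𝓡 3) F.f (e.symm y) (mfderiv (𝓡 2) (𝓡 2) e.symm y b)) :=
      pullForm_zero hv hC3 hr hy X.η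
    have hww := pullForm_zero hv hC3 hr hy (websterForm X A B)
    have hw1' : websterForm X A B (F.f (e.symm y)) (F.Z (e.symm y))
        = ((adaptedCoframe X φ e A B σ).η (0, y) (0, e₁)
          * pullForm (websterForm X A B) (chartVariation φ e) (0, y) (0, e₂)
        - (adaptedCoframe X φ e A B σ).η (0, y) (0, e₂)
          * pullForm (websterForm X A B) (chartVariation φ e) (0, y) (0, e₁))
          / (adaptedCoframe X φ e A B σ).m (0, y) := by
      rw [← hZ, hww, hww]; exact hw1
    have hw2' : X.η (F.f (e.symm y)) (F.Z (e.symm y)) = 0 := by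
      rw [← hZ]
      refine hw2.trans ?_
      rw [hη, hη]
      exact (congrArg (· / _) (sub_eq_zero.mpr (mul_comm _ _))).trans (zero_div _)
    have hζ' : ∀ u, (adaptedCoframe X φ e A B σ).ζ (0, y) u = _ := hζ (0, y)
    have hh : (adaptedCoframe X φ e A B σ).h (0, y)
        = -((adaptedCoframe X φ e A B σ).η (0, y) (0, e₁) * (adaptedCoframe X φ e A B σ).ζ (0, y) (0, e₂)
          - (adaptedCoframe X φ e A B σ).η (0, y) (0, e₂) * (adaptedCoframe X φ e A B σ).ζ (0, y) (0, e₁))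
          / (adaptedCoframe X φ e A B σ).m (0, y) := rfl
    have hE : ∀ G, (adaptedCoframe X φ e A B σ).E G (0, y)
        = ((adaptedCoframe X φ e A B σ).η (0, y) (0, e₁) * fderiv ℝ G (0, y) (0, e₂)
          - (adaptedCoframe X φ e A B σ).η (0, y) (0, e₂) * fderiv ℝ G (0, y) (0, e₁))
          / (adaptedCoframe X φ e A B σ).m (0, y) := fun _ => rfl
    rw [hm2, hh, hw, hw1', hw2', hζ', hζ', hE, hE]
    ring
  · have hb := B_Z_eq hr.frame hO hn0 dc.hasMFDerivAt dd.hasMFDerivAt hcd' hN hfp dn.hasMFDerivAt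
      dt.hasMFDerivAt
    refine ⟨hb.1.trans ?_, hb.2.trans ?_⟩
    · exact congrArg₂ (fun r s : ℝ => F.NT (e.symm y) * (F.NT (e.symm y) - r)
        + F.normNh (e.symm y) * (F.normNh (e.symm y) + s)) dn' dt'
    · exact congrArg₂ (fun r s : ℝ => (2 * F.NT (e.symm y) - r) ^ 2
        + (F.normNh (e.symm y) * (2 * F.meanCurvature (e.symm y))) ^ 2
        + (2 * F.normNh (e.symm y) + s) ^ 2) dn' dt'

end Pointwise

variable {H : ℝ} (hH : ∀ p ∈ F.regularSet, F.meanCurvature p = H)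
  {y : E2} (hy : ((0 : ℝ), y) ∈ Ω)
include hv hC3 hr hH hy

lemma h_zero : (adaptedCoframe X φ e A B σ).h (0, y) = 2 * H := by
  rw [(meanCurvature_shape hv hC3 hr hy).1, hH _ (hr.regular _ hy)]

/-- On the initial slice the mean curvature is constant, so its derivative along the slice vanishes;
the derivative in the direction of the velocity is given by the Jacobi operator. -/
lemma fderiv_h_slice (b : E2) : fderiv ℝ (adaptedCoframe X φ e A B σ).h (0, y) (0, b) = 0 := by
  have hd := ((isCartan hv hC3 hr).contDiffAt_h hy).differentiableAt (by simp)
  have h6 := hd.hasFDerivAt.comp y (hasFDerivAt_prodMk_right (0 : ℝ) y)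
  have h7 : ((adaptedCoframe X φ e A B σ).h ∘ fun w : E2 => ((0 : ℝ), w)) =ᶠ[𝓝 y]
      fun _ => 2 * H := by
    have hc : ContinuousAt (fun w : E2 => ((0 : ℝ), w)) y := by fun_prop
    filter_upwards [hc.preimage_mem_nhds (hr.isOpen.mem_nhds hy)] with w hw
    exact h_zero hv hC3 hr hH hw
  have h8 := h6.unique ((hasFDerivAt_const (2 * H) y).congr_of_eventuallyEq h7)
  have := congrArg (fun l : E2 →L[ℝ] ℝ => l b) h8
  simpa using this

/-- The Jacobi operator in terms of the adapted coframe. -/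
lemma jacobiOp_eq {ψ : S → ℝ} {g : ℝ × E2 → ℝ} (hg : ContDiffAt ℝ 2 g (0, y))
    (hψ : ∀ᶠ p in 𝓝 (e.symm y), ψ p = F.normNh p * g (0, e p)) :
    F.jacobiOp ψ (e.symm y)
      = (adaptedCoframe X φ e A B σ).E ((adaptedCoframe X φ e A B σ).E g) (0, y)
        + 2 * (adaptedCoframe X φ e A B σ).lam (0, y) * (adaptedCoframe X φ e A B σ).E g (0, y)
        + (adaptedCoframe X φ e A B σ).Q (fun z => X.webster (chartVariation φ e z)) (0, y)
          * g (0, y) := by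
  have hcar := isCartan hv hC3 hr
  obtain ⟨hn, ht⟩ := eventually_lam_nh hv hC3 hr hy
  have hyt : e (e.symm y) = y := e.right_inv (hr.target _ hy)
  obtain ⟨hmean, hb, hq⟩ := meanCurvature_shape hv hC3 hr hy
  have hng : ContDiffAt ℝ 2 (fun z => (adaptedCoframe X φ e A B σ).nh z * g z) (0, y) :=
    (hcar.contDiffAt_nh hy).mul hg
  have hψ2 : ∀ᶠ p in 𝓝 (e.symm y), ψ p
      = (fun z => (adaptedCoframe X φ e A B σ).nh z * g z) (0, e p) := by
    filter_upwards [hψ, hn] with p h1 h2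
    rw [h1, h2]
  have hZ := (Zderiv_eq hv hC3 hr hy (hng.differentiableAt (by simp)) hψ2).2.2
  have hZ2 : ∀ᶠ p in 𝓝 (e.symm y), F.Zderiv ψ p = (adaptedCoframe X φ e A B σ).E
      (fun z => (adaptedCoframe X φ e A B σ).nh z * g z) (0, e p) := by
    have hd : ∀ᶠ w in 𝓝 y, ContDiffAt ℝ 2
        (fun z => (adaptedCoframe X φ e A B σ).nh z * g z) (0, w) := by
      have hc : ContinuousAt (fun w : E2 => ((0 : ℝ), w)) y := by fun_prop
      exact hc.eventually (hng.eventually (by simp))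
    have hce : Tendsto e (𝓝 (e.symm y)) (𝓝 y) := by
      have := e.continuousAt (e.map_target (hr.target _ hy))
      rwa [ContinuousAt, hyt] at this
    filter_upwards [hψ2.eventually_nhds, hr.eventually_mem hy, hce.eventually hd] with p h1
      ⟨hp, hp2, hp3⟩ h2
    have h3 := Zderiv_eq hv hC3 hr hp2 (ψ := ψ) (h2.differentiableAt (by simp))
      (by rw [hp3]; exact h1)
    rw [← h3.2.2, hp3]
  have hZZ := (Zderiv_eq hv hC3 hr hy
    ((hcar.contDiffAt_E hy hng).differentiableAt (by simp)) hZ2).2.2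
  have hj := hcar.jacobi_mul_nh hy (fderiv_h_slice hv hC3 hr hH hy e₁)
    (fderiv_h_slice hv hC3 hr hH hy e₂) hg (t := F.NT (e.symm y))
    (by rw [ht.self_of_nhds, hyt]) rfl
  have hw : X.webster (chartVariation φ e (0, y)) = X.webster (F.f (e.symm y)) := by
    rw [chartVariation, hv.zero]
  have hψy := hψ.self_of_nhds
  rw [hyt] at hψy
  rw [← hj, jacobiOp, q, hb, hq, hZ, hZZ, hψy, hw, nh_zero hv hC3 hr hy, hmean]

end OrientedSurface.IsAdaptedRegion

end InitialJacobi

/-! ### Existence of adapted coframes, and functions represented in charts -/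

/-- A form on the plane whose components are the restrictions to the initial slice of functions of
class `C¹` on the product with the time axis is itself of class `C¹`, and it has the same
derivatives along the slice. -/
lemma contDiffAt_of_slice {Θ : E2 → E2 →L[ℝ] ℝ} {Ψ : E2 → ℝ × E2 → ℝ} {W : Set E2} (hW : IsOpen W)
    (hΘ : ∀ w ∈ W, ∀ b, Θ w b = Ψ b (0, w)) (hΨ : ∀ w ∈ W, ∀ b, ContDiffAt ℝ 1 (Ψ b) (0, w))
    {y : E2} (hy : y ∈ W) :
    ContDiffAt ℝ 1 Θ y ∧ ∀ u b, fderiv ℝ Θ y u b = fderiv ℝ (Ψ b) (0, y) (0, u) := by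
  have hi : ∀ w : E2, ContDiffAt ℝ 1 (fun w : E2 => ((0 : ℝ), w)) w := fun w =>
    contDiffAt_const.prodMk contDiffAt_id
  have hc : ∀ b, ContDiffOn ℝ 1 (fun w => Θ w b) W := fun b =>
    ContDiffOn.congr (fun w hw => ((hΨ w hw b).comp w (hi w)).contDiffWithinAt)
      fun w hw => hΘ w hw b
  have h1 : ContDiffAt ℝ 1 Θ y := (contDiffOn_clm_apply.mpr hc).contDiffAt (hW.mem_nhds hy)
  refine ⟨h1, fun u b => ?_⟩
  have hd := h1.differentiableAt (by simp)
  rw [← Coframe.fderiv_form_apply hd]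
  have h2 : (fun w => Θ w b) =ᶠ[𝓝 y] fun w => Ψ b (0, w) := by
    filter_upwards [hW.mem_nhds hy] with w hw using hΘ w hw b
  have h3 := ((hΨ y hy b).differentiableAt (by simp)).hasFDerivAt.comp y
    (hasFDerivAt_prodMk_right (0 : ℝ) y)
  rw [h2.fderiv_eq, show fderiv ℝ (fun w => Ψ b (0, w)) y = _ from h3.fderiv]
  simp

section Region

variable {M : Type*} [TopologicalSpace M] [ChartedSpace E3 M] [IsManifold (𝓡 3) ∞ M]
  {X : SasakianStructure M} {S : Type*} [TopologicalSpace S] [ChartedSpace E2 S]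
  [IsManifold (𝓡 2) 2 S]

/-- The sub-Riemannian area element of an immersion vanishes only at points whose tangent plane is
horizontal. -/
lemma subAreaUnit_ne_zero {h : S → M} {p : S} (hi : Function.Injective (mfderiv (𝓡 2) (𝓡 3) h p))
    (hp : ∃ v, X.η (h p) (mfderiv (𝓡 2) (𝓡 3) h p v) ≠ 0) : subAreaUnit X h p ≠ 0 := by
  intro h0
  let L : E2 →L[ℝ] E3 := mfderiv (𝓡 2) (𝓡 3) h p
  let a : E2 →L[ℝ] ℝ := (X.η (h p)).comp (mfderiv (𝓡 2) (𝓡 3) h p)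
  have hsq := len_sq X.g (cross X (h p) (mfderiv (𝓡 2) (𝓡 3) h p e₁) (mfderiv (𝓡 2) (𝓡 3) h p e₂))
  have hc : cross X (h p) (mfderiv (𝓡 2) (𝓡 3) h p e₁) (mfderiv (𝓡 2) (𝓡 3) h p e₂) = 0 := by
    by_contra hne
    have := X.g.pos (h p) _ hne
    rw [← hsq] at this
    change 0 < subAreaUnit X h p ^ 2 at this
    rw [h0] at this
    norm_num at this
  have h1 : L (a e₁ • e₂ - a e₂ • e₁) = 0 := by
    rw [map_sub, map_smul, map_smul]
    exact hc
  have h2 : a e₁ • e₂ - a e₂ • e₁ = 0 := hi (h1.trans (map_zero L).symm)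
  have h3 : a e₁ = 0 := by
    have := congrArg (fun v : E2 => v 1) h2
    simpa [e₁, e₂] using this
  have h4 : a e₂ = 0 := by
    have := congrArg (fun v : E2 => v 0) h2
    simpa [e₁, e₂] using this
  obtain ⟨v, hv⟩ := hp
  refine hv ?_
  change a v = 0
  have h5 := e2_expand v
  rw [h5, map_add, map_smul, map_smul, h3, h4]
  simp

namespace OrientedSurface

variable {F : OrientedSurface X S} {φ : ℝ → S → M} {I : Set ℝ} {C : Set S}

/-- Around every regular point the adapted coframe exists for small times. -/
lemma exists_isAdaptedRegion (hv : F.IsVariation F.regularSet I C φ) (hC3 : F.IsC3On F.regularSet)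
    [T2Space S] {p : S} (hp : p ∈ F.regularSet) :
    ∃ O A B σ Ω, F.IsAdaptedRegion φ I (chartAt E2 p) O A B σ Ω ∧
      ((0 : ℝ), chartAt E2 p p) ∈ Ω := by
  obtain ⟨O, A, B, hO, hf⟩ := exists_isHorFrame X (F.f p)
  set e := chartAt E2 p with he
  have hea : e ∈ atlas E2 S := chart_mem_atlas E2 p
  have hps : p ∈ e.source := mem_chart_source E2 p
  have hpt : e p ∈ e.target := e.map_source hps
  have hinv : e.symm (e p) = p := e.left_inv hps
  have hD := F.frameDet_ne_zero hea hpt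
  -- `σ` is the sign of the area form of the chart at the point.
  obtain ⟨σ, hσ, hσD⟩ : ∃ σ : ℝ, σ ^ 2 = 1 ∧ 0 < σ * F.frameDet e (e p) := by
    rcases lt_or_gt_of_ne hD with h | h
    · exact ⟨-1, by norm_num, by linarith⟩
    · exact ⟨1, by norm_num, by linarith⟩
  have c1 : ContinuousAt (fun z : ℝ × E2 => z.1) ((0 : ℝ), e p) := by fun_prop
  have c2 : ContinuousAt (fun z : ℝ × E2 => z.2) ((0 : ℝ), e p) := by fun_prop
  have c3 : ContinuousAt (fun z : ℝ × E2 => e.symm z.2) ((0 : ℝ), e p) :=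
    ContinuousAt.comp (g := e.symm) (e.continuousAt_symm hpt) c2
  have hI : ∀ᶠ z in 𝓝 ((0 : ℝ), e p), z.1 ∈ I := c1.eventually (hv.isOpen_I.mem_nhds hv.zero_mem)
  have ht : ∀ᶠ z in 𝓝 ((0 : ℝ), e p), z.2 ∈ e.target := c2.eventually (e.open_target.mem_nhds hpt)
  have hreg : ∀ᶠ z in 𝓝 ((0 : ℝ), e p), e.symm z.2 ∈ F.regularSet := by
    refine c3.eventually (F.isOpen_regularSet.mem_nhds ?_)
    simpa only [hinv] using hp
  have hk := hv.contMDiffAt_chart hC3 hea hv.zero_mem hpt (by rwa [hinv])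
  have hO0 : chartVariation φ e (0, e p) ∈ O := by
    rw [chartVariation, hv.zero]
    simpa only [hinv] using hO
  have hmem : ∀ᶠ z in 𝓝 ((0 : ℝ), e p), chartVariation φ e z ∈ O :=
    hk.continuousAt.eventually (hf.isOpen.mem_nhds hO0)
  have hsign : ∀ᶠ z in 𝓝 ((0 : ℝ), e p), 0 < σ * F.frameDet e z.2 := by
    have h1 : ContinuousAt (fun z : ℝ × E2 => σ * F.frameDet e z.2) ((0 : ℝ), e p) :=
      continuousAt_const.mul (ContinuousAt.comp (g := F.frameDet e)
        ((F.continuousOn_frameDet hea).continuousAt (e.open_target.mem_nhds hpt)) c2)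
    exact h1.eventually (lt_mem_nhds hσD)
  -- the square of the sub-Riemannian area density is a polynomial in the derivatives
  let a : E2 → ℝ × E2 → ℝ := fun b z => pullForm X.η (chartVariation φ e) z (0, b)
  let γ : E2 → E2 → ℝ × E2 → ℝ := fun u w z => X.g.inner (chartVariation φ e z)
    (dMap (chartVariation φ e) z (0, u)) (dMap (chartVariation φ e) z (0, w))
  let G : ℝ × E2 → ℝ := fun z => a e₁ z ^ 2 * γ e₂ e₂ z - 2 * (a e₁ z * a e₂ z) * γ e₁ e₂ z
    + a e₂ z ^ 2 * γ e₁ e₁ z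
  have hG : ContinuousAt G ((0 : ℝ), e p) := by
    have ha : ∀ b, ContinuousAt (a b) ((0 : ℝ), e p) := fun b =>
      ((contDiffAt_pullForm_frame X (n := 2) (by norm_num) hk hf hO0).2.2.clm_apply
        contDiffAt_const).continuousAt
    have hγ : ∀ u w, ContinuousAt (γ u w) ((0 : ℝ), e p) := fun u w =>
      continuousAt_inner_dMap X (hk.of_le (by norm_num)) _ _
    exact ((((ha _).pow 2).mul (hγ _ _)).sub ((continuousAt_const.mul ((ha _).mul (ha _))).mul
      (hγ _ _))).add (((ha _).pow 2).mul (hγ _ _))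
  have hGeq : ∀ z : ℝ × E2, z.1 ∈ I → z.2 ∈ e.target → e.symm z.2 ∈ F.regularSet →
      G z = (chartDet e z.2 * subAreaUnit X (φ z.1) (e.symm z.2)) ^ 2 := by
    rintro ⟨s, y⟩ hs hy hy2
    have hd := hv.dMap_slice hC3 hea hs hy hy2
    have h := cross_comp (X := X) (mfderiv (𝓡 2) (𝓡 3) (φ s) (e.symm y))
      (mfderiv (𝓡 2) (𝓡 2) e.symm y)
    have hx := len_sq X.g (cross X (φ s (e.symm y)) (mfderiv (𝓡 2) (𝓡 3) (φ s) (e.symm y) e₁)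
      (mfderiv (𝓡 2) (𝓡 3) (φ s) (e.symm y) e₂))
    let η' : E3 →L[ℝ] ℝ := X.η (φ s (e.symm y))
    let g' : E3 →L[ℝ] E3 →L[ℝ] ℝ := X.g.inner (φ s (e.symm y))
    have hsymm : ∀ u w, g' u w = g' w u := X.g.symm (φ s (e.symm y))
    let x : E3 := cross X (φ s (e.symm y)) (mfderiv (𝓡 2) (𝓡 3) (φ s) (e.symm y) e₁)
      (mfderiv (𝓡 2) (𝓡 3) (φ s) (e.symm y) e₂)
    let v : E2 → E3 := fun b => mfderiv (𝓡 2) (𝓡 3) (φ s) (e.symm y)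
      (mfderiv (𝓡 2) (𝓡 2) e.symm y b)
    have h' : η' (v e₁) • v e₂ - η' (v e₂) • v e₁ = chartDet e y • x := h
    refine (congrArg₂ (fun x1 x2 : E3 => η' x1 ^ 2 * g' x2 x2 - 2 * (η' x1 * η' x2) * g' x1 x2
      + η' x2 ^ 2 * g' x1 x1) (hd e₁) (hd e₂)).trans ?_
    have h2 : (chartDet e y * subAreaUnit X (φ s) (e.symm y)) ^ 2
        = g' (chartDet e y • x) (chartDet e y • x) := by
      rw [mul_pow, map_smul, map_smul, _root_.smul_apply, smul_eq_mul, smul_eq_mul, ← mul_assoc,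
        ← sq]
      exact congrArg (fun r : ℝ => chartDet e y ^ 2 * r) hx
    refine Eq.trans ?_ h2.symm
    rw [← h']
    change η' (v e₁) ^ 2 * g' (v e₂) (v e₂) - 2 * (η' (v e₁) * η' (v e₂)) * g' (v e₁) (v e₂)
      + η' (v e₂) ^ 2 * g' (v e₁) (v e₁) = _
    simp only [map_sub, map_smul, _root_.sub_apply, _root_.smul_apply, smul_eq_mul]
    rw [hsymm (v e₂) (v e₁)]
    ring
  have h0 : G (0, e p) ≠ 0 := by
    rw [hGeq _ hv.zero_mem hpt (by rwa [hinv])]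
    refine pow_ne_zero 2 (mul_ne_zero (chartDet_ne_zero hea hpt) ?_)
    simp only [hinv]
    rw [show φ 0 = F.f from funext hv.zero]
    exact subAreaUnit_ne_zero (F.immersion p) hp
  obtain ⟨Ω, hΩ, hΩo, hmemΩ⟩ := eventually_nhds_iff.mp
    (hI.and (ht.and (hreg.and (hmem.and (hsign.and (hG.eventually_ne h0))))))
  refine ⟨O, A, B, σ, Ω, ⟨hea, hf, hΩo, fun z hz => (hΩ z hz).1, fun z hz => (hΩ z hz).2.1,
    fun z hz => (hΩ z hz).2.2.1, fun z hz => (hΩ z hz).2.2.2.1, fun z hz => (hΩ z hz).2.2.2.2.1,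
    hσ, fun z hz hz0 => ?_⟩, hmemΩ⟩
  have h1 := (hΩ z hz).2.2.2.2.2
  rw [hGeq z (hΩ z hz).1 (hΩ z hz).2.1 (hΩ z hz).2.2.1, hz0] at h1
  simp at h1

namespace IsAdaptedRegion

variable (hv : F.IsVariation F.regularSet I C φ)
  (hC3 : F.IsC3On F.regularSet) [T2Space S] {e : OpenPartialHomeomorph S E2} {O : Set M}
  {A B : ∀ q : M, TangentSpace (𝓡 3) q} {σ : ℝ} {Ω : Set (ℝ × E2)}
  (hr : F.IsAdaptedRegion φ I e O A B σ Ω)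
include hr

/-- The function `b` on the surface, multiplied by the area form of the chart, is `G`. -/
def Represents (F : OrientedSurface X S) (e : OpenPartialHomeomorph S E2) (Ω : Set (ℝ × E2))
    (b : ℝ → S → ℝ) (G : ℝ × E2 → ℝ) : Prop :=
  ∀ z ∈ Ω, F.frameDet e z.2 * b z.1 (e.symm z.2) = G z

lemma eventually_prod {p : S} (hps : p ∈ e.source) (hp : ((0 : ℝ), e p) ∈ Ω) :
    ∀ᶠ z in 𝓝 ((0 : ℝ), p), z.2 ∈ e.source ∧ (z.1, e z.2) ∈ Ω := by
  have h1 : ContinuousAt (fun z : ℝ × S => (z.1, e z.2)) ((0 : ℝ), p) :=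
    continuousAt_fst.prodMk (ContinuousAt.comp (g := e) (e.continuousAt hps) continuousAt_snd)
  exact (continuousAt_snd.eventually (e.open_source.mem_nhds hps)).and
    (h1.eventually (hr.isOpen.mem_nhds hp))

/-- The time derivative of a represented function is represented by the time derivative, because the
area form of the chart does not depend on time. -/
lemma hasDerivAt_of_represents {b : ℝ → S → ℝ} {G : ℝ × E2 → ℝ} (hb : Represents F e Ω b G)
    {z : ℝ × E2} (hz : z ∈ Ω) (hG : DifferentiableAt ℝ G z) :
    HasDerivAt (fun t => b t (e.symm z.2)) (deriv (fun t => b t (e.symm z.2)) z.1) z.1 ∧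
      F.frameDet e z.2 * deriv (fun t => b t (e.symm z.2)) z.1 = fderiv ℝ G z (1, 0) := by
  have hD := F.frameDet_ne_zero hr.atlas (hr.target z hz)
  have h1 : HasDerivAt (fun t : ℝ => G (t, z.2)) (fderiv ℝ G z (1, 0)) z.1 := by
    have h2 : HasDerivAt (fun t : ℝ => (t, z.2)) ((1 : ℝ), (0 : E2)) z.1 :=
      (hasDerivAt_id _).prodMk (hasDerivAt_const _ _)
    exact (show HasFDerivAt G (fderiv ℝ G z) (z.1, z.2) from hG.hasFDerivAt).comp_hasDerivAt z.1 h2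
  have h3 : (fun t => b t (e.symm z.2)) =ᶠ[𝓝 z.1] fun t => G (t, z.2) / F.frameDet e z.2 := by
    have hc : ContinuousAt (fun t : ℝ => (t, z.2)) z.1 := by fun_prop
    filter_upwards [hc.preimage_mem_nhds (hr.isOpen.mem_nhds hz)] with t ht
    rw [← hb _ ht, mul_div_cancel_left₀ _ hD]
  have h4 := (h1.div_const (F.frameDet e z.2)).congr_of_eventuallyEq h3
  rw [h4.deriv]
  exact ⟨h4, mul_div_cancel₀ _ hD⟩

lemma continuousAt_of_represents {b : ℝ → S → ℝ} {G : ℝ × E2 → ℝ} (hb : Represents F e Ω b G)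
    {z : ℝ × S} (hs : z.2 ∈ e.source) (hz : (z.1, e z.2) ∈ Ω)
    (hG : ContinuousAt G (z.1, e z.2)) :
    ContinuousAt (fun w : ℝ × S => b w.1 w.2) z := by
  have hD := F.frameDet_ne_zero hr.atlas (hr.target _ hz)
  have h1 : ContinuousAt (fun w : ℝ × S => (w.1, e w.2)) z :=
    continuousAt_fst.prodMk (ContinuousAt.comp (g := e) (e.continuousAt hs) continuousAt_snd)
  have h2 : ContinuousAt (fun w : ℝ × S => F.frameDet e (e w.2)) z :=
    ContinuousAt.comp (g := F.frameDet e) ((F.continuousOn_frameDet hr.atlas).continuousAt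
      (e.open_target.mem_nhds (hr.target _ hz)))
      (ContinuousAt.comp (g := e) (e.continuousAt hs) continuousAt_snd)
  have h3 : (fun w : ℝ × S => b w.1 w.2) =ᶠ[𝓝 z]
      fun w => G (w.1, e w.2) / F.frameDet e (e w.2) := by
    filter_upwards [h1.preimage_mem_nhds (hr.isOpen.mem_nhds hz),
      continuousAt_snd.eventually (e.open_source.mem_nhds hs)] with w hw hws
    have h5 := hb _ hw
    simp only [e.left_inv hws] at h5
    rw [← h5, mul_div_cancel_left₀ _ (F.frameDet_ne_zero hr.atlas (hr.target _ hw))]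
  exact (ContinuousAt.div (ContinuousAt.comp (g := G) (f := fun w : ℝ × S => (w.1, e w.2)) (x := z) hG h1) h2 hD).congr_of_eventuallyEq h3

lemma eventually_paramDeriv {b : ℝ → S → ℝ} {G : ℝ × E2 → ℝ} (hb : Represents F e Ω b G)
    (hG : ∀ z ∈ Ω, ContDiffAt ℝ 1 G z) {p : S} (hps : p ∈ e.source) (hp : ((0 : ℝ), e p) ∈ Ω) :
    ∀ᶠ z in 𝓝 ((0 : ℝ), p), HasDerivAt (fun t => b t z.2) (deriv (fun t => b t z.2) z.1) z.1 ∧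
      ContinuousAt (fun w : ℝ × S => b w.1 w.2) z ∧
      ContinuousAt (fun w : ℝ × S => deriv (fun t => b t w.2) w.1) z := by
  filter_upwards [hr.eventually_prod hps hp] with z ⟨hs, hz⟩
  have h1 := (hr.hasDerivAt_of_represents hb hz ((hG _ hz).differentiableAt (by simp))).1
  simp only [e.left_inv hs] at h1
  refine ⟨h1, hr.continuousAt_of_represents hb hs hz (hG _ hz).continuousAt, ?_⟩
  refine hr.continuousAt_of_represents (b := fun s q => deriv (fun t => b t q) s)
    (G := fun z => fderiv ℝ G z (1, 0)) (fun w hw => (hr.hasDerivAt_of_represents hb hw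
      ((hG _ hw).differentiableAt (by simp))).2) hs hz ?_
  exact (((hG _ hz).fderiv_right (m := 0) (by norm_num)).clm_apply contDiffAt_const).continuousAt

end IsAdaptedRegion

end OrientedSurface

end Region

/-! ### Densities of area and volume and their time derivatives -/

section Identities

variable {M : Type*} [TopologicalSpace M] [ChartedSpace E3 M] [IsManifold (𝓡 3) ∞ M]
  {X : SasakianStructure M} {S : Type*} [TopologicalSpace S] [ChartedSpace E2 S]
  [IsManifold (𝓡 2) 2 S]

namespace OrientedSurface

variable (F : OrientedSurface X S) (φ : ℝ → S → M) (H : ℝ)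

/-- The first derivative of the area integrand in the deformation parameter. -/
def dAreaDens (s : ℝ) (p : S) : ℝ := deriv (fun t => F.areaDens φ t p) s

/-- The second derivative of the area integrand in the deformation parameter. -/
def ddAreaDens (s : ℝ) (p : S) : ℝ := deriv (fun t => F.dAreaDens φ t p) s

/-- The derivative of the volume integrand in the deformation parameter. -/
def dVolDens (s : ℝ) (p : S) : ℝ := deriv (fun t => F.volDens φ t p) s

/-- The normal component of the velocity, divided by `-|N_h|`. -/
def normalSpeed (p : S) : ℝ := -F.volDens φ 0 p / F.areaDens φ 0 p

/-- The integrand of the second variation, with the square completed by means of the function `g`;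
here `ψ` is the product of `g` and `|N_h|`. -/
def stabilityDens (ψ g : S → ℝ) (p : S) : ℝ :=
  (F.Zderiv (F.normalSpeed φ) p - F.normalSpeed φ p * (F.Zderiv g p / g p)) ^ 2
    - F.normalSpeed φ p ^ 2 * (F.jacobiOp ψ p / g p)

/-- The primitive of the difference between the second variation of the integrands and the
completed square. -/
def secondFlux (g : S → ℝ) (p : S) : TangentSpace (𝓡 2) p →L[ℝ] ℝ :=
  let a : E2 →L[ℝ] ℝ := deriv (fun s => (F.fluxForm φ s p : E2 →L[ℝ] ℝ)) 0
  let b : E2 →L[ℝ] ℝ := (X.η (F.f p)).comp (mfderiv (𝓡 2) (𝓡 3) F.f p);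
  -(a + (F.normalSpeed φ p * F.Zderiv (F.normalSpeed φ) p
    - F.normalSpeed φ p ^ 2 * (F.Zderiv g p / g p)) • b)

variable {F φ H} {I : Set ℝ} {C : Set S}

namespace IsVariation

variable (hv : F.IsVariation F.regularSet I C φ) [T2Space S]
include hv

lemma velocity_off {s : ℝ} (hs : s ∈ I) {p : S} (hp : p ∉ C) : velocity φ s p = 0 := by
  have h : (fun t => φ t p) =ᶠ[𝓝 s] fun _ => F.f p := by
    filter_upwards [hv.isOpen_I.mem_nhds hs] with t ht using hv.off t ht p hp
  have h1 : (mfderiv 𝓘(ℝ, ℝ) (𝓡 3) (fun t => φ t p) s : ℝ →L[ℝ] E3) = 0 :=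
    h.mfderiv_eq.trans mfderiv_const
  exact congrArg (fun l : ℝ →L[ℝ] E3 => l 1) h1

lemma volDens_off {s : ℝ} (hs : s ∈ I) {p : S} (hp : p ∉ C) : F.volDens φ s p = 0 := by
  rw [volDens, hv.velocity_off hs hp, vol_apply]
  have h1 : X.dη (φ s p) 0 = 0 := by
    ext1 v
    have : X.dη (φ s p) 0 v = -X.dη (φ s p) v 0 := extD_antisymm (φ s p) 0 v
    rw [this, map_zero, neg_zero]; rfl
  rw [h1, map_zero]
  simp

lemma fluxForm_off {s : ℝ} (hs : s ∈ I) {p : S} (hp : p ∉ C) : F.fluxForm φ s p = 0 := by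
  rw [fluxForm, hv.velocity_off hs hp, map_zero, map_zero, zero_smul, zero_smul, sub_zero,
    ContinuousLinearMap.zero_comp]

lemma areaDens_off {s : ℝ} (hs : s ∈ I) {p : S} (hp : p ∉ C) :
    F.areaDens φ s p = subAreaUnit X F.f p / areaUnit X F.f p := by
  have h := hv.eventuallyEq_off hs hp
  have h1 : ∀ (h' : S → M), h' =ᶠ[𝓝 p] F.f → subAreaUnit X h' p = subAreaUnit X F.f p := by
    intro h' hh
    have e1 := hh.self_of_nhds
    have e2 := hh.mfderiv_eq (I := 𝓡 2) (I' := 𝓡 3)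
    have key : ∀ (q : M) (L L' : E2 →L[ℝ] E3) (q' : M), q' = q → L' = L →
        len X.g (p := q') (cross X q' (L' e₁) (L' e₂)) = len X.g (p := q) (cross X q (L e₁) (L e₂)) := by
      rintro q L L' _ rfl rfl; rfl
    exact key (F.f p) (mfderiv (𝓡 2) (𝓡 3) F.f p) (mfderiv (𝓡 2) (𝓡 3) h' p) (h' p) e1 e2
  rw [areaDens, h1 _ h]

lemma dAreaDens_off {s : ℝ} (hs : s ∈ I) {p : S} (hp : p ∉ C) : F.dAreaDens φ s p = 0 := by
  have h : (fun t => F.areaDens φ t p) =ᶠ[𝓝 s] fun _ => subAreaUnit X F.f p / areaUnit X F.f p := by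
    filter_upwards [hv.isOpen_I.mem_nhds hs] with t ht using hv.areaDens_off ht hp
  rw [dAreaDens, h.deriv_eq, deriv_const]

lemma ddAreaDens_off {s : ℝ} (hs : s ∈ I) {p : S} (hp : p ∉ C) : F.ddAreaDens φ s p = 0 := by
  have h : (fun t => F.dAreaDens φ t p) =ᶠ[𝓝 s] fun _ => 0 := by
    filter_upwards [hv.isOpen_I.mem_nhds hs] with t ht using hv.dAreaDens_off ht hp
  rw [ddAreaDens, h.deriv_eq, deriv_const]

lemma dVolDens_off {s : ℝ} (hs : s ∈ I) {p : S} (hp : p ∉ C) : F.dVolDens φ s p = 0 := by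
  have h : (fun t => F.volDens φ t p) =ᶠ[𝓝 s] fun _ => 0 := by
    filter_upwards [hv.isOpen_I.mem_nhds hs] with t ht using hv.volDens_off ht hp
  rw [dVolDens, h.deriv_eq, deriv_const]

lemma normalSpeed_off {p : S} (hp : p ∉ C) : F.normalSpeed φ p = 0 := by
  rw [normalSpeed, hv.volDens_off hv.zero_mem hp, neg_zero, zero_div]

lemma Zderiv_normalSpeed_off {p : S} (hp : p ∉ C) : F.Zderiv (F.normalSpeed φ) p = 0 := by
  have h : F.normalSpeed φ =ᶠ[𝓝 p] fun _ => 0 := by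
    filter_upwards [hv.isCompact_C.isClosed.isOpen_compl.mem_nhds hp] with q hq
      using hv.normalSpeed_off hq
  have h1 : (mfderiv (𝓡 2) 𝓘(ℝ, ℝ) (F.normalSpeed φ) p : E2 →L[ℝ] ℝ) = 0 :=
    h.mfderiv_eq.trans mfderiv_const
  exact congrArg (fun l : E2 →L[ℝ] ℝ => l (F.lift p (F.Z p))) h1

lemma stabilityDens_off (ψ g : S → ℝ) {p : S} (hp : p ∉ C) : F.stabilityDens φ ψ g p = 0 := by
  rw [stabilityDens, hv.Zderiv_normalSpeed_off hp, hv.normalSpeed_off hp]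
  ring

lemma secondFlux_off (g : S → ℝ) {p : S} (hp : p ∉ C) : F.secondFlux φ g p = 0 := by
  let Φ : ℝ → E2 →L[ℝ] ℝ := fun s => F.fluxForm φ s p
  let b : E2 →L[ℝ] ℝ := (X.η (F.f p)).comp (mfderiv (𝓡 2) (𝓡 3) F.f p)
  have h : Φ =ᶠ[𝓝 0] fun _ => 0 := by
    filter_upwards [hv.isOpen_I.mem_nhds hv.zero_mem] with t ht using hv.fluxForm_off ht hp
  have h1 : deriv Φ 0 = 0 := h.deriv_eq.trans (deriv_const _ _)
  change -(deriv Φ 0 + (F.normalSpeed φ p * F.Zderiv (F.normalSpeed φ) p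
    - F.normalSpeed φ p ^ 2 * (F.Zderiv g p / g p)) • b) = (0 : E2 →L[ℝ] ℝ)
  rw [h1, hv.normalSpeed_off hp]
  simp

end IsVariation

namespace IsAdaptedRegion

variable (hv : F.IsVariation F.regularSet I C φ)
  (hC3 : F.IsC3On F.regularSet) [T2Space S] {e : OpenPartialHomeomorph S E2} {O : Set M}
  {A B : ∀ q : M, TangentSpace (𝓡 3) q} {σ : ℝ} {Ω : Set (ℝ × E2)}
  (hr : F.IsAdaptedRegion φ I e O A B σ Ω)
include hv hC3 hr

lemma represents_areaDens : Represents F e Ω (F.areaDens φ)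
    (fun z => -(adaptedCoframe X φ e A B σ).m z) := fun z hz => by
  simp only [m_eq hv hC3 hr hz, neg_neg]

lemma represents_volDens : Represents F e Ω (F.volDens φ)
    (fun z => (adaptedCoframe X φ e A B σ).v z * (adaptedCoframe X φ e A B σ).m z) := fun _ hz =>
  (v_mul_m hv hC3 hr hz).symm

lemma contDiffAt_neg_m {z : ℝ × E2} (hz : z ∈ Ω) :
    ContDiffAt ℝ 2 (fun z => -(adaptedCoframe X φ e A B σ).m z) z :=
  ((isCartan hv hC3 hr).contDiffAt_m hz).neg

lemma contDiffAt_v_mul_m {z : ℝ × E2} (hz : z ∈ Ω) : ContDiffAt ℝ 2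
    (fun z => (adaptedCoframe X φ e A B σ).v z * (adaptedCoframe X φ e A B σ).m z) z :=
  ((isCartan hv hC3 hr).contDiffAt_v hz).mul ((isCartan hv hC3 hr).contDiffAt_m hz)

lemma contDiffAt_fderiv_neg_m {z : ℝ × E2} (hz : z ∈ Ω) : ContDiffAt ℝ 1
    (fun z => fderiv ℝ (fun z => -(adaptedCoframe X φ e A B σ).m z) z (1, 0)) z :=
  ((contDiffAt_neg_m hv hC3 hr hz).fderiv_right (m := 1) (by norm_num)).clm_apply contDiffAt_const

lemma represents_dAreaDens : Represents F e Ω (F.dAreaDens φ)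
    (fun z => fderiv ℝ (fun z => -(adaptedCoframe X φ e A B σ).m z) z (1, 0)) := fun _ hz =>
  (hr.hasDerivAt_of_represents (represents_areaDens hv hC3 hr) hz
    ((contDiffAt_neg_m hv hC3 hr hz).differentiableAt (by simp))).2

lemma represents_ddAreaDens : Represents F e Ω (F.ddAreaDens φ)
    (fun z => fderiv ℝ (fun z => fderiv ℝ (fun z => -(adaptedCoframe X φ e A B σ).m z) z (1, 0)) z
      (1, 0)) := fun _ hz =>
  (hr.hasDerivAt_of_represents (represents_dAreaDens hv hC3 hr) hz
    ((contDiffAt_fderiv_neg_m hv hC3 hr hz).differentiableAt (by simp))).2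

lemma represents_dVolDens : Represents F e Ω (F.dVolDens φ)
    (fun z => fderiv ℝ (fun z => (adaptedCoframe X φ e A B σ).v z
      * (adaptedCoframe X φ e A B σ).m z) z (1, 0)) := fun _ hz =>
  (hr.hasDerivAt_of_represents (represents_volDens hv hC3 hr) hz
    ((contDiffAt_v_mul_m hv hC3 hr hz).differentiableAt (by simp))).2

section Slice

variable {y : E2} (hy : ((0 : ℝ), y) ∈ Ω)
include hy

/-- The component `v` of the velocity in an adapted coframe is a function on the surface,
independent of the chart and of the frame. -/
lemma normalSpeed_eq : F.normalSpeed φ (e.symm y) = (adaptedCoframe X φ e A B σ).v (0, y) := by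
  have h1 := represents_volDens hv hC3 hr _ hy
  have h2 := represents_areaDens hv hC3 hr _ hy
  have h3 := F.frameDet_ne_zero hr.atlas (hr.target _ hy)
  have h4 := areaDens_ne_zero hv hC3 hr hy
  simp only at h1 h2 h3 h4
  rw [normalSpeed, div_eq_iff h4]
  refine mul_left_cancel₀ h3 ?_
  linear_combination -h1 - (adaptedCoframe X φ e A B σ).v (0, y) * h2

lemma eventually_normalSpeed : ∀ᶠ p in 𝓝 (e.symm y), F.normalSpeed φ p
    = (adaptedCoframe X φ e A B σ).v (0, e p) := by
  filter_upwards [hr.eventually_mem hy] with p ⟨_, hp2, hp3⟩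
  have h := normalSpeed_eq hv hC3 hr hp2
  rwa [hp3] at h

lemma Zderiv_normalSpeed_eq : F.Zderiv (F.normalSpeed φ) (e.symm y)
    = (adaptedCoframe X φ e A B σ).E (adaptedCoframe X φ e A B σ).v (0, y) :=
  (Zderiv_eq hv hC3 hr hy (((isCartan hv hC3 hr).contDiffAt_v hy).differentiableAt (by simp))
    (eventually_normalSpeed hv hC3 hr hy)).2.2

omit hv hC3 in
lemma eventually_comp_symm (g : S → ℝ) : ∀ᶠ p in 𝓝 (e.symm y),
    g p = (fun z : ℝ × E2 => g (e.symm z.2)) (0, e p) := by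
  filter_upwards [hr.eventually_mem hy] with p ⟨_, _, hp3⟩
  simp only [hp3]

omit hv hC3 in
lemma contDiffAt_comp_symm {g : S → ℝ} (hg : ContMDiffAt (𝓡 2) 𝓘(ℝ, ℝ) 2 g (e.symm y)) :
    ContDiffAt ℝ 2 (fun z : ℝ × E2 => g (e.symm z.2)) (0, y) := by
  have h1 : ContMDiffAt (𝓡 2) 𝓘(ℝ, ℝ) 2 (g ∘ e.symm) y :=
    hg.comp y (contMDiffAt_chart_symm hr.atlas (hr.target _ hy))
  have h2 : ContDiffAt ℝ 2 (g ∘ e.symm) ((fun z : ℝ × E2 => z.2) (0, y)) :=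
    contMDiffAt_iff_contDiffAt.mp h1
  exact h2.comp ((0 : ℝ), y) contDiffAt_snd

/-- The time derivative of `fluxForm`, in a chart, is the time derivative of `κ`. -/
lemma fluxForm_deriv (b : E2) :
    (deriv (fun s => (F.fluxForm φ s (e.symm y) : E2 →L[ℝ] ℝ)) 0)
        ((mfderiv (𝓡 2) (𝓡 2) e.symm y : E2 →L[ℝ] E2) b)
      = fderiv ℝ ((adaptedCoframe X φ e A B σ).κ (0, b)) (0, y) (1, 0) := by
  let L : E2 →L[ℝ] E2 := mfderiv (𝓡 2) (𝓡 2) e.symm y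
  have hL : Function.Injective L := mfderiv_chart_symm_injective hr.atlas (hr.target _ hy)
  let Φ : ℝ → E2 →L[ℝ] ℝ := fun s => F.fluxForm φ s (e.symm y)
  let K : ℝ → E2 →L[ℝ] ℝ := fun s => ((adaptedCoframe X φ e A B σ).η (s, y) (1, 0)
      • (adaptedCoframe X φ e A B σ).α (s, y) - (adaptedCoframe X φ e A B σ).α (s, y) (1, 0)
      • (adaptedCoframe X φ e A B σ).η (s, y)).comp (ContinuousLinearMap.inr ℝ ℝ E2)
  have hK : ∀ s b, K s b = (adaptedCoframe X φ e A B σ).κ (0, b) (s, y) := fun _ _ => rfl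
  -- The derivative `L` of the inverse chart is invertible and independent of time, so `fluxForm` is
  -- the composition of `κ` with the inverse of `L`; hence it is differentiable in time.
  let Le := (LinearEquiv.ofInjectiveEndo (L : E2 →ₗ[ℝ] E2) hL).toContinuousLinearEquiv
  have hLe : ∀ v, L (Le.symm v) = v := fun v => Le.apply_symm_apply v
  have hnear : ∀ᶠ s in 𝓝 (0 : ℝ), (s, y) ∈ Ω := by
    have hc : ContinuousAt (fun s : ℝ => (s, y)) 0 := by fun_prop
    exact hc.preimage_mem_nhds (hr.isOpen.mem_nhds hy)
  have hΦ : Φ =ᶠ[𝓝 0] fun s => (K s).comp (Le.symm : E2 →L[ℝ] E2) := by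
    filter_upwards [hnear] with s hs
    ext1 v
    have h1 := κ_eq hv hC3 hr hs (Le.symm v)
    change Φ s v = K s (Le.symm v)
    rw [hK, h1]
    exact congrArg (Φ s) (hLe v).symm
  have hcar := isCartan hv hC3 hr
  have hKd : DifferentiableAt ℝ K 0 := by
    have hp : DifferentiableAt ℝ (fun s : ℝ => (s, y)) 0 := by fun_prop
    have d1 : DifferentiableAt ℝ (fun s => (adaptedCoframe X φ e A B σ).η (s, y)) 0 :=
      DifferentiableAt.comp (g := (adaptedCoframe X φ e A B σ).η) 0
        ((hcar.cη _ hy).differentiableAt (by simp)) hp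
    have d2 : DifferentiableAt ℝ (fun s => (adaptedCoframe X φ e A B σ).α (s, y)) 0 :=
      DifferentiableAt.comp (g := (adaptedCoframe X φ e A B σ).α) 0
        ((hcar.cα _ hy).differentiableAt (by simp)) hp
    exact (((d1.clm_apply (differentiableAt_const _)).smul d2).sub
      ((d2.clm_apply (differentiableAt_const _)).smul d1)).clm_comp (differentiableAt_const _)
  have hΦd : DifferentiableAt ℝ Φ 0 :=
    (hKd.clm_comp (differentiableAt_const _)).congr_of_eventuallyEq hΦ
  have h2 : HasDerivAt (fun s => Φ s (L b)) (deriv Φ 0 (L b)) 0 := by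
    simpa using hΦd.hasDerivAt.clm_apply (hasDerivAt_const 0 (L b))
  have h3 : (fun s => Φ s (L b)) =ᶠ[𝓝 0] fun s => (adaptedCoframe X φ e A B σ).κ (0, b) (s, y) := by
    filter_upwards [hnear] with s hs using (κ_eq hv hC3 hr hs b).symm
  have h4 : HasDerivAt (fun s : ℝ => (adaptedCoframe X φ e A B σ).κ (0, b) (s, y))
      (fderiv ℝ ((adaptedCoframe X φ e A B σ).κ (0, b)) (0, y) (1, 0)) 0 := by
    have h5 : HasDerivAt (fun s : ℝ => (s, y)) ((1 : ℝ), (0 : E2)) 0 :=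
      (hasDerivAt_id _).prodMk (hasDerivAt_const _ _)
    exact ((hcar.contDiffAt_κ hy (0, b)).differentiableAt (by simp)).hasFDerivAt.comp_hasDerivAt
      (0 : ℝ) h5
  exact h2.unique (h4.congr_of_eventuallyEq h3)

lemma chartForm_fluxForm (b : E2) : chartForm (fun p => -F.fluxForm φ 0 p) e y b
    = -(adaptedCoframe X φ e A B σ).κ (0, b) (0, y) := by
  rw [κ_eq hv hC3 hr hy b]
  rfl

/-- In a chart, `secondFlux` is the primitive which occurs in `Coframe.IsCartan.second_variation`,
with the opposite sign. -/
lemma chartForm_secondFlux {g : S → ℝ} (hg : ContMDiffAt (𝓡 2) 𝓘(ℝ, ℝ) 2 g (e.symm y)) (b : E2) :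
    chartForm (F.secondFlux φ g) e y b
      = -(fderiv ℝ ((adaptedCoframe X φ e A B σ).κ (0, b)) (0, y) (1, 0)
        + ((adaptedCoframe X φ e A B σ).v (0, y)
            * (adaptedCoframe X φ e A B σ).E (adaptedCoframe X φ e A B σ).v (0, y)
          - (adaptedCoframe X φ e A B σ).v (0, y) ^ 2
            * ((adaptedCoframe X φ e A B σ).E (fun z => g (e.symm z.2)) (0, y) / g (e.symm y)))
          * (adaptedCoframe X φ e A B σ).η (0, y) (0, b)) := by
  have hη : (adaptedCoframe X φ e A B σ).η (0, y) (0, b) = _ := pullForm_zero hv hC3 hr hy X.η b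
  have hgE := (Zderiv_eq hv hC3 hr hy ((contDiffAt_comp_symm hr hy hg).differentiableAt (by simp))
    (hr.eventually_comp_symm hy g)).2.2
  rw [← fluxForm_deriv hv hC3 hr hy b, ← normalSpeed_eq hv hC3 hr hy,
    ← Zderiv_normalSpeed_eq hv hC3 hr hy, ← hgE, hη]
  rfl

end Slice

end IsAdaptedRegion

end OrientedSurface

end Identities

/-! ### First and second variation as exact forms -/

section SecondVariation

variable {M : Type*} [TopologicalSpace M] [ChartedSpace E3 M] [IsManifold (𝓡 3) ∞ M]
  {X : SasakianStructure M} {S : Type*} [TopologicalSpace S] [ChartedSpace E2 S]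
  [IsManifold (𝓡 2) 2 S]

namespace OrientedSurface.IsVariation

variable {F : OrientedSurface X S} {φ : ℝ → S → M} {H : ℝ} {I : Set ℝ} {C : Set S}
  (hv : F.IsVariation F.regularSet I C φ) (hC3 : F.IsC3On F.regularSet) [T2Space S]
include hv hC3

section Curl

variable (hH : ∀ p ∈ F.regularSet, F.meanCurvature p = H)
include hH

/-- The first variation of the integrand of `A + 2 H V` is exact. -/
lemma isCurl_first : IsCurl F.normalDet
    (fun p => F.dAreaDens φ 0 p + 2 * H * F.volDens φ 0 p) (fun p => -F.fluxForm φ 0 p) C where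
  isCompact := hv.isCompact_C
  F_zero p hp := by
    rw [hv.dAreaDens_off hv.zero_mem hp, hv.volDens_off hv.zero_mem hp]; ring
  τ_zero p hp := by
    rw [hv.fluxForm_off hv.zero_mem hp, neg_zero]
  D_ne := F.normalDet_ne_zero
  cont_D e he := F.continuousOn_frameDet he
  curl p hp := by
    obtain ⟨O, A, B, σ, Ω, hr, hpΩ⟩ := exists_isAdaptedRegion hv hC3 (hv.subset hp)
    have hc : Continuous (fun w : E2 => ((0 : ℝ), w)) := by fun_prop
    have hW : IsOpen {w : E2 | ((0 : ℝ), w) ∈ Ω} := hr.isOpen.preimage hc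
    filter_upwards [hW.mem_nhds hpΩ] with y hy
    have hcar := IsAdaptedRegion.isCartan hv hC3 hr
    obtain ⟨h1, h2⟩ := contDiffAt_of_slice hW
      (Ψ := fun b z => -(adaptedCoframe X φ (chartAt E2 p) A B σ).κ (0, b) z)
      (fun w hw b => IsAdaptedRegion.chartForm_fluxForm hv hC3 hr hw b)
      (fun w hw b => ((hcar.contDiffAt_κ hw (0, b)).neg).of_le (by norm_num)) hy
    refine ⟨h1, ?_⟩
    rw [h2, h2]
    have h3 := IsAdaptedRegion.represents_dAreaDens hv hC3 hr _ hy
    have h4 := IsAdaptedRegion.represents_volDens hv hC3 hr _ hy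
    have h5 := hcar.fderiv_m hy
    rw [IsAdaptedRegion.h_zero hv hC3 hr hH hy] at h5
    have hneg : ∀ (G : ℝ × E2 → ℝ) z u, fderiv ℝ (fun z => -G z) z u = -fderiv ℝ G z u :=
      fun G z u => by rw [fderiv_fun_neg]; rfl
    rw [hneg, hneg]
    simp only [hneg] at h3
    change _ * F.frameDet (chartAt E2 p) y = _
    change fderiv ℝ (adaptedCoframe X φ (chartAt E2 p) A B σ).m (0, y) (1, 0) = _
      + (fderiv ℝ ((adaptedCoframe X φ (chartAt E2 p) A B σ).κ (0, e₂)) (0, y) (0, e₁)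
      - fderiv ℝ ((adaptedCoframe X φ (chartAt E2 p) A B σ).κ (0, e₁)) (0, y) (0, e₂)) at h5
    -- The area density is `-m` and `h = 2 H`; so the terms `h v m` cancel in the sum.
    linear_combination h3 + 2 * H * h4 - h5

/-- The second variation of the integrand of `A + 2 H V` is the stability integrand, up to an
exact form. -/
lemma isCurl_second {ψ g : S → ℝ} (hg : ∀ p ∈ F.regularSet, ContMDiffAt (𝓡 2) 𝓘(ℝ, ℝ) 2 g p)
    (hg0 : ∀ p ∈ F.regularSet, g p ≠ 0) (hψ : ∀ p ∈ F.regularSet, ψ p = F.normNh p * g p) :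
    IsCurl F.normalDet (fun p => F.ddAreaDens φ 0 p + 2 * H * F.dVolDens φ 0 p
      - F.normNh p * F.stabilityDens φ ψ g p) (F.secondFlux φ g) C where
  isCompact := hv.isCompact_C
  F_zero p hp := by
    rw [hv.ddAreaDens_off hv.zero_mem hp, hv.dVolDens_off hv.zero_mem hp,
      hv.stabilityDens_off ψ g hp]
    ring
  τ_zero p hp := hv.secondFlux_off g hp
  D_ne := F.normalDet_ne_zero
  cont_D e he := F.continuousOn_frameDet he
  curl p hp := by
    obtain ⟨O, A, B, σ, Ω, hr, hpΩ⟩ := exists_isAdaptedRegion hv hC3 (hv.subset hp)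
    have hc : Continuous (fun w : E2 => ((0 : ℝ), w)) := by fun_prop
    have hW : IsOpen {w : E2 | ((0 : ℝ), w) ∈ Ω} := hr.isOpen.preimage hc
    have hcar := IsAdaptedRegion.isCartan hv hC3 hr
    set e := chartAt E2 p with he
    set c := adaptedCoframe X φ e A B σ with hcdef
    let G : ℝ × E2 → ℝ := fun z => g (e.symm z.2)
    have hG : ∀ w, ((0 : ℝ), w) ∈ Ω → ContDiffAt ℝ 2 G (0, w) := fun w hw =>
      hr.contDiffAt_comp_symm hw (hg _ (hr.regular _ hw))
    have hG0 : ∀ w, ((0 : ℝ), w) ∈ Ω → G (0, w) ≠ 0 := fun w hw => hg0 _ (hr.regular _ hw)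
    let Ψ : E2 → ℝ × E2 → ℝ := fun b z => fderiv ℝ (c.κ (0, b)) z (1, 0)
        + (c.v z * c.E c.v z - c.v z ^ 2 * (c.E G z / G z)) * c.η z (0, b)
    have hΨ : ∀ w, ((0 : ℝ), w) ∈ Ω → ∀ b, ContDiffAt ℝ 1 (Ψ b) (0, w) := by
      intro w hw b
      have k1 : ContDiffAt ℝ 1 (fun z => fderiv ℝ (c.κ (0, b)) z (1, 0)) (0, w) :=
        ((hcar.contDiffAt_κ hw (0, b)).fderiv_right (m := 1) (by norm_num)).clm_apply
          contDiffAt_const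
      have k2 : ContDiffAt ℝ 1 c.v (0, w) := (hcar.contDiffAt_v hw).of_le (by norm_num)
      have k3 : ContDiffAt ℝ 1 (c.E c.v) (0, w) := hcar.contDiffAt_E hw (hcar.contDiffAt_v hw)
      have k4 : ContDiffAt ℝ 1 (c.E G) (0, w) := hcar.contDiffAt_E hw (hG w hw)
      have k5 : ContDiffAt ℝ 1 (fun z => c.η z (0, b)) (0, w) :=
        (hcar.contDiffAt_η hw _).of_le (by norm_num)
      exact k1.add (((k2.mul k3).sub ((k2.pow 2).mul
        (k4.div ((hG w hw).of_le (by norm_num)) (hG0 w hw)))).mul k5)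
    filter_upwards [hW.mem_nhds hpΩ] with y hy
    obtain ⟨h1, h2⟩ := contDiffAt_of_slice hW (Ψ := fun b z => -Ψ b z)
      (fun w hw b => IsAdaptedRegion.chartForm_secondFlux hv hC3 hr hw
        (hg _ (hr.regular _ hw)) b) (fun w hw b => (hΨ w hw b).neg) hy
    refine ⟨h1, ?_⟩
    have hneg : ∀ (G : ℝ × E2 → ℝ) z u, fderiv ℝ (fun z => -G z) z u = -fderiv ℝ G z u :=
      fun G z u => by rw [fderiv_fun_neg]; rfl
    rw [h2, h2, hneg, hneg]
    have h3 := IsAdaptedRegion.represents_ddAreaDens hv hC3 hr _ hy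
    have h4 := IsAdaptedRegion.represents_dVolDens hv hC3 hr _ hy
    have h5 := hcar.second_variation hy (IsAdaptedRegion.fderiv_h_slice hv hC3 hr hH hy e₁)
      (IsAdaptedRegion.fderiv_h_slice hv hC3 hr hH hy e₂) (hG y hy) (hG0 y hy)
    have hj := IsAdaptedRegion.jacobiOp_eq hv hC3 hr hH hy (ψ := ψ) (hG y hy) (by
      filter_upwards [hr.eventually_mem hy, hr.eventually_comp_symm hy g,
        F.isOpen_regularSet.mem_nhds (hr.regular _ hy)] with q _ hq2 hq3
      rw [hψ q hq3, hq2])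
    have hgE := (IsAdaptedRegion.Zderiv_eq hv hC3 hr hy ((hG y hy).differentiableAt (by simp))
      (hr.eventually_comp_symm hy g)).2.2
    rw [IsAdaptedRegion.h_zero hv hC3 hr hH hy] at h5
    have hst : F.stabilityDens φ ψ g (e.symm y)
        = (c.E c.v (0, y) - c.v (0, y) * (c.E G (0, y) / G (0, y))) ^ 2
          - c.v (0, y) ^ 2 * ((c.E (c.E G) (0, y) + 2 * c.lam (0, y) * c.E G (0, y)
            + c.Q (fun z => X.webster (chartVariation φ e z)) (0, y) * G (0, y)) / G (0, y)) := by
      rw [stabilityDens, hj, hgE, IsAdaptedRegion.normalSpeed_eq hv hC3 hr hy,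
        IsAdaptedRegion.Zderiv_normalSpeed_eq hv hC3 hr hy]
    have hm := IsAdaptedRegion.m_zero hv hC3 hr hy
    rw [← hst] at h5
    have h3' : F.frameDet e y * F.ddAreaDens φ 0 (e.symm y)
        = -fderiv ℝ (fun z => fderiv ℝ c.m z (1, 0)) (0, y) (1, 0) := by
      have : (fun z => fderiv ℝ (fun z => -c.m z) z (1, 0))
          = fun z => -fderiv ℝ c.m z (1, 0) := by
        ext z; exact hneg c.m z _
      rw [← hneg, ← this]
      exact h3
    change _ * F.frameDet e y = _
    change -fderiv ℝ (fun z => fderiv ℝ c.m z (1, 0)) (0, y) (1, 0)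
      + 2 * H * fderiv ℝ (fun z => c.v z * c.m z) (0, y) (1, 0) = -c.m (0, y)
      * F.stabilityDens φ ψ g (e.symm y) - (fderiv ℝ (Ψ e₂) (0, y) (0, e₁)
        - fderiv ℝ (Ψ e₁) (0, y) (0, e₂)) at h5
    change F.frameDet e y * F.dVolDens φ 0 (e.symm y)
      = fderiv ℝ (fun z => c.v z * c.m z) (0, y) (1, 0) at h4
    change c.m (0, y) = _ at hm
    rw [hm] at h5
    linear_combination h5 + h3' + 2 * H * h4

end Curl

lemma paramDeriv_areaDens : HasParamDeriv (F.areaDens φ) (F.dAreaDens φ) C := fun p hp => by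
  obtain ⟨O, A, B, σ, Ω, hr, hpΩ⟩ := exists_isAdaptedRegion hv hC3 (hv.subset hp)
  exact hr.eventually_paramDeriv (IsAdaptedRegion.represents_areaDens hv hC3 hr)
    (fun z hz => (IsAdaptedRegion.contDiffAt_neg_m hv hC3 hr hz).of_le (by norm_num))
    (mem_chart_source E2 p) hpΩ

lemma paramDeriv_dAreaDens : HasParamDeriv (F.dAreaDens φ) (F.ddAreaDens φ) C := fun p hp => by
  obtain ⟨O, A, B, σ, Ω, hr, hpΩ⟩ := exists_isAdaptedRegion hv hC3 (hv.subset hp)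
  exact hr.eventually_paramDeriv (IsAdaptedRegion.represents_dAreaDens hv hC3 hr)
    (fun z hz => IsAdaptedRegion.contDiffAt_fderiv_neg_m hv hC3 hr hz)
    (mem_chart_source E2 p) hpΩ

lemma paramDeriv_volDens : HasParamDeriv (F.volDens φ) (F.dVolDens φ) C := fun p hp => by
  obtain ⟨O, A, B, σ, Ω, hr, hpΩ⟩ := exists_isAdaptedRegion hv hC3 (hv.subset hp)
  exact hr.eventually_paramDeriv (IsAdaptedRegion.represents_volDens hv hC3 hr)
    (fun z hz => (IsAdaptedRegion.contDiffAt_v_mul_m hv hC3 hr hz).of_le (by norm_num))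
    (mem_chart_source E2 p) hpΩ

end OrientedSurface.IsVariation

end SecondVariation

/-! ### Stability -/

section Stability

variable {M : Type*} [TopologicalSpace M] [ChartedSpace E3 M] [IsManifold (𝓡 3) ∞ M]
  {X : SasakianStructure M} {S : Type*} [TopologicalSpace S] [ChartedSpace E2 S]
  [IsManifold (𝓡 2) 2 S]

namespace OrientedSurface

variable {F : OrientedSurface X S} {φ : ℝ → S → M} {H : ℝ} {I : Set ℝ} {C : Set S}

namespace IsVariation

variable (hv : F.IsVariation F.regularSet I C φ) (hC3 : F.IsC3On F.regularSet) [T2Space S]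
include hv hC3

section Smooth

omit hv hC3 [T2Space S] in
/-- A function represented in a chart of the surface by a `C²` function on the product with the time
axis is of class `C²`. -/
lemma contMDiffAt_of_eventually {p : S} {ψ : S → ℝ} {G : ℝ × E2 → ℝ}
    (hG : ContDiffAt ℝ 2 G (0, chartAt E2 p p))
    (hψ : ∀ᶠ q in 𝓝 p, ψ q = G (0, chartAt E2 p q)) : ContMDiffAt (𝓡 2) 𝓘(ℝ, ℝ) 2 ψ p := by
  have h1 : ContMDiffAt (𝓡 2) (𝓡 2) 2 (chartAt E2 p) p :=
    SubRiem.contMDiffAt_chart (chart_mem_atlas E2 p) (mem_chart_source E2 p)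
  have h2 : ContDiffAt ℝ 2 (fun w : E2 => G (0, w)) (chartAt E2 p p) :=
    hG.comp (chartAt E2 p p) (contDiffAt_const.prodMk contDiffAt_id)
  exact (h2.contMDiffAt.comp p h1).congr_of_eventuallyEq hψ

lemma contMDiffAt_normNh_NT {p : S} (hp : p ∈ F.regularSet) :
    ContMDiffAt (𝓡 2) 𝓘(ℝ, ℝ) 2 F.normNh p ∧ ContMDiffAt (𝓡 2) 𝓘(ℝ, ℝ) 2 F.NT p := by
  obtain ⟨O, A, B, σ, Ω, hr, hpΩ⟩ := exists_isAdaptedRegion hv hC3 hp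
  have hcar := IsAdaptedRegion.isCartan hv hC3 hr
  obtain ⟨h1, h2⟩ := IsAdaptedRegion.eventually_lam_nh hv hC3 hr hpΩ
  rw [(chartAt E2 p).left_inv (mem_chart_source E2 p)] at h1 h2
  exact ⟨contMDiffAt_of_eventually (hcar.contDiffAt_nh hpΩ) h1,
    contMDiffAt_of_eventually ((hcar.contDiffAt_lam hpΩ).mul (hcar.contDiffAt_nh hpΩ)) h2⟩

/-- The function `⟨N, T⟩` is a Jacobi function. Geometrically, `T` is a Killing field, so its flow
preserves the mean curvature; in the coframe this is the Codazzi equation. -/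
lemma jacobiOp_NT (hH : ∀ p ∈ F.regularSet, F.meanCurvature p = H) {p : S}
    (hp : p ∈ F.regularSet) : F.jacobiOp F.NT p = 0 := by
  obtain ⟨O, A, B, σ, Ω, hr, hpΩ⟩ := exists_isAdaptedRegion hv hC3 hp
  have hcar := IsAdaptedRegion.isCartan hv hC3 hr
  obtain ⟨h1, h2⟩ := IsAdaptedRegion.eventually_lam_nh hv hC3 hr hpΩ
  have h3 := IsAdaptedRegion.jacobiOp_eq hv hC3 hr hH hpΩ (ψ := F.NT) (hcar.contDiffAt_lam hpΩ) (by
    filter_upwards [h1, h2] with q e1 e2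
    rw [e1, e2, mul_comm])
  rw [(chartAt E2 p).left_inv (mem_chart_source E2 p)] at h3
  rw [h3]
  exact hcar.jacobi_lam hpΩ (IsAdaptedRegion.fderiv_h_slice hv hC3 hr hH hpΩ e₁)
    (IsAdaptedRegion.fderiv_h_slice hv hC3 hr hH hpΩ e₂)

lemma areaDens_zero_ne {p : S} (hp : p ∈ F.regularSet) : F.areaDens φ 0 p ≠ 0 := by
  obtain ⟨O, A, B, σ, Ω, hr, hpΩ⟩ := exists_isAdaptedRegion hv hC3 hp
  have h := IsAdaptedRegion.areaDens_ne_zero hv hC3 hr hpΩ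
  simpa only [(chartAt E2 p).left_inv (mem_chart_source E2 p)] using h

lemma continuousAt_normalSpeed {p : S} (hp : p ∈ F.regularSet) :
    ContinuousAt (F.normalSpeed φ) p := by
  obtain ⟨O, A, B, σ, Ω, hr, hpΩ⟩ := exists_isAdaptedRegion hv hC3 hp
  have h := IsAdaptedRegion.eventually_normalSpeed hv hC3 hr hpΩ
  rw [(chartAt E2 p).left_inv (mem_chart_source E2 p)] at h
  exact (contMDiffAt_of_eventually
    ((IsAdaptedRegion.isCartan hv hC3 hr).contDiffAt_v hpΩ) h).continuousAt

/-- The velocity is tangent to the surface where the normal speed vanishes. -/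
lemma normalSpeed_eq_zero_iff {p : S} (hp : p ∈ F.regularSet) : F.normalSpeed φ p = 0 ↔
    ∃ v, mfderiv (𝓡 2) (𝓡 3) (φ 0) p v = velocity φ 0 p := by
  have key : ∀ h : S → M, h = F.f → ∀ w : TangentSpace (𝓡 3) (h p),
      X.vol (h p) w (mfderiv (𝓡 2) (𝓡 3) h p e₁) (mfderiv (𝓡 2) (𝓡 3) h p e₂) = 0 ↔
        ∃ v, mfderiv (𝓡 2) (𝓡 3) h p v = w := by
    rintro _ rfl w
    rw [F.vol_eq_normalDet_mul]
    refine ⟨fun h => F.exists_mfderiv_eq ((mul_eq_zero.mp h).resolve_left (F.normalDet_ne_zero p)),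
      ?_⟩
    rintro ⟨v, rfl⟩
    rw [F.normal_N, mul_zero]
  rw [← key (φ 0) (funext hv.zero), normalSpeed, volDens]
  have h1 := hv.areaDens_zero_ne hC3 hp
  have h2 := F.normalDet_ne_zero p
  simp [div_eq_zero_iff, h1, h2]

end Smooth

variable [SecondCountableTopology S] [MeasurableSpace S] [BorelSpace S]

lemma hasDerivAt_area : ∀ᶠ s in 𝓝 (0 : ℝ), HasDerivAt (fun s => subArea X (φ s) C)
    (∫ p in C, F.dAreaDens φ s p ∂(areaMeasure X.g F.f)) s := by
  have hf1 : ContMDiff (𝓡 2) (𝓡 3) 1 F.f := F.contMDiff_f.of_le (by norm_num)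
  have hlf := isLocallyFiniteMeasure_areaMeasure X hf1
  have h := (hv.paramDeriv_areaDens hC3).setIntegral (μ := areaMeasure X.g F.f) hv.isCompact_C
  have hs : ∀ᶠ s in 𝓝 (0 : ℝ), s ∈ I := hv.isOpen_I.mem_nhds hv.zero_mem
  filter_upwards [h, hs.eventually_nhds] with s h1 h2
  refine h1.1.congr_of_eventuallyEq ?_
  filter_upwards [h2] with t ht
  exact subArea_eq X (hv.contMDiff ht) hf1 (hv.injective_mfderiv ht) F.immersion
    hv.isCompact_C.measurableSet

lemma hasDerivAt_volume : ∀ᶠ s in 𝓝 (0 : ℝ), HasDerivAt (F.volumeFun φ C)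
    (∫ p in C, F.volDens φ s p ∂(areaMeasure X.g F.f)) s := by
  have hf1 : ContMDiff (𝓡 2) (𝓡 3) 1 F.f := F.contMDiff_f.of_le (by norm_num)
  have hlf := isLocallyFiniteMeasure_areaMeasure X hf1
  exact (hv.paramDeriv_volDens hC3).primitive (μ := areaMeasure X.g F.f) hv.isCompact_C

omit hC3 [T2Space S] in
lemma integrableOn_of_paramDeriv [T2Space S] {b b' : ℝ → S → ℝ} (hb : HasParamDeriv b b' C) :
    IntegrableOn (b 0) C (areaMeasure X.g F.f) ∧ IntegrableOn (b' 0) C (areaMeasure X.g F.f) ∧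
      ContinuousOn (b' 0) C := by
  have hf1 : ContMDiff (𝓡 2) (𝓡 3) 1 F.f := F.contMDiff_f.of_le (by norm_num)
  have hlf := isLocallyFiniteMeasure_areaMeasure X hf1
  have h := (hb.eventually hv.isCompact_C).self_of_nhds
  have h1 : ContinuousOn (b 0) C := fun p hp => (ContinuousAt.comp (f := fun q => ((0 : ℝ), q))
    (h p hp).2.1 (by fun_prop)).continuousWithinAt
  have h2 : ContinuousOn (b' 0) C := fun p hp => (ContinuousAt.comp (f := fun q => ((0 : ℝ), q))
    (h p hp).2.2 (by fun_prop)).continuousWithinAt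
  exact ⟨h1.integrableOn_compact hv.isCompact_C, h2.integrableOn_compact hv.isCompact_C, h2⟩

variable (hH : ∀ p ∈ F.regularSet, F.meanCurvature p = H)
include hH

/-- The first variation formula. -/
lemma first_variation : ∫ p in C, F.dAreaDens φ 0 p ∂(areaMeasure X.g F.f)
    + 2 * H * ∫ p in C, F.volDens φ 0 p ∂(areaMeasure X.g F.f) = 0 := by
  have hf1 : ContMDiff (𝓡 2) (𝓡 3) 1 F.f := F.contMDiff_f.of_le (by norm_num)
  have hcurl := hv.isCurl_first hC3 hH
  have h1 := hcurl.integral_eq_zero hf1 F.abs_normalDet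
  have i1 := (hv.integrableOn_of_paramDeriv (hv.paramDeriv_areaDens hC3)).2.1
  have i2 := (hv.integrableOn_of_paramDeriv (hv.paramDeriv_volDens hC3)).1
  rw [← setIntegral_eq_integral_of_forall_compl_eq_zero (fun p hp => hcurl.F_zero p hp),
    integral_add i1 (i2.const_mul _), integral_const_mul] at h1
  exact h1

/-- The second variation formula, with the square completed. -/
lemma second_variation {ψ g : S → ℝ}
    (hg : ∀ p ∈ F.regularSet, ContMDiffAt (𝓡 2) 𝓘(ℝ, ℝ) 2 g p)
    (hg0 : ∀ p ∈ F.regularSet, g p ≠ 0) (hψ : ∀ p ∈ F.regularSet, ψ p = F.normNh p * g p) :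
    ContDiffAt ℝ 2 (F.areaVolume H φ C) 0 ∧
    iteratedDeriv 2 (F.areaVolume H φ C) 0
      = ∫ p in C, F.normNh p * F.stabilityDens φ ψ g p ∂(areaMeasure X.g F.f) ∧
    ContinuousOn (fun p => F.normNh p * F.stabilityDens φ ψ g p) C := by
  have hf1 : ContMDiff (𝓡 2) (𝓡 3) 1 F.f := F.contMDiff_f.of_le (by norm_num)
  have hlf := isLocallyFiniteMeasure_areaMeasure X hf1
  have hcurl := hv.isCurl_second hC3 hH hg hg0 hψ
  have h1 := hcurl.integral_eq_zero hf1 F.abs_normalDet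
  obtain ⟨-, i1, c1⟩ := hv.integrableOn_of_paramDeriv (hv.paramDeriv_dAreaDens hC3)
  obtain ⟨-, i2, c2⟩ := hv.integrableOn_of_paramDeriv (hv.paramDeriv_volDens hC3)
  have hc : ContinuousOn (fun p => F.normNh p * F.stabilityDens φ ψ g p) C := by
    refine ((c1.add (continuousOn_const (c := 2 * H) |>.mul c2)).sub
      hcurl.continuous_F.continuousOn).congr fun p _ => ?_
    simp only [Pi.add_apply, Pi.sub_apply, Pi.mul_apply]
    ring
  have ic : IntegrableOn (fun p => F.normNh p * F.stabilityDens φ ψ g p) C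
      (areaMeasure X.g F.f) := hc.integrableOn_compact hv.isCompact_C
  have hA := (hv.paramDeriv_dAreaDens hC3).setIntegral (μ := areaMeasure X.g F.f) hv.isCompact_C
  have hV := (hv.paramDeriv_volDens hC3).setIntegral (μ := areaMeasure X.g F.f) hv.isCompact_C
  obtain ⟨d1, d2⟩ := contDiffAt_two_of_hasDerivAt (f := F.areaVolume H φ C) (x := 0)
    (f' := fun s => ∫ p in C, F.dAreaDens φ s p ∂(areaMeasure X.g F.f)
      + 2 * H * ∫ p in C, F.volDens φ s p ∂(areaMeasure X.g F.f))
    (f'' := fun s => ∫ p in C, F.ddAreaDens φ s p ∂(areaMeasure X.g F.f)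
      + 2 * H * ∫ p in C, F.dVolDens φ s p ∂(areaMeasure X.g F.f))
    (by filter_upwards [hv.hasDerivAt_area hC3, hv.hasDerivAt_volume hC3] with s k1 k2
        exact k1.add (k2.const_mul _))
    (by filter_upwards [hA, hV] with s k1 k2 using k1.1.add (k2.1.const_mul _))
    (by filter_upwards [hA, hV] with s k1 k2 using k1.2.add (continuousAt_const.mul k2.2))
  refine ⟨d1, d2.trans ?_, hc⟩
  have i3 : IntegrableOn (fun p => F.ddAreaDens φ 0 p + 2 * H * F.dVolDens φ 0 p) C
      (areaMeasure X.g F.f) := Integrable.add i1 (Integrable.const_mul i2 _)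
  rw [← setIntegral_eq_integral_of_forall_compl_eq_zero (fun p hp => hcurl.F_zero p hp),
    integral_sub i3 ic, integral_add i1 (Integrable.const_mul i2 _), integral_const_mul] at h1
  linarith

end IsVariation

variable [T2Space S] [SecondCountableTopology S] [MeasurableSpace S] [BorelSpace S]

/-- By the first variation formula `A' = -2 H V'` at the initial time, and `V' = 0` when the volume
is preserved. -/
lemma isVolumePreservingAreaStationary (hC3 : F.IsC3On F.regularSet)
    (hH : ∀ p ∈ F.regularSet, F.meanCurvature p = H) :
    F.IsVolumePreservingAreaStationary F.regularSet := by
  intro I C φ hv hV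
  have h1 := (hv.hasDerivAt_area hC3).self_of_nhds
  have h2 := (hv.hasDerivAt_volume hC3).self_of_nhds
  have h3 := h2.unique ((hasDerivAt_const (0 : ℝ) _).congr_of_eventuallyEq hV)
  have h4 := hv.first_variation hC3 hH
  rw [h3, mul_zero, add_zero] at h4
  rwa [h4] at h1

/-- A function `g` without zeros for which `|N_h| g` is a supersolution of the Jacobi equation where
`g` is positive, and a subsolution where `g` is negative, makes the surface strongly stable. -/
lemma isStronglyStable_of_supersolution (hC3 : F.IsC3On F.regularSet)
    (hH : ∀ p ∈ F.regularSet, F.meanCurvature p = H)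
    (h : ∀ I C φ, F.IsVariation F.regularSet I C φ → ∃ ψ g : S → ℝ,
      (∀ p ∈ F.regularSet, ContMDiffAt (𝓡 2) 𝓘(ℝ, ℝ) 2 g p) ∧ (∀ p ∈ F.regularSet, g p ≠ 0) ∧
      (∀ p ∈ F.regularSet, ψ p = F.normNh p * g p) ∧
      ∀ p ∈ F.regularSet, F.jacobiOp ψ p / g p ≤ 0) :
    F.IsStronglyStable F.regularSet H := by
  refine ⟨isVolumePreservingAreaStationary hC3 hH, fun I C φ hv => ?_⟩
  obtain ⟨ψ, g, hg, hg0, hψ, hj⟩ := h I C φ hv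
  obtain ⟨h1, h2, -⟩ := hv.second_variation hC3 hH hg hg0 hψ
  refine ⟨h1, ?_⟩
  rw [h2]
  refine setIntegral_nonneg hv.isCompact_C.measurableSet fun p hp => ?_
  refine mul_nonneg (F.normNh_nonneg p) ?_
  have h3 := mul_nonpos_of_nonneg_of_nonpos (sq_nonneg (F.normalSpeed φ p)) (hj p (hv.subset hp))
  have h4 := sq_nonneg (F.Zderiv (F.normalSpeed φ) p - F.normalSpeed φ p * (F.Zderiv g p / g p))
  rw [stabilityDens]
  linarith

/-- Here the function which completes the square is the quotient of the Jacobi function by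
`|N_h|`. -/
lemma isStronglyStable_of_isJacobiFunction (hC3 : F.IsC3On F.regularSet)
    (hH : ∀ p ∈ F.regularSet, F.meanCurvature p = H) {ψ : S → ℝ} (hψ : F.IsJacobiFunction ψ)
    (hψ0 : ∀ p ∈ F.regularSet, ψ p ≠ 0) : F.IsStronglyStable F.regularSet H := by
  refine isStronglyStable_of_supersolution hC3 hH fun I C φ hv =>
    ⟨ψ, fun p => ψ p / F.normNh p, fun p hp => ?_, fun p hp => ?_, fun p hp => ?_, fun p hp => ?_⟩
  · exact (hψ.1.contMDiffAt (F.isOpen_regularSet.mem_nhds hp)).div₀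
      (hv.contMDiffAt_normNh_NT hC3 hp).1 (F.normNh_pos hp).ne'
  · exact div_ne_zero (hψ0 p hp) (F.normNh_pos hp).ne'
  · exact (mul_div_cancel₀ _ (F.normNh_pos hp).ne').symm
  · rw [hψ.2 p hp, zero_div]

/-- Without vertical points the Jacobi function `⟨N, T⟩` has no zeros. -/
lemma isStronglyStable_of_not_isVertical (hC3 : F.IsC3On F.regularSet)
    (hH : ∀ p ∈ F.regularSet, F.meanCurvature p = H) (hT : ∀ p, ¬ F.IsVertical p) :
    F.IsStronglyStable F.regularSet H := by
  refine isStronglyStable_of_supersolution hC3 hH fun I C φ hv =>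
    ⟨F.NT, fun p => F.NT p / F.normNh p, fun p hp => ?_, fun p hp => ?_, fun p hp => ?_,
      fun p hp => ?_⟩
  · exact (hv.contMDiffAt_normNh_NT hC3 hp).2.div₀ (hv.contMDiffAt_normNh_NT hC3 hp).1
      (F.normNh_pos hp).ne'
  · exact div_ne_zero (F.not_isVertical_ne_zero (hT p)) (F.normNh_pos hp).ne'
  · exact (mul_div_cancel₀ _ (F.normNh_pos hp).ne').symm
  · rw [hv.jacobiOp_NT hC3 hH hp, zero_div]

/-- The square is completed by a constant function. -/
lemma isStronglyStable_of_jacobiOp_normNh_nonpos (hC3 : F.IsC3On F.regularSet)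
    (hH : ∀ p ∈ F.regularSet, F.meanCurvature p = H)
    (hj : ∀ p ∈ F.regularSet, F.jacobiOp F.normNh p ≤ 0) : F.IsStronglyStable F.regularSet H :=
  isStronglyStable_of_supersolution hC3 hH fun _ _ _ _ =>
    ⟨F.normNh, fun _ => 1, fun _ _ => contMDiffAt_const, fun _ _ => one_ne_zero,
      fun _ _ => (mul_one _).symm, fun p hp => by simpa using hj p hp⟩

/-- The stability integrand is positive wherever the normal speed does not vanish. -/
lemma isStrictlyStable_of_jacobiOp_normNh_neg (hC3 : F.IsC3On F.regularSet)
    (hH : ∀ p ∈ F.regularSet, F.meanCurvature p = H)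
    (hj : ∀ p ∈ F.regularSet, F.jacobiOp F.normNh p < 0) : F.IsStrictlyStable F.regularSet H := by
  refine ⟨isStronglyStable_of_jacobiOp_normNh_nonpos hC3 hH fun p hp => (hj p hp).le,
    fun I C φ hv => ?_⟩
  have hf1 : ContMDiff (𝓡 2) (𝓡 3) 1 F.f := F.contMDiff_f.of_le (by norm_num)
  have hlf := isLocallyFiniteMeasure_areaMeasure X hf1
  have hop := isOpenPosMeasure_areaMeasure X hf1 F.immersion
  obtain ⟨-, h2, hc⟩ := hv.second_variation hC3 hH (ψ := F.normNh) (g := fun _ => 1)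
    (fun _ _ => contMDiffAt_const) (fun _ _ => one_ne_zero) (fun _ _ => (mul_one _).symm)
  have hst : ∀ p ∈ F.regularSet, F.normalSpeed φ p ^ 2 * -F.jacobiOp F.normNh p
      ≤ F.stabilityDens φ F.normNh (fun _ => 1) p := by
    intro p _
    have h4 := sq_nonneg (F.Zderiv (F.normalSpeed φ) p
      - F.normalSpeed φ p * (F.Zderiv (fun _ => (1 : ℝ)) p / 1))
    rw [stabilityDens, div_one (F.jacobiOp _ _)]
    linarith
  have hpos : ∀ p ∈ F.regularSet, 0 ≤ F.normNh p * F.stabilityDens φ F.normNh (fun _ => 1) p :=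
    fun p hp => mul_nonneg (F.normNh_nonneg p) ((mul_nonneg (sq_nonneg _)
      (neg_nonneg.mpr (hj p hp).le)).trans (hst p hp))
  have hiff : (∀ p ∈ F.regularSet, ∃ v, mfderiv (𝓡 2) (𝓡 3) (φ 0) p v = velocity φ 0 p) ↔
      ∀ p ∈ F.regularSet, F.normalSpeed φ p = 0 :=
    forall₂_congr fun p hp => (hv.normalSpeed_eq_zero_iff hC3 hp).symm
  rw [hiff, h2]
  constructor
  · intro h0 p hp
    by_contra hne
    -- If the normal speed does not vanish at `p`, it does not vanish on a neighbourhood of `p`,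
    -- which is contained in `C` and has positive area; there the integrand is positive.
    have hU : {q | F.normalSpeed φ q ≠ 0} ∈ 𝓝 p :=
      (hv.continuousAt_normalSpeed hC3 hp).eventually_ne hne
    have hUC : {q | F.normalSpeed φ q ≠ 0} ⊆ C := fun q hq =>
      by_contra fun hqC => hq (hv.normalSpeed_off hqC)
    have h5 : 0 < ∫ p in C, F.normNh p * F.stabilityDens φ F.normNh (fun _ => 1) p
        ∂(areaMeasure X.g F.f) := by
      rw [setIntegral_pos_iff_support_of_nonneg_ae
        ((ae_restrict_iff' hv.isCompact_C.measurableSet).mpr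
          (ae_of_all _ fun q hq => hpos q (hv.subset hq)))
        (hc.integrableOn_compact hv.isCompact_C)]
      refine (Measure.measure_pos_of_mem_nhds _ hU).trans_le (measure_mono fun q hq => ?_)
      have hqC := hUC hq
      have hqr := hv.subset hqC
      refine ⟨?_, hqC⟩
      exact (mul_pos (F.normNh_pos hqr) ((mul_pos ((sq_nonneg _).lt_of_ne (pow_ne_zero 2 hq).symm)
        (neg_pos.mpr (hj q hqr))).trans_le (hst q hqr))).ne'
    exact h5.ne' h0
  · intro h0
    refine setIntegral_eq_zero_of_forall_eq_zero fun p hp => ?_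
    have hp' := hv.subset hp
    have hZ : F.Zderiv (F.normalSpeed φ) p = 0 := by
      have h : F.normalSpeed φ =ᶠ[𝓝 p] fun _ => 0 := by
        filter_upwards [F.isOpen_regularSet.mem_nhds hp'] with q hq using h0 q hq
      have h1 : (mfderiv (𝓡 2) 𝓘(ℝ, ℝ) (F.normalSpeed φ) p : E2 →L[ℝ] ℝ) = 0 :=
        h.mfderiv_eq.trans mfderiv_const
      exact congrArg (fun l : E2 →L[ℝ] ℝ => l (F.lift p (F.Z p))) h1
    rw [stabilityDens, hZ, h0 p hp']
    ring

end OrientedSurface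

end Stability

end SubRiem

end

theorem mainTheorem2 {M : Type*} [TopologicalSpace M] [ChartedSpace SubRiem.E3 M]
    [IsManifold (𝓡 3) ∞ M] [T2Space M] [SecondCountableTopology M] [ConnectedSpace M]
    (X : SubRiem.SasakianStructure M)
    {S : Type*} [TopologicalSpace S] [ChartedSpace SubRiem.E2 S] [IsManifold (𝓡 2) 2 S]
    [T2Space S] [SecondCountableTopology S] [MeasurableSpace S] [BorelSpace S]
    (F : SubRiem.OrientedSurface X S) (hF : F.IsC3On F.regularSet)
    (H : ℝ) (hH : ∀ p ∈ F.regularSet, F.meanCurvature p = H) :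
    (((∃ ψ : S → ℝ, F.IsJacobiFunction ψ ∧ ∀ p ∈ F.regularSet, ψ p ≠ 0) ∨
        (∀ p, ¬ F.IsVertical p) ∨
        (∀ p ∈ F.regularSet, F.jacobiOp F.normNh p ≤ 0)) →
      F.IsStronglyStable F.regularSet H) ∧
    ((∀ p ∈ F.regularSet, F.jacobiOp F.normNh p < 0) → F.IsStrictlyStable F.regularSet H) := by
  refine ⟨?_, SubRiem.OrientedSurface.isStrictlyStable_of_jacobiOp_normNh_neg hF hH⟩
  rintro (⟨ψ, hψ, hψ0⟩ | hT | hj)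
  · exact SubRiem.OrientedSurface.isStronglyStable_of_isJacobiFunction hF hH hψ hψ0
  · exact SubRiem.OrientedSurface.isStronglyStable_of_not_isVertical hF hH hT
  · exact SubRiem.OrientedSurface.isStronglyStable_of_jacobiOp_normNh_nonpos hF hH hj
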